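/- Let $\omega$ be an irrational number of bounded type: for the denominators $q_n$ of its continued fraction convergents there is $M\ge\frac{\sqrt5+1}{2}$ with $q_{n+1}<Mq_n$ for all $n\ge1$. Put $\delta=\frac14M^{-20}$ and $Tx=x+2\pi\omega$ on $\mathbb S^1=\mathbb R/2\pi\mathbb Z$. For $A:\mathbb S^1\to SL(2,\mathbb R)$ write $A^j(x)=A(T^{j-1}x)\cdots A(x)$, $A^{-j}(x)=A(T^{-j}x)^{-1}\cdots A(T^{-1}x)^{-1}$, and $L(A)=\lim_{j\to\infty}\frac1j\frac1{2\pi}\int_{\mathbb S^1}\log\|A^j(x)\|\,dx$. For $\lambda>1$ and a phase $\varphi$ put $A_\varphi=\Lambda R_{\frac\pi2-\varphi}$, where $\Lambda=\mathrm{diag}(\lambda,\lambda^{-1})$ and $R_\theta$ is the rotation by $\theta$. *Notation.* Let $c_1\in[0,\pi)$, $c_2=c_1+\pi$, let $I_n$ be the set of points at distance at most $q_n^{-2}$ from $\{c_1,c_2\}$, and let $I_n/10$ be the set of points at distance at most $\frac1{10}q_n^{-2}$ from $\{c_1,c_2\}$. Let $r_n$ be the smallest $j\ge1$ for which some $x\in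 I_n$ has $T^jx\in I_n$. For a matrix $A$ with $\|A\|>1$ let $s(A)\in\mathbb R/\pi\mathbb Z$ be its most contracted direction. The stable and unstable directions of $\varphi$ at level $n$ are $s(A_\varphi^{r_n}(x))$ and $s(A_\varphi^{-r_n}(x))$, and $\Delta_n[\varphi](x)\in(-\frac\pi2,\frac\pi2]$ denotes the representative of their difference. *Initial phase.* Let either $l\ge1$ be an integer and $g(t)=\mathrm{sgn}(t)|t|^{l+1}$, or $l=\infty$ and $g(t)=\mathrm{sgn}(t)e^{-1/|t|^a}$ with $0<a<\frac1{10}$. Let $0<\delta_0<1$, and let $\phi$ be a lift of a $C^l$ function on $\mathbb S^1$ which, in the first variant, is $2\pi$-periodic with $\phi=g(x-c_1)$ for $|x-c_1|\le\delta_0$ and $\phi=-g(x-c_2)$ for $|x-c_2|\le\delta_0$; or, in the second variant, is the identity plus a $2\pi$-periodic function with $\phi=g(x-c_1)$ for $|x-c_1|\le\delta_0$ and $\phi=\pi+g(x-c_2)$ for $|x-c_2|\le\delta_0$. In both variants let $|\phi(x)-k\pi|>g(\delta_0)$ for all $k\in\mathbb Z$ at all other points. Let $\phi_0$ be the representative of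 $\phi$ modulo $\pi$ in $(-\frac\pi2,\frac\pi2]$. *The cocycle $D_l$.* For an integer $N$ and $\lambda>1$, define phases $\phi_n$, $n\ge N$, by $\phi_N=\phi+e_N$ and $\phi_{n}=\phi_{n-1}+e_{n}$ for $n>N$, where $e_n$ is a $2\pi$-periodic $C^l$ function vanishing outside $I_n$, with target function $t_N=\phi_0-\Delta_N[\phi]$ and $t_{n}=\Delta_{n-1}[\phi_{n-1}]-\Delta_{n}[\phi_{n-1}]$ for $n>N$. If $l<\infty$, $e_n=t_n$ on $I_n/10$ and $e_n$ is a polynomial of degree at most $2l+1$ on each component of $I_n\setminus\frac{I_n}{10}$. If $l=\infty$, $e_n=t_nf_n$ on $I_n$, where $f_n$ is a $2\pi$-periodic $C^\infty$ function with values in $[0,1]$, $f_n=1$ on $I_n/10$, $f_n=0$ outside $I_n$, and $|f_n^{(r)}|\le q_n^{3r}$ for $0\le r\le q_n^{1/10}$. When the cocycles $A_{\phi_n}$ converge in the $C^l$ topology, their limit is denoted $D_l$. **Theorem 4.** For every such $\phi$ there is $N_0$ such that for every $N\ge N_0$ there are (if $l=\infty$) cut-off functions $f_n$ ($n\ge N$)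 as above, and there is $\lambda_0$, such that for every $\lambda\ge\lambda_0$ the construction can be carried out (all the matrices $A^{\pm r}$ whose most contracted directions it uses have norm greater than $1$ on the interval set concerned), and $A_{\phi_n}\to D_l$ in $C^l(\mathbb S^1,SL(2,\mathbb R))$. Moreover there are cocycles $\tilde A_n=\Lambda R_{\frac\pi2-\tilde\phi_n}\in C^l(\mathbb S^1,SL(2,\mathbb R))$, $n\ge N$, such that 1. $\tilde\phi_n-\phi_n$ is $2\pi$-periodic and vanishes outside $I_n$, and the stable and unstable directions of $\tilde\phi_n$ at level $n$ are well defined on $I_n$ and coincide on $I_n/10$; 2. $\tilde A_n\to D_l$ in the $C^l$ topology (the $C^\infty$ topology if $l=\infty$); 3. for all sufficiently large $n$, the Lyapunov exponent satisfies $L(\tilde A_n)<(1-\delta)\log\lambda$. -/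

import Mathlib

open scoped Matrix.Norms.L2Operator

namespace QPCocycle

noncomputable section

/-- Real `2 × 2` matrices. With `Matrix.Norms.L2Operator` open, `‖A‖` is the operator norm of `A`
for the Euclidean norm of the plane. -/
abbrev Mat : Type := Matrix (Fin 2) (Fin 2) ℝ

/-- The denominator `q_n` of the `n`-th continued fraction convergent of `ω` (`q_0 = 1`). -/
def q (ω : ℝ) (n : ℕ) : ℝ := (GenContFract.of ω).dens n

/-! ### Cocycles over the rotation `T x = x + 2πω` of the circle `ℝ / 2πℤ`

Functions on the circle are written as `2π`-periodic functions on the line. -/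

/-- The rotation matrix `R_θ`. -/
def rot (θ : ℝ) : Mat := !![Real.cos θ, -Real.sin θ; Real.sin θ, Real.cos θ]

/-- The cocycle `x ↦ Λ R_{π/2 - φ(x)}` with `Λ = diag(lam, lam⁻¹)`. -/
def cocycle (lam : ℝ) (φ : ℝ → ℝ) (x : ℝ) : Mat :=
  !![lam, 0; 0, lam⁻¹] * rot (Real.pi / 2 - φ x)

/-- `A^j(x) = A(T^{j-1} x) ⋯ A(T x) A(x)`. -/
def fwd (ω : ℝ) (A : ℝ → Mat) : ℕ → ℝ → Mat
  | 0, _ => 1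
  | j + 1, x => A (x + 2 * Real.pi * ω * j) * fwd ω A j x

/-- `A^{-j}(x) = A(T^{-j} x)⁻¹ ⋯ A(T^{-1} x)⁻¹`. -/
def bwd (ω : ℝ) (A : ℝ → Mat) : ℕ → ℝ → Mat
  | 0, _ => 1
  | j + 1, x => (A (x - 2 * Real.pi * ω * (j + 1)))⁻¹ * bwd ω A j x

/-- `A ∈ C^l(S¹, SL(2, ℝ))`. -/
structure IsCocycle (l : ℕ∞) (A : ℝ → Mat) : Prop where
  smooth : ContDiff ℝ l A
  periodic : Function.Periodic A (2 * Real.pi)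
  det_eq_one : ∀ x, (A x).det = 1

/-- Convergence in the `C^l` topology of `C^l(S¹, SL(2, ℝ))`: uniform convergence of all the
derivatives of order `k ≤ l` (of all orders if `l = ∞`). -/
def ConvergesC (l : ℕ∞) (A : ℕ → ℝ → Mat) (D : ℝ → Mat) : Prop :=
  ∀ k : ℕ, (k : ℕ∞) ≤ l →
    TendstoUniformly (fun n => iteratedDeriv k (A n)) (iteratedDeriv k D) Filter.atTop

/-- `L` is the Lyapunov exponent of the cocycle `A`: the limit of `1/j ∫ log ‖A^j‖` with respect to
the normalized Lebesgue measure of the circle. -/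
def HasLyapunovExponent (ω : ℝ) (A : ℝ → Mat) (L : ℝ) : Prop :=
  Filter.Tendsto
    (fun j : ℕ => (j : ℝ)⁻¹ *
      ((2 * Real.pi)⁻¹ * ∫ x in (0 : ℝ)..(2 * Real.pi), Real.log ‖fwd ω A j x‖))
    Filter.atTop (nhds L)

/-! ### Most contracted directions -/

/-- The length of `A θ̂`, where `θ̂ = (cos θ, sin θ)`. -/
def stretch (A : Mat) (θ : ℝ) : ℝ :=
  ‖(WithLp.toLp 2 (A.mulVec ![Real.cos θ, Real.sin θ]) : EuclideanSpace ℝ (Fin 2))‖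

theorem exists_mostContracted (A : Mat) :
    ∃ θ ∈ Set.Ioc (-(Real.pi / 2)) (Real.pi / 2), ∀ ψ, stretch A θ ≤ stretch A ψ := by
  have hper : Function.Periodic (stretch A) Real.pi := by
    intro x
    have h : A.mulVec ![Real.cos (x + Real.pi), Real.sin (x + Real.pi)]
        = -(A.mulVec ![Real.cos x, Real.sin x]) := by
      rw [← Matrix.mulVec_neg]
      congr 1
      ext i
      fin_cases i <;> simp
    unfold stretch
    rw [h, WithLp.toLp_neg, norm_neg]
  have hcont : Continuous (stretch A) := by
    unfold stretch
    fun_prop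
  have hpi := Real.pi_pos
  obtain ⟨θ, -, hθ⟩ := isCompact_Icc.exists_isMinOn
    (Set.nonempty_Icc.2 (by linarith : -(Real.pi / 2) ≤ Real.pi / 2)) hcont.continuousOn
  have hmin : ∀ ψ, stretch A θ ≤ stretch A ψ := by
    intro ψ
    obtain ⟨y, hy, hψ⟩ := hper.exists_mem_Ioc hpi ψ (-(Real.pi / 2))
    rw [hψ]
    exact hθ ⟨hy.1.le, by linarith [hy.2]⟩
  obtain ⟨y, hy, h⟩ := hper.exists_mem_Ioc hpi θ (-(Real.pi / 2))
  exact ⟨y, ⟨hy.1, by linarith [hy.2]⟩, fun ψ => h ▸ hmin ψ⟩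

/-- The direction `s(A)` that is most contracted by `A`, as an angle: the element of the projective
line `ℝ / πℤ` is represented by its representative in `(-π/2, π/2]`. It is unique if
`|det A| = 1` and `‖A‖ > 1`. -/
def mostContracted (A : Mat) : ℝ := Classical.choose (exists_mostContracted A)

/-- The representative in `(-π/2, π/2]` of a real number modulo `π`. -/
def nearZero (t : ℝ) : ℝ := toIocMod Real.pi_pos (-(Real.pi / 2)) t

/-! ### Critical intervals, return times, stable and unstable directions -/

/-- The lift to the line of the set `I_n / C`, where
`I_n = [c_1 - q_n⁻², c_1 + q_n⁻²] ∪ [c_2 - q_n⁻², c_2 + q_n⁻²]`, `c_1 = c`, `c_2 = c + π`. -/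
def crit (ω c C : ℝ) (n : ℕ) : Set ℝ :=
  {x | ∃ m : ℤ, |x - (c + m * Real.pi)| ≤ 1 / (C * q ω n ^ 2)}

/-- The smallest first return time to `I_n` of a point of `I_n`. It is the same for `T` and
`T⁻¹`. -/
def minReturn (ω c : ℝ) (n : ℕ) : ℕ :=
  sInf {j : ℕ | 1 ≤ j ∧ ∃ x ∈ crit ω c 1 n, x + 2 * Real.pi * ω * j ∈ crit ω c 1 n}

/-- `s(A^{r}(x))`, with `A = Λ R_{π/2 - φ}` and `r` the smallest return time to `I_n`. -/
def stableDir (ω c lam : ℝ) (φ : ℝ → ℝ) (n : ℕ) (x : ℝ) : ℝ :=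
  mostContracted (fwd ω (cocycle lam φ) (minReturn ω c n) x)

/-- `s(A^{-r}(x))`, with `A = Λ R_{π/2 - φ}` and `r` the smallest return time to `I_n`. -/
def unstableDir (ω c lam : ℝ) (φ : ℝ → ℝ) (n : ℕ) (x : ℝ) : ℝ :=
  mostContracted (bwd ω (cocycle lam φ) (minReturn ω c n) x)

/-- On `I_n`, the two matrices that define the stable and the unstable direction are hyperbolic, so
that these directions are well defined. -/
def HyperbolicOn (ω c lam : ℝ) (φ : ℝ → ℝ) (n : ℕ) : Prop :=
  ∀ x ∈ crit ω c 1 n,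
    1 < ‖fwd ω (cocycle lam φ) (minReturn ω c n) x‖ ∧
    1 < ‖bwd ω (cocycle lam φ) (minReturn ω c n) x‖

/-- The signed angle between the stable and the unstable direction. -/
def angle (ω c lam : ℝ) (φ : ℝ → ℝ) (n : ℕ) (x : ℝ) : ℝ :=
  nearZero (stableDir ω c lam φ n x - unstableDir ω c lam φ n x)

/-! ### The initial phase -/

/-- `t ↦ sgn(t) |t|^{l+1}`. -/
def powProfile (l : ℕ) (t : ℝ) : ℝ := Real.sign t * |t| ^ (l + 1)

/-- `t ↦ sgn(t) exp(-1 / |t|^a)`. -/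
def expProfile (a t : ℝ) : ℝ := Real.sign t * Real.exp (-(1 / |t| ^ a))

/-- `φ` is a lift of a `C^l` function on the circle that has the profile `g` at the two critical
points `c_1 = c` and `c_2 = c + π` and is away from `πℤ` elsewhere. If `twisted` is false, `φ` is
`2π`-periodic, equal to `g(x - c_1)` near `c_1` and to `-g(x - c_2)` near `c_2` (the cocycle is
homotopic to the identity). If `twisted` is true, `φ` is the identity plus a `2π`-periodic function,
equal to `g(x - c_1)` near `c_1` and to `π + g(x - c_2)` near `c_2`. -/
structure IsBasePhase (l : ℕ∞) (g : ℝ → ℝ) (c δ₀ : ℝ) (twisted : Bool) (φ : ℝ → ℝ) : Prop where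
  smooth : ContDiff ℝ l φ
  lift : ∀ x, φ (x + 2 * Real.pi) = φ x + if twisted then 2 * Real.pi else 0
  near : ∀ (m : ℤ) (t : ℝ), |t| ≤ δ₀ →
    φ (c + m * Real.pi + t) = if twisted then m * Real.pi + g t else (-1) ^ m * g t
  away : ∀ x, (∀ m : ℤ, δ₀ < |x - (c + m * Real.pi)|) → ∀ k : ℤ, g δ₀ < |φ x - k * Real.pi|

/-! ### The inductive construction -/

/-- Correction in the finitely smooth case: `e` is a `2π`-periodic `C^l` function equal to `target`
on `I_n / 10`, to zero outside `I_n`, and to a polynomial of degree at most `2l + 1` on each of the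
intervals that make up `I_n ∖ (I_n / 10)`. The derivatives of order `0, …, l` at the end points
determine these polynomials. -/
structure IsPolyCorrection (ω c : ℝ) (l n : ℕ) (target e : ℝ → ℝ) : Prop where
  smooth : ContDiff ℝ l e
  periodic : Function.Periodic e (2 * Real.pi)
  inner : ∀ x ∈ crit ω c 10 n, e x = target x
  outer : ∀ x, x ∉ crit ω c 1 n → e x = 0
  right : ∀ m : ℤ, ∃ P : Polynomial ℝ, P.natDegree ≤ 2 * l + 1 ∧
    ∀ t ∈ Set.Ioo (1 / (10 * q ω n ^ 2)) (1 / q ω n ^ 2), e (c + m * Real.pi + t) = P.eval t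
  left : ∀ m : ℤ, ∃ P : Polynomial ℝ, P.natDegree ≤ 2 * l + 1 ∧
    ∀ t ∈ Set.Ioo (1 / (10 * q ω n ^ 2)) (1 / q ω n ^ 2), e (c + m * Real.pi - t) = P.eval t

/-- A cut-off function for `I_n`. -/
structure IsCutoff (ω c : ℝ) (n : ℕ) (f : ℝ → ℝ) : Prop where
  smooth : ContDiff ℝ (⊤ : ℕ∞) f
  periodic : Function.Periodic f (2 * Real.pi)
  inner : ∀ x ∈ crit ω c 10 n, f x = 1
  mem_Icc : ∀ x, f x ∈ Set.Icc (0 : ℝ) 1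
  outer : ∀ x, x ∉ crit ω c 1 n → f x = 0
  deriv_le : ∀ r : ℕ, (r : ℝ) ≤ q ω n ^ (1 / 10 : ℝ) →
    ∀ x, |iteratedDeriv r f x| ≤ q ω n ^ (3 * r)

/-- Correction in the smooth case: `e` is the `2π`-periodic smooth function equal to `target * f`
on `I_n` and to zero outside `I_n`. -/
structure IsCutoffCorrection (ω c : ℝ) (f : ℝ → ℝ) (n : ℕ) (target e : ℝ → ℝ) : Prop where
  smooth : ContDiff ℝ (⊤ : ℕ∞) e
  periodic : Function.Periodic e (2 * Real.pi)
  inner : ∀ x ∈ crit ω c 1 n, e x = target x * f x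
  outer : ∀ x, x ∉ crit ω c 1 n → e x = 0

/-- The phases `φ_n = Φ n`, `n ≥ N`, are obtained from `φ` by successive corrections; they are
determined by `φ` and by the kind of correction, `step n target e`.
The first correction replaces the angle `s̄_N - s̄'_N` of `φ` by `φ_0`, which is `φ` modulo `π`.
The correction that leads from `φ_n` to `φ_{n+1}` replaces `s̄_{n+1} - s̄'_{n+1}`, the angle of
`φ_n` for the return time to `I_{n+1}`, by `s_n - s'_n`, the angle of `φ_n` for the return time to
`I_n`. -/
structure IsConstruction (ω c lam : ℝ) (N : ℕ) (step : ℕ → (ℝ → ℝ) → (ℝ → ℝ) → Prop)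
    (φ : ℝ → ℝ) (Φ : ℕ → ℝ → ℝ) : Prop where
  hyperbolic_base : HyperbolicOn ω c lam φ N
  first : step N (fun x => nearZero (φ x) - angle ω c lam φ N x) (fun x => Φ N x - φ x)
  hyperbolic : ∀ n, N ≤ n → HyperbolicOn ω c lam (Φ n) n
  hyperbolic_next : ∀ n, N ≤ n → HyperbolicOn ω c lam (Φ n) (n + 1)
  next : ∀ n, N ≤ n →
    step (n + 1) (fun x => angle ω c lam (Φ n) n x - angle ω c lam (Φ n) (n + 1) x)
      (fun x => Φ (n + 1) x - Φ n x)

/-! ### The approximating cocycles -/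

/-- `ψ` is a modification of `φ` inside `I_n` for which the stable and the unstable direction
are well defined on `I_n` and coincide on `I_n / 10`. -/
structure IsTangentModification (ω c lam : ℝ) (l : ℕ∞) (n : ℕ) (φ ψ : ℝ → ℝ) : Prop where
  smooth : ContDiff ℝ l ψ
  periodic : Function.Periodic (fun x => ψ x - φ x) (2 * Real.pi)
  outer : ∀ x, x ∉ crit ω c 1 n → ψ x = φ x
  hyperbolic : HyperbolicOn ω c lam ψ n
  tangent : ∀ x ∈ crit ω c 10 n, stableDir ω c lam ψ n x = unstableDir ω c lam ψ n x

/-- The cocycles `A_n = Λ R_{π/2 - Φ n}` converge in the `C^l` topology to a cocycle `D`, and `D` is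
also the `C^l` limit of cocycles `Ã_n = Λ R_{π/2 - Ψ n}`, where `Ψ n` is a tangent modification of
`Φ n`, with Lyapunov exponents less than `(1 - M⁻²⁰ / 4) log lam` for all large `n`. -/
def LimitHasSlowApproximation (ω M c lam : ℝ) (l : ℕ∞) (N : ℕ) (Φ : ℕ → ℝ → ℝ) : Prop :=
  ∃ D : ℝ → Mat, IsCocycle l D ∧ ConvergesC l (fun n => cocycle lam (Φ n)) D ∧
    ∃ Ψ : ℕ → ℝ → ℝ,
      (∀ n, N ≤ n → IsTangentModification ω c lam l n (Φ n) (Ψ n)) ∧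
      (∀ n, N ≤ n → IsCocycle l (cocycle lam (Ψ n))) ∧
      ConvergesC l (fun n => cocycle lam (Ψ n)) D ∧
      ∃ n₀, ∀ n, n₀ ≤ n → ∃ L,
        HasLyapunovExponent ω (cocycle lam (Ψ n)) L ∧
        L < (1 - (M ^ 20)⁻¹ / 4) * Real.log lam

end

end QPCocycle

/-!
Near the critical points `c + mπ` the phase `φ` of the cocycle `Λ R_{π/2 - φ}` is, modulo `π`, the
flat function `± g`, and elsewhere it stays away from `πℤ`. Between two visits to the critical
intervals `I_n` the products of the cocycle are hyperbolic with a rate close to the maximal one, and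
`φ + s - u`, where `s` and `u` are the stable and unstable directions of the adjacent blocks, is the
angle that decides how well these blocks fit together (`mul_crot_mul_00_eq`,
`abs_sin_le_norm_junction`).

*Return times.* As `ω` is of bounded type, a return to `I_n` takes at least a time of order `q_n ^ 2`
and every orbit visits `I_n / 10` within a time of the same order (`le_of_abs_rotation_le`,
`exists_visit`).

*Hyperbolicity.* Blocks between visits to `I_{n+1}` are composed of blocks between visits to `I_n`.
At a visit to `I_n ∖ I_{n+1}` the angle is at least of the order of `g (q_{n+1} ^ (-2))`, which is
larger than `exp (-√q)`; on a block of length `q_n ^ 2` this costs a negligible part of the rate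
(`Hyp.base`, `Hyp.step`, `HypAt.succ`). The directions determined by different blocks at the same
point agree up to `exp (-len)`, where `len` is of order `q_n ^ 2`
(`PairGood.norm_cdirDiff_sub_le`).

*The corrections.* The correction `e_n` makes up for the change of the directions when `I_{n-1}` is
replaced by `I_n`, so that `φ_n + s_n - u_n = φ` holds on `I_n / 10` for all `n`, and the angle stays
comparable to `g` on `I_n` (`Setting.exists_stage`, `Setting.exists_next`). The hyperbolicity
estimates hold for all complex phases within `exp (-q_n)` of `φ_n`. By Cauchy's estimates, passing
to derivatives of order `k` costs a factor `exp (k q_n)` only, which is small compared with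
`exp (len)` (`abs_iteratedDeriv_dirDiff_sub_le`). Hence the corrections, be they built by Hermite
interpolation (`corrector_poly`) or with cut-off functions (`corrector_cutoff`), decay geometrically
in `C^l`, and the cocycles converge (`Setting.exists_bound`, `exists_limit`,
`convergesC_cocycle`).

*The nearby cocycles with a smaller exponent.* On `I_n / 10` the angle is `φ`, and subtracting from
`φ_n` a cut-off of `φ - φ (c + mπ)`, which is small in `C^l` as `φ` is flat, makes the stable and
unstable directions coincide there (`flatPart`, `Setting.isTangentModification`). If `B` and `A⁻¹`
contract the same direction most and their norms are comparable, then `B * A` is small compared with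
`‖B‖ * ‖A‖` (`norm_mul_inv_le_of_common_minimizer`). So at each visit to `I_n / 10` a block of length
`2 r_n` has norm at most `lam ^ (r_n / 2)` instead of `lam ^ (2 r_n)`. Since the time between such
visits is at most a fixed multiple of `r_n`, the Lyapunov exponent drops by a definite proportion
of `log lam` (`log_norm_fwd_le`, `HypAt.exists_lyapunov_lt`).
-/

namespace QPCocycle

noncomputable section

/-! ### Denominators of convergents and Diophantine bounds -/

theorem not_terminatedAt_of_irrational {ω : ℝ} (hω : Irrational ω) (n : ℕ) :
    ¬ (GenContFract.of ω).TerminatedAt n := by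
  intro h
  obtain ⟨r, hr⟩ := (GenContFract.terminates_iff_rat ω).1 ⟨n, h⟩
  exact hω ⟨r, hr.symm⟩

theorem fib_le_q {ω : ℝ} (hω : Irrational ω) (n : ℕ) : (Nat.fib (n + 1) : ℝ) ≤ q ω n :=
  GenContFract.succ_nth_fib_le_of_nth_den (Or.inr (not_terminatedAt_of_irrational hω _))

theorem one_le_q {ω : ℝ} (hω : Irrational ω) (n : ℕ) : 1 ≤ q ω n := by
  refine le_trans ?_ (fib_le_q hω n)
  exact_mod_cast Nat.fib_pos.2 (Nat.succ_pos n)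

theorem q_pos {ω : ℝ} (hω : Irrational ω) (n : ℕ) : 0 < q ω n :=
  lt_of_lt_of_le one_pos (one_le_q hω n)

theorem q_mono (ω : ℝ) : Monotone (q ω) :=
  monotone_nat_of_le_succ fun _ => GenContFract.of_den_mono

theorem exists_get_s {ω : ℝ} (hω : Irrational ω) (n : ℕ) :
    ∃ gp, (GenContFract.of ω).s.get? n = some gp ∧ gp.a = 1 ∧ 1 ≤ gp.b ∧ ∃ z : ℤ, gp.b = z := by
  obtain ⟨gp, hgp⟩ := Option.ne_none_iff_exists'.1 (not_terminatedAt_of_irrational hω n)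
  have h := GenContFract.of_partNum_eq_one_and_exists_int_partDen_eq hgp
  exact ⟨gp, hgp, h.1, GenContFract.of_one_le_get?_partDen (GenContFract.partDen_eq_s_b hgp), h.2⟩

theorem q_add_le {ω : ℝ} (hω : Irrational ω) (n : ℕ) : q ω (n + 1) + q ω n ≤ q ω (n + 2) := by
  obtain ⟨gp, hgp, ha, hb, -⟩ := exists_get_s hω (n + 1)
  have h := GenContFract.dens_recurrence hgp (rfl : (GenContFract.of ω).dens n = _) rfl
  have h1 := q_pos hω (n + 1)
  unfold q at *
  rw [h, ha]
  nlinarith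

theorem exists_int_convergent {ω : ℝ} (hω : Irrational ω) (n : ℕ) :
    (∃ p : ℤ, (GenContFract.of ω).nums n = p) ∧ ∃ d : ℤ, (GenContFract.of ω).dens n = d := by
  induction n using Nat.strong_induction_on with
  | _ n ih =>
    match n with
    | 0 => exact ⟨⟨⌊ω⌋, by simp [GenContFract.zeroth_num_eq_h, GenContFract.of_h_eq_floor]⟩,
        ⟨1, by simp [GenContFract.zeroth_den_eq_one]⟩⟩
    | 1 =>
      obtain ⟨gp, hgp, ha, -, z, hz⟩ := exists_get_s hω 0
      refine ⟨⟨z * ⌊ω⌋ + 1, ?_⟩, ⟨z, ?_⟩⟩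
      · rw [GenContFract.first_num_eq hgp, ha, hz, GenContFract.of_h_eq_floor]; push_cast; ring
      · rw [GenContFract.first_den_eq hgp, hz]
    | k + 2 =>
      obtain ⟨gp, hgp, ha, -, z, hz⟩ := exists_get_s hω (k + 1)
      obtain ⟨⟨p0, hp0⟩, d0, hd0⟩ := ih k (by omega)
      obtain ⟨⟨p1, hp1⟩, d1, hd1⟩ := ih (k + 1) (by omega)
      refine ⟨⟨z * p1 + p0, ?_⟩, ⟨z * d1 + d0, ?_⟩⟩
      · rw [GenContFract.nums_recurrence hgp hp0 hp1, ha, hz]; push_cast; ring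
      · rw [GenContFract.dens_recurrence hgp hd0 hd1, ha, hz]; push_cast; ring

theorem abs_q_mul_sub_num_le {ω : ℝ} (hω : Irrational ω) (n : ℕ) :
    |q ω n * ω - (GenContFract.of ω).nums n| ≤ 1 / q ω (n + 1) := by
  have h := GenContFract.abs_sub_convs_le (not_terminatedAt_of_irrational hω n)
  have h0 := q_pos hω n
  have h1 := q_pos hω (n + 1)
  have hc : (GenContFract.of ω).convs n = (GenContFract.of ω).nums n / q ω n := rfl
  have e : q ω n * ω - (GenContFract.of ω).nums n = q ω n * (ω - (GenContFract.of ω).convs n) := by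
    rw [hc]; field_simp
  rw [e, abs_mul, abs_of_pos h0]
  calc q ω n * |ω - (GenContFract.of ω).convs n|
      ≤ q ω n * (1 / (q ω n * q ω (n + 1))) := by gcongr; exact h
    _ = 1 / q ω (n + 1) := by field_simp

theorem determinant_ne_zero {ω : ℝ} (hω : Irrational ω) (n : ℕ) :
    (GenContFract.of ω).nums n * q ω (n + 1) - q ω n * (GenContFract.of ω).nums (n + 1) ≠ 0 := by
  have h := GenContFract.determinant (g := GenContFract.of ω) (n := n)
  unfold q
  rw [h, Finset.prod_ne_zero_iff]
  intro i _
  obtain ⟨gp, hgp, ha, -, -⟩ := exists_get_s hω i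
  rw [GenContFract.partNum_eq_s_a hgp, ha]
  simp

/-- A rational approximation `k / j` with `j ≤ q_{n+1} / 2` and `|j ω - k| < 1 / (2 q_{n+1})` would
equal both the `n`-th and the `(n+1)`-st convergent. -/
theorem half_inv_q_le_abs {ω : ℝ} (hω : Irrational ω) (n : ℕ) (j : ℕ) (hj : 1 ≤ j)
    (hjq : (j : ℝ) ≤ q ω (n + 1) / 2) (k : ℤ) : 1 / (2 * q ω (n + 1)) ≤ |j * ω - k| := by
  by_contra! hlt
  have key : ∀ i, i = n ∨ i = n + 1 → k * q ω i = j * (GenContFract.of ω).nums i := by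
    intro i hi
    obtain ⟨⟨p, hp⟩, d, hd⟩ := exists_int_convergent hω i
    have hd' : q ω i = d := hd
    have h0 := q_pos hω i
    have hqi : q ω i ≤ q ω (n + 1) := q_mono ω (by omega)
    have hqi' : q ω (n + 1) ≤ q ω (i + 1) := q_mono ω (by omega)
    have hq1 := q_pos hω (n + 1)
    have e : (k * d - j * p : ℝ) = j * (q ω i * ω - p) - (j * ω - k) * q ω i := by rw [hd']; ring
    have h1 : |j * (q ω i * ω - p)| ≤ 1 / 2 := by
      rw [abs_mul, Nat.abs_cast]
      have := abs_q_mul_sub_num_le hω i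
      rw [hp] at this
      calc (j : ℝ) * |q ω i * ω - p| ≤ (q ω (n + 1) / 2) * (1 / q ω (n + 1)) := by
            gcongr
            exact this.trans (one_div_le_one_div_of_le hq1 hqi')
        _ = 1 / 2 := by field_simp
    have h2 : |(j * ω - k) * q ω i| < 1 / 2 := by
      rw [abs_mul, abs_of_pos h0]
      calc |(j : ℝ) * ω - k| * q ω i < 1 / (2 * q ω (n + 1)) * q ω i := by gcongr
        _ ≤ 1 / (2 * q ω (n + 1)) * q ω (n + 1) := by gcongr
        _ = 1 / 2 := by field_simp
    have h3 : |(k * d - j * p : ℝ)| < 1 := by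
      rw [e]
      refine (abs_sub _ _).trans_lt ?_
      linarith
    have h4 : (k * d - j * p : ℤ) = 0 := by
      rw [← Int.abs_lt_one_iff]
      exact_mod_cast h3
    have h5 : (k * d - j * p : ℝ) = 0 := by exact_mod_cast h4
    rw [hd', hp]; linarith
  have h1 := key n (Or.inl rfl)
  have h2 := key (n + 1) (Or.inr rfl)
  apply determinant_ne_zero hω n
  have hj0 : (j : ℝ) ≠ 0 := by positivity
  apply mul_left_cancel₀ hj0
  linear_combination (-q ω (n + 1)) * h1 + q ω n * h2

/-- `ω` is badly approximable, with a constant that only depends on `M` once `j > q_1 / 2`. -/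
theorem badly_approximable {ω M : ℝ} (hω : Irrational ω)
    (hbdd : ∀ n : ℕ, 1 ≤ n → q ω (n + 1) < M * q ω n) (j : ℕ) (hj : q ω 1 / 2 < j) (k : ℤ) :
    1 / (4 * M * j) ≤ |j * ω - k| := by
  have hj1 : 1 ≤ j := by
    have := q_pos hω 1
    have h : (0 : ℝ) < j := by linarith
    exact_mod_cast h
  have hex : ∃ n, (j : ℝ) ≤ q ω (n + 1) / 2 := by
    refine ⟨2 * j + 4, ?_⟩
    have h1 := fib_le_q hω (2 * j + 4 + 1)
    have h2 : 2 * j + 4 + 1 + 1 ≤ Nat.fib (2 * j + 4 + 1 + 1) := Nat.le_fib_self (by omega)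
    have h3 : ((2 * j + 4 + 1 + 1 : ℕ) : ℝ) ≤ q ω (2 * j + 4 + 1) := le_trans (by exact_mod_cast h2) h1
    push_cast at h3
    linarith
  classical
  have hn := Nat.find_spec hex
  obtain ⟨m, hm⟩ : ∃ m, Nat.find hex = m + 1 := by
    refine Nat.exists_eq_succ_of_ne_zero fun h0 => ?_
    rw [h0] at hn
    simp only [zero_add] at hn
    linarith
  have hmin := Nat.find_min hex (m := m) (by omega)
  rw [hm] at hn
  push Not at hmin
  refine le_trans ?_ (half_inv_q_le_abs hω (m + 1) j hj1 hn k)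
  have h1 := hbdd (m + 1) (by omega)
  have hq := q_pos hω (m + 1 + 1)
  have hq' := q_pos hω (m + 1)
  have hM : 0 < M := by
    by_contra! h
    nlinarith
  apply one_div_le_one_div_of_le (by positivity)
  nlinarith

/-! ### Return times to the critical intervals -/

/-- The point `T^i x` of the orbit of `x`, on the line. -/
def tr (ω x : ℝ) (i : ℤ) : ℝ := x + 2 * Real.pi * ω * i

theorem tr_tr (ω x : ℝ) (i j : ℤ) : tr ω (tr ω x i) j = tr ω x (i + j) := by
  unfold tr; push_cast; ring

@[simp] theorem tr_zero (ω x : ℝ) : tr ω x 0 = x := by simp [tr]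

theorem crit_subset {ω : ℝ} (hω : Irrational ω) (c : ℝ) {C C' : ℝ} {n n' : ℕ} (hC' : 0 < C')
    (hC : C' ≤ C) (hn : n' ≤ n) : crit ω c C n ⊆ crit ω c C' n' := by
  rintro x ⟨m, hm⟩
  refine ⟨m, hm.trans ?_⟩
  have h1 := q_pos hω n'
  have h2 := q_mono ω hn
  have h3 : 0 ≤ C := hC'.le.trans hC
  apply one_div_le_one_div_of_le (by positivity)
  gcongr

/-- If two points of the orbit of `x` are in critical intervals, the rotation between them is small
modulo `π`. -/
theorem abs_rotation_le {ω c C C' : ℝ} {n : ℕ} {x : ℝ} {i : ℤ} (hx : x ∈ crit ω c C n)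
    (hy : tr ω x i ∈ crit ω c C' n) :
    ∃ k : ℤ, |2 * Real.pi * ω * i - k * Real.pi| ≤ 1 / (C * q ω n ^ 2) + 1 / (C' * q ω n ^ 2) := by
  obtain ⟨m, hm⟩ := hx
  obtain ⟨m', hm'⟩ := hy
  refine ⟨m' - m, ?_⟩
  have e : 2 * Real.pi * ω * i - ((m' - m : ℤ) : ℝ) * Real.pi
      = (tr ω x i - (c + m' * Real.pi)) - (x - (c + m * Real.pi)) := by
    unfold tr; push_cast; ring
  rw [e]
  refine (abs_sub _ _).trans ?_
  linarith

theorem tr_mem_crit_of_abs_rotation_le {ω c : ℝ} {n : ℕ} {x : ℝ} {i k : ℤ}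
    (hx : x ∈ crit ω c 1 n) (h : |2 * Real.pi * ω * i - k * Real.pi| ≤ 2 / q ω n ^ 2) :
    tr ω x i ∈ crit ω c (1 / 3) n := by
  obtain ⟨m, hm⟩ := hx
  refine ⟨m + k, ?_⟩
  have e : tr ω x i - (c + ((m + k : ℤ) : ℝ) * Real.pi)
      = (x - (c + m * Real.pi)) + (2 * Real.pi * ω * i - k * Real.pi) := by
    unfold tr; push_cast; ring
  rw [e]
  refine (abs_add_le _ _).trans ((add_le_add hm h).trans (le_of_eq ?_))
  ring

/-- A lower bound for the times at which the rotation is within `6 q_n⁻²` of the identity. -/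
theorem le_of_abs_rotation_le {ω M : ℝ} (hω : Irrational ω) (hM : 1 ≤ M)
    (hbdd : ∀ n : ℕ, 1 ≤ n → q ω (n + 1) < M * q ω n) {n : ℕ} (hn : 4 * q ω 1 < q ω n ^ 2)
    {j : ℕ} (hj : 1 ≤ j) {k : ℤ} (h : |2 * Real.pi * ω * j - k * Real.pi| ≤ 6 / q ω n ^ 2) :
    q ω n ^ 2 / (16 * M) ≤ j := by
  have hq := q_pos hω n
  have hq1 := q_pos hω 1
  have hj' : (1 : ℝ) ≤ j := by exact_mod_cast hj
  have h2 : |((2 * j : ℕ) : ℝ) * ω - k| ≤ 2 / q ω n ^ 2 := by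
    have e : 2 * Real.pi * ω * j - k * Real.pi = Real.pi * (((2 * j : ℕ) : ℝ) * ω - k) := by
      push_cast; ring
    rw [e, abs_mul, abs_of_pos Real.pi_pos] at h
    have h3 := Real.pi_gt_three
    have h4 : 3 * |((2 * j : ℕ) : ℝ) * ω - k| ≤ 6 / q ω n ^ 2 := le_trans (by gcongr) h
    have e2 : 6 / q ω n ^ 2 = 3 * (2 / q ω n ^ 2) := by ring
    linarith
  by_cases hc : q ω 1 / 2 < ((2 * j : ℕ) : ℝ)
  · have h3 := (badly_approximable hω hbdd (2 * j) hc k).trans h2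
    rw [div_le_div_iff₀ (by positivity) (by positivity)] at h3
    rw [div_le_iff₀ (by positivity)]
    push_cast at h3
    linarith
  · have h3 := (half_inv_q_le_abs hω 0 (2 * j) (by omega) (by push Not at hc; simpa using hc) k).trans h2
    rw [div_le_div_iff₀ (by positivity) (by positivity)] at h3
    simp only [zero_add] at h3
    linarith

/-- Every orbit visits `I_n / 10` within `384 M q_n²` steps. -/
theorem exists_visit {ω M : ℝ} (hω : Irrational ω) (hM : 1 ≤ M)
    (hbdd : ∀ n : ℕ, 1 ≤ n → q ω (n + 1) < M * q ω n) {n : ℕ} (hn : 4 * q ω 1 < q ω n ^ 2)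
    (c x : ℝ) : ∃ j : ℕ, 1 ≤ j ∧ (j : ℝ) ≤ 384 * M * q ω n ^ 2 ∧ tr ω x j ∈ crit ω c 10 n := by
  have hq1 := one_le_q hω n
  have hqq := one_le_q hω 1
  have hq2 : (1 : ℝ) ≤ q ω n ^ 2 := one_le_pow₀ hq1
  set B : ℝ := 384 * M * q ω n ^ 2 with hB
  have hB1 : 384 * q ω n ^ 2 ≤ B := by rw [hB]; nlinarith
  have hfl := Nat.floor_le (show 0 ≤ B by linarith)
  have hfl' := Nat.lt_floor_add_one B
  -- Dirichlet: a fraction `p` with denominator at most `B` whose multiples describe the orbit modulo `π`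
  obtain ⟨p, hp, hpd⟩ := Real.exists_rat_abs_sub_le_and_den_le (2 * ω) (n := ⌊B⌋₊)
    (Nat.floor_pos.2 (by linarith))
  have hd0 : (0 : ℝ) < p.den := by exact_mod_cast p.den_pos
  have hd1 : (1 : ℝ) ≤ p.den := by exact_mod_cast p.den_pos
  have hdB : (p.den : ℝ) ≤ B := le_trans (by exact_mod_cast hpd) hfl
  have hpq : (p : ℝ) = p.num / p.den := by exact_mod_cast (Rat.num_div_den p).symm
  have happ : |((2 * p.den : ℕ) : ℝ) * ω - p.num| ≤ 1 / B := by
    have e : ((2 * p.den : ℕ) : ℝ) * ω - p.num = p.den * (2 * ω - p) := by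
      rw [hpq]; push_cast; field_simp
    rw [e, abs_mul, abs_of_pos hd0]
    calc (p.den : ℝ) * |2 * ω - p| ≤ p.den * (1 / ((⌊B⌋₊ + 1) * p.den)) := by gcongr
      _ = 1 / (⌊B⌋₊ + 1) := by field_simp
      _ ≤ 1 / B := one_div_le_one_div_of_le (by linarith) hfl'.le
  -- bounded type: no smaller denominator approximates `2ω` as well as this, so the points
  -- `j * p` with `j ≤ p.den` are denser than `I_n / 10` is wide
  have hd : 48 * q ω n ^ 2 ≤ p.den := by
    by_cases hc : q ω 1 / 2 < ((2 * p.den : ℕ) : ℝ)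
    · have h3 := (badly_approximable hω hbdd _ hc p.num).trans happ
      rw [div_le_div_iff₀ (by positivity) (by positivity), hB] at h3
      push_cast at h3
      by_contra! hlt
      nlinarith
    · have h3 := (half_inv_q_le_abs hω 0 (2 * p.den) (by linarith [p.den_pos])
        (by push Not at hc; simpa using hc) p.num).trans happ
      rw [div_le_div_iff₀ (by positivity) (by positivity)] at h3
      simp only [zero_add] at h3
      linarith
  set y := (c - x) / Real.pi with hy
  set u : ℤ := round (y * p.den) with hu
  have hround := abs_sub_round (y * p.den)
  -- the residue `j` solves `j * p.num ≡ u` modulo the denominator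
  have hcop : IsCoprime p.num (p.den : ℤ) := Rat.isCoprime_num_den p
  obtain ⟨a, b, hab⟩ := hcop
  set j0 : ℤ := (u * a - 1) % p.den + 1 with hj0
  have hdz : (0 : ℤ) < p.den := by exact_mod_cast p.den_pos
  have hj0pos : 1 ≤ j0 := by have := Int.emod_nonneg (u * a - 1) hdz.ne'; omega
  have hj0le : j0 ≤ p.den := by have := Int.emod_lt_of_pos (u * a - 1) hdz; omega
  obtain ⟨k, hk⟩ : ∃ k : ℤ, j0 * p.num = u + k * p.den := by
    refine ⟨-(u * b) - ((u * a - 1) / p.den) * p.num, ?_⟩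
    have h := Int.emod_add_mul_ediv (u * a - 1) p.den
    have h' : j0 = u * a - p.den * ((u * a - 1) / p.den) := by omega
    rw [h']
    linear_combination u * hab
  obtain ⟨j, hj⟩ := Int.eq_ofNat_of_zero_le (show 0 ≤ j0 by omega)
  have hjR : (j : ℝ) = j0 := by rw [hj]; simp
  refine ⟨j, by omega, ?_, k, ?_⟩
  · have : (j : ℝ) ≤ p.den := by rw [hjR]; exact_mod_cast hj0le
    linarith
  · have hkR : (j0 : ℝ) * p.num = u + k * p.den := by exact_mod_cast hk
    have hjd : (j : ℝ) ≤ p.den := by rw [hjR]; exact_mod_cast hj0le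
    have e : tr ω x j - (c + k * Real.pi)
        = Real.pi * (j * (2 * ω - p) + (u - y * p.den) / p.den) := by
      have hx : x = c - y * Real.pi := by rw [hy]; field_simp; ring
      rw [hpq, hjR, hx]
      unfold tr
      rw [show (((j : ℕ) : ℤ) : ℝ) = j0 by rw [hj, Int.cast_natCast]]
      field_simp
      linear_combination Real.pi * hkR
    rw [e, abs_mul, abs_of_pos Real.pi_pos]
    have h1 : |(j : ℝ) * (2 * ω - p)| ≤ 1 / p.den := by
      rw [abs_mul, Nat.abs_cast]
      calc (j : ℝ) * |2 * ω - p| ≤ p.den * (1 / ((⌊B⌋₊ + 1) * p.den)) := by gcongr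
        _ = 1 / (⌊B⌋₊ + 1) := by field_simp
        _ ≤ 1 / p.den := one_div_le_one_div_of_le hd0 (by linarith)
    have h2 : |(u - y * p.den) / p.den| ≤ 1 / 2 / p.den := by
      rw [abs_div, abs_of_pos hd0, abs_sub_comm]
      gcongr
    have h3 := (abs_add_le ((j : ℝ) * (2 * ω - p)) ((u - y * p.den) / p.den)).trans (add_le_add h1 h2)
    have h4 : 1 / (p.den : ℝ) + 1 / 2 / p.den ≤ 1 / (32 * q ω n ^ 2) := by
      rw [show 1 / (p.den : ℝ) + 1 / 2 / p.den = 3 / (2 * p.den) by field_simp; norm_num,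
        div_le_div_iff₀ (by positivity) (by positivity)]
      linarith
    calc Real.pi * |(j : ℝ) * (2 * ω - p) + (u - y * p.den) / p.den|
        ≤ 3.15 * (1 / (32 * q ω n ^ 2)) := by
          gcongr
          · exact Real.pi_lt_d2.le
          · exact h3.trans h4
      _ ≤ 1 / (10 * q ω n ^ 2) := by
          rw [mul_one_div, div_le_div_iff₀ (by positivity) (by positivity)]
          nlinarith

/-! #### The minimal return time -/

theorem self_mem_crit {ω : ℝ} (hω : Irrational ω) (c : ℝ) {C : ℝ} (hC : 0 < C) (n : ℕ) :
    c ∈ crit ω c C n := by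
  refine ⟨0, ?_⟩
  have := q_pos hω n
  simp only [Int.cast_zero, zero_mul, add_zero, sub_self, abs_zero]
  positivity

theorem minReturn_mem {ω M : ℝ} (hω : Irrational ω) (hM : 1 ≤ M)
    (hbdd : ∀ n : ℕ, 1 ≤ n → q ω (n + 1) < M * q ω n) {n : ℕ} (hn : 4 * q ω 1 < q ω n ^ 2)
    (c : ℝ) : 1 ≤ minReturn ω c n ∧
      (∃ x ∈ crit ω c 1 n, tr ω x (minReturn ω c n) ∈ crit ω c 1 n) ∧
      (minReturn ω c n : ℝ) ≤ 384 * M * q ω n ^ 2 := by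
  obtain ⟨j, hj, hjle, hjm⟩ := exists_visit hω hM hbdd hn c c
  have hmem : j ∈ {j : ℕ | 1 ≤ j ∧ ∃ x ∈ crit ω c 1 n, x + 2 * Real.pi * ω * j ∈ crit ω c 1 n} :=
    ⟨hj, c, self_mem_crit hω c one_pos n,
      crit_subset (C := 10) hω c one_pos (by norm_num) le_rfl (by simpa [tr] using hjm)⟩
  have h := Nat.sInf_mem ⟨j, hmem⟩
  refine ⟨h.1, ?_, le_trans (by exact_mod_cast Nat.sInf_le hmem) hjle⟩
  obtain ⟨x, hx, hx'⟩ := h.2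
  exact ⟨x, hx, by simpa [tr, minReturn] using hx'⟩

theorem tr_minReturn_mem {ω M : ℝ} (hω : Irrational ω) (hM : 1 ≤ M)
    (hbdd : ∀ n : ℕ, 1 ≤ n → q ω (n + 1) < M * q ω n) {n : ℕ} (hn : 4 * q ω 1 < q ω n ^ 2)
    {c x : ℝ} (hx : x ∈ crit ω c 1 n) :
    tr ω x (minReturn ω c n) ∈ crit ω c (1 / 3) n ∧
      tr ω x (-(minReturn ω c n : ℤ)) ∈ crit ω c (1 / 3) n := by
  obtain ⟨-, ⟨y, hy, hy'⟩, -⟩ := minReturn_mem hω hM hbdd hn c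
  obtain ⟨k, hk⟩ := abs_rotation_le hy hy'
  have hk' : |2 * Real.pi * ω * (minReturn ω c n : ℤ) - k * Real.pi| ≤ 2 / q ω n ^ 2 :=
    hk.trans (le_of_eq (by ring))
  refine ⟨tr_mem_crit_of_abs_rotation_le hx hk', tr_mem_crit_of_abs_rotation_le (k := -k) hx ?_⟩
  rw [← abs_neg]
  convert hk' using 2
  push_cast; ring

theorem tr_not_mem_of_lt_minReturn {ω c x : ℝ} {n : ℕ} (hx : x ∈ crit ω c 1 n) {j : ℤ}
    (hj : j ≠ 0) (hj' : |j| < minReturn ω c n) : tr ω x j ∉ crit ω c 1 n := by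
  intro hy
  have aux : ∀ (k : ℕ) (z : ℝ), 1 ≤ k → k < minReturn ω c n → z ∈ crit ω c 1 n →
      tr ω z k ∉ crit ω c 1 n := by
    intro k z hk hk' hz hz'
    exact Nat.notMem_of_lt_sInf hk' ⟨hk, z, hz, by simpa [tr] using hz'⟩
  rw [← Int.natCast_natAbs] at hj'
  rcases lt_or_gt_of_ne hj with h | h
  · refine aux j.natAbs (tr ω x j) (by omega) (by omega) hy ?_
    rw [tr_tr]
    have e : j + (j.natAbs : ℤ) = 0 := by omega
    rwa [e, tr_zero]
  · refine aux j.natAbs x (by omega) (by omega) hx ?_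
    have e : (j.natAbs : ℤ) = j := by omega
    rwa [e]

/-! ### Blocks of the complexified cocycle -/

/-- The rotation `R_{π/2 - z}` with a complex angle. -/
def crot (z : ℂ) : Matrix (Fin 2) (Fin 2) ℂ :=
  !![Complex.sin z, -Complex.cos z; Complex.cos z, Complex.sin z]

/-- The inverse of `crot z`. -/
def crotInv (z : ℂ) : Matrix (Fin 2) (Fin 2) ℂ :=
  !![Complex.sin z, Complex.cos z; -Complex.cos z, Complex.sin z]

/-- `Λ = diag(lam, lam⁻¹)` as a complex matrix. -/
def cdiag (lam : ℝ) : Matrix (Fin 2) (Fin 2) ℂ := !![(lam : ℂ), 0; 0, (lam : ℂ)⁻¹]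

/-- The product `Λ R_{π/2 - θ_{i+m-1}} ⋯ Λ R_{π/2 - θ_i}` for a sequence of complex phases. -/
def cprod (lam : ℝ) (θ : ℤ → ℂ) (i : ℤ) : ℕ → Matrix (Fin 2) (Fin 2) ℂ
  | 0 => 1
  | m + 1 => cdiag lam * crot (θ (i + m)) * cprod lam θ i m

/-- The block `Λ R_{π/2 - θ_{i+m-1}} Λ ⋯ R_{π/2 - θ_{i+1}} Λ` of length `m`: the product `cprod`
without its first rotation. It depends only on the phases strictly between `i` and `i + m`. -/
def blk (lam : ℝ) (θ : ℤ → ℂ) (i : ℤ) (m : ℕ) : Matrix (Fin 2) (Fin 2) ℂ :=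
  cprod lam θ i m * crotInv (θ i)

theorem crotInv_mul_crot (z : ℂ) : crotInv z * crot z = 1 := by
  have h := Complex.sin_sq_add_cos_sq z
  ext i j
  fin_cases i <;> fin_cases j <;> simp [crotInv, crot, Matrix.mul_apply, Fin.sum_univ_two] <;>
    first | linear_combination h | ring1

theorem crot_mul_crotInv (z : ℂ) : crot z * crotInv z = 1 :=
  mul_eq_one_comm.1 (crotInv_mul_crot z)

theorem blk_mul_crot (lam : ℝ) (θ : ℤ → ℂ) (i : ℤ) (m : ℕ) :
    blk lam θ i m * crot (θ i) = cprod lam θ i m := by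
  rw [blk, mul_assoc, crotInv_mul_crot, mul_one]

theorem cprod_add (lam : ℝ) (θ : ℤ → ℂ) (i : ℤ) (m m' : ℕ) :
    cprod lam θ i (m + m') = cprod lam θ (i + m) m' * cprod lam θ i m := by
  induction m' with
  | zero => simp [cprod]
  | succ k ih =>
    rw [← add_assoc, cprod, ih, cprod]
    push_cast
    simp only [mul_assoc, add_assoc]

theorem blk_add (lam : ℝ) (θ : ℤ → ℂ) (i : ℤ) (m m' : ℕ) :
    blk lam θ i (m + m') = blk lam θ (i + m) m' * crot (θ (i + m)) * blk lam θ i m := by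
  rw [blk_mul_crot, blk, cprod_add, blk, mul_assoc]

theorem blk_one (lam : ℝ) (θ : ℤ → ℂ) (i : ℤ) : blk lam θ i 1 = cdiag lam := by
  simp [blk, cprod, mul_assoc, crot_mul_crotInv]

theorem blk_succ (lam : ℝ) (θ : ℤ → ℂ) (i : ℤ) (m : ℕ) :
    blk lam θ i (m + 1) = cdiag lam * crot (θ (i + m)) * blk lam θ i m := by
  rw [blk_add, blk_one]

theorem blk_congr {lam : ℝ} {θ θ' : ℤ → ℂ} {i : ℤ} {m : ℕ}
    (h : ∀ j : ℤ, i < j → j < i + m → θ j = θ' j) : 1 ≤ m → blk lam θ i m = blk lam θ' i m := by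
  intro hm
  induction m, hm using Nat.le_induction with
  | base => rw [blk_one, blk_one]
  | succ k hk ih =>
    rw [blk_succ, blk_succ, h (i + k) (by omega) (by push_cast; omega),
      ih fun j hj hj' => h j hj (by push_cast; omega)]

theorem cprod_shift (lam : ℝ) (θ : ℤ → ℂ) (i s : ℤ) (m : ℕ) :
    cprod lam (fun j => θ (j + s)) i m = cprod lam θ (i + s) m := by
  induction m with
  | zero => rfl
  | succ k ih => rw [cprod, cprod, ih, add_right_comm]

theorem blk_shift (lam : ℝ) (θ : ℤ → ℂ) (i s : ℤ) (m : ℕ) :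
    blk lam (fun j => θ (j + s)) i m = blk lam θ (i + s) m := by
  rw [blk, cprod_shift, blk]

theorem det_crot (z : ℂ) : (crot z).det = 1 := by
  have h := Complex.sin_sq_add_cos_sq z
  simp [crot, Matrix.det_fin_two]
  linear_combination h

theorem det_cdiag {lam : ℝ} (hlam : lam ≠ 0) : (cdiag lam).det = 1 := by
  simp [cdiag, Matrix.det_fin_two, hlam]

theorem det_blk {lam : ℝ} (hlam : lam ≠ 0) (θ : ℤ → ℂ) (i : ℤ) {m : ℕ} (hm : 1 ≤ m) :
    (blk lam θ i m).det = 1 := by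
  induction m, hm using Nat.le_induction with
  | base => rw [blk_one, det_cdiag hlam]
  | succ k _ ih => rw [blk_succ, Matrix.det_mul, Matrix.det_mul, ih, det_cdiag hlam, det_crot]; simp

theorem entry_det {A : Matrix (Fin 2) (Fin 2) ℂ} (h : A.det = 1) :
    A 0 0 * A 1 1 - A 0 1 * A 1 0 = 1 := by rwa [Matrix.det_fin_two] at h

/-! #### Entries of a product of blocks -/

theorem mul_crot_mul_00 (A B : Matrix (Fin 2) (Fin 2) ℂ) (z : ℂ) :
    (A * crot z * B) 0 0 = A 0 0 * (Complex.sin z * B 0 0 - Complex.cos z * B 1 0)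
      + A 0 1 * (Complex.cos z * B 0 0 + Complex.sin z * B 1 0) := by
  simp [crot, Matrix.mul_apply, Fin.sum_univ_two]; ring

theorem mul_crot_mul_01 (A B : Matrix (Fin 2) (Fin 2) ℂ) (z : ℂ) :
    (A * crot z * B) 0 1 = A 0 0 * (Complex.sin z * B 0 1 - Complex.cos z * B 1 1)
      + A 0 1 * (Complex.cos z * B 0 1 + Complex.sin z * B 1 1) := by
  simp [crot, Matrix.mul_apply, Fin.sum_univ_two]; ring

theorem mul_crot_mul_10 (A B : Matrix (Fin 2) (Fin 2) ℂ) (z : ℂ) :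
    (A * crot z * B) 1 0 = A 1 0 * (Complex.sin z * B 0 0 - Complex.cos z * B 1 0)
      + A 1 1 * (Complex.cos z * B 0 0 + Complex.sin z * B 1 0) := by
  simp [crot, Matrix.mul_apply, Fin.sum_univ_two]; ring

theorem mul_crot_mul_11 (A B : Matrix (Fin 2) (Fin 2) ℂ) (z : ℂ) :
    (A * crot z * B) 1 1 = A 1 0 * (Complex.sin z * B 0 1 - Complex.cos z * B 1 1)
      + A 1 1 * (Complex.cos z * B 0 1 + Complex.sin z * B 1 1) := by
  simp [crot, Matrix.mul_apply, Fin.sum_univ_two]; ring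

theorem norm_sin_cos_le {z : ℂ} (hz : |z.im| ≤ 1) : ‖Complex.sin z‖ ≤ 2 ∧ ‖Complex.cos z‖ ≤ 2 := by
  have h1 : ‖Complex.exp (z * Complex.I)‖ + ‖Complex.exp (-z * Complex.I)‖ ≤ 4 := by
    rw [Complex.norm_exp, Complex.norm_exp]
    simp only [Complex.mul_re, Complex.I_re, mul_zero, Complex.I_im, mul_one, zero_sub,
      neg_neg, neg_mul, Complex.neg_re]
    have hc := Real.cosh_eq z.im
    have h2 : Real.cosh z.im ≤ Real.cosh 1 := by
      rw [Real.cosh_le_cosh]; simpa using hz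
    have h3 : Real.cosh 1 ≤ 2 := by
      rw [Real.cosh_eq]
      have := Real.exp_one_lt_d9
      have h5 : Real.exp (-1) ≤ 1 := Real.exp_le_one_iff.2 (by norm_num)
      linarith
    linarith
  constructor
  · rw [Complex.sin, norm_div, norm_mul, Complex.norm_I, mul_one, Complex.norm_two]
    have := norm_sub_le (Complex.exp (-z * Complex.I)) (Complex.exp (z * Complex.I))
    linarith
  · rw [Complex.cos, norm_div, Complex.norm_two]
    have := norm_add_le (Complex.exp (z * Complex.I)) (Complex.exp (-z * Complex.I))
    linarith

/-- Trivial upper bound for the entries of a block. -/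
theorem norm_blk_le {lam : ℝ} (hlam : 1 ≤ lam) {θ : ℤ → ℂ} (hθ : ∀ i, |(θ i).im| ≤ 1) (i : ℤ)
    {m : ℕ} (hm : 1 ≤ m) (k l : Fin 2) : ‖blk lam θ i m k l‖ ≤ (4 * lam) ^ m := by
  have hinv : lam⁻¹ ≤ 1 := inv_le_one_of_one_le₀ hlam
  have hpos : 0 < lam := by linarith
  have hinv0 : 0 < lam⁻¹ := by positivity
  induction m, hm using Nat.le_induction generalizing k l with
  | base =>
    rw [blk_one, pow_one]
    have h0 : ‖(lam : ℂ)‖ = lam := by rw [Complex.norm_real, Real.norm_of_nonneg hpos.le]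
    have h0' : ‖(lam : ℂ)⁻¹‖ = lam⁻¹ := by rw [norm_inv, h0]
    fin_cases k <;> fin_cases l <;> simp [cdiag] <;> first | linarith | (rw [abs_of_pos hpos]; linarith)
  | succ n hn ih =>
    obtain ⟨hs, hc⟩ := norm_sin_cos_le (hθ (i + n))
    have h0 : ‖(lam : ℂ)‖ = lam := by rw [Complex.norm_real, Real.norm_of_nonneg hpos.le]
    have h0' : ‖(lam : ℂ)⁻¹‖ ≤ lam := by rw [norm_inv, h0]; linarith
    set D := (4 * lam) ^ n with hD
    have hD0 : 0 < D := by positivity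
    have key : ∀ x y u v : ℂ, ‖x‖ ≤ lam → ‖y‖ ≤ 2 → ‖u‖ ≤ 2 → ‖v‖ ≤ D → ∀ w : ℂ, ‖w‖ ≤ D →
        ‖x * (y * v + u * w)‖ ≤ (4 * lam) ^ (n + 1) := by
      intro x y u v hx hy hu hv w hw
      rw [norm_mul]
      have h1 : ‖y * v + u * w‖ ≤ 2 * D + 2 * D := by
        refine (norm_add_le _ _).trans ?_
        rw [norm_mul, norm_mul]
        gcongr
      calc ‖x‖ * ‖y * v + u * w‖ ≤ lam * (2 * D + 2 * D) := by gcongr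
        _ = (4 * lam) ^ (n + 1) := by rw [pow_succ, ← hD]; ring
    rw [blk_succ]
    have hc' : ‖-Complex.cos (θ (i + n))‖ ≤ 2 := by rwa [norm_neg]
    fin_cases k <;> fin_cases l
    · change ‖(cdiag lam * crot (θ (i + n)) * blk lam θ i n) 0 0‖ ≤ _
      rw [mul_crot_mul_00]
      convert key lam _ _ _ h0.le hs hc' (ih 0 0) _ (ih 1 0) using 2
      simp [cdiag, sub_eq_add_neg]
    · change ‖(cdiag lam * crot (θ (i + n)) * blk lam θ i n) 0 1‖ ≤ _
      rw [mul_crot_mul_01]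
      convert key lam _ _ _ h0.le hs hc' (ih 0 1) _ (ih 1 1) using 2
      simp [cdiag, sub_eq_add_neg]
    · change ‖(cdiag lam * crot (θ (i + n)) * blk lam θ i n) 1 0‖ ≤ _
      rw [mul_crot_mul_10]
      convert key _ _ _ _ h0' hc hs (ih 0 0) _ (ih 1 0) using 2
      simp [cdiag]
    · change ‖(cdiag lam * crot (θ (i + n)) * blk lam θ i n) 1 1‖ ≤ _
      rw [mul_crot_mul_11]
      convert key _ _ _ _ h0' hc hs (ih 0 1) _ (ih 1 1) using 2
      simp [cdiag]

/-- Two blocks with the same start have nearly the same `b / a`. -/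
theorem norm_sub_le_of_same_start {lam : ℝ} (hlam : 1 ≤ lam) {θ : ℤ → ℂ}
    (hθ : ∀ i, |(θ i).im| ≤ 1) (i : ℤ) {m m' : ℕ} (hm : 1 ≤ m) (hmm : m ≤ m')
    (ha : blk lam θ i m 0 0 ≠ 0) (ha' : blk lam θ i m' 0 0 ≠ 0) :
    ‖blk lam θ i m' 0 1 / blk lam θ i m' 0 0 - blk lam θ i m 0 1 / blk lam θ i m 0 0‖ ≤
      4 * (4 * lam) ^ (m' - m) / (‖blk lam θ i m 0 0‖ * ‖blk lam θ i m' 0 0‖) := by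
  obtain ⟨k, rfl⟩ := Nat.exists_eq_add_of_le hmm
  rcases Nat.eq_zero_or_pos k with rfl | hk
  · simp only [add_zero, sub_self, norm_zero]; positivity
  have hdet := entry_det (det_blk (by linarith : lam ≠ 0) θ i hm)
  obtain ⟨hs, hc⟩ := norm_sin_cos_le (hθ (i + m))
  have e : blk lam θ i (m + k) 0 1 / blk lam θ i (m + k) 0 0 - blk lam θ i m 0 1 / blk lam θ i m 0 0
      = (blk lam θ (i + m) k 0 1 * Complex.sin (θ (i + m))
        - blk lam θ (i + m) k 0 0 * Complex.cos (θ (i + m))) /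
        (blk lam θ i m 0 0 * blk lam θ i (m + k) 0 0) := by
    rw [div_sub_div _ _ ha' ha, div_eq_div_iff (mul_ne_zero ha' ha) (mul_ne_zero ha ha'), blk_add,
      mul_crot_mul_01, mul_crot_mul_00]
    linear_combination (-(blk lam θ (i + m) k 0 0 * Complex.cos (θ (i + m))) +
      blk lam θ (i + m) k 0 1 * Complex.sin (θ (i + m))) *
      (blk lam θ i m 0 0 * (blk lam θ (i + m) k 0 0 *
        (Complex.sin (θ (i + m)) * blk lam θ i m 0 0 - Complex.cos (θ (i + m)) * blk lam θ i m 1 0)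
      + blk lam θ (i + m) k 0 1 *
        (Complex.cos (θ (i + m)) * blk lam θ i m 0 0 + Complex.sin (θ (i + m)) * blk lam θ i m 1 0)))
      * hdet
  rw [e, norm_div, norm_mul, Nat.add_sub_cancel_left]
  gcongr
  refine (norm_sub_le _ _).trans ?_
  rw [norm_mul, norm_mul]
  have h1 := norm_blk_le hlam hθ (i + m) hk 0 1
  have h2 := norm_blk_le hlam hθ (i + m) hk 0 0
  calc _ ≤ (4 * lam) ^ k * 2 + (4 * lam) ^ k * 2 := by gcongr
    _ = _ := by ring

/-- Two blocks with the same end have nearly the same `c / a`. -/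
theorem norm_sub_le_of_same_end {lam : ℝ} (hlam : 1 ≤ lam) {θ : ℤ → ℂ}
    (hθ : ∀ i, |(θ i).im| ≤ 1) {i i' : ℤ} {m m' : ℕ} (hm : 1 ≤ m) (hmm : m ≤ m')
    (hi : i + m = i' + m') (ha : blk lam θ i m 0 0 ≠ 0) (ha' : blk lam θ i' m' 0 0 ≠ 0) :
    ‖blk lam θ i' m' 1 0 / blk lam θ i' m' 0 0 - blk lam θ i m 1 0 / blk lam θ i m 0 0‖ ≤
      4 * (4 * lam) ^ (m' - m) / (‖blk lam θ i m 0 0‖ * ‖blk lam θ i' m' 0 0‖) := by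
  obtain ⟨k, rfl⟩ := Nat.exists_eq_add_of_le' hmm
  have hi' : i = i' + k := by push_cast at hi; linarith
  subst hi'
  rcases Nat.eq_zero_or_pos k with rfl | hk
  · simp only [Nat.cast_zero, add_zero, zero_add, sub_self, norm_zero]; positivity
  have hdet := entry_det (det_blk (by linarith : lam ≠ 0) θ (i' + k) hm)
  obtain ⟨hs, hc⟩ := norm_sin_cos_le (hθ (i' + k))
  rw [add_comm k m] at *
  rw [add_comm m k] at *
  have e : blk lam θ i' (k + m) 1 0 / blk lam θ i' (k + m) 0 0
        - blk lam θ (i' + k) m 1 0 / blk lam θ (i' + k) m 0 0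
      = (blk lam θ i' k 0 0 * Complex.cos (θ (i' + k))
        + blk lam θ i' k 1 0 * Complex.sin (θ (i' + k))) /
        (blk lam θ (i' + k) m 0 0 * blk lam θ i' (k + m) 0 0) := by
    rw [div_sub_div _ _ ha' ha, div_eq_div_iff (mul_ne_zero ha' ha) (mul_ne_zero ha ha'), blk_add,
      mul_crot_mul_10, mul_crot_mul_00]
    linear_combination (blk lam θ i' k 0 0 * Complex.cos (θ (i' + k))
        + blk lam θ i' k 1 0 * Complex.sin (θ (i' + k))) *
      (blk lam θ (i' + k) m 0 0 * (blk lam θ (i' + k) m 0 0 *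
        (Complex.sin (θ (i' + k)) * blk lam θ i' k 0 0 - Complex.cos (θ (i' + k)) * blk lam θ i' k 1 0)
      + blk lam θ (i' + k) m 0 1 *
        (Complex.cos (θ (i' + k)) * blk lam θ i' k 0 0 + Complex.sin (θ (i' + k)) * blk lam θ i' k 1 0)))
      * hdet
  rw [e, norm_div, norm_mul, Nat.add_sub_cancel]
  gcongr
  refine (norm_add_le _ _).trans ?_
  rw [norm_mul, norm_mul]
  have h1 := norm_blk_le hlam hθ i' hk 1 0
  have h2 := norm_blk_le hlam hθ i' hk 0 0
  calc _ ≤ (4 * lam) ^ k * 2 + (4 * lam) ^ k * 2 := by gcongr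
    _ = _ := by ring

/-! ### Smooth dependence of blocks on the phases -/

section Smooth

variable {𝕜 : Type*} [NontriviallyNormedField 𝕜] [NormedAlgebra 𝕜 ℂ]
  {E : Type*} [NormedAddCommGroup E] [NormedSpace 𝕜 E]

theorem contDiffAt_mul_entry {n : WithTop ℕ∞} {w₀ : E} {A B : E → Matrix (Fin 2) (Fin 2) ℂ}
    (hA : ∀ k l, ContDiffAt 𝕜 n (fun w => A w k l) w₀)
    (hB : ∀ k l, ContDiffAt 𝕜 n (fun w => B w k l) w₀) (k l : Fin 2) :
    ContDiffAt 𝕜 n (fun w => (A w * B w) k l) w₀ := by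
  simp only [Matrix.mul_apply, Fin.sum_univ_two]
  exact ((hA k 0).mul (hB 0 l)).add ((hA k 1).mul (hB 1 l))

theorem contDiffAt_csin {n : WithTop ℕ∞} {w₀ : E} {f : E → ℂ} (hf : ContDiffAt 𝕜 n f w₀) :
    ContDiffAt 𝕜 n (fun w => Complex.sin (f w)) w₀ :=
  (Complex.contDiff_sin.restrict_scalars 𝕜).contDiffAt.comp w₀ hf

theorem contDiffAt_ccos {n : WithTop ℕ∞} {w₀ : E} {f : E → ℂ} (hf : ContDiffAt 𝕜 n f w₀) :
    ContDiffAt 𝕜 n (fun w => Complex.cos (f w)) w₀ :=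
  (Complex.contDiff_cos.restrict_scalars 𝕜).contDiffAt.comp w₀ hf

theorem contDiffAt_blk {n : WithTop ℕ∞} {w₀ : E} (lam : ℝ) {θ : E → ℤ → ℂ}
    (hθ : ∀ i, ContDiffAt 𝕜 n (fun w => θ w i) w₀) (i : ℤ) (m : ℕ) (k l : Fin 2) :
    ContDiffAt 𝕜 n (fun w => blk lam (θ w) i m k l) w₀ := by
  have hrot : ∀ j k l, ContDiffAt 𝕜 n (fun w => crot (θ w j) k l) w₀ := by
    intro j k l
    have hs := contDiffAt_csin (hθ j)
    have hc := contDiffAt_ccos (hθ j)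
    fin_cases k <;> fin_cases l
    exacts [hs, hc.neg, hc, hs]
  have hinv : ∀ j k l, ContDiffAt 𝕜 n (fun w => crotInv (θ w j) k l) w₀ := by
    intro j k l
    have hs := contDiffAt_csin (hθ j)
    have hc := contDiffAt_ccos (hθ j)
    fin_cases k <;> fin_cases l
    exacts [hs, hc, hc.neg, hs]
  have hprod : ∀ k l, ContDiffAt 𝕜 n (fun w => cprod lam (θ w) i m k l) w₀ := by
    induction m with
    | zero => intro k l; exact contDiffAt_const
    | succ m ih =>
      exact contDiffAt_mul_entry
        (contDiffAt_mul_entry (fun _ _ => contDiffAt_const) (hrot _)) ih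
  exact contDiffAt_mul_entry hprod (hinv i) k l

end Smooth

/-! ### The hyperbolicity induction -/

/-- The complex phases `θ` are `ρ`-close to the phases `φ(T^i x)` along the orbit of `x`. -/
def Near (ω : ℝ) (φ : ℝ → ℝ) (x ρ : ℝ) (θ : ℤ → ℂ) : Prop :=
  ∀ i, ‖θ i - φ (tr ω x i)‖ < ρ

/-- The block `A` of length `m` is expanding at rate `lam ^ κ`, and the directions that it expands
and contracts are close to the coordinate axes. -/
structure BlkGood (lam κ b : ℝ) (A : Matrix (Fin 2) (Fin 2) ℂ) (m : ℕ) : Prop where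
  le : lam ^ (κ * m) ≤ ‖A 0 0‖
  right : ‖A 0 1‖ ≤ b * ‖A 0 0‖
  left : ‖A 1 0‖ ≤ b * ‖A 0 0‖

/-- All blocks of the cocycle between two points of `E` that do not meet `F` in between are good,
even for complex phases within `ρ` of `φ`. -/
def Hyp (ω lam : ℝ) (φ : ℝ → ℝ) (E F : Set ℝ) (κ b ρ : ℝ) : Prop :=
  ∀ (x : ℝ) (m : ℕ), 1 ≤ m → x ∈ E → tr ω x m ∈ E →
    (∀ j : ℤ, 0 < j → j < m → tr ω x j ∉ F) →
    ∀ θ : ℤ → ℂ, Near ω φ x ρ θ → BlkGood lam κ b (blk lam θ 0 m) m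

theorem Near.shift {ω : ℝ} {φ : ℝ → ℝ} {x ρ : ℝ} {θ : ℤ → ℂ} (h : Near ω φ x ρ θ) (i : ℤ) :
    Near ω φ (tr ω x i) ρ (fun j => θ (j + i)) := by
  intro j
  have := h (j + i)
  rwa [tr_tr, add_comm i j]

theorem Near.mono {ω : ℝ} {φ : ℝ → ℝ} {x ρ ρ' : ℝ} {θ : ℤ → ℂ} (h : Near ω φ x ρ θ) (hρ : ρ ≤ ρ') :
    Near ω φ x ρ' θ := fun i => (h i).trans_le hρ

theorem near_self {ω : ℝ} (φ : ℝ → ℝ) (x : ℝ) {ρ : ℝ} (hρ : 0 < ρ) :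
    Near ω φ x ρ (fun i => (φ (tr ω x i) : ℂ)) := fun i => by simpa using hρ

theorem Near.abs_im_le {ω : ℝ} {φ : ℝ → ℝ} {x ρ : ℝ} {θ : ℤ → ℂ} (h : Near ω φ x ρ θ) (hρ : ρ ≤ 1)
    (i : ℤ) : |(θ i).im| ≤ 1 := by
  have h1 := Complex.abs_im_le_norm (θ i - φ (tr ω x i))
  have h2 := h i
  simp only [Complex.sub_im, Complex.ofReal_im, sub_zero] at h1
  linarith

theorem BlkGood.mono {lam κ κ' b b' : ℝ} {A : Matrix (Fin 2) (Fin 2) ℂ} {m : ℕ}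
    (h : BlkGood lam κ b A m) (hlam : 1 ≤ lam) (hκ : κ' ≤ κ) (hb : b ≤ b') :
    BlkGood lam κ' b' A m where
  le := (Real.rpow_le_rpow_of_exponent_le hlam (by gcongr)).trans h.le
  right := h.right.trans (by gcongr)
  left := h.left.trans (by gcongr)

theorem BlkGood.pos {lam κ b : ℝ} {A : Matrix (Fin 2) (Fin 2) ℂ} {m : ℕ}
    (h : BlkGood lam κ b A m) (hlam : 1 ≤ lam) : 0 < ‖A 0 0‖ :=
  (Real.rpow_pos_of_pos (by linarith) _).trans_le h.le

theorem BlkGood.ne_zero {lam κ b : ℝ} {A : Matrix (Fin 2) (Fin 2) ℂ} {m : ℕ}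
    (h : BlkGood lam κ b A m) (hlam : 1 ≤ lam) : A 0 0 ≠ 0 := norm_pos_iff.1 (h.pos hlam)

theorem BlkGood.norm_right_le {lam κ b : ℝ} {A : Matrix (Fin 2) (Fin 2) ℂ} {m : ℕ}
    (h : BlkGood lam κ b A m) (hlam : 1 ≤ lam) : ‖A 0 1 / A 0 0‖ ≤ b := by
  rw [norm_div, div_le_iff₀ (h.pos hlam)]; exact h.right

theorem BlkGood.norm_left_le {lam κ b : ℝ} {A : Matrix (Fin 2) (Fin 2) ℂ} {m : ℕ}
    (h : BlkGood lam κ b A m) (hlam : 1 ≤ lam) : ‖A 1 0 / A 0 0‖ ≤ b := by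
  rw [norm_div, div_le_iff₀ (h.pos hlam)]; exact h.left

theorem Hyp.at {ω lam : ℝ} {φ : ℝ → ℝ} {E F : Set ℝ} {κ b ρ : ℝ} (h : Hyp ω lam φ E F κ b ρ)
    {x : ℝ} {θ : ℤ → ℂ} (hθ : Near ω φ x ρ θ) {i : ℤ} {m : ℕ} (hm : 1 ≤ m) (hi : tr ω x i ∈ E)
    (hi' : tr ω x (i + m) ∈ E) (hF : ∀ j : ℤ, i < j → j < i + m → tr ω x j ∉ F) :
    BlkGood lam κ b (blk lam θ i m) m := by
  have := h (tr ω x i) m hm hi (by rwa [tr_tr])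
    (fun j h0 h1 => by rw [tr_tr]; exact hF _ (by omega) (by omega)) _ (hθ.shift i)
  rwa [blk_shift, zero_add] at this

/-- Hyperbolicity concerns only the values of the phase outside `F`. -/
theorem Hyp.congr {ω lam : ℝ} {φ ψ : ℝ → ℝ} {E F : Set ℝ} {κ b ρ : ℝ} (h : Hyp ω lam φ E F κ b ρ)
    (hρ : 0 < ρ) (hψ : ∀ x, x ∉ F → ψ x = φ x) : Hyp ω lam ψ E F κ b ρ := by
  classical
  intro x m hm hx hx' hF θ hθ
  have key := h x m hm hx hx' hF
    (fun i => if 0 < i ∧ i < m then θ i else (φ (tr ω x i) : ℂ)) ?_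
  · rwa [blk_congr (θ' := θ) ?_ hm] at key
    intro j h0 h1
    rw [if_pos ⟨h0, by omega⟩]
  · intro i
    dsimp only
    split_ifs with hi
    · rw [← hψ _ (hF i hi.1 hi.2)]; exact hθ i
    · simpa using hρ

theorem norm_sin_sub_le {z : ℂ} {t : ℝ} {ρ : ℝ} (h : ‖z - t‖ ≤ ρ) (hρ : ρ ≤ 1) :
    ‖Complex.sin z - Complex.sin t‖ ≤ 2 * ρ ∧ ‖Complex.cos z - Complex.cos t‖ ≤ 2 * ρ := by
  have him : ∀ u ∈ Metric.closedBall (t : ℂ) ρ, |u.im| ≤ 1 := by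
    intro u hu
    have h1 := Complex.abs_im_le_norm (u - t)
    rw [Metric.mem_closedBall, dist_eq_norm] at hu
    simp only [Complex.sub_im, Complex.ofReal_im, sub_zero] at h1
    linarith
  have hρ0 : 0 ≤ ρ := (norm_nonneg _).trans h
  have hz : z ∈ Metric.closedBall (t : ℂ) ρ := by rwa [Metric.mem_closedBall, dist_eq_norm]
  have ht : (t : ℂ) ∈ Metric.closedBall (t : ℂ) ρ := Metric.mem_closedBall_self hρ0
  constructor
  · refine ((convex_closedBall (t : ℂ) ρ).norm_image_sub_le_of_norm_hasDerivWithin_le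
      (fun u hu => (Complex.hasDerivAt_sin u).hasDerivWithinAt)
      (fun u hu => (norm_sin_cos_le (him u hu)).2) ht hz).trans ?_
    gcongr
  · refine ((convex_closedBall (t : ℂ) ρ).norm_image_sub_le_of_norm_hasDerivWithin_le
      (fun u hu => (Complex.hasDerivAt_cos u).hasDerivWithinAt)
      (fun u hu => by rw [norm_neg]; exact (norm_sin_cos_le (him u hu)).1) ht hz).trans ?_
    gcongr

/-- A quantity that is holomorphic and bounded for phases within `ρ` of `φ` varies little when
the phases vary within `ρ' ≪ ρ` of `φ` (Schwarz lemma). -/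
theorem norm_ratio_sub_le {ω lam : ℝ} {φ : ℝ → ℝ} {x ρ ρ' ζ : ℝ} {θ : ℤ → ℂ}
    (hθ : Near ω φ x ρ' θ) (hρ : 0 < ρ) (hρ' : ρ' ≤ ζ * ρ) (hζ : ζ < 1) {i : ℤ} {m : ℕ} (k l : Fin 2)
    (hgood : ∀ θ : ℤ → ℂ, Near ω φ x ρ θ →
      blk lam θ i m 0 0 ≠ 0 ∧ ‖blk lam θ i m k l / blk lam θ i m 0 0‖ ≤ 1 / 4) :
    ‖blk lam θ i m k l / blk lam θ i m 0 0 -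
      blk lam (fun i => (φ (tr ω x i) : ℂ)) i m k l /
        blk lam (fun i => (φ (tr ω x i) : ℂ)) i m 0 0‖ ≤ ζ := by
  have hρ0 : 0 < ρ' := (norm_nonneg _).trans_lt (hθ 0)
  set c : ℂ → ℤ → ℂ := fun w i => φ (tr ω x i) + w * (θ i - φ (tr ω x i)) with hc
  set f : ℂ → ℂ := fun w => blk lam (c w) i m k l / blk lam (c w) i m 0 0 with hf
  have hnear : ∀ w ∈ Metric.ball (0 : ℂ) (ρ / ρ'), Near ω φ x ρ (c w) := by
    intro w hw j
    rw [mem_ball_zero_iff, lt_div_iff₀ hρ0] at hw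
    simp only [hc, add_sub_cancel_left, norm_mul]
    have h1 := (hθ j).le
    calc ‖w‖ * ‖θ j - φ (tr ω x j)‖ ≤ ‖w‖ * ρ' := by gcongr
      _ < ρ := hw
  have hd : DifferentiableOn ℂ f (Metric.ball 0 (ρ / ρ')) := by
    intro w hw
    have hcd : ∀ i, ContDiffAt ℂ 1 (fun w => c w i) w := by
      intro i
      exact contDiffAt_const.add (contDiffAt_id.mul contDiffAt_const)
    exact (((contDiffAt_blk lam hcd i m k l).div (contDiffAt_blk lam hcd i m 0 0)
      (hgood _ (hnear w hw)).1).differentiableAt (by norm_num)).differentiableWithinAt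
  have hlt : ρ' < ρ := hρ'.trans_lt (by nlinarith)
  have h0 : (0 : ℂ) ∈ Metric.ball (0 : ℂ) (ρ / ρ') := Metric.mem_ball_self (by positivity)
  have h1 : (1 : ℂ) ∈ Metric.ball (0 : ℂ) (ρ / ρ') := by
    rw [mem_ball_zero_iff, norm_one, lt_div_iff₀ hρ0]; linarith
  have hmaps : Set.MapsTo f (Metric.ball 0 (ρ / ρ')) (Metric.ball (f 0) 1) := by
    intro w hw
    rw [Metric.mem_ball, dist_eq_norm]
    have h2 := (hgood _ (hnear w hw)).2
    have h3 := (hgood _ (hnear 0 h0)).2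
    refine (norm_sub_le _ _).trans_lt ?_
    simp only [hf]
    linarith
  have h := Complex.dist_le_div_mul_dist_of_mapsTo_ball hd
    (hmaps.mono_right Metric.ball_subset_closedBall) h1
  have e1 : c 1 = θ := by ext i; simp [hc]
  have e0 : c 0 = fun i => (φ (tr ω x i) : ℂ) := by ext i; simp [hc]
  simp only [hf, e1, e0, dist_eq_norm, sub_zero, norm_one, mul_one] at h
  refine h.trans ?_
  rw [one_div, inv_div, div_le_iff₀ hρ]
  exact hρ'

/-- Blocks with a common start: closeness of `b / a`, whichever of them is longer. -/
theorem norm_right_sub_le {lam κ b b' ℓ U ζ : ℝ} (hlam : 1 ≤ lam) {θ : ℤ → ℂ}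
    (hθ : ∀ i, |(θ i).im| ≤ 1)
    (hζ : ∀ m m' : ℕ, ℓ ≤ m → m ≤ m' → (m' : ℝ) ≤ U →
      4 * (4 * lam) ^ (m' - m) ≤ ζ * (lam ^ (κ * m) * lam ^ (κ * m')))
    {i : ℤ} {m m' : ℕ} (hm1 : 1 ≤ m) (hm1' : 1 ≤ m') (hm : ℓ ≤ m) (hmU : (m : ℝ) ≤ U) (hm' : ℓ ≤ m')
    (hmU' : (m' : ℝ) ≤ U) (h : BlkGood lam κ b (blk lam θ i m) m)
    (h' : BlkGood lam κ b' (blk lam θ i m') m') :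
    ‖blk lam θ i m' 0 1 / blk lam θ i m' 0 0 - blk lam θ i m 0 1 / blk lam θ i m 0 0‖ ≤ ζ := by
  wlog hmm : m ≤ m' generalizing m m' b b'
  · rw [norm_sub_rev]
    exact this hm1' hm1 hm' hmU' hm hmU h' h (by omega)
  refine (norm_sub_le_of_same_start hlam hθ i hm1 hmm (h.ne_zero hlam) (h'.ne_zero hlam)).trans ?_
  have h1 := h.pos hlam
  have h2 := h'.pos hlam
  rw [div_le_iff₀ (by positivity)]
  have hl : 0 < lam := by linarith
  have hζ0 : 0 ≤ ζ := by
    have := hζ m m' hm hmm hmU'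
    have h3 : 0 < lam ^ (κ * m) * lam ^ (κ * m') := by positivity
    by_contra! hneg
    have : 0 < 4 * (4 * lam) ^ (m' - m) := by positivity
    nlinarith
  refine (hζ m m' hm hmm hmU').trans ?_
  gcongr
  · exact h.le
  · exact h'.le

/-- Blocks with a common end: closeness of `c / a`, whichever of them is longer. -/
theorem norm_left_sub_le {lam κ b b' ℓ U ζ : ℝ} (hlam : 1 ≤ lam) {θ : ℤ → ℂ}
    (hθ : ∀ i, |(θ i).im| ≤ 1)
    (hζ : ∀ m m' : ℕ, ℓ ≤ m → m ≤ m' → (m' : ℝ) ≤ U →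
      4 * (4 * lam) ^ (m' - m) ≤ ζ * (lam ^ (κ * m) * lam ^ (κ * m')))
    {i i' : ℤ} {m m' : ℕ} (hm1 : 1 ≤ m) (hm1' : 1 ≤ m') (hm : ℓ ≤ m) (hmU : (m : ℝ) ≤ U)
    (hm' : ℓ ≤ m') (hmU' : (m' : ℝ) ≤ U) (hi : i + m = i' + m')
    (h : BlkGood lam κ b (blk lam θ i m) m) (h' : BlkGood lam κ b' (blk lam θ i' m') m') :
    ‖blk lam θ i' m' 1 0 / blk lam θ i' m' 0 0 - blk lam θ i m 1 0 / blk lam θ i m 0 0‖ ≤ ζ := by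
  wlog hmm : m ≤ m' generalizing m m' b b' i i'
  · rw [norm_sub_rev]
    exact this hm1' hm1 hm' hmU' hm hmU hi.symm h' h (by omega)
  refine (norm_sub_le_of_same_end hlam hθ hm1 hmm hi (h.ne_zero hlam) (h'.ne_zero hlam)).trans ?_
  have h1 := h.pos hlam
  have h2 := h'.pos hlam
  rw [div_le_iff₀ (by positivity)]
  have hl : 0 < lam := by linarith
  have hζ0 : 0 ≤ ζ := by
    have := hζ m m' hm hmm hmU'
    have h3 : 0 < lam ^ (κ * m) * lam ^ (κ * m') := by positivity
    by_contra! hneg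
    have : 0 < 4 * (4 * lam) ^ (m' - m) := by positivity
    nlinarith
  refine (hζ m m' hm hmm hmU').trans ?_
  gcongr
  · exact h.le
  · exact h'.le

/-- `sin (θ + arctan β - arctan γ)` up to a positive factor: the factor by which the junction of two
blocks at a point with phase `z` diminishes the product of their norms. -/
def junction (z β γ : ℂ) : ℂ :=
  Complex.sin z * (1 + β * γ) + Complex.cos z * (β - γ)

theorem mul_crot_mul_00_eq {A B : Matrix (Fin 2) (Fin 2) ℂ} (hA : A 0 0 ≠ 0) (hB : B 0 0 ≠ 0)
    (z : ℂ) : (A * crot z * B) 0 0 =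
      A 0 0 * B 0 0 * junction z (A 0 1 / A 0 0) (B 1 0 / B 0 0) := by
  rw [mul_crot_mul_00, junction]
  field_simp
  ring

theorem norm_junction_sub_le {z β γ β' γ' : ℂ} {t ζ : ℝ} (hz : ‖z - t‖ ≤ ζ) (hζ : ζ ≤ 1)
    (hβ : ‖β‖ ≤ 1 / 4) (hγ : ‖γ‖ ≤ 1 / 4) (hγ' : ‖γ'‖ ≤ 1 / 4)
    (hββ : ‖β - β'‖ ≤ 2 * ζ) (hγγ : ‖γ - γ'‖ ≤ 2 * ζ) :
    ‖junction z β γ - junction t β' γ'‖ ≤ 20 * ζ := by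
  obtain ⟨h1, h2⟩ := norm_sin_sub_le hz hζ
  have hζ0 : 0 ≤ ζ := (norm_nonneg _).trans hz
  have hs : ‖Complex.sin t‖ ≤ 1 := by
    rw [← Complex.ofReal_sin, Complex.norm_real]; exact Real.abs_sin_le_one t
  have hc : ‖Complex.cos t‖ ≤ 1 := by
    rw [← Complex.ofReal_cos, Complex.norm_real]; exact Real.abs_cos_le_one t
  have e : junction z β γ - junction t β' γ' = (Complex.sin z - Complex.sin t) * (1 + β * γ)
      + Complex.sin t * (β * (γ - γ') + (β - β') * γ') + (Complex.cos z - Complex.cos t) * (β - γ)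
      + Complex.cos t * ((β - β') - (γ - γ')) := by
    unfold junction; ring
  rw [e]
  have n1 : ‖1 + β * γ‖ ≤ 2 := by
    refine (norm_add_le _ _).trans ?_
    rw [norm_one, norm_mul]
    nlinarith [norm_nonneg β, norm_nonneg γ]
  have n2 : ‖β * (γ - γ') + (β - β') * γ'‖ ≤ ζ := by
    refine (norm_add_le _ _).trans ?_
    rw [norm_mul, norm_mul]
    have : ‖β‖ * ‖γ - γ'‖ + ‖β - β'‖ * ‖γ'‖ ≤ 1 / 4 * (2 * ζ) + (2 * ζ) * (1 / 4) := by gcongr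
    linarith
  have n3 : ‖β - γ‖ ≤ 1 := (norm_sub_le _ _).trans (by linarith)
  have n4 : ‖(β - β') - (γ - γ')‖ ≤ 4 * ζ := (norm_sub_le _ _).trans (by linarith)
  calc _ ≤ ‖(Complex.sin z - Complex.sin t) * (1 + β * γ)‖
      + ‖Complex.sin t * (β * (γ - γ') + (β - β') * γ')‖ + ‖(Complex.cos z - Complex.cos t) * (β - γ)‖
      + ‖Complex.cos t * ((β - β') - (γ - γ'))‖ := by
        refine (norm_add_le _ _).trans ?_
        gcongr
        refine (norm_add_le _ _).trans ?_
        gcongr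
        exact norm_add_le _ _
    _ ≤ 2 * ζ * 2 + 1 * ζ + 2 * ζ * 1 + 1 * (4 * ζ) := by
        simp only [norm_mul]
        gcongr
    _ ≤ 20 * ζ := by linarith

theorem exists_last_visit {P : ℕ → Prop} {m : ℕ} (h : ∃ j, 0 < j ∧ j < m ∧ P j) :
    ∃ j, 0 < j ∧ j < m ∧ P j ∧ ∀ i, j < i → i < m → ¬ P i := by
  classical
  obtain ⟨j, ⟨h0, h1, h2⟩⟩ := h
  let s := (Finset.range m).filter fun i => 0 < i ∧ P i
  have hs : s.Nonempty := ⟨j, by simp [s, h0, h1, h2]⟩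
  have hmax := s.max'_mem hs
  simp only [s, Finset.mem_filter, Finset.mem_range] at hmax
  refine ⟨s.max' hs, hmax.2.1, hmax.1, hmax.2.2, fun i hi hi' hP => ?_⟩
  have : i ≤ s.max' hs := s.le_max' i (by simp [s, hi', hP]; omega)
  omega

theorem exists_first_visit {P : ℕ → Prop} {m : ℕ} (h : ∃ j, 0 < j ∧ j < m ∧ P j) :
    ∃ j, 0 < j ∧ j < m ∧ P j ∧ ∀ i, 0 < i → i < j → ¬ P i := by
  classical
  have hex : ∃ j, 0 < j ∧ j < m ∧ P j := h
  refine ⟨Nat.find hex, (Nat.find_spec hex).1, (Nat.find_spec hex).2.1, (Nat.find_spec hex).2.2, ?_⟩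
  intro i hi hi' hP
  exact Nat.find_min hex hi' ⟨hi, hi'.trans (Nat.find_spec hex).2.1, hP⟩

/-- One step of the hyperbolicity induction. Long blocks are cut at their visits to `F`; the
junctions there are compared with the junction of the two blocks of length `r`, for the real
phase. -/
theorem Hyp.step {ω lam : ℝ} {φ : ℝ → ℝ} {E F E' F' : Set ℝ} {κ κ' b b' ρ ρ' ℓ U s ζ : ℝ} {r : ℕ}
    (h : Hyp ω lam φ E F κ b ρ) (hlam : 1 ≤ lam) (hE : E' ⊆ E) (hF : F ⊆ E') (hF' : F' ⊆ F)
    (hlen : ∀ x ∈ E, ∀ j : ℕ, 1 ≤ j → tr ω x j ∈ E → ℓ ≤ j)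
    (hwait : ∀ (x : ℝ) (m : ℕ), 1 ≤ m → (∀ j : ℤ, 0 < j → j < m → tr ω x j ∉ F') → (m : ℝ) ≤ U)
    (hr : 1 ≤ r)
    (hret : ∀ y ∈ F, tr ω y r ∈ E' ∧ tr ω y (-(r : ℤ)) ∈ E' ∧
      ∀ j : ℤ, j ≠ 0 → |j| < r → tr ω y j ∉ F)
    (hζ : ∀ m m' : ℕ, ℓ ≤ m → m ≤ m' → (m' : ℝ) ≤ U →
      4 * (4 * lam) ^ (m' - m) ≤ ζ * (lam ^ (κ' * m) * lam ^ (κ' * m')))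
    (hκ : κ' ≤ κ) (hloss : ∀ m : ℕ, ℓ ≤ m → lam ^ (κ' * m) ≤ s / 2 * lam ^ (κ * m))
    (hρ : 0 < ρ) (hρ1 : ρ ≤ 1) (hρ' : ρ' ≤ ζ * ρ) (hb : b + ζ ≤ b') (hb' : b' ≤ 1 / 4)
    (hζ0 : 0 ≤ ζ) (hs : 40 * ζ ≤ s) (hs1 : s ≤ 1)
    (hJ : ∀ y ∈ F, y ∉ F' → ∀ B C : Matrix (Fin 2) (Fin 2) ℂ,
      B = blk lam (fun i => (φ (tr ω y i) : ℂ)) 0 r →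
      C = blk lam (fun i => (φ (tr ω y i) : ℂ)) (-(r : ℤ)) r →
      s ≤ ‖junction (φ y) (B 0 1 / B 0 0) (C 1 0 / C 0 0)‖) :
    Hyp ω lam φ E' F' κ' b' ρ' := by
  intro x m hm hx hxm hvis θ hθ
  have hl : 0 < lam := by linarith
  have hζ1 : ζ < 1 := by linarith
  have hρρ : ρ' ≤ ρ := hρ'.trans (by nlinarith)
  have hbb : b ≤ b' := by linarith
  have him := hθ.abs_im_le (hρρ.trans hρ1)
  have hθ' : Near ω φ x ρ θ := hθ.mono hρρ
  -- peel off the last subblock: the first part is covered by the induction hypothesis, so only one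
  -- junction is estimated at a time
  induction m using Nat.strong_induction_on with
  | _ m ih =>
  by_cases hv : ∃ j : ℕ, 0 < j ∧ j < m ∧ tr ω x j ∈ F
  swap
  · push Not at hv
    refine (h x m hm (hE hx) (hE hxm) (fun j h0 h1 => ?_) θ hθ').mono hlam hκ hbb
    have := hv j.toNat (by omega) (by omega)
    rwa [Int.toNat_of_nonneg h0.le] at this
  obtain ⟨j, hj0, hjm, hjF, hjlast⟩ := exists_last_visit hv
  obtain ⟨j₁, hj₁0, hj₁m, hj₁F, hjfirst⟩ := exists_first_visit hv
  obtain ⟨k, rfl⟩ := Nat.exists_eq_add_of_le hjm.le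
  have hk : 1 ≤ k := by omega
  -- the two blocks that meet at the last visit to `F`
  have hA : BlkGood lam κ' b' (blk lam θ 0 j) j :=
    ih j hjm (by omega) (hF hjF) fun i h0 h1 => hvis i h0 (by push_cast; omega)
  have hB : BlkGood lam κ b (blk lam θ j k) k := by
    refine h.at hθ' hk (hE (hF hjF)) (by exact_mod_cast hE hxm) fun i h0 h1 => ?_
    have := hjlast i.toNat (by omega) (by omega)
    rwa [Int.toNat_of_nonneg (by omega)] at this
  have hA₁ : BlkGood lam κ b (blk lam θ 0 j₁) j₁ := by
    refine h x j₁ hj₁0 (hE hx) (hE (hF hj₁F)) (fun i h0 h1 => ?_) θ hθ'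
    have := hjfirst i.toNat (by omega) (by omega)
    rwa [Int.toNat_of_nonneg h0.le] at this
  -- lengths
  have hjF' := hE (hF hjF)
  have hlj : ℓ ≤ j := hlen x (hE hx) j hj0 hjF'
  have hlj₁ : ℓ ≤ j₁ := hlen x (hE hx) j₁ hj₁0 (hE (hF hj₁F))
  have hlk : ℓ ≤ k := by
    refine hlen _ hjF' k hk ?_
    rw [tr_tr]; exact_mod_cast hE hxm
  have hmU : ((j + k : ℕ) : ℝ) ≤ U := hwait x _ hm hvis
  have hjU : (j : ℝ) ≤ U := by push_cast at hmU; linarith [(Nat.cast_nonneg k : (0 : ℝ) ≤ k)]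
  have hkU : (k : ℝ) ≤ U := by push_cast at hmU; linarith [(Nat.cast_nonneg j : (0 : ℝ) ≤ j)]
  have hlm : ℓ ≤ ((j + k : ℕ) : ℝ) := by push_cast; linarith [(Nat.cast_nonneg k : (0 : ℝ) ≤ k)]
  have hj₁U : (j₁ : ℝ) ≤ U := le_trans (by exact_mod_cast hj₁m.le) hmU
  -- the reference blocks at `y`
  set y := tr ω x j with hy
  obtain ⟨hr1, hr2, hr3⟩ := hret y hjF
  have hlr : ℓ ≤ r := hlen y hjF' r hr (hE hr1)
  have hrU : (r : ℝ) ≤ U :=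
    hwait y r hr fun i h0 h1 hi => hr3 i h0.ne' (by rw [abs_of_pos h0]; exact h1) (hF' hi)
  have hRp : ∀ θ, Near ω φ x ρ θ → BlkGood lam κ b (blk lam θ j r) r := by
    intro θ hθ
    refine h.at hθ hr hjF' (by rw [← tr_tr]; exact hE hr1) fun i h0 h1 => ?_
    have := hr3 (i - j) (by omega) (by rw [abs_of_pos (by omega)]; omega)
    rwa [hy, tr_tr, add_sub_cancel] at this
  have hRm : ∀ θ, Near ω φ x ρ θ → BlkGood lam κ b (blk lam θ (j - r) r) r := by
    intro θ hθ
    refine h.at hθ hr ?_ (by rw [sub_add_cancel]; exact hjF') fun i h0 h1 => ?_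
    · rw [sub_eq_add_neg, ← tr_tr]; exact hE hr2
    have := hr3 (i - j) (by omega) (by rw [abs_of_neg (by omega)]; omega)
    rwa [hy, tr_tr, add_sub_cancel] at this
  have hz : ‖θ j - φ y‖ ≤ ζ := by
    have := (hθ j).le
    refine this.trans (hρ'.trans (by nlinarith))
  set θR : ℤ → ℂ := fun i => (φ (tr ω x i) : ℂ) with hθR
  have hββ : ‖blk lam θ j k 0 1 / blk lam θ j k 0 0 - blk lam θR j r 0 1 / blk lam θR j r 0 0‖
      ≤ 2 * ζ := by
    have e1 := norm_right_sub_le hlam him hζ hr hk hlr hrU hlk hkU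
      ((hRp θ hθ').mono hlam hκ le_rfl) (hB.mono hlam hκ le_rfl)
    have e2 := norm_ratio_sub_le (lam := lam) hθ hρ hρ' hζ1 (i := j) (m := r) 0 1 fun θ hθ =>
      ⟨(hRp θ hθ).ne_zero hlam, ((hRp θ hθ).norm_right_le hlam).trans (by linarith)⟩
    refine (norm_sub_le_norm_sub_add_norm_sub _ _ _).trans ((add_le_add e1 e2).trans ?_)
    linarith
  have hγγ : ‖blk lam θ 0 j 1 0 / blk lam θ 0 j 0 0
      - blk lam θR (j - r) r 1 0 / blk lam θR (j - r) r 0 0‖ ≤ 2 * ζ := by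
    have e1 := norm_left_sub_le hlam him hζ hr hj0 hlr hrU hlj hjU
      (by ring) ((hRm θ hθ').mono hlam hκ le_rfl) hA
    have e2 := norm_ratio_sub_le (lam := lam) hθ hρ hρ' hζ1 (i := j - r) (m := r) 1 0 fun θ hθ =>
      ⟨(hRm θ hθ).ne_zero hlam, ((hRm θ hθ).norm_left_le hlam).trans (by linarith)⟩
    refine (norm_sub_le_norm_sub_add_norm_sub _ _ _).trans ((add_le_add e1 e2).trans ?_)
    linarith
  have hRnear : Near ω φ x ρ θR := near_self φ x hρ
  have hjunc := norm_junction_sub_le hz (by linarith)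
    ((hB.norm_right_le hlam).trans (by linarith)) ((hA.norm_left_le hlam).trans (by linarith))
    (((hRm _ hRnear).norm_left_le hlam).trans (by linarith)) hββ hγγ
  have hshift : (fun i => (φ (tr ω y i) : ℂ)) = fun i => θR (i + j) := by
    ext i; rw [hθR, hy]; simp only [tr_tr]; rw [add_comm]
  have hJy : s ≤ ‖junction (φ y) (blk lam θR j r 0 1 / blk lam θR j r 0 0)
      (blk lam θR (j - r) r 1 0 / blk lam θR (j - r) r 0 0)‖ := by
    refine hJ y hjF (hvis j (by omega) (by push_cast; omega)) _ _ ?_ ?_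
    · rw [hshift, blk_shift, zero_add]
    · rw [hshift, blk_shift]; congr 1; ring
  have hJlow : s / 2 ≤ ‖junction (θ j) (blk lam θ j k 0 1 / blk lam θ j k 0 0)
      (blk lam θ 0 j 1 0 / blk lam θ 0 j 0 0)‖ := by
    have := norm_sub_norm_le (junction (φ y) (blk lam θR j r 0 1 / blk lam θR j r 0 0)
      (blk lam θR (j - r) r 1 0 / blk lam θR (j - r) r 0 0))
      (junction (θ j) (blk lam θ j k 0 1 / blk lam θ j k 0 0)
      (blk lam θ 0 j 1 0 / blk lam θ 0 j 0 0))
    rw [norm_sub_rev] at this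
    linarith
  -- the growth rates add up; the factor `s / 2` lost at the junction is paid for by `κ - κ'`
  have hle : lam ^ (κ' * (j + k : ℕ)) ≤ ‖blk lam θ 0 (j + k) 0 0‖ := by
    have e := mul_crot_mul_00_eq (hB.ne_zero hlam) (hA.ne_zero hlam) (θ j)
    rw [blk_add, zero_add, e, norm_mul, norm_mul]
    have hs0 : 0 ≤ s := by linarith
    calc lam ^ (κ' * (j + k : ℕ)) = lam ^ (κ' * k) * lam ^ (κ' * j) := by
          rw [← Real.rpow_add hl]; push_cast; ring_nf
      _ ≤ (s / 2 * lam ^ (κ * k)) * lam ^ (κ' * j) := by gcongr; exact hloss k hlk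
      _ = lam ^ (κ * k) * lam ^ (κ' * j) * (s / 2) := by ring
      _ ≤ _ := by
          gcongr
          · exact hB.le
          · exact hA.le
  -- a crude bound for the slopes of the whole block; by `norm_right_sub_le` and `norm_left_sub_le`
  -- they are within `ζ` of those of its first and of its last subblock, whatever the number of visits
  have hC0 : BlkGood lam κ' (‖blk lam θ 0 (j + k) 0 1‖ / ‖blk lam θ 0 (j + k) 0 0‖
      + ‖blk lam θ 0 (j + k) 1 0‖ / ‖blk lam θ 0 (j + k) 0 0‖)
      (blk lam θ 0 (j + k)) (j + k) := by
    have hpos : 0 < ‖blk lam θ 0 (j + k) 0 0‖ := (Real.rpow_pos_of_pos hl _).trans_le hle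
    refine ⟨hle, ?_, ?_⟩ <;> rw [add_mul, div_mul_cancel₀ _ hpos.ne', div_mul_cancel₀ _ hpos.ne']
    · linarith [norm_nonneg (blk lam θ 0 (j + k) 1 0)]
    · linarith [norm_nonneg (blk lam θ 0 (j + k) 0 1)]
  have hpos := hC0.pos hlam
  refine ⟨hle, ?_, ?_⟩
  · rw [← div_le_iff₀ hpos, ← norm_div]
    have e1 := norm_right_sub_le hlam him hζ (i := 0) hj₁0 hm hlj₁ hj₁U hlm hmU
      (hA₁.mono hlam hκ le_rfl) hC0
    have e2 := norm_le_norm_add_norm_sub' (blk lam θ 0 (j + k) 0 1 / blk lam θ 0 (j + k) 0 0)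
      (blk lam θ 0 j₁ 0 1 / blk lam θ 0 j₁ 0 0)
    have e3 := hA₁.norm_right_le hlam
    linarith
  · rw [← div_le_iff₀ hpos, ← norm_div]
    have e1 := norm_left_sub_le hlam him hζ (i := j) (i' := 0) hk hm hlk hkU hlm hmU
      (by push_cast; ring) (hB.mono hlam hκ le_rfl) hC0
    have e2 := norm_le_norm_add_norm_sub' (blk lam θ 0 (j + k) 1 0 / blk lam θ 0 (j + k) 0 0)
      (blk lam θ j k 1 0 / blk lam θ j k 0 0)
    have e3 := hB.norm_left_le hlam
    linarith

/-- The start of the hyperbolicity induction: if the phase is away from `πℤ` outside `F` and `lam`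
is large, each step outside `F` expands. -/
theorem Hyp.base {ω lam : ℝ} {φ : ℝ → ℝ} {F : Set ℝ} {s ρ : ℝ} (hs : 0 < s) (hs1 : s ≤ 1)
    (hρ : ρ ≤ s / 8) (hsin : ∀ x, x ∉ F → s / 2 ≤ |Real.sin (φ x)|) (hlam : 512 / s ^ 2 ≤ lam)
    (x : ℝ) (m : ℕ) (hm : 1 ≤ m) (hF : ∀ j : ℤ, 0 < j → j < m → tr ω x j ∉ F) (θ : ℤ → ℂ)
    (hθ : Near ω φ x ρ θ) :
    (lam * s / 8) ^ m ≤ ‖blk lam θ 0 m 0 0‖ ∧ lam ≤ ‖blk lam θ 0 m 0 0‖ ∧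
      ‖blk lam θ 0 m 0 1‖ ≤ 1 / 8 * ‖blk lam θ 0 m 0 0‖ ∧
      ‖blk lam θ 0 m 1 0‖ ≤ 1 / 8 * ‖blk lam θ 0 m 0 0‖ := by
  have hsq : s ^ 2 ≤ s := by nlinarith
  have hls : 512 ≤ lam * s ^ 2 := by rwa [div_le_iff₀ (by positivity)] at hlam
  have hl512 : 512 ≤ lam := by nlinarith [sq_nonneg s, mul_pos hs hs]
  have hls1 : 512 ≤ lam * s := by nlinarith
  have hl : 0 < lam := by linarith
  have him := hθ.abs_im_le (show ρ ≤ 1 by linarith)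
  have hnl : ‖(lam : ℂ)‖ = lam := by rw [Complex.norm_real, Real.norm_of_nonneg hl.le]
  -- the deviation of `b / a` is bounded by a quantity that improves as the block grows
  suffices hmain : (lam * s / 8) ^ m ≤ ‖blk lam θ 0 m 0 0‖ ∧ lam ≤ ‖blk lam θ 0 m 0 0‖ ∧
      ‖blk lam θ 0 m 0 1‖ ≤ 1 / 8 * ‖blk lam θ 0 m 0 0‖ - 1 ∧
      ‖blk lam θ 0 m 1 0‖ ≤ s / 16 * ‖blk lam θ 0 m 0 0‖ by
    obtain ⟨h1, h2, h3, h4⟩ := hmain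
    refine ⟨h1, h2, h3.trans (by linarith), h4.trans ?_⟩
    gcongr
    linarith
  induction m, hm using Nat.le_induction with
  | base =>
    rw [blk_one, pow_one]
    simp only [cdiag, Matrix.of_apply, Matrix.cons_val', Matrix.cons_val_zero, Matrix.cons_val_one,
      Matrix.cons_val_fin_one, hnl, norm_zero]
    refine ⟨by nlinarith, le_rfl, by linarith, by positivity⟩
  | succ k hk ih =>
    obtain ⟨h1, h2, h3, h4⟩ := ih fun j h0 h1 => hF j h0 (by push_cast; omega)
    set a := blk lam θ 0 k 0 0 with ha
    set b := blk lam θ 0 k 0 1 with hb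
    set c := blk lam θ 0 k 1 0 with hc
    set d := blk lam θ 0 k 1 1 with hd
    set z := θ (0 + k) with hz
    have hdet : a * d - b * c = 1 := entry_det (det_blk hl.ne' θ 0 hk)
    have hapos : 0 < ‖a‖ := by linarith
    have ha0 : a ≠ 0 := norm_pos_iff.1 hapos
    obtain ⟨hsz, hcz⟩ := norm_sin_cos_le (him (0 + k))
    have hsinz : s / 4 ≤ ‖Complex.sin z‖ := by
      have e0 : (0 : ℤ) + k = k := zero_add _
      have hnk := (hθ k).le
      have e1 := (norm_sin_sub_le hnk (by linarith)).1
      have e2 := hsin _ (hF k (by omega) (by push_cast; omega))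
      rw [← Real.norm_eq_abs, ← Complex.norm_real, Complex.ofReal_sin] at e2
      have e3 := norm_sub_norm_le (Complex.sin (φ (tr ω x k))) (Complex.sin (θ k))
      rw [norm_sub_rev] at e3
      rw [hz, e0]
      linarith
    set J := Complex.sin z * a - Complex.cos z * c with hJ
    have hJlow : s / 8 * ‖a‖ ≤ ‖J‖ := by
      have e3 := norm_sub_norm_le (Complex.sin z * a) (Complex.cos z * c)
      rw [norm_mul, norm_mul] at e3
      have e4 : ‖Complex.cos z‖ * ‖c‖ ≤ 2 * (s / 16 * ‖a‖) := by gcongr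
      have e5 : s / 4 * ‖a‖ ≤ ‖Complex.sin z‖ * ‖a‖ := by gcongr
      linarith
    have E00 : blk lam θ 0 (k + 1) 0 0 = lam * J := by
      rw [blk_succ, mul_crot_mul_00]; simp [cdiag, hJ, a, c, z]
    have E01 : blk lam θ 0 (k + 1) 0 1 = lam * (Complex.sin z * b - Complex.cos z * d) := by
      rw [blk_succ, mul_crot_mul_01]; simp [cdiag, b, d, z]
    have E10 : blk lam θ 0 (k + 1) 1 0 = (lam : ℂ)⁻¹ * (Complex.cos z * a + Complex.sin z * c) := by
      rw [blk_succ, mul_crot_mul_10]; simp [cdiag, a, c, z]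
    rw [E00, E01, E10]
    simp only [norm_mul, norm_inv, hnl]
    have hgrow : lam * (s / 8 * ‖a‖) ≤ lam * ‖J‖ := by gcongr
    have hbig : 64 * ‖a‖ ≤ lam * ‖J‖ := by nlinarith
    refine ⟨?_, by linarith, ?_, ?_⟩
    · calc (lam * s / 8) ^ (k + 1) = (lam * s / 8) ^ k * (lam * s / 8) := pow_succ _ _
        _ ≤ ‖a‖ * (lam * s / 8) := by gcongr
        _ = lam * (s / 8 * ‖a‖) := by ring
        _ ≤ _ := hgrow
    -- the determinant replaces the entry `d`
    · have e : (Complex.sin z * b - Complex.cos z * d) = (b * J - Complex.cos z) / a := by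
        rw [eq_div_iff ha0, hJ]
        linear_combination (-Complex.cos z) * hdet
      have e1 : ‖Complex.sin z * b - Complex.cos z * d‖ ≤ (‖b‖ * ‖J‖ + 2) / ‖a‖ := by
        rw [e, norm_div]
        gcongr
        refine (norm_sub_le _ _).trans ?_
        rw [norm_mul]
        gcongr
      have e2 : (‖b‖ * ‖J‖ + 2) / ‖a‖ ≤ ‖J‖ / 8 - 1 / lam := by
        rw [div_le_iff₀ hapos]
        have e3 : ‖b‖ * ‖J‖ ≤ (1 / 8 * ‖a‖ - 1) * ‖J‖ := by gcongr
        have e4 : 2 + ‖a‖ / lam ≤ ‖J‖ := by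
          have e5 : ‖a‖ / lam ≤ s / 16 * ‖a‖ := by
            rw [div_le_iff₀ hl]
            nlinarith
          have e6 : 2 ≤ s / 16 * ‖a‖ := by nlinarith
          linarith
        have e7 : 1 / lam * ‖a‖ = ‖a‖ / lam := by ring
        nlinarith
      calc lam * ‖Complex.sin z * b - Complex.cos z * d‖ ≤ lam * (‖J‖ / 8 - 1 / lam) := by
            gcongr; exact e1.trans e2
        _ = 1 / 8 * (lam * ‖J‖) - 1 := by field_simp
    · have e1 : ‖Complex.cos z * a + Complex.sin z * c‖ ≤ 4 * ‖a‖ := by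
        refine (norm_add_le _ _).trans ?_
        rw [norm_mul, norm_mul]
        have : ‖c‖ ≤ ‖a‖ := h4.trans (by nlinarith)
        have e2 : ‖Complex.cos z‖ * ‖a‖ + ‖Complex.sin z‖ * ‖c‖ ≤ 2 * ‖a‖ + 2 * ‖a‖ := by gcongr
        linarith
      have e2 : lam⁻¹ * (4 * ‖a‖) ≤ s / 16 * (lam * (s / 8 * ‖a‖)) := by
        rw [inv_mul_le_iff₀ hl]
        have : (512 * 512 : ℝ) ≤ (lam * s) * (lam * s) := by gcongr
        nlinarith
      calc lam⁻¹ * ‖Complex.cos z * a + Complex.sin z * c‖ ≤ lam⁻¹ * (4 * ‖a‖) := by gcongr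
        _ ≤ s / 16 * (lam * (s / 8 * ‖a‖)) := e2
        _ ≤ _ := by gcongr

/-! ### The most contracted direction in terms of matrix entries -/

/-- Up to the factor `1 / 2`, the quadratic form `|A u|²` is
`(qT A) |u|² + (qX A) (u₁² - u₂²) + (qY A) (2 u₁ u₂)`. -/
def qT (A : Mat) : ℝ := A 0 0 ^ 2 + A 1 0 ^ 2 + A 0 1 ^ 2 + A 1 1 ^ 2

/-- See `qT`. -/
def qX (A : Mat) : ℝ := A 0 0 ^ 2 + A 1 0 ^ 2 - A 0 1 ^ 2 - A 1 1 ^ 2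

/-- See `qT`. -/
def qY (A : Mat) : ℝ := 2 * (A 0 0 * A 0 1 + A 1 0 * A 1 1)

theorem norm_toLp_sq (u : Fin 2 → ℝ) :
    ‖(WithLp.toLp 2 u : EuclideanSpace ℝ (Fin 2))‖ ^ 2 = u 0 ^ 2 + u 1 ^ 2 := by
  rw [EuclideanSpace.norm_sq_eq]; simp [Fin.sum_univ_two]

theorem norm_mulVec_sq (A : Mat) (u : Fin 2 → ℝ) :
    ‖(WithLp.toLp 2 (A.mulVec u) : EuclideanSpace ℝ (Fin 2))‖ ^ 2 =
      (qT A * (u 0 ^ 2 + u 1 ^ 2) + qX A * (u 0 ^ 2 - u 1 ^ 2) + qY A * (2 * u 0 * u 1)) / 2 := by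
  rw [norm_toLp_sq]
  simp only [Matrix.mulVec, dotProduct, Fin.sum_univ_two, qT, qX, qY]
  ring

theorem stretch_sq (A : Mat) (ψ : ℝ) : stretch A ψ ^ 2 =
    (qT A + qX A * Real.cos (2 * ψ) + qY A * Real.sin (2 * ψ)) / 2 := by
  rw [stretch, norm_mulVec_sq, Real.cos_two_mul, Real.sin_two_mul]
  simp only [Matrix.cons_val_zero, Matrix.cons_val_one]
  have h := Real.sin_sq_add_cos_sq ψ
  linear_combination ((qT A - qX A) / 2) * h

theorem exists_cos_sin {x y : ℝ} (h : x ^ 2 + y ^ 2 = 1) : ∃ ψ, Real.cos ψ = x ∧ Real.sin ψ = y := by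
  have hn : ‖(⟨x, y⟩ : ℂ)‖ = 1 := by
    rw [Complex.norm_def, Complex.normSq_mk, ← sq, ← sq, h, Real.sqrt_one]
  have h0 : (⟨x, y⟩ : ℂ) ≠ 0 := by rw [← norm_ne_zero_iff, hn]; exact one_ne_zero
  exact ⟨Complex.arg ⟨x, y⟩, by rw [Complex.cos_arg h0, hn, div_one],
    by rw [Complex.sin_arg, hn, div_one]⟩

/-- A minimizing direction `s` is opposite, on the doubled circle, to the vector `(qX A, qY A)`. -/
theorem quadratic_of_minimizer {A : Mat} {s : ℝ} (hs : ∀ ψ, stretch A s ≤ stretch A ψ) :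
    qX A = -√(qX A ^ 2 + qY A ^ 2) * Real.cos (2 * s) ∧
      qY A = -√(qX A ^ 2 + qY A ^ 2) * Real.sin (2 * s) := by
  set r := √(qX A ^ 2 + qY A ^ 2) with hr
  have hr2 : r ^ 2 = qX A ^ 2 + qY A ^ 2 := Real.sq_sqrt (by positivity)
  have hr0 : 0 ≤ r := Real.sqrt_nonneg _
  have hle : qX A * Real.cos (2 * s) + qY A * Real.sin (2 * s) ≤ -r := by
    rcases hr0.eq_or_lt with h0 | h0
    · rw [← h0] at hr2
      have h1 : qX A = 0 := by nlinarith [sq_nonneg (qX A), sq_nonneg (qY A)]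
      have h2 : qY A = 0 := by nlinarith [sq_nonneg (qX A), sq_nonneg (qY A)]
      rw [h1, h2, ← h0]; simp
    · obtain ⟨ψ, hc, hsn⟩ := exists_cos_sin (x := -qX A / r) (y := -qY A / r) (by
        field_simp; linarith)
      have h1 : stretch A s ^ 2 ≤ stretch A (ψ / 2) ^ 2 := by
        have h0 : 0 ≤ stretch A s := norm_nonneg _
        gcongr
        exact hs _
      rw [stretch_sq, stretch_sq, mul_div_cancel₀ _ two_ne_zero, hc, hsn] at h1
      have h2 : qX A * (-qX A / r) + qY A * (-qY A / r) = -r := by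
        field_simp; linarith
      linarith
  have hcs := Real.sin_sq_add_cos_sq (2 * s)
  have hz : (qX A + r * Real.cos (2 * s)) ^ 2 + (qY A + r * Real.sin (2 * s)) ^ 2 ≤ 0 := by
    nlinarith
  have h1 : qX A + r * Real.cos (2 * s) = 0 := by
    nlinarith [sq_nonneg (qX A + r * Real.cos (2 * s)), sq_nonneg (qY A + r * Real.sin (2 * s))]
  have h2 : qY A + r * Real.sin (2 * s) = 0 := by
    nlinarith [sq_nonneg (qX A + r * Real.cos (2 * s)), sq_nonneg (qY A + r * Real.sin (2 * s))]
  constructor <;> linarith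

theorem minimizer_aux {X Y r s : ℝ} (hX : X ≠ 0) (hr : r = √(X ^ 2 + Y ^ 2))
    (h1 : X = -r * Real.cos (2 * s)) (h2 : Y = -r * Real.sin (2 * s)) :
    Real.cos (2 * s - Real.arctan (Y / X)) = -(|X| / X) := by
  have hr0 : 0 < r := by rw [hr]; positivity
  have hsq : √(1 + (Y / X) ^ 2) = r / |X| := by
    rw [hr, ← Real.sqrt_sq_eq_abs, ← Real.sqrt_div (by positivity)]
    congr 1
    field_simp
  have hc : Real.cos (2 * s) = -X / r := by field_simp; linarith
  have hs : Real.sin (2 * s) = -Y / r := by field_simp; linarith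
  have hr2 : r ^ 2 = X ^ 2 + Y ^ 2 := by rw [hr]; exact Real.sq_sqrt (by positivity)
  have habs : 0 < |X| := abs_pos.2 hX
  rw [Real.cos_sub, Real.cos_arctan, Real.sin_arctan, hsq, hc, hs]
  field_simp
  linear_combination hr2

theorem minimizer_of_pos {A : Mat} {s : ℝ} (hs : ∀ ψ, stretch A s ≤ stretch A ψ) (hX : 0 < qX A) :
    ∃ k : ℤ, s = Real.arctan (qY A / qX A) / 2 + Real.pi / 2 + k * Real.pi := by
  obtain ⟨h1, h2⟩ := quadratic_of_minimizer hs
  have h := minimizer_aux hX.ne' rfl h1 h2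
  rw [abs_of_pos hX, div_self hX.ne', Real.cos_eq_neg_one_iff] at h
  obtain ⟨k, hk⟩ := h
  exact ⟨k, by linarith⟩

theorem minimizer_of_neg {A : Mat} {s : ℝ} (hs : ∀ ψ, stretch A s ≤ stretch A ψ) (hX : qX A < 0) :
    ∃ k : ℤ, s = Real.arctan (qY A / qX A) / 2 + k * Real.pi := by
  obtain ⟨h1, h2⟩ := quadratic_of_minimizer hs
  have h := minimizer_aux hX.ne rfl h1 h2
  rw [abs_of_neg hX, neg_div, div_self hX.ne, neg_neg, Real.cos_eq_one_iff] at h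
  obtain ⟨k, hk⟩ := h
  exact ⟨k, by linarith⟩

theorem mostContracted_le (A : Mat) (ψ : ℝ) : stretch A (mostContracted A) ≤ stretch A ψ :=
  (Classical.choose_spec (exists_mostContracted A)).2 ψ

theorem mostContracted_mem (A : Mat) :
    mostContracted A ∈ Set.Ioc (-(Real.pi / 2)) (Real.pi / 2) :=
  (Classical.choose_spec (exists_mostContracted A)).1

theorem stretch_mul_rot (A : Mat) (β ψ : ℝ) : stretch (A * rot β) ψ = stretch A (ψ + β) := by
  unfold stretch
  congr 2
  rw [← Matrix.mulVec_mulVec]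
  congr 1
  ext i
  fin_cases i <;> simp [rot, Matrix.mulVec, dotProduct, Fin.sum_univ_two, Real.cos_add, Real.sin_add] <;>
    ring

theorem stretch_rot_mul (A : Mat) (β ψ : ℝ) : stretch (rot β * A) ψ = stretch A ψ := by
  have h : stretch (rot β * A) ψ ^ 2 = stretch A ψ ^ 2 := by
    unfold stretch
    rw [norm_toLp_sq, norm_toLp_sq, ← Matrix.mulVec_mulVec]
    set u := A.mulVec ![Real.cos ψ, Real.sin ψ]
    simp only [rot, Matrix.mulVec, dotProduct, Fin.sum_univ_two, Matrix.of_apply, Matrix.cons_val',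
      Matrix.cons_val_zero, Matrix.cons_val_one, Matrix.cons_val_fin_one]
    have := Real.sin_sq_add_cos_sq β
    linear_combination (u 0 ^ 2 + u 1 ^ 2) * this
  exact (pow_left_inj₀ (norm_nonneg _) (norm_nonneg _) two_ne_zero).1 h

theorem rot_mul_rot (α β : ℝ) : rot α * rot β = rot (α + β) := by
  ext i j
  fin_cases i <;> fin_cases j <;>
    simp [rot, Matrix.mul_apply, Fin.sum_univ_two, Real.cos_add, Real.sin_add] <;> ring

theorem rot_zero : rot 0 = 1 := by
  ext i j
  fin_cases i <;> fin_cases j <;> simp [rot]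

theorem rot_mul_rot_neg (β : ℝ) : rot β * rot (-β) = 1 := by
  rw [rot_mul_rot, add_neg_cancel, rot_zero]

theorem rot_inv (β : ℝ) : (rot β)⁻¹ = rot (-β) := Matrix.inv_eq_right_inv (rot_mul_rot_neg β)

theorem det_rot (β : ℝ) : (rot β).det = 1 := by
  simp only [rot, Matrix.det_fin_two_of]
  linear_combination Real.sin_sq_add_cos_sq β

/-- The angle, up to `π / 2`, of the direction most contracted by a matrix whose first column
dominates; for a block `A`, the stable direction is the phase plus `sdir A`. -/
def sdir (A : Mat) : ℝ :=
  Real.arctan (2 * (A 0 0 * A 0 1 + A 1 0 * A 1 1) /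
    (A 0 0 ^ 2 + A 1 0 ^ 2 - A 0 1 ^ 2 - A 1 1 ^ 2)) / 2

/-- The angle of the direction most contracted by the inverse of a matrix whose first row dominates;
for a block, this is the unstable direction at its end. -/
def udir (A : Mat) : ℝ := sdir A.transpose

theorem exists_mostContracted_mul_rot {A : Mat} (hX : 0 < qX A) (φ : ℝ) :
    ∃ k : ℤ, mostContracted (A * rot (Real.pi / 2 - φ)) = φ + sdir A + k * Real.pi := by
  have h : ∀ ψ, stretch A (mostContracted (A * rot (Real.pi / 2 - φ)) + (Real.pi / 2 - φ)) ≤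
      stretch A ψ := by
    intro ψ
    have := mostContracted_le (A * rot (Real.pi / 2 - φ)) (ψ - (Real.pi / 2 - φ))
    rwa [stretch_mul_rot, stretch_mul_rot, sub_add_cancel] at this
  obtain ⟨k, hk⟩ := minimizer_of_pos h hX
  exact ⟨k, by unfold sdir; unfold qX qY at hk; linarith⟩

theorem exists_mostContracted_inv {A : Mat} (hA : A.det = 1) (hX : 0 < qX A.transpose) (φ : ℝ) :
    ∃ k : ℤ, mostContracted (A * rot (Real.pi / 2 - φ))⁻¹ = udir A + k * Real.pi := by
  have hinv : A⁻¹ = !![A 1 1, -A 0 1; -A 1 0, A 0 0] := by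
    rw [Matrix.inv_def, hA, Matrix.adjugate_fin_two]; simp
  have h : ∀ ψ, stretch A⁻¹ (mostContracted (A * rot (Real.pi / 2 - φ))⁻¹) ≤ stretch A⁻¹ ψ := by
    intro ψ
    have e : (A * rot (Real.pi / 2 - φ))⁻¹ = rot (-(Real.pi / 2 - φ)) * A⁻¹ := by
      rw [Matrix.mul_inv_rev, rot_inv]
    have e' : ∀ ψ, stretch (A * rot (Real.pi / 2 - φ))⁻¹ ψ = stretch A⁻¹ ψ := fun ψ => by
      rw [e]; exact stretch_rot_mul _ _ _
    rw [← e', ← e']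
    exact mostContracted_le _ ψ
  have eX : qX A⁻¹ = -qX A.transpose := by rw [hinv]; simp [qX]; ring
  have eY : qY A⁻¹ = -qY A.transpose := by rw [hinv]; simp [qY]; ring
  obtain ⟨k, hk⟩ := minimizer_of_neg h (by rw [eX]; linarith)
  refine ⟨k, ?_⟩
  rw [eX, eY, neg_div_neg_eq] at hk
  rw [hk, udir, sdir, qX, qY]

/-! #### Operator norms -/

theorem norm_entry_le (A : Mat) (i j : Fin 2) : |A i j| ≤ ‖A‖ := by
  have h := Matrix.l2_opNorm_mulVec A (EuclideanSpace.single j (1 : ℝ))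
  have h1 : ‖(EuclideanSpace.single j (1 : ℝ) : EuclideanSpace ℝ (Fin 2))‖ = 1 := by simp
  rw [h1, mul_one] at h
  refine le_trans ?_ h
  have h2 := PiLp.norm_apply_le (WithLp.toLp 2 (A.mulVec (EuclideanSpace.single j (1 : ℝ)).ofLp) :
    EuclideanSpace ℝ (Fin 2)) i
  refine le_trans (le_of_eq ?_) h2
  simp [Matrix.mulVec_single]

theorem norm_le_of_mulVec {A : Mat} {K : ℝ} (hK : 0 ≤ K)
    (h : ∀ u : Fin 2 → ℝ, ‖(WithLp.toLp 2 (A.mulVec u) : EuclideanSpace ℝ (Fin 2))‖ ≤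
      K * ‖(WithLp.toLp 2 u : EuclideanSpace ℝ (Fin 2))‖) : ‖A‖ ≤ K := by
  rw [Matrix.cstar_norm_def]
  refine ContinuousLinearMap.opNorm_le_bound _ hK fun x => ?_
  have := h x.ofLp
  rwa [← Matrix.toEuclideanCLM_toLp (𝕜 := ℝ) A] at this

theorem norm_rot_le (β : ℝ) : ‖rot β‖ ≤ 1 := by
  refine norm_le_of_mulVec zero_le_one fun u => ?_
  rw [one_mul, ← abs_of_nonneg (norm_nonneg (WithLp.toLp 2 ((rot β).mulVec u) :
    EuclideanSpace ℝ (Fin 2))), ← abs_of_nonneg (norm_nonneg (WithLp.toLp 2 u :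
    EuclideanSpace ℝ (Fin 2))), ← sq_le_sq, norm_toLp_sq, norm_toLp_sq]
  refine le_of_eq ?_
  simp only [rot, Matrix.mulVec, dotProduct, Fin.sum_univ_two, Matrix.of_apply, Matrix.cons_val',
      Matrix.cons_val_zero, Matrix.cons_val_one, Matrix.cons_val_fin_one]
  have := Real.sin_sq_add_cos_sq β
  linear_combination (u 0 ^ 2 + u 1 ^ 2) * this

theorem norm_mul_rot (A : Mat) (β : ℝ) : ‖A * rot β‖ = ‖A‖ := by
  apply le_antisymm
  · refine (Matrix.l2_opNorm_mul _ _).trans ?_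
    nlinarith [norm_nonneg A, norm_rot_le β]
  · have h : A = (A * rot β) * rot (-β) := by rw [mul_assoc, rot_mul_rot_neg, mul_one]
    conv_lhs => rw [h]
    refine (Matrix.l2_opNorm_mul _ _).trans ?_
    nlinarith [norm_nonneg (A * rot β), norm_rot_le (-β)]

theorem norm_rot_mul (A : Mat) (β : ℝ) : ‖rot β * A‖ = ‖A‖ := by
  apply le_antisymm
  · refine (Matrix.l2_opNorm_mul _ _).trans ?_
    nlinarith [norm_nonneg A, norm_rot_le β]
  · have h : A = rot (-β) * (rot β * A) := by
      rw [← mul_assoc, rot_mul_rot, neg_add_cancel, rot_zero, one_mul]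
    conv_lhs => rw [h]
    refine (Matrix.l2_opNorm_mul _ _).trans ?_
    nlinarith [norm_nonneg (rot β * A), norm_rot_le (-β)]

theorem norm_cocycle_le {lam : ℝ} (hlam : 1 ≤ lam) (φ : ℝ → ℝ) (x : ℝ) :
    ‖cocycle lam φ x‖ ≤ lam := by
  rw [cocycle, norm_mul_rot]
  refine norm_le_of_mulVec (by linarith) fun u => ?_
  have hinv : lam⁻¹ ≤ 1 := inv_le_one_of_one_le₀ hlam
  have hinv0 : 0 < lam⁻¹ := by positivity
  refine le_of_sq_le_sq ?_ (by positivity)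
  rw [mul_pow, norm_toLp_sq, norm_toLp_sq]
  simp only [Matrix.mulVec, dotProduct, Fin.sum_univ_two, Matrix.of_apply, Matrix.cons_val',
      Matrix.cons_val_zero, Matrix.cons_val_one, Matrix.cons_val_fin_one]
  have h2 : lam⁻¹ ^ 2 ≤ lam ^ 2 := by gcongr; linarith
  nlinarith [sq_nonneg (u 0), sq_nonneg (u 1)]

theorem det_cocycle {lam : ℝ} (hlam : lam ≠ 0) (φ : ℝ → ℝ) (x : ℝ) : (cocycle lam φ x).det = 1 := by
  rw [cocycle, Matrix.det_mul, det_rot, Matrix.det_fin_two_of]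
  simp [hlam]

theorem norm_inv_of_det_eq_one {A : Mat} (hA : A.det = 1) : ‖A⁻¹‖ = ‖A‖ := by
  have hinv : A⁻¹ = rot (Real.pi / 2) * A.transpose * rot (-(Real.pi / 2)) := by
    rw [Matrix.inv_def, hA, Matrix.adjugate_fin_two]
    ext i j
    fin_cases i <;> fin_cases j <;>
      simp [rot, Matrix.mul_apply, Matrix.vecMul, dotProduct, Fin.sum_univ_two]
  rw [hinv, norm_mul_rot, norm_rot_mul]
  have := Matrix.l2_opNorm_conjTranspose A
  rwa [Matrix.conjTranspose_eq_transpose_of_trivial] at this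

/-! ### The complexified contracted direction -/

theorem hasDerivAt_carctan {z : ℂ} (hz : ‖z‖ < 1) :
    HasDerivAt Complex.arctan (1 / (1 + z ^ 2)) z := by
  have hI : ‖z * Complex.I‖ < 1 := by simpa using hz
  have h1 : 1 + z * Complex.I ≠ 0 := by
    intro h
    have : z * Complex.I = -1 := by linear_combination h
    rw [this] at hI; simp at hI
  have h2 : 1 - z * Complex.I ≠ 0 := by
    intro h
    have : z * Complex.I = 1 := by linear_combination -h
    rw [this] at hI; simp at hI
  have hmem : (1 + z * Complex.I) / (1 - z * Complex.I) ∈ Complex.slitPlane := by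
    left
    rw [Complex.div_re, ← add_div]
    apply div_pos _ (Complex.normSq_pos.2 h2)
    have := Complex.normSq_eq_norm_sq (z * Complex.I)
    have h3 : Complex.normSq (z * Complex.I) < 1 := by rw [this]; nlinarith [norm_nonneg (z * Complex.I)]
    rw [Complex.normSq_apply] at h3
    simp only [Complex.add_re, Complex.sub_re, Complex.add_im, Complex.sub_im, Complex.one_re,
      Complex.one_im] at h3 ⊢
    nlinarith
  have hn : HasDerivAt (fun z : ℂ => 1 + z * Complex.I) Complex.I z := by
    simpa using ((hasDerivAt_id z).mul_const Complex.I).const_add 1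
  have hd : HasDerivAt (fun z : ℂ => 1 - z * Complex.I) (-Complex.I) z := by
    simpa using ((hasDerivAt_id z).mul_const Complex.I).const_sub 1
  have h := (((hn.div hd h2).clog hmem).const_mul (-Complex.I / 2))
  have e : 1 + z ^ 2 = (1 + z * Complex.I) * (1 - z * Complex.I) := by
    linear_combination z ^ 2 * Complex.I_sq
  refine h.congr_deriv ?_
  simp only [Pi.div_apply]
  rw [e]
  have e2 : Complex.I * (1 - z * Complex.I) - (1 + z * Complex.I) * -Complex.I = 2 * Complex.I := by
    ring
  rw [e2]
  have e3 : -Complex.I / 2 * (2 * Complex.I / (1 - z * Complex.I) ^ 2 /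
      ((1 + z * Complex.I) / (1 - z * Complex.I)))
      = -(Complex.I ^ 2) * (1 / ((1 + z * Complex.I) * (1 - z * Complex.I))) := by
    field_simp
  rw [e3, Complex.I_sq, neg_neg, one_mul]

theorem norm_carctan_sub_le {z w : ℂ} (hz : ‖z‖ ≤ 3 / 4) (hw : ‖w‖ ≤ 3 / 4) :
    ‖Complex.arctan z - Complex.arctan w‖ ≤ 3 * ‖z - w‖ := by
  refine (convex_closedBall (0 : ℂ) (3 / 4)).norm_image_sub_le_of_norm_hasDerivWithin_le
      (fun u hu => (hasDerivAt_carctan ?_).hasDerivWithinAt) (fun u hu => ?_) (by simpa using hw)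
      (by simpa using hz)
  · rw [mem_closedBall_zero_iff] at hu; linarith
  · rw [mem_closedBall_zero_iff] at hu
    rw [norm_div, norm_one]
    have h1 : 1 - ‖u‖ ^ 2 ≤ ‖1 + u ^ 2‖ := by
      have := norm_sub_norm_le (1 : ℂ) (-u ^ 2)
      rw [norm_one, norm_neg, norm_pow, sub_neg_eq_add] at this
      exact this
    have h2 : ‖u‖ ^ 2 ≤ (3 / 4) ^ 2 := by gcongr
    rw [div_le_iff₀ (by linarith)]
    linarith

/-- The tangent of twice the angle `cdir A`. -/
def cquot (A : Matrix (Fin 2) (Fin 2) ℂ) : ℂ :=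
  2 * (A 0 0 * A 0 1 + A 1 0 * A 1 1) / (A 0 0 ^ 2 + A 1 0 ^ 2 - A 0 1 ^ 2 - A 1 1 ^ 2)

/-- The holomorphic extension of `sdir` to complex matrices. -/
def cdir (A : Matrix (Fin 2) (Fin 2) ℂ) : ℂ := Complex.arctan (cquot A) / 2

theorem ofReal_sdir (A : Mat) : ((sdir A : ℝ) : ℂ) = cdir (A.map Complex.ofReal) := by
  unfold sdir cdir cquot
  push_cast
  simp

/-- A matrix of determinant one whose upper left entry dominates. -/
structure Dominant (A : Matrix (Fin 2) (Fin 2) ℂ) : Prop where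
  det : A.det = 1
  le : 4 ≤ ‖A 0 0‖
  right : ‖A 0 1‖ ≤ 1 / 4 * ‖A 0 0‖
  left : ‖A 1 0‖ ≤ 1 / 4 * ‖A 0 0‖

theorem Dominant.transpose {A : Matrix (Fin 2) (Fin 2) ℂ} (h : Dominant A) : Dominant A.transpose where
  det := by rw [Matrix.det_transpose]; exact h.det
  le := h.le
  right := h.left
  left := h.right

theorem BlkGood.dominant {lam κ b : ℝ} {A : Matrix (Fin 2) (Fin 2) ℂ} {m : ℕ}
    (h : BlkGood lam κ b A m) (hA : A.det = 1) (hb : b ≤ 1 / 4) (h4 : 4 ≤ ‖A 0 0‖) : Dominant A :=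
  ⟨hA, h4, h.right.trans (by gcongr), h.left.trans (by gcongr)⟩

theorem Dominant.quot {A : Matrix (Fin 2) (Fin 2) ℂ} (h : Dominant A) :
    A 0 0 ^ 2 + A 1 0 ^ 2 - A 0 1 ^ 2 - A 1 1 ^ 2 ≠ 0 ∧ ‖cquot A‖ ≤ 3 / 4 ∧
      ‖2 * (A 0 1 / A 0 0) / (1 - (A 0 1 / A 0 0) ^ 2)‖ ≤ 3 / 4 ∧ 1 - (A 0 1 / A 0 0) ^ 2 ≠ 0 ∧
      ‖cquot A - 2 * (A 0 1 / A 0 0) / (1 - (A 0 1 / A 0 0) ^ 2)‖ ≤ (‖A 0 0‖ ^ 2)⁻¹ := by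
  have hdet := entry_det h.det
  have h4 := h.le
  have hR := h.right
  have hL := h.left
  have hpos : 0 < ‖A 0 0‖ := by linarith
  have ha : A 0 0 ≠ 0 := norm_pos_iff.1 hpos
  obtain ⟨β, hβ⟩ : ∃ β, A 0 1 = β * A 0 0 := ⟨A 0 1 / A 0 0, by field_simp⟩
  obtain ⟨γ, hγ⟩ : ∃ γ, A 1 0 = γ * A 0 0 := ⟨A 1 0 / A 0 0, by field_simp⟩
  set ε : ℂ := (A 0 0 ^ 2)⁻¹ with hε
  have hd : A 1 1 = (ε + β * γ) * A 0 0 := by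
    rw [hβ, hγ] at hdet
    rw [hε]
    field_simp
    linear_combination hdet
  have hβ' : A 0 1 / A 0 0 = β := by rw [hβ]; field_simp
  have nβ : ‖β‖ ≤ 1 / 4 := by
    rw [hβ, norm_mul] at hR; exact le_of_mul_le_mul_right hR hpos
  have nγ : ‖γ‖ ≤ 1 / 4 := by
    rw [hγ, norm_mul] at hL; exact le_of_mul_le_mul_right hL hpos
  have nε0 : ‖ε‖ = (‖A 0 0‖ ^ 2)⁻¹ := by rw [hε, norm_inv, norm_pow]
  have nε : ‖ε‖ ≤ 1 / 16 := by
    rw [nε0, one_div]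
    apply inv_anti₀ (by norm_num)
    nlinarith
  set δ := ε + β * γ with hδ
  have nδ : ‖δ‖ ≤ 1 / 8 := by
    refine (norm_add_le _ _).trans ?_
    rw [norm_mul]
    nlinarith [norm_nonneg β, norm_nonneg γ]
  have nβ2 : ‖β ^ 2‖ ≤ 1 / 16 := by rw [norm_pow]; nlinarith [norm_nonneg β]
  have nγ2 : ‖γ ^ 2‖ ≤ 1 / 16 := by rw [norm_pow]; nlinarith [norm_nonneg γ]
  have nδ2 : ‖δ ^ 2‖ ≤ 1 / 64 := by rw [norm_pow]; nlinarith [norm_nonneg δ]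
  have hden : 0.85 ≤ ‖1 + γ ^ 2 - β ^ 2 - δ ^ 2‖ := by
    have e : (1 : ℂ) = (1 + γ ^ 2 - β ^ 2 - δ ^ 2) + (-γ ^ 2 + β ^ 2 + δ ^ 2) := by ring
    have h1 := norm_add_le (1 + γ ^ 2 - β ^ 2 - δ ^ 2) (-γ ^ 2 + β ^ 2 + δ ^ 2)
    rw [← e, norm_one] at h1
    have h2 : ‖-γ ^ 2 + β ^ 2 + δ ^ 2‖ ≤ ‖γ ^ 2‖ + ‖β ^ 2‖ + ‖δ ^ 2‖ := by
      refine (norm_add₃_le).trans ?_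
      rw [norm_neg]
    norm_num
    linarith
  have hden0 : 1 + γ ^ 2 - β ^ 2 - δ ^ 2 ≠ 0 := by
    exact norm_pos_iff.1 (lt_of_lt_of_le (by norm_num) hden)
  have hden' : 0.9 ≤ ‖1 - β ^ 2‖ := by
    have h1 := norm_sub_norm_le (1 : ℂ) (β ^ 2)
    rw [norm_one] at h1
    norm_num
    linarith
  have hden0' : 1 - β ^ 2 ≠ 0 := by
    exact norm_pos_iff.1 (lt_of_lt_of_le (by norm_num) hden')
  have hfac : A 0 0 ^ 2 + A 1 0 ^ 2 - A 0 1 ^ 2 - A 1 1 ^ 2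
      = A 0 0 ^ 2 * (1 + γ ^ 2 - β ^ 2 - δ ^ 2) := by rw [hd, hγ, hβ]; ring
  have hq : cquot A = 2 * (β + γ * δ) / (1 + γ ^ 2 - β ^ 2 - δ ^ 2) := by
    rw [cquot, hfac, hd, hγ, hβ]
    field_simp
  refine ⟨by rw [hfac]; exact mul_ne_zero (pow_ne_zero 2 ha) hden0, ?_, ?_, by rwa [hβ'], ?_⟩
  · rw [hq, norm_div, norm_mul, Complex.norm_two, div_le_iff₀ (norm_pos_iff.2 hden0)]
    have h1 : ‖β + γ * δ‖ ≤ 1 / 4 + 1 / 4 * (1 / 8) := by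
      refine (norm_add_le _ _).trans ?_
      rw [norm_mul]
      gcongr
    norm_num at hden
    linarith
  · rw [hβ', norm_div, norm_mul, Complex.norm_two, div_le_iff₀ (norm_pos_iff.2 hden0')]
    norm_num at hden'
    linarith
  · rw [hβ', hq, ← nε0]
    have e : 2 * (β + γ * δ) / (1 + γ ^ 2 - β ^ 2 - δ ^ 2) - 2 * β / (1 - β ^ 2)
        = 2 * ε * (γ * (1 + β ^ 2) + β * ε) / ((1 + γ ^ 2 - β ^ 2 - δ ^ 2) * (1 - β ^ 2)) := by
      rw [div_sub_div _ _ hden0 hden0', hδ]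
      ring
    rw [e, norm_div, norm_mul, norm_mul, norm_mul, Complex.norm_two,
      div_le_iff₀ (mul_pos (norm_pos_iff.2 hden0) (norm_pos_iff.2 hden0'))]
    have h1 : ‖γ * (1 + β ^ 2) + β * ε‖ ≤ 1 / 4 * (1 + 1 / 16) + 1 / 4 * (1 / 16) := by
      refine (norm_add_le _ _).trans ?_
      rw [norm_mul, norm_mul]
      gcongr
      refine (norm_add_le _ _).trans ?_
      rw [norm_one]
      gcongr
    have h2 : 0.85 * 0.9 ≤ ‖1 + γ ^ 2 - β ^ 2 - δ ^ 2‖ * ‖1 - β ^ 2‖ := by gcongr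
    norm_num at h2
    calc 2 * ‖ε‖ * ‖γ * (1 + β ^ 2) + β * ε‖
        ≤ 2 * ‖ε‖ * (1 / 4 * (1 + 1 / 16) + 1 / 4 * (1 / 16)) := by gcongr
      _ = ‖ε‖ * (9 / 16) := by ring
      _ ≤ _ := by
        gcongr
        linarith

theorem Dominant.norm_cdir_sub_le {A B : Matrix (Fin 2) (Fin 2) ℂ} (hA : Dominant A)
    (hB : Dominant B) : ‖cdir A - cdir B‖ ≤ 3 / 2 * ((‖A 0 0‖ ^ 2)⁻¹ + (‖B 0 0‖ ^ 2)⁻¹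
      + 3 * ‖A 0 1 / A 0 0 - B 0 1 / B 0 0‖) := by
  obtain ⟨-, a1, a2, a3, a4⟩ := hA.quot
  obtain ⟨-, b1, b2, b3, b4⟩ := hB.quot
  have h1 := norm_carctan_sub_le a1 b1
  have e : cdir A - cdir B = (Complex.arctan (cquot A) - Complex.arctan (cquot B)) / 2 := by
    unfold cdir; ring
  rw [e, norm_div, Complex.norm_two]
  have hpA : 0 < ‖A 0 0‖ := by linarith [hA.le]
  have hpB : 0 < ‖B 0 0‖ := by linarith [hB.le]
  have nβ : ‖A 0 1 / A 0 0‖ ≤ 1 / 4 := by rw [norm_div, div_le_iff₀ hpA]; exact hA.right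
  have nβ' : ‖B 0 1 / B 0 0‖ ≤ 1 / 4 := by rw [norm_div, div_le_iff₀ hpB]; exact hB.right
  set β := A 0 1 / A 0 0
  set β' := B 0 1 / B 0 0
  have h2 : ‖2 * β / (1 - β ^ 2) - 2 * β' / (1 - β' ^ 2)‖ ≤ 3 * ‖β - β'‖ := by
    have e2 : 2 * β / (1 - β ^ 2) - 2 * β' / (1 - β' ^ 2)
        = (2 * (1 + β * β') / ((1 - β ^ 2) * (1 - β' ^ 2))) * (β - β') := by
      field_simp; ring
    rw [e2, norm_mul]
    gcongr
    rw [norm_div, norm_mul, norm_mul, Complex.norm_two,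
      div_le_iff₀ (mul_pos (norm_pos_iff.2 a3) (norm_pos_iff.2 b3))]
    have n1 : ‖1 + β * β'‖ ≤ 1 + 1 / 4 * (1 / 4) := by
      refine (norm_add_le _ _).trans ?_
      rw [norm_one, norm_mul]
      gcongr
    have n2 : ∀ β : ℂ, ‖β‖ ≤ 1 / 4 → 15 / 16 ≤ ‖1 - β ^ 2‖ := by
      intro β hβ
      have h1 := norm_sub_norm_le (1 : ℂ) (β ^ 2)
      rw [norm_one, norm_pow] at h1
      nlinarith [norm_nonneg β]
    have n3 : 15 / 16 * (15 / 16) ≤ ‖1 - β ^ 2‖ * ‖1 - β' ^ 2‖ := by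
      gcongr
      · exact n2 β nβ
      · exact n2 β' nβ'
    linarith
  have h3 : ‖cquot A - cquot B‖ ≤ (‖A 0 0‖ ^ 2)⁻¹ + (‖B 0 0‖ ^ 2)⁻¹ + 3 * ‖β - β'‖ := by
    have e3 : cquot A - cquot B = (cquot A - 2 * β / (1 - β ^ 2)) - (cquot B - 2 * β' / (1 - β' ^ 2))
        + (2 * β / (1 - β ^ 2) - 2 * β' / (1 - β' ^ 2)) := by ring
    rw [e3]
    refine (norm_add_le _ _).trans ?_
    gcongr
    refine (norm_sub_le _ _).trans ?_
    gcongr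
  linarith

/-- For large blocks, `sdir` is close to the arctangent of `b / a`. -/
theorem abs_sdir_sub_arctan_le {A : Mat} (h : Dominant (A.map Complex.ofReal)) :
    |sdir A - Real.arctan (A 0 1 / A 0 0)| ≤ 3 / 2 * (A 0 0 ^ 2)⁻¹ := by
  obtain ⟨-, a1, a2, a3, a4⟩ := h.quot
  have hA := h.le
  have hR := h.right
  simp only [Matrix.map_apply, Complex.norm_real, Real.norm_eq_abs] at hA hR a2 a4
  have hpos : 0 < |A 0 0| := by linarith
  have hβ : |A 0 1 / A 0 0| ≤ 1 / 4 := by rw [abs_div, div_le_iff₀ hpos]; exact hR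
  set β := A 0 1 / A 0 0 with hβd
  have htwo := Real.two_mul_arctan (x := β) (by linarith [neg_abs_le β]) (by linarith [le_abs_self β])
  have e1 : ((Real.arctan β : ℝ) : ℂ) = Complex.arctan (2 * β / (1 - β ^ 2)) / 2 := by
    have : ((2 * Real.arctan β : ℝ) : ℂ) = Complex.arctan (2 * β / (1 - β ^ 2)) := by
      rw [htwo, Complex.ofReal_arctan]; push_cast; ring
    rw [← this]; push_cast; ring
  have e2 : (β : ℂ) = (A 0 1 : ℂ) / (A 0 0 : ℂ) := by rw [hβd]; push_cast; ring
  rw [← e2] at a2 a4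
  have h1 := norm_carctan_sub_le a1 a2
  rw [← Real.norm_eq_abs, ← Complex.norm_real, Complex.ofReal_sub, ofReal_sdir, e1, cdir, ← sub_div,
    norm_div, Complex.norm_two]
  rw [sq_abs] at a4
  linarith

theorem qX_pos_of_dominant {A : Mat} (h : Dominant (A.map Complex.ofReal)) : 0 < qX A := by
  have hdet := entry_det h.det
  have hA := h.le
  have hR := h.right
  have hL := h.left
  simp only [Matrix.map_apply, Complex.norm_real, Real.norm_eq_abs] at hA hR hL hdet
  have hdet' : A 0 0 * A 1 1 - A 0 1 * A 1 0 = 1 := by exact_mod_cast hdet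
  have hpos : 0 < |A 0 0| := by linarith
  have h1 : |A 0 0| * |A 1 1| ≤ 1 / 8 * |A 0 0| ^ 2 := by
    rw [← abs_mul]
    have e : A 0 0 * A 1 1 = 1 + A 0 1 * A 1 0 := by linarith
    rw [e]
    refine (abs_add_le _ _).trans ?_
    rw [abs_one, abs_mul]
    have : |A 0 1| * |A 1 0| ≤ (1 / 4 * |A 0 0|) * (1 / 4 * |A 0 0|) := by gcongr
    nlinarith
  have h2 : |A 1 1| ≤ 1 / 8 * |A 0 0| := by
    refine le_of_mul_le_mul_left ?_ hpos
    linarith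
  unfold qX
  rw [← sq_abs (A 0 0), ← sq_abs (A 0 1), ← sq_abs (A 1 1)]
  have h3 : |A 0 1| ^ 2 ≤ (1 / 4 * |A 0 0|) ^ 2 := by gcongr
  have h4 : |A 1 1| ^ 2 ≤ (1 / 8 * |A 0 0|) ^ 2 := by gcongr
  nlinarith [sq_nonneg (A 1 0)]

/-- The junction of two blocks is controlled from below by the angle between the stable and the
unstable direction. -/
theorem abs_sin_le_norm_junction {A B : Mat} (hA : Dominant (A.map Complex.ofReal))
    (hB : Dominant (B.map Complex.ofReal)) (t : ℝ) :
    |Real.sin (t + sdir A - udir B)| - 3 / 2 * ((A 0 0 ^ 2)⁻¹ + (B 0 0 ^ 2)⁻¹) ≤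
      ‖junction t ((A 0 1 / A 0 0 : ℝ) : ℂ) ((B 1 0 / B 0 0 : ℝ) : ℂ)‖ := by
  have h1 := abs_sdir_sub_arctan_le hA
  have h2 : |udir B - Real.arctan (B 1 0 / B 0 0)| ≤ 3 / 2 * (B 0 0 ^ 2)⁻¹ :=
    abs_sdir_sub_arctan_le (A := B.transpose) (by
      rw [Matrix.transpose_map]; exact hB.transpose)
  set β := A 0 1 / A 0 0
  set γ := B 1 0 / B 0 0
  have e : junction t β γ = ((Real.sin t * (1 + β * γ) + Real.cos t * (β - γ) : ℝ) : ℂ) := by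
    unfold junction; push_cast; ring
  rw [e, Complex.norm_real, Real.norm_eq_abs]
  have hc1 := Real.cos_arctan_pos β
  have hc2 := Real.cos_arctan_pos γ
  have hs1 : Real.sin (Real.arctan β) = β * Real.cos (Real.arctan β) := by
    have := Real.tan_mul_cos hc1.ne'
    rw [Real.tan_arctan] at this; linarith
  have hs2 : Real.sin (Real.arctan γ) = γ * Real.cos (Real.arctan γ) := by
    have := Real.tan_mul_cos hc2.ne'
    rw [Real.tan_arctan] at this; linarith
  have e2 : Real.sin (t + Real.arctan β - Real.arctan γ) =
      (Real.cos (Real.arctan β) * Real.cos (Real.arctan γ)) *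
        (Real.sin t * (1 + β * γ) + Real.cos t * (β - γ)) := by
    rw [Real.sin_sub, Real.sin_add, Real.cos_add, hs1, hs2]; ring
  have h3 : |Real.sin (t + Real.arctan β - Real.arctan γ)| ≤
      |Real.sin t * (1 + β * γ) + Real.cos t * (β - γ)| := by
    rw [e2, abs_mul, abs_of_pos (mul_pos hc1 hc2)]
    have : Real.cos (Real.arctan β) * Real.cos (Real.arctan γ) ≤ 1 :=
      mul_le_one₀ (Real.cos_le_one _) hc2.le (Real.cos_le_one _)
    exact mul_le_of_le_one_left (abs_nonneg _) this
  have h4 : |Real.sin (t + sdir A - udir B)| ≤ |Real.sin (t + Real.arctan β - Real.arctan γ)|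
      + |(t + sdir A - udir B) - (t + Real.arctan β - Real.arctan γ)| := by
    have h5 := abs_sub_abs_le_abs_sub (Real.sin (t + sdir A - udir B))
      (Real.sin (t + Real.arctan β - Real.arctan γ))
    have h6 := Real.abs_sin_sub_sin_le (t + sdir A - udir B) (t + Real.arctan β - Real.arctan γ)
    linarith
  have h5 : |(t + sdir A - udir B) - (t + Real.arctan β - Real.arctan γ)| ≤
      |sdir A - Real.arctan β| + |udir B - Real.arctan γ| := by
    rw [show (t + sdir A - udir B) - (t + Real.arctan β - Real.arctan γ)
      = (sdir A - Real.arctan β) - (udir B - Real.arctan γ) by ring]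
    exact abs_sub _ _
  linarith

/-! ### Real blocks -/

/-- The real block of length `m` that starts at `x`. -/
def rblk (ω lam : ℝ) (φ : ℝ → ℝ) (x : ℝ) (m : ℕ) : Mat :=
  fwd ω (cocycle lam φ) m x * rot (-(Real.pi / 2 - φ x))

theorem fwd_eq_rblk_mul (ω lam : ℝ) (φ : ℝ → ℝ) (x : ℝ) (m : ℕ) :
    fwd ω (cocycle lam φ) m x = rblk ω lam φ x m * rot (Real.pi / 2 - φ x) := by
  rw [rblk, mul_assoc, rot_mul_rot, neg_add_cancel, rot_zero, mul_one]

theorem map_cocycle (lam : ℝ) (φ : ℝ → ℝ) (y : ℝ) :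
    (cocycle lam φ y).map Complex.ofReal = cdiag lam * crot (φ y) := by
  ext i j
  fin_cases i <;> fin_cases j <;>
    simp [cocycle, cdiag, crot, rot, Matrix.mul_apply, Fin.sum_univ_two,
      Real.cos_pi_div_two_sub, Real.sin_pi_div_two_sub]

theorem map_mul_ofReal (A B : Mat) : (A * B).map Complex.ofReal
    = A.map Complex.ofReal * B.map Complex.ofReal := by
  ext i j
  simp [Matrix.mul_apply]

theorem map_fwd (ω lam : ℝ) (φ : ℝ → ℝ) (x : ℝ) (m : ℕ) :
    (fwd ω (cocycle lam φ) m x).map Complex.ofReal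
      = cprod lam (fun i => (φ (tr ω x i) : ℂ)) 0 m := by
  induction m with
  | zero => ext i j; fin_cases i <;> fin_cases j <;> simp [fwd, cprod]
  | succ k ih =>
    rw [fwd, cprod, map_mul_ofReal, map_cocycle, ih]
    simp [tr]

theorem map_rblk (ω lam : ℝ) (φ : ℝ → ℝ) (x : ℝ) (m : ℕ) :
    (rblk ω lam φ x m).map Complex.ofReal = blk lam (fun i => (φ (tr ω x i) : ℂ)) 0 m := by
  rw [rblk, map_mul_ofReal, map_fwd, blk]
  congr 1
  ext i j
  fin_cases i <;> fin_cases j <;>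
    simp [crotInv, rot, Complex.cos_sub_pi_div_two, Complex.sin_sub_pi_div_two]

theorem map_rblk_neg (ω lam : ℝ) (φ : ℝ → ℝ) (x : ℝ) (m : ℕ) :
    (rblk ω lam φ (tr ω x (-(m : ℤ))) m).map Complex.ofReal
      = blk lam (fun i => (φ (tr ω x i) : ℂ)) (-(m : ℤ)) m := by
  rw [map_rblk]
  simp only [tr_tr]
  have := blk_shift lam (fun i => (φ (tr ω x i) : ℂ)) 0 (-(m : ℤ)) m
  rw [zero_add] at this
  rw [← this]
  congr 2
  ext i
  rw [add_comm]

theorem det_fwd_eq_one (ω : ℝ) {A : ℝ → Mat} (hA : ∀ x, (A x).det = 1) (j : ℕ) (x : ℝ) :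
    (fwd ω A j x).det = 1 := by
  induction j with
  | zero => simp [fwd]
  | succ k ih => rw [fwd, Matrix.det_mul, ih, hA, one_mul]

theorem det_fwd {ω lam : ℝ} (hlam : lam ≠ 0) (φ : ℝ → ℝ) (m : ℕ) (x : ℝ) :
    (fwd ω (cocycle lam φ) m x).det = 1 := det_fwd_eq_one ω (det_cocycle hlam φ) m x

theorem det_rblk {ω lam : ℝ} (hlam : lam ≠ 0) (φ : ℝ → ℝ) (x : ℝ) (m : ℕ) :
    (rblk ω lam φ x m).det = 1 := by
  rw [rblk, Matrix.det_mul, det_fwd hlam, det_rot, one_mul]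

theorem fwd_add (ω : ℝ) (A : ℝ → Mat) (j k : ℕ) (x : ℝ) :
    fwd ω A (j + k) x = fwd ω A k (tr ω x j) * fwd ω A j x := by
  induction k with
  | zero => simp [fwd]
  | succ k ih =>
    have e : x + 2 * Real.pi * ω * ((j + k : ℕ) : ℝ) = tr ω x j + 2 * Real.pi * ω * k := by
      unfold tr
      push_cast
      ring
    rw [← add_assoc, fwd, fwd, ih, e, ← mul_assoc]

theorem bwd_eq_inv_fwd (ω : ℝ) (A : ℝ → Mat) (j : ℕ) (x : ℝ) :
    bwd ω A j x = (fwd ω A j (tr ω x (-(j : ℤ))))⁻¹ := by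
  induction j with
  | zero => simp [bwd, fwd]
  | succ j ih =>
    rw [bwd, ih, add_comm j 1, fwd_add, Matrix.mul_inv_rev]
    congr 1
    · simp only [fwd, mul_one, Nat.cast_zero, mul_zero, add_zero]
      congr 2
      unfold tr; push_cast; ring
    · congr 2
      rw [tr_tr]; push_cast; ring_nf

theorem one_lt_norm_of_lt {ω lam : ℝ} {φ : ℝ → ℝ} {x : ℝ} {m : ℕ}
    (h : 1 < |rblk ω lam φ x m 0 0|) : 1 < ‖fwd ω (cocycle lam φ) m x‖ := by
  rw [fwd_eq_rblk_mul, norm_mul_rot]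
  exact h.trans_le (norm_entry_le _ _ _)

/-- The data of an orbit segment around `x` that determine the angle between the stable and the
unstable direction, both of them defined by blocks of length `m`. -/
def dirDiff (ω lam : ℝ) (φ : ℝ → ℝ) (m : ℕ) (x : ℝ) : ℝ :=
  sdir (rblk ω lam φ x m) - udir (rblk ω lam φ (tr ω x (-(m : ℤ))) m)

theorem nearZero_add_int_mul (t : ℝ) (k : ℤ) : nearZero (t + k * Real.pi) = nearZero t := by
  unfold nearZero
  have := toIocMod_add_zsmul Real.pi_pos (-(Real.pi / 2)) t k
  rwa [zsmul_eq_mul] at this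

theorem nearZero_eq_self {t : ℝ} (h : |t| < Real.pi / 2) : nearZero t = t := by
  unfold nearZero
  rw [toIocMod_eq_self]
  rw [abs_lt] at h
  constructor <;> linarith [h.1, h.2]

theorem exists_stableDir {ω lam c : ℝ} {φ : ℝ → ℝ} {x : ℝ} {n : ℕ}
    (h : Dominant ((rblk ω lam φ x (minReturn ω c n)).map Complex.ofReal)) :
    ∃ k : ℤ, stableDir ω c lam φ n x = φ x + sdir (rblk ω lam φ x (minReturn ω c n)) + k * Real.pi := by
  rw [stableDir, fwd_eq_rblk_mul]
  exact exists_mostContracted_mul_rot (qX_pos_of_dominant h) _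

theorem exists_unstableDir {ω lam c : ℝ} (hlam : lam ≠ 0) {φ : ℝ → ℝ} {x : ℝ} {n : ℕ}
    (h : Dominant ((rblk ω lam φ (tr ω x (-(minReturn ω c n : ℤ)))
      (minReturn ω c n)).map Complex.ofReal)) :
    ∃ k : ℤ, unstableDir ω c lam φ n x =
      udir (rblk ω lam φ (tr ω x (-(minReturn ω c n : ℤ))) (minReturn ω c n)) + k * Real.pi := by
  rw [unstableDir, bwd_eq_inv_fwd, fwd_eq_rblk_mul]
  refine exists_mostContracted_inv (det_rblk hlam _ _ _) (qX_pos_of_dominant ?_) _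
  rw [Matrix.transpose_map]
  exact h.transpose

theorem angle_eq {ω lam c : ℝ} (hlam : lam ≠ 0) {φ : ℝ → ℝ} {x : ℝ} {n : ℕ}
    (h : Dominant ((rblk ω lam φ x (minReturn ω c n)).map Complex.ofReal))
    (h' : Dominant ((rblk ω lam φ (tr ω x (-(minReturn ω c n : ℤ)))
      (minReturn ω c n)).map Complex.ofReal)) :
    angle ω c lam φ n x = nearZero (φ x + dirDiff ω lam φ (minReturn ω c n) x) := by
  obtain ⟨k, hk⟩ := exists_stableDir h
  obtain ⟨k', hk'⟩ := exists_unstableDir hlam h'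
  rw [angle, hk, hk', ← nearZero_add_int_mul _ (k - k')]
  rw [← nearZero_add_int_mul (φ x + dirDiff ω lam φ (minReturn ω c n) x) (k - k' + (k - k'))]
  congr 1
  unfold dirDiff
  push_cast
  ring

/-! ### Derivatives of the correction terms -/

/-- Cauchy estimates for the Fréchet derivatives of a bounded holomorphic function. -/
theorem norm_iteratedFDeriv_le_of_ball {E G : Type*} [NormedAddCommGroup E] [NormedSpace ℂ E]
    [NormedAddCommGroup G] [NormedSpace ℂ G] {F : E → G} {x : E} {η : ℝ} {K : ℕ}
    (h : ∀ y ∈ Metric.ball x (2 * K), ContDiffAt ℂ K F y)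
    (hη : ∀ y ∈ Metric.ball x (2 * K), ‖F y‖ ≤ η) (k : ℕ) (hk : k ≤ K) :
    ∀ y ∈ Metric.ball x (2 * ((K : ℝ) - k)), ‖iteratedFDeriv ℂ k F y‖ ≤ η := by
  induction k with
  | zero =>
    intro y hy
    rw [norm_iteratedFDeriv_zero]
    exact hη y (by simpa using hy)
  | succ k ih =>
    intro y hy
    have hk' : (k : ℝ) + 1 ≤ K := by exact_mod_cast hk
    rw [← norm_fderiv_iteratedFDeriv]
    -- each derivative costs a layer of width `2`; with this radius a Cauchy estimate of the oscillation
    -- of the previous derivative, at most `2 * η`, costs no constant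
    have hsub : Metric.ball y 2 ⊆ Metric.ball x (2 * ((K : ℝ) - k)) := by
      apply Metric.ball_subset_ball'
      rw [Metric.mem_ball] at hy
      push_cast at hy
      linarith
    have hsub' : Metric.ball x (2 * ((K : ℝ) - k)) ⊆ Metric.ball x (2 * K) := by
      apply Metric.ball_subset_ball
      have : (0 : ℝ) ≤ k := k.cast_nonneg
      linarith
    have hb := ih (by omega)
    have key := Complex.norm_fderiv_le_div_of_mapsTo_ball (f := iteratedFDeriv ℂ k F) (c := y)
      (R₁ := 2) (R₂ := 2 * η) (fun z hz => ?_) (fun z hz => ?_) two_pos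
    · linarith
    · exact ((h z (hsub' (hsub hz))).differentiableAt_iteratedFDeriv
        (by exact_mod_cast (by omega : k < K))).differentiableWithinAt
    · rw [Metric.mem_closedBall, dist_eq_norm]
      refine (norm_sub_le _ _).trans ?_
      linarith [hb z (hsub hz), hb y (hsub (Metric.mem_ball_self two_pos))]

/-- A bound for the derivatives of a bounded holomorphic function along a real curve. -/
theorem norm_iteratedDeriv_comp_le {E : Type*} [NormedAddCommGroup E] [NormedSpace ℂ E] {F : E → ℂ}
    {η D : ℝ} {k : ℕ} (h : ∀ y ∈ Metric.ball (0 : E) (2 * (k + 1 : ℕ)), ContDiffAt ℂ (k + 1 : ℕ) F y)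
    (hη : ∀ y ∈ Metric.ball (0 : E) (2 * (k + 1 : ℕ)), ‖F y‖ ≤ η) {γ : ℝ → E} {x₀ : ℝ}
    (hγ : ContDiff ℝ k γ) (h0 : γ x₀ = 0)
    (hD : ∀ i, 1 ≤ i → i ≤ k → ‖iteratedDeriv i γ x₀‖ ≤ D ^ i) :
    ContDiffAt ℝ k (fun x => F (γ x)) x₀ ∧
      ‖iteratedDeriv k (fun x => F (γ x)) x₀‖ ≤ k.factorial * η * D ^ k := by
  set t := Metric.ball (0 : E) (2 * (k + 1 : ℕ)) with ht
  have hto : IsOpen t := Metric.isOpen_ball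
  have h0t : (0 : E) ∈ t := Metric.mem_ball_self (by positivity)
  set s := γ ⁻¹' t with hs
  have hso : IsOpen s := hto.preimage hγ.continuous
  have hxs : x₀ ∈ s := by rw [hs, Set.mem_preimage, h0]; exact h0t
  have hF : ContDiffOn ℝ k F t := fun y hy =>
    (((h y hy).restrict_scalars ℝ).of_le (by exact_mod_cast k.le_succ)).contDiffWithinAt
  have hcomp : ContDiffAt ℝ k (fun x => F (γ x)) x₀ :=
    (((h (γ x₀) hxs).restrict_scalars ℝ).of_le (by exact_mod_cast k.le_succ)).comp x₀ hγ.contDiffAt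
  refine ⟨hcomp, ?_⟩
  -- Faà di Bruno
  have key := norm_iteratedFDerivWithin_comp_le (n := k) (N := k) (C := η) (D := D) hF
    hγ.contDiffOn le_rfl hto.uniqueDiffOn hso.uniqueDiffOn (fun _ h => h) hxs (fun i hi => ?_)
    (fun i hi hik => ?_)
  · rw [iteratedFDerivWithin_of_isOpen k hso hxs, norm_iteratedFDeriv_eq_norm_iteratedDeriv] at key
    exact key
  · have hy : γ x₀ ∈ t := hxs
    rw [iteratedFDerivWithin_of_isOpen i hto hy]
    have h1 : ContDiffAt ℂ i F (γ x₀) := (h _ hy).of_le (by exact_mod_cast (by omega : i ≤ k + 1))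
    rw [← h1.restrictScalars_iteratedFDeriv (𝕜 := ℝ), Function.comp_apply,
      ContinuousMultilinearMap.norm_restrictScalars]
    refine norm_iteratedFDeriv_le_of_ball h hη i (by omega) _ ?_
    rw [h0]
    apply Metric.mem_ball_self
    have : (i : ℝ) ≤ k := by exact_mod_cast hi
    push_cast
    linarith
  · rw [iteratedFDerivWithin_of_isOpen i hso hxs, norm_iteratedFDeriv_eq_norm_iteratedDeriv]
    exact hD i hi hik

theorem iteratedDeriv_pi_apply {ι : Type*} [Fintype ι] {γ : ℝ → ι → ℂ} (k : ℕ)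
    (hγ : ContDiff ℝ k γ) (x : ℝ) (i : ι) :
    iteratedDeriv k γ x i = iteratedDeriv k (fun x => γ x i) x := by
  induction k generalizing x with
  | zero => simp
  | succ k ih =>
    have h1 : ContDiff ℝ k γ := hγ.of_le (by exact_mod_cast k.le_succ)
    have hd : DifferentiableAt ℝ (iteratedDeriv k γ) x :=
      (hγ.differentiable_iteratedDeriv k (by exact_mod_cast k.lt_succ_self)) x
    rw [iteratedDeriv_succ, iteratedDeriv_succ]
    have h2 : iteratedDeriv k (fun x => γ x i) = fun x => iteratedDeriv k γ x i := by
      funext y; exact (ih h1 y).symm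
    rw [h2, deriv_pi (fun j => (differentiableAt_pi.1 hd) j)]

theorem norm_iteratedDeriv_ofReal {f : ℝ → ℝ} {k : ℕ} {x : ℝ} (hf : ContDiffAt ℝ k f x) :
    ‖iteratedDeriv k (fun y => (f y : ℂ)) x‖ = |iteratedDeriv k f x| := by
  rw [← norm_iteratedFDeriv_eq_norm_iteratedDeriv, ← Real.norm_eq_abs,
    ← norm_iteratedFDeriv_eq_norm_iteratedDeriv]
  exact Complex.ofRealLI.norm_iteratedFDeriv_comp_left hf le_rfl

/-- The holomorphic extension of `dirDiff`. -/
def cdirDiff (lam : ℝ) (m : ℕ) (θ : ℤ → ℂ) : ℂ :=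
  cdir (blk lam θ 0 m) - cdir (blk lam θ (-(m : ℤ)) m).transpose

theorem ofReal_dirDiff (ω lam : ℝ) (φ : ℝ → ℝ) (m : ℕ) (x : ℝ) :
    ((dirDiff ω lam φ m x : ℝ) : ℂ) = cdirDiff lam m (fun i => (φ (tr ω x i) : ℂ)) := by
  rw [dirDiff, udir, Complex.ofReal_sub, ofReal_sdir, ofReal_sdir, Matrix.transpose_map, map_rblk,
    map_rblk_neg, cdirDiff]

theorem contDiffAt_cdir {E : Type*} [NormedAddCommGroup E] [NormedSpace ℂ E] {n : ℕ}
    {A : E → Matrix (Fin 2) (Fin 2) ℂ} {w : E} (hA : ∀ k l, ContDiffAt ℂ n (fun w => A w k l) w)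
    (h : Dominant (A w)) : ContDiffAt ℂ n (fun w => cdir (A w)) w := by
  obtain ⟨h1, h2, -⟩ := h.quot
  have hq : ContDiffAt ℂ n (fun w => cquot (A w)) w := by
    unfold cquot
    refine ContDiffAt.div ?_ ?_ h1
    · exact contDiffAt_const.mul (((hA 0 0).mul (hA 0 1)).add ((hA 1 0).mul (hA 1 1)))
    · exact ((((hA 0 0).pow 2).add ((hA 1 0).pow 2)).sub ((hA 0 1).pow 2)).sub ((hA 1 1).pow 2)
  have hat : ContDiffAt ℂ n Complex.arctan (cquot (A w)) := by
    have hd : DifferentiableOn ℂ Complex.arctan (Metric.ball 0 1) := fun z hz =>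
      (hasDerivAt_carctan (by simpa using hz)).differentiableAt.differentiableWithinAt
    exact (hd.contDiffOn Metric.isOpen_ball).contDiffAt
      (Metric.isOpen_ball.mem_nhds (by rw [mem_ball_zero_iff]; linarith))
  exact (hat.comp w hq).div_const 2

/-- The two blocks of length `m` from which `cdirDiff` is computed are dominated by their upper left
entries. -/
def DominantAt (lam : ℝ) (m : ℕ) (θ : ℤ → ℂ) : Prop :=
  Dominant (blk lam θ 0 m) ∧ Dominant (blk lam θ (-(m : ℤ)) m)

theorem contDiffAt_cdirDiff {E : Type*} [NormedAddCommGroup E] [NormedSpace ℂ E] {n : ℕ}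
    {lam : ℝ} {m : ℕ} {θ : E → ℤ → ℂ} {w : E} (hθ : ∀ i, ContDiffAt ℂ n (fun w => θ w i) w)
    (h : DominantAt lam m (θ w)) : ContDiffAt ℂ n (fun w => cdirDiff lam m (θ w)) w :=
  (contDiffAt_cdir (contDiffAt_blk lam hθ _ _) h.1).sub
    (contDiffAt_cdir (fun k l => contDiffAt_blk lam hθ _ _ l k) h.2.transpose)

/-- `cdirDiff` depends on finitely many phases. -/
theorem cdirDiff_congr {lam : ℝ} {m : ℕ} {θ θ' : ℤ → ℂ} (hm : 1 ≤ m)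
    (h : ∀ i : ℤ, |i| < m → θ i = θ' i) : cdirDiff lam m θ = cdirDiff lam m θ' := by
  unfold cdirDiff
  rw [blk_congr (θ' := θ') (fun j h0 h1 => h j (by rw [abs_lt]; omega)) hm,
    blk_congr (θ' := θ') (fun j h0 h1 => h j (by rw [abs_lt]; omega)) hm]

/-- If the angles determined by blocks of length `m` and `m'` differ by at most `η`, even for complex
phases within `ρ` of `φ`, then the derivatives of their difference are small as well. -/
theorem abs_iteratedDeriv_dirDiff_sub_le {ω lam : ℝ} {φ : ℝ → ℝ} {m m' : ℕ} {x₀ ρ η D : ℝ} {k : ℕ}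
    (hm : 1 ≤ m) (hm' : 1 ≤ m') (hρ : 0 < ρ) (hφ : ContDiff ℝ k φ)
    (hdom : ∀ θ, Near ω φ x₀ ρ θ → DominantAt lam m θ ∧ DominantAt lam m' θ)
    (hη : ∀ θ, Near ω φ x₀ ρ θ → ‖cdirDiff lam m θ - cdirDiff lam m' θ‖ ≤ η)
    (hD : ∀ i, 1 ≤ i → i ≤ k → ∀ x, |iteratedDeriv i φ x| * (2 * (k + 1) / ρ) ≤ D ^ i) :
    ContDiffAt ℝ k (fun x => dirDiff ω lam φ m x - dirDiff ω lam φ m' x) x₀ ∧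
      |iteratedDeriv k (fun x => dirDiff ω lam φ m x - dirDiff ω lam φ m' x) x₀| ≤
        k.factorial * η * D ^ k := by
  classical
  have hD0 : k = 0 ∨ 0 ≤ D := by
    rcases Nat.eq_zero_or_pos k with h | h
    · exact Or.inl h
    · right
      have := hD 1 le_rfl h x₀
      rw [pow_one] at this
      exact le_trans (by positivity) this
  -- the finitely many values of the phase that enter are coordinates of a vector `w`, rescaled so that
  -- the ball of radius `2 * (k + 1)` corresponds to the phases within `ρ`
  set a : ℝ := ρ / (2 * (k + 1)) with ha
  have ha0 : 0 < a := by positivity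
  set S := Finset.Ioo (-(max m m' : ℕ) : ℤ) (max m m' : ℕ) with hS
  set Θ : (S → ℂ) → ℤ → ℂ := fun w i =>
    φ (tr ω x₀ i) + if h : i ∈ S then a * w ⟨i, h⟩ else 0 with hΘ
  set γ : ℝ → S → ℂ := fun x i => ((φ (tr ω x i) - φ (tr ω x₀ i)) / a : ℝ) with hγd
  set F : (S → ℂ) → ℂ := fun w => cdirDiff lam m (Θ w) - cdirDiff lam m' (Θ w) with hF
  have hnear : ∀ w ∈ Metric.ball (0 : S → ℂ) (2 * (k + 1 : ℕ)), Near ω φ x₀ ρ (Θ w) := by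
    intro w hw i
    rw [mem_ball_zero_iff] at hw
    simp only [hΘ, add_sub_cancel_left]
    split_ifs with h
    · rw [norm_mul, Complex.norm_real, Real.norm_of_nonneg ha0.le]
      have h1 := (norm_le_pi_norm w ⟨i, h⟩).trans_lt hw
      calc a * ‖w ⟨i, h⟩‖ < a * (2 * (k + 1 : ℕ)) := by gcongr
        _ = ρ := by rw [ha]; push_cast; field_simp
    · simpa using hρ
  have hΘs : ∀ (n : ℕ) w i, ContDiffAt ℂ n (fun w => Θ w i) w := by
    intro n w i
    simp only [hΘ]
    split_ifs with h
    · exact contDiffAt_const.add (contDiffAt_const.mul (contDiffAt_apply ℂ ℂ _ w))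
    · exact contDiffAt_const
  have hcomp : ∀ i : S, ContDiff ℝ k (fun x => ((φ (tr ω x i) - φ (tr ω x₀ i)) / a : ℝ)) := by
    intro i
    unfold tr
    fun_prop
  have hγ : ContDiff ℝ k γ := by
    rw [contDiff_pi]
    intro i
    exact Complex.ofRealCLM.contDiff.comp (hcomp i)
  have hγ0 : γ x₀ = 0 := by
    funext i
    simp [hγd]
  have hγD : ∀ i, 1 ≤ i → i ≤ k → ‖iteratedDeriv i γ x₀‖ ≤ D ^ i := by
    intro i hi hik
    have hle : (i : WithTop ℕ∞) ≤ k := by exact_mod_cast hik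
    have hD0' : 0 ≤ D ^ i := pow_nonneg (hD0.resolve_left (by omega)) i
    rw [pi_norm_le_iff_of_nonneg hD0']
    intro j
    rw [iteratedDeriv_pi_apply i (hγ.of_le hle), norm_iteratedDeriv_ofReal
      ((hcomp j).of_le hle).contDiffAt]
    have e : (fun x => (φ (tr ω x j) - φ (tr ω x₀ j)) / a) =
        fun x => a⁻¹ * (φ (x + 2 * Real.pi * ω * j) - φ (tr ω x₀ j)) := by
      funext x; unfold tr; rw [div_eq_inv_mul]
    have e2 : iteratedDeriv i (fun x => a⁻¹ * (φ (x + 2 * Real.pi * ω * j) - φ (tr ω x₀ j))) x₀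
        = a⁻¹ * iteratedDeriv i φ (x₀ + 2 * Real.pi * ω * j) := by
      rw [iteratedDeriv_const_mul_field]
      congr 1
      have e3 : (fun x => φ (x + 2 * Real.pi * ω * j) - φ (tr ω x₀ j)) =
          fun x => -φ (tr ω x₀ j) + φ (x + 2 * Real.pi * ω * j) := by funext x; ring
      rw [e3, iteratedDeriv_const_add (by omega), iteratedDeriv_comp_add_const]
    rw [e, e2, abs_mul, abs_of_pos (inv_pos.2 ha0)]
    refine le_trans (le_of_eq ?_) (hD i hi hik (x₀ + 2 * Real.pi * ω * j))
    rw [ha, inv_div, mul_comm]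
  have hfun : (fun x => ((dirDiff ω lam φ m x - dirDiff ω lam φ m' x : ℝ) : ℂ)) = fun x => F (γ x) := by
    funext x
    rw [Complex.ofReal_sub, ofReal_dirDiff, ofReal_dirDiff]
    have hc : ∀ i : ℤ, |i| < (max m m' : ℕ) → (φ (tr ω x i) : ℂ) = Θ (γ x) i := by
      intro i hi
      have hi' : i ∈ S := by rw [hS, Finset.mem_Ioo]; rwa [abs_lt] at hi
      have : (a : ℂ) ≠ 0 := by exact_mod_cast ha0.ne'
      simp only [hΘ, hγd, dif_pos hi']
      push_cast
      field_simp
      ring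
    simp only [hF]
    rw [cdirDiff_congr hm (fun i hi => hc i (hi.trans_le (by exact_mod_cast le_max_left _ _))),
      cdirDiff_congr hm' (fun i hi => hc i (hi.trans_le (by exact_mod_cast le_max_right _ _)))]
  obtain ⟨h1, h2⟩ := norm_iteratedDeriv_comp_le (F := F) (η := η) (D := D) (γ := γ) (x₀ := x₀)
    (k := k) (fun w hw => (contDiffAt_cdirDiff (hΘs _ w) (hdom _ (hnear w hw)).1).sub
      (contDiffAt_cdirDiff (hΘs _ w) (hdom _ (hnear w hw)).2)) (fun w hw => hη _ (hnear w hw))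
    hγ hγ0 hγD
  rw [← hfun] at h1 h2
  have hre : ContDiffAt ℝ k (fun x => dirDiff ω lam φ m x - dirDiff ω lam φ m' x) x₀ :=
    Complex.reCLM.contDiff.contDiffAt.comp x₀ h1
  exact ⟨hre, by rwa [norm_iteratedDeriv_ofReal hre] at h2⟩

/-! ### The scales of the induction -/

/-- A lower bound for the return times to a neighbourhood of `I_n`. -/
def len (ω M : ℝ) (n : ℕ) : ℝ := q ω n ^ 2 / (16 * M)

/-- An upper bound for the waiting times for a visit to `I_n / 10`. -/
def wait (ω M : ℝ) (n : ℕ) : ℝ := 384 * M * q ω n ^ 2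

/-- Half of the total loss of the exponential growth rate in the induction. -/
def eps (M : ℝ) : ℝ := 1 / (24576 * M ^ 6)

/-- The exponential growth rate of the blocks between visits to `I_n`. -/
def rate (M : ℝ) (n : ℕ) : ℝ := 1 - 2 * eps M + eps M / n

/-- A bound for the slopes of the directions at level `n`. -/
def slope (n : ℕ) : ℝ := 1 / 4 - 1 / (8 * n)

/-- The size of the complex perturbations of the phase at level `n`. -/
def rad (ω : ℝ) (n : ℕ) : ℝ := Real.exp (-q ω n)

/-- A lower bound for the phase on the boundary of `I_n`. -/
def gap (ω : ℝ) (n : ℕ) : ℝ := Real.exp (-√(q ω n))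

/-- A bound for the effect of one step of the induction on the directions. -/
def eta (ω M : ℝ) (n : ℕ) : ℝ := Real.exp (-len ω M n)

/-- The level `p` is so large that the step of the induction from `p + 1` to `p + 2` works. -/
structure Large (ω M : ℝ) (p : ℕ) : Prop where
  one_le : 1 ≤ p
  lt_sq : 4 * q ω 1 < q ω p ^ 2
  three_le_len : 3 ≤ len ω M p
  q_le_len : q ω p ≤ len ω M p
  slope_le : Real.exp (-q ω p) ≤ 1 / (8 * ((p + 1) * (p + 2)))
  le_gap : 160 * Real.exp (-q ω p) ≤ gap ω (p + 2)
  loss : 8 ≤ gap ω (p + 2) * Real.exp (eps M / ((p + 1) * (p + 2)) * len ω M p)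

theorem eventually_mul_sqrt_add_le (A B : ℝ) {ε : ℝ} (hε : 0 < ε) (hB : 0 ≤ B) :
    ∀ᶠ Q : ℝ in Filter.atTop, A * √Q + B ≤ ε * Q := by
  have h1 : ∀ᶠ Q : ℝ in Filter.atTop, (A + B) / ε ≤ √Q := Real.tendsto_sqrt_atTop.eventually_ge_atTop _
  have h2 : ∀ᶠ Q : ℝ in Filter.atTop, 1 ≤ √Q := Real.tendsto_sqrt_atTop.eventually_ge_atTop _
  filter_upwards [h1, h2, Filter.eventually_ge_atTop 0] with Q h1 h2 h3
  rw [div_le_iff₀ hε] at h1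
  have h4 := Real.mul_self_sqrt h3
  nlinarith

/-- Since `q_p` is at least a Fibonacci number, it dominates quadratic polynomials in `p`. -/
theorem mul_le_fib (p : ℕ) (hp : 12 ≤ p) : (p + 1) * (p + 2) ≤ Nat.fib (p + 1) := by
  induction p using Nat.strong_induction_on with
  | _ p ih =>
    rcases Nat.lt_or_ge p 14 with h | h
    · interval_cases p <;> decide
    · obtain ⟨k, rfl⟩ : ∃ k, p = k + 2 := ⟨p - 2, by omega⟩
      have h1 := ih k (by omega) (by omega)
      have h2 := ih (k + 1) (by omega) (by omega)
      rw [show k + 2 + 1 = (k + 1) + 2 by ring, Nat.fib_add_two]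
      nlinarith

theorem tendsto_q {ω : ℝ} (hω : Irrational ω) : Filter.Tendsto (q ω) Filter.atTop Filter.atTop := by
  refine Filter.tendsto_atTop_mono (fib_le_q hω) ?_
  refine tendsto_natCast_atTop_atTop.comp ?_
  rw [← Filter.tendsto_add_atTop_iff_nat 12]
  refine Filter.tendsto_atTop_mono (fun n => ?_) Filter.tendsto_id
  have := mul_le_fib (n + 12) (by omega)
  simp only [id]
  nlinarith

theorem q_add_two_le {ω M : ℝ} (hM : 1 ≤ M)
    (hbdd : ∀ n : ℕ, 1 ≤ n → q ω (n + 1) < M * q ω n) {p : ℕ} (hp : 1 ≤ p) :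
    q ω (p + 2) ≤ M ^ 2 * q ω p := by
  have h1 := hbdd p hp
  have h2 := hbdd (p + 1) (by omega)
  nlinarith

theorem eventually_large {ω M : ℝ} (hω : Irrational ω) (hM : 1 ≤ M)
    (hbdd : ∀ n : ℕ, 1 ≤ n → q ω (n + 1) < M * q ω n) :
    ∀ᶠ p in Filter.atTop, Large ω M p := by
  have hM0 : 0 < M := by linarith
  have hε : 0 < eps M := by unfold eps; positivity
  have hQ := tendsto_q hω
  have e1 := hQ.eventually (Filter.eventually_ge_atTop (4 * q ω 1 + 1))
  have e2 := hQ.eventually (Filter.eventually_ge_atTop (48 * M))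
  have e3 := hQ.eventually (Real.tendsto_exp_neg_atTop_nhds_zero.eventually
    (eventually_le_nhds (show (0 : ℝ) < 1 / 8 by norm_num)))
  have e4 := hQ.eventually (eventually_mul_sqrt_add_le M (Real.log 160) one_pos
    (Real.log_nonneg (by norm_num)))
  have e5 := hQ.eventually (eventually_mul_sqrt_add_le M (Real.log 8)
    (show 0 < eps M / (16 * M) by positivity) (Real.log_nonneg (by norm_num)))
  have e6 : ∀ᶠ Q : ℝ in Filter.atTop, Q * Real.exp (-Q) ≤ 1 / 8 := by
    have := Real.tendsto_pow_mul_exp_neg_atTop_nhds_zero 1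
    simp only [pow_one] at this
    exact this.eventually (eventually_le_nhds (by norm_num))
  have e6' := hQ.eventually e6
  filter_upwards [e1, e2, e3, e4, e5, e6', Filter.eventually_ge_atTop 12] with p h1 h2 h3 h4 h5 h6 hp
  have hq1 := one_le_q hω 1
  have hqp := one_le_q hω p
  have hlen : 3 * q ω p ≤ len ω M p := by
    unfold len
    rw [le_div_iff₀ (by positivity)]
    nlinarith
  have hpp : ((p : ℝ) + 1) * (p + 2) ≤ q ω p := by
    refine le_trans ?_ (fib_le_q hω p)
    exact_mod_cast mul_le_fib p hp
  have hgap : Real.exp (-(M * √(q ω p))) ≤ gap ω (p + 2) := by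
    unfold gap
    apply Real.exp_le_exp.2
    apply neg_le_neg
    rw [show M * √(q ω p) = √(M ^ 2 * q ω p) by
      rw [Real.sqrt_mul (by positivity), Real.sqrt_sq hM0.le]]
    exact Real.sqrt_le_sqrt (q_add_two_le hM hbdd (by omega))
  refine ⟨by omega, by nlinarith, by linarith, by linarith, ?_, ?_, ?_⟩
  · rw [le_div_iff₀ (by positivity)]
    nlinarith [Real.exp_pos (-q ω p)]
  · refine le_trans ?_ hgap
    rw [show (160 : ℝ) = Real.exp (Real.log 160) by rw [Real.exp_log (by norm_num)], ← Real.exp_add]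
    apply Real.exp_le_exp.2
    linarith
  · refine le_trans ?_ (mul_le_mul_of_nonneg_right hgap (Real.exp_pos _).le)
    rw [← Real.exp_add]
    nth_rw 1 [show (8 : ℝ) = Real.exp (Real.log 8) by rw [Real.exp_log (by norm_num)]]
    apply Real.exp_le_exp.2
    have : eps M / (16 * M) * q ω p ≤ eps M / (((p : ℝ) + 1) * (p + 2)) * len ω M p := by
      unfold len
      rw [div_mul_eq_mul_div, div_mul_div_comm, div_le_div_iff₀ (by positivity) (by positivity)]
      have : q ω p * (((p : ℝ) + 1) * (p + 2)) ≤ q ω p * q ω p := by gcongr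
      nlinarith [mul_pos hε hM0]
    linarith

/-- The largeness conditions on `lam` that do not depend on the level. -/
structure LamLarge (M lam : ℝ) : Prop where
  exp_le : Real.exp 1 ≤ lam
  four_le : 4 ≤ lam ^ eps M

theorem LamLarge.one_lt {M lam : ℝ} (h : LamLarge M lam) : 1 < lam :=
  lt_of_lt_of_le (by have := Real.add_one_lt_exp (one_ne_zero (α := ℝ)); linarith) h.exp_le

theorem LamLarge.exp_le_rpow {M lam : ℝ} (h : LamLarge M lam) {t : ℝ} (ht : 0 ≤ t) :
    Real.exp t ≤ lam ^ t := by
  calc Real.exp t = Real.exp 1 ^ t := by rw [Real.exp_one_rpow]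
    _ ≤ lam ^ t := Real.rpow_le_rpow (Real.exp_pos 1).le h.exp_le ht

theorem eventually_lamLarge {M : ℝ} (hM : 1 ≤ M) : ∀ᶠ lam in Filter.atTop, LamLarge M lam := by
  have hε : 0 < eps M := by unfold eps; positivity
  filter_upwards [Filter.eventually_ge_atTop (Real.exp 1),
    (tendsto_rpow_atTop hε).eventually_ge_atTop 4] with lam h1 h2
  exact ⟨h1, h2⟩

theorem eps_pos {M : ℝ} (hM : 1 ≤ M) : 0 < eps M := by unfold eps; positivity

theorem eps_le {M : ℝ} (hM : 1 ≤ M) : eps M ≤ 1 / 24576 := by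
  unfold eps
  apply one_div_le_one_div_of_le (by norm_num)
  have : 1 ≤ M ^ 6 := one_le_pow₀ hM
  linarith

theorem eps_mul_wait_le {ω M : ℝ} (hω : Irrational ω) (hM : 1 ≤ M)
    (hbdd : ∀ n : ℕ, 1 ≤ n → q ω (n + 1) < M * q ω n) {p : ℕ} (hp : 1 ≤ p) :
    eps M * wait ω M (p + 2) ≤ 1 / 4 * len ω M p := by
  have h1 := q_add_two_le hM hbdd hp
  have h2 : q ω (p + 2) ^ 2 ≤ (M ^ 2 * q ω p) ^ 2 := by
    have := (q_pos hω (p + 2)).le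
    gcongr
  have hM0 : 0 < M := by linarith
  unfold eps wait len
  rw [div_mul_eq_mul_div, div_le_iff₀ (by positivity)]
  have e : 1 / 4 * (q ω p ^ 2 / (16 * M)) * (24576 * M ^ 6) = 384 * M * (M ^ 2 * q ω p) ^ 2 := by
    field_simp; ring
  rw [e, one_mul]
  gcongr

theorem le_rate {M : ℝ} (hM : 1 ≤ M) (n : ℕ) : 1 - 2 * eps M ≤ rate M n := by
  have := eps_pos hM
  unfold rate
  have : 0 ≤ eps M / n := by positivity
  linarith

/-- The condition under which the slopes of blocks with lengths between `len` and `wait` agree up to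
`eta`. -/
theorem four_mul_pow_le {ω M lam : ℝ} (hω : Irrational ω) (hM : 1 ≤ M)
    (hbdd : ∀ n : ℕ, 1 ≤ n → q ω (n + 1) < M * q ω n) {p : ℕ} (hp : Large ω M p)
    (hlam : LamLarge M lam) {κ : ℝ} (hκ : 1 - 2 * eps M ≤ κ) (m m' : ℕ) (hm : len ω M p ≤ m)
    (hmm : m ≤ m') (hm' : (m' : ℝ) ≤ wait ω M (p + 2)) :
    4 * (4 * lam) ^ (m' - m) ≤ eta ω M p * (lam ^ (κ * m) * lam ^ (κ * m')) := by
  have hl1 := hlam.one_lt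
  have hl : 0 < lam := by linarith
  have hε := eps_pos hM
  have hε' := eps_le hM
  have hm3 := hp.three_le_len
  have hU := eps_mul_wait_le hω hM hbdd hp.one_le
  have h1 : eps M * m' ≤ 1 / 4 * m := by nlinarith
  have hmm' : (m : ℝ) ≤ m' := by exact_mod_cast hmm
  have h2 : lam ^ (-len ω M p) ≤ eta ω M p := by
    rw [eta, Real.rpow_neg hl.le, Real.exp_neg]
    exact inv_anti₀ (Real.exp_pos _) (hlam.exp_le_rpow (by linarith))
  calc 4 * (4 * lam) ^ (m' - m) ≤ lam ^ eps M * (lam ^ eps M * lam) ^ (m' - m) := by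
        have := hlam.four_le
        gcongr
    _ = lam ^ (eps M + (1 + eps M) * (m' - m)) := by
        rw [← Real.rpow_add_one hl.ne', ← Real.rpow_natCast, ← Real.rpow_mul hl.le,
          ← Real.rpow_add hl, Nat.cast_sub hmm, add_comm (eps M) 1]
    _ ≤ lam ^ (-len ω M p + (κ * m + κ * m')) := by
        apply Real.rpow_le_rpow_of_exponent_le hl1.le
        nlinarith
    _ = lam ^ (-len ω M p) * (lam ^ (κ * m) * lam ^ (κ * m')) := by
        rw [Real.rpow_add hl, Real.rpow_add hl]
    _ ≤ _ := by gcongr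

theorem eta_le_exp {ω M : ℝ} {p : ℕ} (hp : Large ω M p) : eta ω M p ≤ Real.exp (-q ω p) :=
  Real.exp_le_exp.2 (neg_le_neg hp.q_le_len)

/-! ### Hyperbolicity at one level -/

/-- The blocks between visits to `I_{p+1}` are good. -/
def HypAt (ω M c lam : ℝ) (φ : ℝ → ℝ) (p : ℕ) : Prop :=
  Hyp ω lam φ (crit ω c (1 / 3) p) (crit ω c 1 (p + 1)) (rate M (p + 1)) (slope (p + 1))
    (rad ω (p + 1))

theorem len_le_of_mem {ω M : ℝ} (hω : Irrational ω) (hM : 1 ≤ M)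
    (hbdd : ∀ n : ℕ, 1 ≤ n → q ω (n + 1) < M * q ω n) {p : ℕ} (hp : 4 * q ω 1 < q ω p ^ 2) {c x : ℝ}
    {j : ℕ} (hj : 1 ≤ j) (hx : x ∈ crit ω c (1 / 3) p) (hx' : tr ω x j ∈ crit ω c (1 / 3) p) :
    len ω M p ≤ j := by
  obtain ⟨k, hk⟩ := abs_rotation_le hx hx'
  refine le_of_abs_rotation_le hω hM hbdd hp hj (k := k) ?_
  push_cast at hk
  refine hk.trans (le_of_eq ?_)
  ring

theorem le_wait_of_forall_not_mem {ω M : ℝ} (hω : Irrational ω) (hM : 1 ≤ M)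
    (hbdd : ∀ n : ℕ, 1 ≤ n → q ω (n + 1) < M * q ω n) {n : ℕ} (hn : 4 * q ω 1 < q ω n ^ 2) {c x : ℝ}
    {m : ℕ} (h : ∀ j : ℤ, 0 < j → j < m → tr ω x j ∉ crit ω c 1 n) : (m : ℝ) ≤ wait ω M n := by
  obtain ⟨j, hj, hjU, hjm⟩ := exists_visit hω hM hbdd hn c x
  by_contra! hlt
  have hjm' : j < m := by exact_mod_cast hjU.trans_lt hlt
  exact h j (by exact_mod_cast hj) (by exact_mod_cast hjm')
    (crit_subset hω c one_pos (by norm_num) le_rfl hjm)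

theorem lt_sq_of_le {ω : ℝ} (hω : Irrational ω) {p n : ℕ} (hp : 4 * q ω 1 < q ω p ^ 2)
    (hn : p ≤ n) : 4 * q ω 1 < q ω n ^ 2 := by
  have h1 := q_mono ω hn
  have h2 := q_pos hω p
  exact hp.trans_le (by gcongr)

/-- The estimates for a block that starts in a neighbourhood of `I_p`. -/
theorem dominant_of_blkGood {ω M lam : ℝ} (hM : 1 ≤ M) {p : ℕ} (hp : Large ω M p)
    (hlam : LamLarge M lam) {θ : ℤ → ℂ} {i : ℤ} {m : ℕ} (hm : len ω M p ≤ m)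
    (h : BlkGood lam (rate M (p + 1)) (slope (p + 1)) (blk lam θ i m) m) :
    Dominant (blk lam θ i m) ∧ (‖blk lam θ i m 0 0‖ ^ 2)⁻¹ ≤ eta ω M p := by
  have hl1 := hlam.one_lt
  have hε' := eps_le hM
  have hκ := le_rate hM (p + 1)
  have h3 := hp.three_le_len
  have hm1 : 1 ≤ m := by exact_mod_cast (by linarith : (1 : ℝ) ≤ m)
  have h1 : Real.exp (len ω M p / 2) ≤ ‖blk lam θ i m 0 0‖ := by
    refine le_trans ?_ h.le
    refine le_trans (Real.exp_le_exp.2 ?_) (hlam.exp_le_rpow ?_) <;> nlinarith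
  constructor
  · refine h.dominant (det_blk (by linarith) θ i hm1) ?_ (le_trans ?_ h1)
    · unfold slope
      have : 0 ≤ 1 / (8 * ((p + 1 : ℕ) : ℝ)) := by positivity
      linarith
    · have h4 : (4 : ℝ) ≤ Real.exp (3 / 2) := by
        have h := Real.exp_one_gt_d9
        have h5 : Real.exp (3 / 2) ^ 2 = Real.exp 1 ^ 3 := by
          rw [← Real.exp_nat_mul, ← Real.exp_nat_mul]; norm_num
        have h6 : (2.7 : ℝ) ^ 3 ≤ Real.exp 1 ^ 3 := by gcongr; linarith
        nlinarith [Real.exp_pos (3 / 2)]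
      exact h4.trans (Real.exp_le_exp.2 (by linarith))
  · rw [eta, Real.exp_neg]
    apply inv_anti₀ (Real.exp_pos _)
    calc Real.exp (len ω M p) = Real.exp (len ω M p / 2) ^ 2 := by
          rw [← Real.exp_nat_mul]; congr 1; push_cast; ring
      _ ≤ _ := by gcongr

/-- Consequences of hyperbolicity for the two blocks of length `m` around a point of `I_{p+1}`. -/
structure PairGood (ω M lam : ℝ) (p : ℕ) (m : ℕ) (θ : ℤ → ℂ) : Prop where
  len_le : len ω M p ≤ m
  le_wait : (m : ℝ) ≤ wait ω M (p + 2)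
  right : BlkGood lam (rate M (p + 1)) (slope (p + 1)) (blk lam θ 0 m) m
  left : BlkGood lam (rate M (p + 1)) (slope (p + 1)) (blk lam θ (-(m : ℤ)) m) m
  dominant : DominantAt lam m θ
  right_sq : (‖blk lam θ 0 m 0 0‖ ^ 2)⁻¹ ≤ eta ω M p
  left_sq : (‖blk lam θ (-(m : ℤ)) m 0 0‖ ^ 2)⁻¹ ≤ eta ω M p

theorem HypAt.pairGood {ω M c lam : ℝ} (hω : Irrational ω) (hM : 1 ≤ M)
    (hbdd : ∀ n : ℕ, 1 ≤ n → q ω (n + 1) < M * q ω n) {φ : ℝ → ℝ} {p : ℕ}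
    (h : HypAt ω M c lam φ p) (hp : Large ω M p) (hlam : LamLarge M lam) {x : ℝ} {n : ℕ}
    (hpn : p ≤ n) (hn : n ≤ p + 1) (hx : x ∈ crit ω c 1 (p + 1)) {θ : ℤ → ℂ}
    (hθ : Near ω φ x (rad ω (p + 1)) θ) : PairGood ω M lam p (minReturn ω c n) θ := by
  have hn' := lt_sq_of_le hω hp.lt_sq hpn
  have hxn : x ∈ crit ω c 1 n := crit_subset hω c one_pos le_rfl hn hx
  obtain ⟨hr1, -, hrU⟩ := minReturn_mem hω hM hbdd hn' c
  obtain ⟨hR, hL⟩ := tr_minReturn_mem hω hM hbdd hn' hxn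
  set r := minReturn ω c n
  have hsub : crit ω c (1 / 3) n ⊆ crit ω c (1 / 3) p := crit_subset hω c (by norm_num) le_rfl hpn
  have hxp : x ∈ crit ω c (1 / 3) p :=
    crit_subset hω c (by norm_num) (by norm_num) (show p ≤ p + 1 by omega) hx
  have hvis : ∀ j : ℤ, j ≠ 0 → |j| < r → tr ω x j ∉ crit ω c 1 (p + 1) := fun j h0 h1 hj =>
    tr_not_mem_of_lt_minReturn hxn h0 h1 (crit_subset hω c one_pos le_rfl hn hj)
  have hlen : len ω M p ≤ r := len_le_of_mem hω hM hbdd hp.lt_sq hr1 hxp (hsub hR)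
  have gR := h.at hθ (i := 0) hr1 (by rwa [tr_zero]) (by simpa using hsub hR)
    (fun j h0 h1 => hvis j (by omega) (by rw [abs_lt]; omega))
  have gL := h.at hθ (i := -(r : ℤ)) hr1 (hsub hL) (by simpa using hxp)
    (fun j h0 h1 => hvis j (by omega) (by rw [abs_lt]; omega))
  obtain ⟨dR, sR⟩ := dominant_of_blkGood hM hp hlam hlen gR
  obtain ⟨dL, sL⟩ := dominant_of_blkGood hM hp hlam hlen gL
  refine ⟨hlen, hrU.trans ?_, gR, gL, ⟨dR, dL⟩, sR, sL⟩
  have h1 := q_mono ω (show n ≤ p + 2 by omega)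
  have h2 := q_pos hω n
  unfold wait
  gcongr

/-- The directions defined by the return times to `I_p` and to `I_{p+1}` are exponentially close. -/
theorem PairGood.norm_cdirDiff_sub_le {ω M lam : ℝ} (hω : Irrational ω) (hM : 1 ≤ M)
    (hbdd : ∀ n : ℕ, 1 ≤ n → q ω (n + 1) < M * q ω n) {p : ℕ} (hp : Large ω M p)
    (hlam : LamLarge M lam) {θ : ℤ → ℂ} (hθ : ∀ i, |(θ i).im| ≤ 1) {m m' : ℕ}
    (h : PairGood ω M lam p m θ) (h' : PairGood ω M lam p m' θ) :
    ‖cdirDiff lam m θ - cdirDiff lam m' θ‖ ≤ 15 * eta ω M p := by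
  have hl1 := hlam.one_lt
  have hζ := four_mul_pow_le hω hM hbdd hp hlam (le_rate hM (p + 1))
  have hpos : ∀ {k : ℕ}, len ω M p ≤ k → 1 ≤ k := fun {k} hk => by
    have := hp.three_le_len.trans hk
    exact_mod_cast (by linarith : (1 : ℝ) ≤ k)
  have b1 := norm_right_sub_le hl1.le hθ hζ (hpos h'.len_le) (hpos h.len_le) h'.len_le h'.le_wait
    h.len_le h.le_wait h'.right h.right
  have b2 := norm_left_sub_le hl1.le hθ hζ (hpos h'.len_le) (hpos h.len_le) h'.len_le h'.le_wait
    h.len_le h.le_wait (by ring) h'.left h.left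
  have d1 := h.dominant.1.norm_cdir_sub_le h'.dominant.1
  have d2 := h.dominant.2.transpose.norm_cdir_sub_le h'.dominant.2.transpose
  simp only [Matrix.transpose_apply] at d2
  have e : cdirDiff lam m θ - cdirDiff lam m' θ =
      (cdir (blk lam θ 0 m) - cdir (blk lam θ 0 m')) -
      (cdir (blk lam θ (-(m : ℤ)) m).transpose - cdir (blk lam θ (-(m' : ℤ)) m').transpose) := by
    unfold cdirDiff; ring
  rw [e]
  refine (norm_sub_le _ _).trans ?_
  linarith [h.right_sq, h.left_sq, h'.right_sq, h'.left_sq]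

theorem rad_add_two_le {ω : ℝ} (hω : Irrational ω) (p : ℕ) :
    rad ω (p + 2) ≤ Real.exp (-q ω p) * rad ω (p + 1) := by
  unfold rad
  rw [← Real.exp_add]
  apply Real.exp_le_exp.2
  linarith [q_add_le hω p]

/-- The induction step for hyperbolicity: the angle between the stable and the unstable direction
has to be bounded from below on `I_{p+1} ∖ I_{p+2}`. -/
theorem HypAt.succ {ω M c lam : ℝ} (hω : Irrational ω) (hM : 1 ≤ M)
    (hbdd : ∀ n : ℕ, 1 ≤ n → q ω (n + 1) < M * q ω n) {φ : ℝ → ℝ} {p : ℕ}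
    (h : HypAt ω M c lam φ p) (hp : Large ω M p) (hlam : LamLarge M lam)
    (hangle : ∀ y ∈ crit ω c 1 (p + 1), y ∉ crit ω c 1 (p + 2) →
      3 / 10 * gap ω (p + 2) ≤ |Real.sin (φ y + dirDiff ω lam φ (minReturn ω c (p + 1)) y)|) :
    HypAt ω M c lam φ (p + 1) := by
  have hl1 := hlam.one_lt
  have hε := eps_pos hM
  have hp1 := lt_sq_of_le hω hp.lt_sq (show p ≤ p + 1 by omega)
  have hp2 := lt_sq_of_le hω hp.lt_sq (show p ≤ p + 2 by omega)
  have hgap1 : gap ω (p + 2) ≤ 1 := Real.exp_le_one_iff.2 (neg_nonpos.2 (Real.sqrt_nonneg _))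
  have hrad : rad ω (p + 1) ≤ 1 := Real.exp_le_one_iff.2 (neg_nonpos.2 (q_pos hω _).le)
  have hexp := Real.exp_pos (-q ω p)
  have hstep := Hyp.step (E' := crit ω c (1 / 3) (p + 1)) (F' := crit ω c 1 (p + 2))
    (κ' := rate M (p + 2)) (b' := slope (p + 2)) (ρ' := rad ω (p + 2)) (ℓ := len ω M p)
    (U := wait ω M (p + 2)) (s := gap ω (p + 2) / 4) (ζ := Real.exp (-q ω p))
    (r := minReturn ω c (p + 1)) h hl1.le (crit_subset hω c (by norm_num) le_rfl (by omega))
    (crit_subset hω c (by norm_num) (by norm_num) le_rfl)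
    (crit_subset hω c one_pos le_rfl (by omega))
    (fun x hx j hj hx' => len_le_of_mem hω hM hbdd hp.lt_sq hj hx hx')
    (fun x m _ hF => le_wait_of_forall_not_mem hω hM hbdd hp2 hF)
    (minReturn_mem hω hM hbdd hp1 c).1
    (fun y hy => ⟨(tr_minReturn_mem hω hM hbdd hp1 hy).1, (tr_minReturn_mem hω hM hbdd hp1 hy).2,
      fun j h0 h1 => tr_not_mem_of_lt_minReturn hy h0 h1⟩)
    (fun m m' h1 h2 h3 =>
      (four_mul_pow_le hω hM hbdd hp hlam (le_rate hM (p + 2)) m m' h1 h2 h3).trans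
        (mul_le_mul_of_nonneg_right (eta_le_exp hp)
          (mul_nonneg (Real.rpow_nonneg (by linarith) _) (Real.rpow_nonneg (by linarith) _))))
    ?_ ?_ (Real.exp_pos _) hrad (rad_add_two_le hω p) ?_ ?_ hexp.le
    (by linarith [hp.le_gap]) (by linarith) ?_
  · exact hstep
  · unfold rate
    have : eps M / ((p + 2 : ℕ) : ℝ) ≤ eps M / ((p + 1 : ℕ) : ℝ) := by
      gcongr
      omega
    linarith
  · intro m hm
    -- the loss of rate at this level is `eps / ((p + 1) * (p + 2))`
    have e : rate M (p + 1) * m = rate M (p + 2) * m + eps M / ((p + 1) * (p + 2)) * m := by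
      unfold rate
      push_cast
      field_simp
      ring
    have hm0 : (0 : ℝ) ≤ m := m.cast_nonneg
    rw [e, Real.rpow_add (by linarith)]
    have h1 : Real.exp (eps M / ((p + 1) * (p + 2)) * len ω M p) ≤
        lam ^ (eps M / ((p + 1) * (p + 2)) * m) :=
      le_trans (Real.exp_le_exp.2 (by gcongr)) (hlam.exp_le_rpow (by positivity))
    have h2 : 8 ≤ gap ω (p + 2) * lam ^ (eps M / ((p + 1) * (p + 2)) * m) :=
      hp.loss.trans (mul_le_mul_of_nonneg_left h1 (Real.exp_pos _).le)
    have h3 : 0 ≤ lam ^ (rate M (p + 2) * m) := Real.rpow_nonneg (by linarith) _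
    nlinarith
  · have := hp.slope_le
    unfold slope
    push_cast
    have e : 1 / (8 * ((p : ℝ) + 1)) - 1 / (8 * ((p : ℝ) + 2)) = 1 / (8 * ((p + 1) * (p + 2))) := by
      field_simp; ring
    linarith
  · unfold slope
    have : 0 ≤ 1 / (8 * ((p + 2 : ℕ) : ℝ)) := by positivity
    linarith
  · rintro y hy hy' B C rfl rfl
    have hpair := h.pairGood hω hM hbdd hp hlam (n := p + 1) (by omega) le_rfl hy
      (near_self φ y (Real.exp_pos _))
    set r := minReturn ω c (p + 1)
    have hB : (rblk ω lam φ y r).map Complex.ofReal = blk lam (fun i => (φ (tr ω y i) : ℂ)) 0 r :=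
      map_rblk ω lam φ y r
    have hC := map_rblk_neg ω lam φ y r
    -- the junction of the two blocks is the sine of the angle, up to quadratic errors in the entries
    have key := abs_sin_le_norm_junction (A := rblk ω lam φ y r)
      (B := rblk ω lam φ (tr ω y (-(r : ℤ))) r) (by rw [hB]; exact hpair.dominant.1)
      (by rw [hC]; exact hpair.dominant.2) (φ y)
    have h1 := hpair.right_sq
    have h2 := hpair.left_sq
    have h3 := hangle y hy hy'
    rw [← hB] at h1 ⊢
    rw [← hC] at h2 ⊢
    simp only [Matrix.map_apply, Complex.norm_real, Real.norm_eq_abs, sq_abs] at h1 h2 ⊢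
    push_cast at key
    refine le_trans ?_ key
    have e : φ y + sdir (rblk ω lam φ y r) - udir (rblk ω lam φ (tr ω y (-(r : ℤ))) r)
      = φ y + dirDiff ω lam φ r y := by unfold dirDiff; ring
    rw [e]
    have := eta_le_exp hp
    linarith [hp.le_gap]

theorem HypAt.congr {ω M c lam : ℝ} {φ ψ : ℝ → ℝ} {p : ℕ} (h : HypAt ω M c lam φ p)
    (hψ : ∀ x, x ∉ crit ω c 1 (p + 1) → ψ x = φ x) : HypAt ω M c lam ψ p :=
  Hyp.congr h (Real.exp_pos _) hψ

theorem PairGood.one_lt_norm {ω M lam : ℝ} {p m : ℕ} {φ : ℝ → ℝ} {x : ℝ} (hl : lam ≠ 0)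
    (h : PairGood ω M lam p m (fun i => (φ (tr ω x i) : ℂ))) :
    1 < ‖fwd ω (cocycle lam φ) m x‖ ∧ 1 < ‖bwd ω (cocycle lam φ) m x‖ := by
  have h1 := h.dominant.1.le
  have h2 := h.dominant.2.le
  rw [← map_rblk] at h1
  rw [← map_rblk_neg] at h2
  simp only [Matrix.map_apply, Complex.norm_real, Real.norm_eq_abs] at h1 h2
  refine ⟨one_lt_norm_of_lt (by linarith), ?_⟩
  rw [bwd_eq_inv_fwd, norm_inv_of_det_eq_one (det_fwd hl _ _ _)]
  exact one_lt_norm_of_lt (by linarith)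

theorem HypAt.hyperbolicOn {ω M c lam : ℝ} (hω : Irrational ω) (hM : 1 ≤ M)
    (hbdd : ∀ n : ℕ, 1 ≤ n → q ω (n + 1) < M * q ω n) {φ : ℝ → ℝ} {p : ℕ}
    (h : HypAt ω M c lam φ p) (hp : Large ω M p) (hlam : LamLarge M lam) :
    HyperbolicOn ω c lam φ (p + 1) := fun x hx =>
  (h.pairGood hω hM hbdd hp hlam (by omega) le_rfl hx
    (near_self φ x (Real.exp_pos _))).one_lt_norm (by linarith [hlam.one_lt])

theorem HypAt.angle_eq {ω M c lam : ℝ} (hω : Irrational ω) (hM : 1 ≤ M)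
    (hbdd : ∀ n : ℕ, 1 ≤ n → q ω (n + 1) < M * q ω n) {φ : ℝ → ℝ} {p : ℕ}
    (h : HypAt ω M c lam φ p) (hp : Large ω M p) (hlam : LamLarge M lam) {n : ℕ} (hpn : p ≤ n)
    (hn : n ≤ p + 1) {x : ℝ} (hx : x ∈ crit ω c 1 (p + 1)) :
    angle ω c lam φ n x = nearZero (φ x + dirDiff ω lam φ (minReturn ω c n) x) := by
  have hpair := h.pairGood hω hM hbdd hp hlam hpn hn hx (near_self φ x (Real.exp_pos _))
  refine QPCocycle.angle_eq (by linarith [hlam.one_lt]) ?_ ?_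
  · rw [map_rblk]; exact hpair.dominant.1
  · rw [map_rblk_neg]; exact hpair.dominant.2

/-! ### The first level -/

/-- As long as the phase stays away from `πℤ`, all blocks are good if `lam` is large. -/
theorem eventually_hyp_univ {κ s ρ : ℝ} (hκ : κ < 1) (hs : 0 < s) (hs1 : s ≤ 1) (hρ : ρ ≤ s / 8) :
    ∀ᶠ lam : ℝ in Filter.atTop, ∀ (ω : ℝ) (φ : ℝ → ℝ) (F : Set ℝ),
      (∀ x, x ∉ F → s / 2 ≤ |Real.sin (φ x)|) → Hyp ω lam φ Set.univ F κ (1 / 8) ρ := by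
  filter_upwards [Filter.eventually_ge_atTop (512 / s ^ 2), Filter.eventually_gt_atTop 0,
    (tendsto_rpow_atTop (show 0 < 1 - κ by linarith)).eventually_ge_atTop (8 / s)] with lam h1 h0 h2
  intro ω φ F hsin x m hm _ _ hF θ hθ
  obtain ⟨b1, b2, b3, b4⟩ := Hyp.base hs hs1 hρ hsin h1 x m hm hF θ hθ
  refine ⟨le_trans ?_ b1, b3, b4⟩
  rw [Real.rpow_mul h0.le, Real.rpow_natCast]
  refine pow_le_pow_left₀ (Real.rpow_nonneg h0.le _) ?_ m
  rw [div_le_iff₀ hs] at h2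
  have e : lam = lam ^ κ * lam ^ (1 - κ) := by
    rw [← Real.rpow_add h0]; simp
  have h3 : 0 < lam ^ κ := Real.rpow_pos_of_pos h0 _
  calc lam ^ κ = lam ^ κ * 8 / 8 := by ring
    _ ≤ lam ^ κ * (lam ^ (1 - κ) * s) / 8 := by gcongr
    _ = lam * s / 8 := by rw [← mul_assoc, ← e]

theorem cdirDiff_one (lam : ℝ) (θ : ℤ → ℂ) : cdirDiff lam 1 θ = 0 := by
  have h0 : Complex.arctan 0 = 0 := by simp [Complex.arctan]
  have h : cdir (cdiag lam) = 0 ∧ cdir (cdiag lam).transpose = 0 := by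
    simp [cdir, cquot, cdiag, h0]
  rw [cdirDiff, blk_one, blk_one, h.1, h.2, sub_zero]

theorem dirDiff_one (ω lam : ℝ) (φ : ℝ → ℝ) (x : ℝ) : dirDiff ω lam φ 1 x = 0 := by
  have := ofReal_dirDiff ω lam φ 1 x
  rw [cdirDiff_one] at this
  exact_mod_cast this

theorem gap_anti {ω : ℝ} {n n' : ℕ} (h : n ≤ n') : gap ω n' ≤ gap ω n :=
  Real.exp_le_exp.2 (neg_le_neg (Real.sqrt_le_sqrt (q_mono ω h)))

theorem rad_le_gap {ω M : ℝ} {p : ℕ} (hp : Large ω M p) :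
    rad ω (p + 1) ≤ gap ω (p + 1) / 8 := by
  have h1 : rad ω (p + 1) ≤ Real.exp (-q ω p) :=
    Real.exp_le_exp.2 (neg_le_neg (q_mono ω (by omega)))
  have h2 := gap_anti (ω := ω) (show p + 1 ≤ p + 2 by omega)
  have h3 := hp.le_gap
  have h4 := Real.exp_pos (-q ω p)
  linarith

theorem eventually_hypAt {ω M : ℝ} (hM : 1 ≤ M) {p : ℕ} (hp : Large ω M p)
    (c : ℝ) : ∀ᶠ lam : ℝ in Filter.atTop, ∀ φ : ℝ → ℝ,
      (∀ x, x ∉ crit ω c 1 (p + 1) → gap ω (p + 1) / 2 ≤ |Real.sin (φ x)|) →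
        HypAt ω M c lam φ p := by
  have hε := eps_pos hM
  have hκ : rate M (p + 1) < 1 := by
    unfold rate
    have : eps M / ((p + 1 : ℕ) : ℝ) ≤ eps M := div_le_self hε.le (by push_cast; linarith [p.cast_nonneg (α := ℝ)])
    linarith
  have hgap1 : gap ω (p + 1) ≤ 1 := Real.exp_le_one_iff.2 (neg_nonpos.2 (Real.sqrt_nonneg _))
  filter_upwards [eventually_hyp_univ hκ (Real.exp_pos _) hgap1 (rad_le_gap hp),
    Filter.eventually_ge_atTop 1] with lam h h1 φ hφ x m hm hx hx' hF θ hθ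
  refine (h ω φ _ hφ x m hm trivial trivial hF θ hθ).mono h1 le_rfl ?_
  unfold slope
  have : 1 / (8 * ((p + 1 : ℕ) : ℝ)) ≤ 1 / 8 := by
    apply one_div_le_one_div_of_le (by norm_num)
    push_cast
    linarith [p.cast_nonneg (α := ℝ)]
  linarith

/-- At the first level, the stable and the unstable direction are close to the coordinate axes if
`lam` is large. -/
theorem eventually_norm_cdirDiff_le {ω M : ℝ} (hω : Irrational ω) (hM : 1 ≤ M)
    (hbdd : ∀ n : ℕ, 1 ≤ n → q ω (n + 1) < M * q ω n) {p : ℕ} (hp : Large ω M p) (c : ℝ) {τ : ℝ}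
    (hτ : 0 < τ) : ∀ᶠ lam : ℝ in Filter.atTop, ∀ φ : ℝ → ℝ,
      (∀ x, x ∉ crit ω c 1 (p + 1) → gap ω (p + 1) / 2 ≤ |Real.sin (φ x)|) →
      ∀ x ∈ crit ω c 1 (p + 1), ∀ θ, Near ω φ x (rad ω (p + 1)) θ →
        DominantAt lam 1 θ ∧ DominantAt lam (minReturn ω c (p + 1)) θ ∧
        ‖cdirDiff lam 1 θ - cdirDiff lam (minReturn ω c (p + 1)) θ‖ ≤ τ := by
  obtain ⟨ζ, hζ0, hζ⟩ : ∃ ζ : ℝ, 0 < ζ ∧ ζ * 15 = τ := ⟨τ / 15, by positivity, by ring⟩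
  have hp1 := lt_sq_of_le hω hp.lt_sq (show p ≤ p + 1 by omega)
  set r := minReturn ω c (p + 1) with hr
  have hr1 : 1 ≤ r := (minReturn_mem hω hM hbdd hp1 c).1
  have hr1' : (1 : ℝ) ≤ r := by exact_mod_cast hr1
  obtain ⟨κ, hκ⟩ : ∃ κ : ℝ, κ = 1 - 1 / (4 * r) := ⟨_, rfl⟩
  have hκr : (1 - κ) * (4 * r) = 1 := by rw [hκ]; field_simp; ring
  have hκ1 : κ < 1 := by
    have : 0 < 1 / (4 * (r : ℝ)) := by positivity
    linarith
  have hκ2 : 1 / 2 ≤ κ := by nlinarith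
  have hgap1 : gap ω (p + 1) ≤ 1 := Real.exp_le_one_iff.2 (neg_nonpos.2 (Real.sqrt_nonneg _))
  have hrad : rad ω (p + 1) ≤ 1 := Real.exp_le_one_iff.2 (neg_nonpos.2 (q_pos hω _).le)
  filter_upwards [eventually_hyp_univ hκ1 (Real.exp_pos _) hgap1 (rad_le_gap hp),
    Filter.eventually_ge_atTop 16, Filter.eventually_ge_atTop ζ⁻¹,
    Filter.eventually_ge_atTop (4 * 4 ^ r / ζ)] with lam h h16 hl1 hl2 φ hφ x hx θ hθ
  have h0 : 0 < lam := by linarith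
  have h1 : 1 ≤ lam := by linarith
  have hyp := h ω φ _ hφ
  have hvis : ∀ j : ℤ, j ≠ 0 → |j| < r → tr ω x j ∉ crit ω c 1 (p + 1) := fun j h0 h1 =>
    tr_not_mem_of_lt_minReturn hx h0 h1
  have good : ∀ k : ℕ, 1 ≤ k → k ≤ r → BlkGood lam κ (1 / 8) (blk lam θ 0 k) k ∧
      BlkGood lam κ (1 / 8) (blk lam θ (-(k : ℤ)) k) k := fun k hk hkr =>
    ⟨hyp.at hθ hk trivial trivial (fun j h0 h1 => hvis j (by omega) (by rw [abs_lt]; omega)),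
      hyp.at hθ hk trivial trivial (fun j h0 h1 => hvis j (by omega) (by rw [abs_lt]; omega))⟩
  have hsq : ∀ (k : ℕ) (A : Matrix (Fin 2) (Fin 2) ℂ), 1 ≤ k → BlkGood lam κ (1 / 8) A k →
      4 ≤ ‖A 0 0‖ ∧ (‖A 0 0‖ ^ 2)⁻¹ ≤ ζ := by
    intro k A hk hA
    have hk' : (1 : ℝ) ≤ k := by exact_mod_cast hk
    have h2 : lam ^ (1 / 2 : ℝ) ≤ ‖A 0 0‖ :=
      (Real.rpow_le_rpow_of_exponent_le h1 (by nlinarith)).trans hA.le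
    rw [← Real.sqrt_eq_rpow] at h2
    have h3 : 4 ≤ √lam := Real.le_sqrt_of_sq_le (by norm_num; linarith)
    refine ⟨h3.trans h2, ?_⟩
    rw [inv_le_comm₀ (by have := h3.trans h2; positivity) hζ0]
    calc ζ⁻¹ ≤ lam := hl1
      _ = √lam ^ 2 := (Real.sq_sqrt h0.le).symm
      _ ≤ _ := by gcongr
  have hcmp : ∀ m m' : ℕ, (1 : ℝ) ≤ m → m ≤ m' → (m' : ℝ) ≤ r →
      4 * (4 * lam) ^ (m' - m) ≤ ζ * (lam ^ (κ * m) * lam ^ (κ * m')) := by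
    intro m m' hm hmm hm'
    have hmm' : (m : ℝ) ≤ m' := by exact_mod_cast hmm
    have hm'r : m' ≤ r := by exact_mod_cast hm'
    rw [div_le_iff₀ hζ0] at hl2
    have h4 : (4 : ℝ) ^ (m' - m) ≤ 4 ^ r := pow_le_pow_right₀ (by norm_num) (by omega)
    calc 4 * (4 * lam) ^ (m' - m) = 4 * 4 ^ (m' - m) * lam ^ (m' - m) := by rw [mul_pow]; ring
      _ ≤ 4 * 4 ^ r * lam ^ (m' - m) := by gcongr
      _ ≤ lam * ζ * lam ^ (m' - m) := by gcongr
      _ = ζ * lam ^ (1 + ((m' : ℝ) - m)) := by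
          rw [Real.rpow_add h0, Real.rpow_one, ← Nat.cast_sub hmm, Real.rpow_natCast]; ring
      _ ≤ ζ * lam ^ (κ * m + κ * m') := by
          refine mul_le_mul_of_nonneg_left (Real.rpow_le_rpow_of_exponent_le h1 ?_) hζ0.le
          have : (1 - κ) * (m + m') ≤ (1 - κ) * (2 * r) :=
            mul_le_mul_of_nonneg_left (by linarith) (by linarith)
          linarith
      _ = _ := by rw [Real.rpow_add h0]
  have him := hθ.abs_im_le hrad
  obtain ⟨g1, g2⟩ := good 1 le_rfl hr1
  obtain ⟨g3, g4⟩ := good r hr1 le_rfl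
  have hl0 : lam ≠ 0 := h0.ne'
  have D : ∀ (k : ℕ) (i : ℤ), 1 ≤ k → BlkGood lam κ (1 / 8) (blk lam θ i k) k →
      Dominant (blk lam θ i k) := fun k i hk hA =>
    hA.dominant (det_blk hl0 θ i hk) (by norm_num) (hsq k _ hk hA).1
  have d1 := D 1 _ le_rfl g1
  have d2 := D 1 _ le_rfl g2
  have d3 := D r _ hr1 g3
  have d4 := D r _ hr1 g4
  refine ⟨⟨d1, d2⟩, ⟨d3, d4⟩, ?_⟩
  have b1 := norm_right_sub_le h1 him hcmp hr1 le_rfl hr1' le_rfl (by simp) (by simpa using hr1') g3 g1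
  have b2 := norm_left_sub_le h1 him hcmp hr1 le_rfl hr1' le_rfl (by simp) (by simpa using hr1')
    (by ring) g4 g2
  have e1 := d1.norm_cdir_sub_le d3
  have e2 := d2.transpose.norm_cdir_sub_le d4.transpose
  simp only [Matrix.transpose_apply] at e2
  have e : cdirDiff lam 1 θ - cdirDiff lam r θ =
      (cdir (blk lam θ 0 1) - cdir (blk lam θ 0 r)) -
      (cdir (blk lam θ (-((1 : ℕ) : ℤ)) 1).transpose - cdir (blk lam θ (-(r : ℤ)) r).transpose) := by
    unfold cdirDiff; ring
  rw [e]
  refine (norm_sub_le _ _).trans ?_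
  have s1 := (hsq 1 _ le_rfl g1).2
  have s2 := (hsq 1 _ le_rfl g2).2
  have s3 := (hsq r _ hr1 g3).2
  have s4 := (hsq r _ hr1 g4).2
  have sum_le : ∀ {X a b d : ℝ}, X ≤ 3 / 2 * (a + b + 3 * d) → a ≤ ζ → b ≤ ζ → d ≤ ζ →
      X ≤ 15 / 2 * ζ := by
    intros; linarith
  have e1' := sum_le e1 s1 s3 b1
  have e2' := sum_le e2 s2 s4 b2
  exact (add_le_add e1' e2').trans (le_of_eq (by rw [← hζ]; ring))

/-! ### Functions supported near the critical points -/

/-- The function that is equal to `e m` around the critical point `c + mπ`, in the coordinate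
centred at that point. -/
def patch (c : ℝ) (e : ℤ → ℝ → ℝ) (x : ℝ) : ℝ :=
  e (round ((x - c) / Real.pi)) (x - (c + round ((x - c) / Real.pi) * Real.pi))

theorem abs_sub_round_le (c x : ℝ) :
    |x - (c + round ((x - c) / Real.pi) * Real.pi)| ≤ Real.pi / 2 := by
  have h := abs_sub_round ((x - c) / Real.pi)
  have hpi := Real.pi_pos
  have e : x - (c + round ((x - c) / Real.pi) * Real.pi)
      = Real.pi * ((x - c) / Real.pi - round ((x - c) / Real.pi)) := by field_simp; ring
  rw [e, abs_mul, abs_of_pos hpi]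
  nlinarith

section patch

variable {c h : ℝ} {e : ℤ → ℝ → ℝ}

theorem patch_apply (hh : h ≤ 1) (he : ∀ m s, h ≤ |s| → e m s = 0) (m : ℤ) {s : ℝ}
    (hs : |s| < Real.pi - h) : patch c e (c + m * Real.pi + s) = e m s := by
  have hpi := Real.pi_gt_three
  set x := c + m * Real.pi + s with hx
  have h1 := abs_sub_round_le c x
  unfold patch
  set j := round ((x - c) / Real.pi) with hj
  by_cases hjm : j = m
  · rw [hjm]; congr 1; rw [hx]; ring
  · have hne : (1 : ℝ) ≤ |((m - j : ℤ) : ℝ)| := by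
      rw [← Int.cast_abs]
      exact_mod_cast Int.one_le_abs (sub_ne_zero.2 (Ne.symm hjm))
    have e1 : x - (c + j * Real.pi) = ((m - j : ℤ) : ℝ) * Real.pi + s := by rw [hx]; push_cast; ring
    have h2 : Real.pi ≤ |((m - j : ℤ) : ℝ) * Real.pi| := by
      rw [abs_mul, abs_of_pos Real.pi_pos]; nlinarith
    have h3 : |((m - j : ℤ) : ℝ) * Real.pi| ≤ |x - (c + j * Real.pi)| + |s| := by
      rw [e1]
      have := abs_sub (((m - j : ℤ) : ℝ) * Real.pi + s) s
      rwa [add_sub_cancel_right] at this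
    rw [he _ _ (by linarith), he _ _ (by linarith)]

theorem patch_eventuallyEq (hh : h ≤ 1) (he : ∀ m s, h ≤ |s| → e m s = 0) (m : ℤ) {x : ℝ}
    (hx : |x - (c + m * Real.pi)| < Real.pi - h) :
    patch c e =ᶠ[nhds x] fun y => e m (y - (c + m * Real.pi)) := by
  have : ∀ᶠ y in nhds x, |y - (c + m * Real.pi)| < Real.pi - h :=
    (by fun_prop : Continuous fun y => |y - (c + m * Real.pi)|).continuousAt.eventually_lt
      continuousAt_const hx
  filter_upwards [this] with y hy
  rw [← patch_apply hh he m hy]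
  congr 1
  ring

theorem patch_eq_zero (he : ∀ m s, h ≤ |s| → e m s = 0) {x : ℝ}
    (hx : ∀ m : ℤ, h ≤ |x - (c + m * Real.pi)|) : patch c e x = 0 := he _ _ (hx _)

theorem contDiff_patch {l : WithTop ℕ∞} (hh : h ≤ 1) (he : ∀ m s, h ≤ |s| → e m s = 0)
    (hs : ∀ m, ContDiff ℝ l (e m)) : ContDiff ℝ l (patch c e) := by
  have hpi := Real.pi_gt_three
  rw [contDiff_iff_contDiffAt]
  intro x
  refine ContDiffAt.congr_of_eventuallyEq ?_ (patch_eventuallyEq hh he (round ((x - c) / Real.pi))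
    ((abs_sub_round_le c x).trans_lt (by linarith)))
  exact ((hs _).comp (contDiff_id.sub contDiff_const)).contDiffAt

theorem iteratedDeriv_patch (hh : h ≤ 1) (he : ∀ m s, h ≤ |s| → e m s = 0) (k : ℕ) (m : ℤ) {x : ℝ}
    (hx : |x - (c + m * Real.pi)| < Real.pi - h) :
    iteratedDeriv k (patch c e) x = iteratedDeriv k (e m) (x - (c + m * Real.pi)) := by
  rw [(patch_eventuallyEq hh he m hx).iteratedDeriv_eq, iteratedDeriv_comp_sub_const]

theorem abs_iteratedDeriv_patch_le (hh : h ≤ 1) (he : ∀ m s, h ≤ |s| → e m s = 0) {k : ℕ} {B : ℝ}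
    (hB : ∀ m s, |iteratedDeriv k (e m) s| ≤ B) (x : ℝ) : |iteratedDeriv k (patch c e) x| ≤ B := by
  have hpi := Real.pi_gt_three
  rw [iteratedDeriv_patch hh he k (round ((x - c) / Real.pi))
    ((abs_sub_round_le c x).trans_lt (by linarith))]
  exact hB _ _

theorem periodic_patch (he : ∀ m s, e (m + 2) s = e m s) :
    Function.Periodic (patch c e) (2 * Real.pi) := by
  intro x
  unfold patch
  have e1 : (x + 2 * Real.pi - c) / Real.pi = (x - c) / Real.pi + (2 : ℤ) := by
    have := Real.pi_ne_zero
    field_simp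
    push_cast
    ring
  rw [e1, round_add_intCast, he]
  congr 1
  push_cast
  ring

end patch

/-! ### Cutting off a function -/

/-- The product `T * f`, extended by zero outside `(-h, h)`. -/
def cutMul (h : ℝ) (T f : ℝ → ℝ) (s : ℝ) : ℝ := if |s| < h then T s * f s else 0

section cutMul

variable {h : ℝ} {T f : ℝ → ℝ}

theorem cutMul_eq_zero (s : ℝ) (hs : h ≤ |s|) : cutMul h T f s = 0 := if_neg (not_lt.2 hs)

theorem cutMul_eventuallyEq_zero (hh : 0 < h) (hf : ∀ s, 5 / 8 * h ≤ |s| → f s = 0) {s : ℝ}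
    (hs : h ≤ |s|) : cutMul h T f =ᶠ[nhds s] fun _ => 0 := by
  have : ∀ᶠ y in nhds s, 5 / 8 * h < |y| :=
    continuousAt_const.eventually_lt continuous_abs.continuousAt (by linarith)
  filter_upwards [this] with y hy
  unfold cutMul
  split_ifs
  · rw [hf y hy.le, mul_zero]
  · rfl

theorem cutMul_eventuallyEq_mul {s : ℝ} (hs : |s| < h) :
    cutMul h T f =ᶠ[nhds s] fun s => T s * f s := by
  have : ∀ᶠ y in nhds s, |y| < h := continuous_abs.continuousAt.eventually_lt continuousAt_const hs
  filter_upwards [this] with y hy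
  exact if_pos hy

theorem contDiff_cutMul {l : WithTop ℕ∞} (hh : 0 < h) (hT : ∀ s, |s| < h → ContDiffAt ℝ l T s)
    (hfs : ContDiff ℝ l f) (hf : ∀ s, 5 / 8 * h ≤ |s| → f s = 0) : ContDiff ℝ l (cutMul h T f) := by
  rw [contDiff_iff_contDiffAt]
  intro s
  rcases lt_or_ge |s| h with hs | hs
  · exact ((hT s hs).mul hfs.contDiffAt).congr_of_eventuallyEq (cutMul_eventuallyEq_mul hs)
  · exact contDiffAt_const.congr_of_eventuallyEq (cutMul_eventuallyEq_zero hh hf hs)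

theorem abs_iteratedDeriv_cutMul_le (hh : 0 < h) (hf : ∀ s, 5 / 8 * h ≤ |s| → f s = 0) {k : ℕ}
    {B : ℝ} (hB : 0 ≤ B) (hTf : ∀ s, |s| < h → |iteratedDeriv k (fun s => T s * f s) s| ≤ B) (s : ℝ) :
    |iteratedDeriv k (cutMul h T f) s| ≤ B := by
  rcases lt_or_ge |s| h with hs | hs
  · rw [(cutMul_eventuallyEq_mul hs).iteratedDeriv_eq]
    exact hTf s hs
  · rw [(cutMul_eventuallyEq_zero hh hf hs).iteratedDeriv_eq, iteratedDeriv_fun_const_zero, abs_zero]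
    exact hB

end cutMul

theorem abs_iteratedDeriv_mul_le {f g : ℝ → ℝ} {x : ℝ} {k : ℕ} (hf : ContDiffAt ℝ k f x)
    (hg : ContDiffAt ℝ k g x) {B : ℝ}
    (hB : ∀ i ≤ k, |iteratedDeriv i f x| * |iteratedDeriv (k - i) g x| ≤ B) :
    |iteratedDeriv k (fun y => f y * g y) x| ≤ 2 ^ k * B := by
  rw [iteratedDeriv_fun_mul hf hg]
  refine (Finset.abs_sum_le_sum_abs _ _).trans ?_
  have e : (2 : ℝ) ^ k * B = ∑ i ∈ Finset.range (k + 1), (k.choose i : ℝ) * B := by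
    rw [← Finset.sum_mul]
    congr 1
    exact_mod_cast (Nat.sum_range_choose k).symm
  rw [e]
  refine Finset.sum_le_sum fun i hi => ?_
  rw [abs_mul, abs_mul, Nat.abs_cast, mul_assoc]
  exact mul_le_mul_of_nonneg_left (hB i (by rw [Finset.mem_range] at hi; omega)) (by positivity)

/-! ### Averages and cut-off functions -/

/-- The average of `F` over `[x - w, x + w]`. -/
def avg (w : ℝ) (F : ℝ → ℝ) (x : ℝ) : ℝ := (∫ y in (x - w)..(x + w), F y) / (2 * w)

theorem hasDerivAt_avg {F : ℝ → ℝ} (hF : Continuous F) (w x : ℝ) :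
    HasDerivAt (avg w F) ((F (x + w) - F (x - w)) / (2 * w)) x := by
  have h0 : ∀ a b, IntervalIntegrable F MeasureTheory.volume a b := fun a b => hF.intervalIntegrable a b
  have h1 : HasDerivAt (fun u => ∫ y in (0 : ℝ)..u, F y) (F (x + w)) (x + w) :=
    intervalIntegral.integral_hasDerivAt_right (h0 _ _)
      (hF.stronglyMeasurableAtFilter _ _) hF.continuousAt
  have h2 : HasDerivAt (fun u => ∫ y in (0 : ℝ)..u, F y) (F (x - w)) (x - w) :=
    intervalIntegral.integral_hasDerivAt_right (h0 _ _)
      (hF.stronglyMeasurableAtFilter _ _) hF.continuousAt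
  have h3 := h1.comp_add_const x w
  have h4 := h2.comp_sub_const x w
  refine ((h3.sub h4).div_const (2 * w)).congr_of_eventuallyEq ?_
  filter_upwards with y
  unfold avg
  rw [Pi.sub_apply, intervalIntegral.integral_interval_sub_left (h0 _ _) (h0 _ _)]

theorem avg_eq_of_eqOn {F : ℝ → ℝ} {w x a : ℝ} (hw : 0 < w)
    (h : ∀ y, |y - x| ≤ w → F y = a) : avg w F x = a := by
  unfold avg
  have : ∫ y in (x - w)..(x + w), F y = ∫ y in (x - w)..(x + w), a := by
    apply intervalIntegral.integral_congr
    intro y hy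
    rw [Set.uIcc_of_le (by linarith), Set.mem_Icc] at hy
    exact h y (abs_le.2 ⟨by linarith, by linarith⟩)
  rw [this, intervalIntegral.integral_const, smul_eq_mul]
  field_simp
  ring

theorem avg_mem_Icc {F : ℝ → ℝ} (hF : Continuous F) {w x : ℝ} (hw : 0 < w)
    (h : ∀ y, F y ∈ Set.Icc (0 : ℝ) 1) : avg w F x ∈ Set.Icc (0 : ℝ) 1 := by
  unfold avg
  have h0 : ∀ a b, IntervalIntegrable F MeasureTheory.volume a b := fun a b => hF.intervalIntegrable a b
  constructor
  · apply div_nonneg _ (by linarith)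
    exact intervalIntegral.integral_nonneg (by linarith) fun y _ => (h y).1
  · rw [div_le_one (by linarith)]
    have := intervalIntegral.integral_mono_on (a := x - w) (b := x + w) (f := F) (g := fun _ => 1)
      (by linarith) (h0 _ _) (by simp) fun y _ => (h y).2
    refine this.trans (le_of_eq ?_)
    rw [intervalIntegral.integral_const, smul_eq_mul]
    ring

/-- Averaging `j` times a bump function gives a bump function with explicit bounds for the first `j`
derivatives. -/
theorem exists_averaged_bump {w : ℝ} (hw : 0 < w) (j : ℕ) : ∃ F : ℝ → ℝ,
    ContDiff ℝ (⊤ : ℕ∞) F ∧ (∀ s, F s ∈ Set.Icc (0 : ℝ) 1) ∧ (∀ s, |s| ≤ 1 / 4 - j * w → F s = 1) ∧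
    (∀ s, 1 / 2 + j * w ≤ |s| → F s = 0) ∧ ∀ r ≤ j, ∀ s, |iteratedDeriv r F s| ≤ (w⁻¹) ^ r := by
  induction j with
  | zero =>
    let b : ContDiffBump (0 : ℝ) := ⟨1 / 4, 1 / 2, by norm_num, by norm_num⟩
    refine ⟨b, b.contDiff, fun s => ⟨b.nonneg, b.le_one⟩, fun s hs => ?_, fun s hs => ?_, ?_⟩
    · rw [Nat.cast_zero, zero_mul, sub_zero] at hs
      refine b.one_of_mem_closedBall ?_
      rw [mem_closedBall_zero_iff]
      exact hs
    · rw [Nat.cast_zero, zero_mul, add_zero] at hs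
      refine b.zero_of_le_dist ?_
      rw [dist_zero_right]
      exact hs
    · intro r hr s
      obtain rfl : r = 0 := by omega
      simp only [iteratedDeriv_zero, pow_zero]
      rw [abs_of_nonneg b.nonneg]
      exact b.le_one
  | succ j ih =>
    obtain ⟨F, h1, h2, h3, h4, h5⟩ := ih
    have hd : deriv (avg w F) = fun x => (F (x + w) - F (x - w)) / (2 * w) :=
      funext fun x => (hasDerivAt_avg h1.continuous w x).deriv
    refine ⟨avg w F, ?_, fun s => avg_mem_Icc h1.continuous hw h2, fun s hs => ?_, fun s hs => ?_, ?_⟩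
    · rw [contDiff_infty_iff_deriv, hd]
      exact ⟨fun x => (hasDerivAt_avg h1.continuous w x).differentiableAt, by fun_prop⟩
    · push_cast at hs
      refine avg_eq_of_eqOn hw fun y hy => h3 y ?_
      have := abs_add_le (y - s) s
      rw [sub_add_cancel] at this
      linarith
    · push_cast at hs
      refine avg_eq_of_eqOn hw fun y hy => h4 y ?_
      have := abs_sub_abs_le_abs_sub s y
      rw [abs_sub_comm] at this
      linarith
    · intro r hr s
      rcases r with _ | r
      · simp only [iteratedDeriv_zero, pow_zero]
        have := avg_mem_Icc h1.continuous (x := s) hw h2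
        rw [abs_of_nonneg this.1]
        exact this.2
      · rw [iteratedDeriv_succ', hd, iteratedDeriv_div_const]
        have hp : ContDiff ℝ r fun x => F (x + w) := by
          have := h1.of_le (show (r : WithTop ℕ∞) ≤ _ by exact_mod_cast le_top)
          fun_prop
        have hm : ContDiff ℝ r fun x => F (x - w) := by
          have := h1.of_le (show (r : WithTop ℕ∞) ≤ _ by exact_mod_cast le_top)
          fun_prop
        rw [iteratedDeriv_fun_sub hp.contDiffAt hm.contDiffAt, iteratedDeriv_comp_add_const,
          iteratedDeriv_comp_sub_const, abs_div, abs_of_pos (show 0 < 2 * w by linarith),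
          div_le_iff₀ (by linarith)]
        refine (abs_sub _ _).trans ?_
        have a1 := h5 r (by omega) (s + w)
        have a2 := h5 r (by omega) (s - w)
        have e : w⁻¹ ^ (r + 1) * (2 * w) = w⁻¹ ^ r + w⁻¹ ^ r := by
          rw [pow_succ]; field_simp; ring
        linarith

/-- For every `R` there is a bump function whose derivatives of order `r ≤ R` are bounded by
`(8R)^r`. -/
theorem exists_bump (R : ℕ) (hR : 1 ≤ R) : ∃ F : ℝ → ℝ,
    ContDiff ℝ (⊤ : ℕ∞) F ∧ (∀ s, F s ∈ Set.Icc (0 : ℝ) 1) ∧ (∀ s, |s| ≤ 1 / 8 → F s = 1) ∧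
    (∀ s, 5 / 8 ≤ |s| → F s = 0) ∧ ∀ r ≤ R, ∀ s, |iteratedDeriv r F s| ≤ (8 * R : ℝ) ^ r := by
  have hR' : (0 : ℝ) < R := by exact_mod_cast hR
  obtain ⟨F, h1, h2, h3, h4, h5⟩ := exists_averaged_bump (w := (8 * R : ℝ)⁻¹) (by positivity) R
  have e : (R : ℝ) * (8 * R : ℝ)⁻¹ = 1 / 8 := by field_simp
  rw [e] at h3 h4
  rw [inv_inv] at h5
  exact ⟨F, h1, h2, fun s hs => h3 s (by linarith), fun s hs => h4 s (by linarith), h5⟩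

/-! ### Flat functions -/

theorem iteratedDeriv_eq_zero_of_isLittleO {u : ℝ → ℝ} {k : ℕ} (hu : ContDiff ℝ k u)
    (ho : u =o[nhds 0] fun s => s ^ k) (j : ℕ) (hj : j ≤ k) : iteratedDeriv j u 0 = 0 := by
  induction j using Nat.strong_induction_on with
  | _ j ih =>
    have hT := taylor_isLittleO_univ (x₀ := (0 : ℝ)) (hu.of_le (show (j : WithTop ℕ∞) ≤ k by
      exact_mod_cast hj))
    simp only [sub_zero] at hT
    have ho' : u =o[nhds 0] fun s => s ^ j := by
      refine ho.trans_isBigO ?_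
      rcases hj.eq_or_lt with rfl | hlt
      · exact Asymptotics.isBigO_refl _ _
      · exact (Asymptotics.isLittleO_pow_pow hlt).isBigO
    have h3 := ho'.sub hT
    simp only [sub_sub_cancel] at h3
    have e : (fun x => taylorWithinEval u j Set.univ 0 x)
        = fun x => ((j.factorial : ℝ)⁻¹ * iteratedDeriv j u 0) * x ^ j := by
      funext x
      rw [taylor_within_apply, Finset.sum_range_succ, Finset.sum_eq_zero, zero_add]
      · rw [iteratedDerivWithin_univ, sub_zero, smul_eq_mul]; ring
      · intro i hi
        rw [Finset.mem_range] at hi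
        rw [iteratedDerivWithin_univ, ih i hi (by omega), smul_zero]
    rw [e] at h3
    by_contra hne
    have hne' : (j.factorial : ℝ)⁻¹ * iteratedDeriv j u 0 ≠ 0 :=
      mul_ne_zero (inv_ne_zero (by exact_mod_cast j.factorial_ne_zero)) hne
    rw [Asymptotics.isLittleO_const_mul_left_iff hne'] at h3
    refine Asymptotics.isLittleO_irrefl' ?_ h3
    have h4 : ∃ᶠ x : ℝ in nhdsWithin 0 {0}ᶜ, ‖x ^ j‖ ≠ 0 := by
      refine Filter.Eventually.frequently ?_
      filter_upwards [self_mem_nhdsWithin] with x hx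
      exact norm_ne_zero_iff.2 (pow_ne_zero j hx)
    exact h4.filter_mono nhdsWithin_le_nhds

theorem isLittleO_iteratedDeriv {u : ℝ → ℝ} {k : ℕ} (hu : ContDiff ℝ k u)
    (ho : u =o[nhds 0] fun s => s ^ k) (i j : ℕ) (hij : i + j = k) :
    iteratedDeriv i u =o[nhds 0] fun s => s ^ j := by
  induction j generalizing i with
  | zero =>
    obtain rfl : i = k := by omega
    simp only [pow_zero, Asymptotics.isLittleO_one_iff]
    have := (hu.continuous_iteratedDeriv i le_rfl).tendsto 0
    rwa [iteratedDeriv_eq_zero_of_isLittleO hu ho i le_rfl] at this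
  | succ j ih =>
    have h1 := ih (i + 1) (by omega)
    rw [Asymptotics.isLittleO_iff] at h1 ⊢
    intro ε hε
    obtain ⟨δ, hδ, h2⟩ := Metric.eventually_nhds_iff.1 (h1 hε)
    refine Metric.eventually_nhds_iff.2 ⟨δ, hδ, fun s hs => ?_⟩
    rw [dist_zero_right, Real.norm_eq_abs] at hs
    have hd : Differentiable ℝ (iteratedDeriv i u) :=
      hu.differentiable_iteratedDeriv i (by exact_mod_cast (by omega : i < k))
    have key := (convex_closedBall (0 : ℝ) |s|).norm_image_sub_le_of_norm_deriv_le
      (f := iteratedDeriv i u) (C := ε * |s| ^ j) (fun y _ => hd y) (fun y hy => ?_)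
      (by simp : (0 : ℝ) ∈ _) (by simp : s ∈ _)
    · rw [iteratedDeriv_eq_zero_of_isLittleO hu ho i (by omega), sub_zero, sub_zero] at key
      refine key.trans (le_of_eq ?_)
      rw [norm_pow, Real.norm_eq_abs, pow_succ]; ring
    · rw [mem_closedBall_zero_iff, Real.norm_eq_abs] at hy
      rw [← iteratedDeriv_succ]
      refine (h2 (by rw [dist_zero_right, Real.norm_eq_abs]; linarith)).trans ?_
      rw [norm_pow, Real.norm_eq_abs]
      gcongr

/-! ### Corrections with a cut-off function -/

/-- The interior of `I_n`. -/
def critOpen (ω c : ℝ) (n : ℕ) : Set ℝ := {x | ∃ m : ℤ, |x - (c + m * Real.pi)| < 1 / q ω n ^ 2}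

/-- The kind `step` of correction can be carried out from level `n₁` on, for every target function
that is smooth inside the critical intervals. The derivatives of order `k` of the correction are
bounded in terms of the derivatives of order at most `max k k₀` of the target, with a polynomial loss
in `q_n`, as soon as `n ≥ nk k`. -/
structure Corrector (ω c : ℝ) (l : ℕ∞) (step : ℕ → (ℝ → ℝ) → (ℝ → ℝ) → Prop) (k₀ n₁ : ℕ)
    (C : ℕ → ℝ) (B nk : ℕ → ℕ) : Prop where
  le : (k₀ : ℕ∞) ≤ l
  nonneg : ∀ k, 0 ≤ C k
  nk_le : ∀ k ≤ k₀, nk k ≤ n₁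
  congr : ∀ n t t' e, (∀ x ∈ crit ω c 1 n, t x = t' x) → step n t e → step n t' e
  exists_correction : ∀ n, n₁ ≤ n → ∀ t : ℝ → ℝ, Function.Periodic t (2 * Real.pi) →
    (∀ k : ℕ, (k : ℕ∞) ≤ l → ∀ x ∈ critOpen ω c n, ContDiffAt ℝ k t x) →
    ∃ e : ℝ → ℝ, step n t e ∧ ContDiff ℝ l e ∧ Function.Periodic e (2 * Real.pi) ∧
      (∀ x ∈ crit ω c 10 n, e x = t x) ∧ (∀ x, x ∉ crit ω c 1 n → e x = 0) ∧
      ∀ k : ℕ, (k : ℕ∞) ≤ l → nk k ≤ n → ∀ T : ℝ,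
        (∀ j ≤ max k k₀, ∀ x ∈ critOpen ω c n, |iteratedDeriv j t x| ≤ T) →
        ∀ x, |iteratedDeriv k e x| ≤ C k * q ω n ^ B k * T

theorem mem_crit_one_iff {ω c : ℝ} {n : ℕ} {x : ℝ} :
    x ∈ crit ω c 1 n ↔ ∃ m : ℤ, |x - (c + m * Real.pi)| ≤ 1 / q ω n ^ 2 := by
  simp [crit]

theorem one_div_sq_le_one {ω : ℝ} (hω : Irrational ω) (n : ℕ) :
    0 < 1 / q ω n ^ 2 ∧ 1 / q ω n ^ 2 ≤ 1 := by
  have h1 := one_le_q hω n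
  have h2 : 1 ≤ q ω n ^ 2 := one_le_pow₀ h1
  exact ⟨by positivity, (div_le_one (by positivity)).2 h2⟩

theorem patch_eq_zero_of_not_mem {ω c : ℝ} {n : ℕ} {e : ℤ → ℝ → ℝ}
    (he : ∀ m s, 1 / q ω n ^ 2 ≤ |s| → e m s = 0) {x : ℝ} (hx : x ∉ crit ω c 1 n) :
    patch c e x = 0 := by
  refine patch_eq_zero he fun m => ?_
  by_contra! h
  exact hx (mem_crit_one_iff.2 ⟨m, h.le⟩)

theorem exists_of_mem_crit {ω : ℝ} (hω : Irrational ω) {c C : ℝ} (hC : 1 ≤ C) {n : ℕ} {x : ℝ}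
    (hx : x ∈ crit ω c C n) : ∃ (m : ℤ) (s : ℝ), x = c + m * Real.pi + s ∧
      |s| ≤ 1 / (C * q ω n ^ 2) ∧ |s| ≤ 1 / q ω n ^ 2 ∧ |s| < Real.pi - 1 / q ω n ^ 2 := by
  obtain ⟨m, hm⟩ := hx
  obtain ⟨h0, h1⟩ := one_div_sq_le_one hω n
  have hpi := Real.pi_gt_three
  have h2 : 1 / (C * q ω n ^ 2) ≤ 1 / q ω n ^ 2 := by
    have := one_le_q hω n
    apply one_div_le_one_div_of_le (by positivity)
    nlinarith [sq_nonneg (q ω n)]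
  exact ⟨m, x - (c + m * Real.pi), by ring, hm, hm.trans h2, by linarith⟩

/-- A cut-off function in the coordinate centred at a critical point, with a bound for its
derivatives that suits the definition of `IsCutoff`. -/
structure IsLocalCutoff (ω : ℝ) (n : ℕ) (F : ℝ → ℝ) : Prop where
  smooth : ContDiff ℝ (⊤ : ℕ∞) F
  mem_Icc : ∀ s, F s ∈ Set.Icc (0 : ℝ) 1
  inner : ∀ s, |s| ≤ 1 / (10 * q ω n ^ 2) → F s = 1
  outer : ∀ s, 5 / 8 * (1 / q ω n ^ 2) ≤ |s| → F s = 0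
  deriv_le : ∀ r : ℕ, (r : ℝ) ≤ q ω n ^ (1 / 10 : ℝ) → ∀ s, |iteratedDeriv r F s| ≤ q ω n ^ (3 * r)

theorem exists_isLocalCutoff {ω : ℝ} {n : ℕ} (hn : 32 ≤ q ω n) : ∃ F, IsLocalCutoff ω n F := by
  have hq : 0 < q ω n := by linarith
  set y := q ω n ^ (1 / 10 : ℝ) with hy
  have hy1 : 1 ≤ y := Real.one_le_rpow (by linarith) (by norm_num)
  obtain ⟨F, h1, h2, h3, h4, h5⟩ := exists_bump ⌈y⌉₊ (Nat.one_le_ceil_iff.2 (by linarith))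
  have hR : (⌈y⌉₊ : ℝ) ≤ 2 * y := by
    have := Nat.ceil_lt_add_one (show 0 ≤ y by linarith)
    linarith
  -- `32` is chosen for this bound: `8 * ⌈y⌉₊` has to be at most `q`
  have hyq : 16 * y ≤ q ω n := by
    have e : q ω n = q ω n ^ (9 / 10 : ℝ) * y := by
      rw [hy, ← Real.rpow_add hq]; norm_num
    have h16 : (16 : ℝ) ≤ q ω n ^ (9 / 10 : ℝ) := by
      calc (16 : ℝ) = (32 : ℝ) ^ (4 / 5 : ℝ) := by
            rw [show (32 : ℝ) = 2 ^ (5 : ℝ) by norm_num, ← Real.rpow_mul (by norm_num)]; norm_num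
        _ ≤ (32 : ℝ) ^ (9 / 10 : ℝ) := Real.rpow_le_rpow_of_exponent_le (by norm_num) (by norm_num)
        _ ≤ _ := Real.rpow_le_rpow (by norm_num) hn (by norm_num)
    rw [e]
    gcongr
  have hsc : ∀ s, |q ω n ^ 2 * s| = q ω n ^ 2 * |s| := fun s => by
    rw [abs_mul, abs_of_pos (by positivity)]
  refine ⟨fun s => F (q ω n ^ 2 * s), ?_, fun s => h2 _, fun s hs => h3 _ ?_, fun s hs => h4 _ ?_, ?_⟩
  · exact h1.comp (contDiff_const.mul contDiff_id)
  · rw [hsc]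
    rw [le_div_iff₀ (by positivity)] at hs
    linarith
  · rw [hsc]
    rw [mul_one_div, div_le_iff₀ (by positivity)] at hs
    linarith
  · intro r hr s
    have hr' : r ≤ ⌈y⌉₊ := by exact_mod_cast hr.trans (Nat.le_ceil y)
    rw [congrFun (iteratedDeriv_comp_const_mul (h1.of_le (by exact_mod_cast le_top)) _) s, abs_mul,
      abs_of_pos (by positivity)]
    calc (q ω n ^ 2) ^ r * |iteratedDeriv r F (q ω n ^ 2 * s)|
        ≤ (q ω n ^ 2) ^ r * (8 * ⌈y⌉₊) ^ r := by
          gcongr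
          exact h5 r hr' _
      _ = (q ω n ^ 2 * (8 * ⌈y⌉₊)) ^ r := (mul_pow _ _ _).symm
      _ ≤ (q ω n ^ 2 * q ω n) ^ r := by
          gcongr
          linarith
      _ = q ω n ^ (3 * r) := by rw [pow_mul, ← pow_succ]

theorem IsLocalCutoff.eq_zero {ω : ℝ} {n : ℕ} {F : ℝ → ℝ} (h : IsLocalCutoff ω n F) (s : ℝ)
    (hs : 1 / q ω n ^ 2 ≤ |s|) : F s = 0 :=
  h.outer s (by have := abs_nonneg s; linarith)

theorem IsLocalCutoff.isCutoff {ω : ℝ} (hω : Irrational ω) {n : ℕ} {F : ℝ → ℝ}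
    (h : IsLocalCutoff ω n F) (c : ℝ) : IsCutoff ω c n (patch c fun _ => F) where
  smooth := contDiff_patch (one_div_sq_le_one hω n).2 (fun _ => h.eq_zero) fun _ => h.smooth
  periodic := periodic_patch fun _ _ => rfl
  inner := by
    intro x hx
    obtain ⟨m, s, rfl, hs, -, hs'⟩ := exists_of_mem_crit hω (by norm_num) hx
    rw [patch_apply (one_div_sq_le_one hω n).2 (fun _ => h.eq_zero) m hs']
    exact h.inner s hs
  mem_Icc := fun x => h.mem_Icc _
  outer := fun x hx => patch_eq_zero_of_not_mem (fun _ => h.eq_zero) hx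
  deriv_le := fun r hr => abs_iteratedDeriv_patch_le (one_div_sq_le_one hω n).2 (fun _ => h.eq_zero)
    fun _ => h.deriv_le r hr

theorem iteratedDeriv_shift (t : ℝ → ℝ) (a : ℝ) (j : ℕ) (s : ℝ) :
    iteratedDeriv j (fun s => t (a + s)) s = iteratedDeriv j t (a + s) :=
  congrFun (iteratedDeriv_comp_const_add j t a) s

/-- The corrections defined by a family of cut-off functions. -/
theorem corrector_cutoff {ω : ℝ} (hω : Irrational ω) (c : ℝ) {n₁ : ℕ} {F : ℕ → ℝ → ℝ}
    (hF : ∀ n, n₁ ≤ n → IsLocalCutoff ω n (F n)) : ∃ nk : ℕ → ℕ,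
    Corrector ω c ⊤ (fun n => IsCutoffCorrection ω c (patch c fun _ => F n) n) 0 n₁
      (fun k => 2 ^ k) (fun k => 3 * k) nk := by
  have hnk : ∀ k : ℕ, ∃ N, (k = 0 → N = 0) ∧ ∀ n, N ≤ n → (k : ℝ) ≤ q ω n ^ (1 / 10 : ℝ) := by
    intro k
    rcases Nat.eq_zero_or_pos k with rfl | hk
    · refine ⟨0, fun _ => rfl, fun n _ => ?_⟩
      rw [Nat.cast_zero]
      exact Real.rpow_nonneg (q_pos hω n).le _
    · obtain ⟨N, hN⟩ := Filter.eventually_atTop.1 (((tendsto_rpow_atTop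
        (show (0 : ℝ) < 1 / 10 by norm_num)).comp (tendsto_q hω)).eventually_ge_atTop (k : ℝ))
      exact ⟨N, fun h => absurd h hk.ne', hN⟩
  choose nk hnk0 hnk using hnk
  refine ⟨nk, ⟨le_top, fun k => by positivity, fun k hk => ?_, ?_, ?_⟩⟩
  · rw [hnk0 k (by omega)]; exact Nat.zero_le _
  · rintro n t t' e h ⟨h1, h2, h3, h4⟩
    exact ⟨h1, h2, fun x hx => by rw [h3 x hx, h x hx], h4⟩
  · intro n hn t ht hts
    have hFn := hF n hn
    obtain ⟨hh0, hh1⟩ := one_div_sq_le_one hω n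
    set h := 1 / q ω n ^ 2 with hh
    set e : ℤ → ℝ → ℝ := fun m => cutMul h (fun s => t (c + m * Real.pi + s)) (F n) with he
    have he0 : ∀ m s, h ≤ |s| → e m s = 0 := fun m => cutMul_eq_zero
    have heF : ∀ m s, e m s = t (c + m * Real.pi + s) * F n s := by
      intro m s
      simp only [he, cutMul]
      split_ifs with hs
      · rfl
      · rw [hFn.eq_zero s (not_lt.1 hs), mul_zero]
    have hmem : ∀ (m : ℤ) s, |s| < h → c + m * Real.pi + s ∈ critOpen ω c n := by
      intro m s hs
      refine ⟨m, ?_⟩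
      rwa [add_sub_cancel_left]
    have hsm : ∀ (k : ℕ) (m : ℤ) s, |s| < h →
        ContDiffAt ℝ k (fun s => t (c + m * Real.pi + s)) s := by
      intro k m s hs
      exact (hts k le_top _ (hmem m s hs)).comp s (contDiffAt_const.add contDiffAt_id)
    have hsmooth : ContDiff ℝ (⊤ : ℕ∞) (patch c e) := by
      rw [contDiff_infty]
      intro k
      refine contDiff_patch hh1 he0 fun m => contDiff_cutMul hh0 (hsm k m)
        (hFn.smooth.of_le (by exact_mod_cast le_top)) hFn.outer
    have hper : Function.Periodic (patch c e) (2 * Real.pi) := by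
      refine periodic_patch fun m s => ?_
      rw [heF, heF]
      congr 1
      rw [← ht (c + m * Real.pi + s)]
      congr 1
      push_cast
      ring
    have hout : ∀ x, x ∉ crit ω c 1 n → patch c e x = 0 := fun x hx => patch_eq_zero_of_not_mem he0 hx
    refine ⟨patch c e, ⟨hsmooth, hper, ?_, hout⟩, hsmooth, hper, ?_, hout, ?_⟩
    · intro x hx
      obtain ⟨m, s, rfl, hs, -, hs'⟩ := exists_of_mem_crit hω le_rfl hx
      rw [patch_apply hh1 he0 m hs', patch_apply hh1 (fun _ => hFn.eq_zero) m hs', heF]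
    · intro x hx
      obtain ⟨m, s, rfl, hs, -, hs'⟩ := exists_of_mem_crit hω (by norm_num) hx
      rw [patch_apply hh1 he0 m hs', heF, hFn.inner s hs, mul_one]
    · intro k _ hkn T hT
      have hq1 := one_le_q hω n
      have hT0 : 0 ≤ T := by
        refine (abs_nonneg _).trans (hT 0 (Nat.zero_le _) (c + (0 : ℤ) * Real.pi + 0) ?_)
        exact hmem 0 0 (by rwa [abs_zero])
      refine abs_iteratedDeriv_patch_le hh1 he0 fun m => ?_
      refine abs_iteratedDeriv_cutMul_le hh0 hFn.outer (by positivity) fun s hs => ?_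
      rw [mul_assoc]
      refine abs_iteratedDeriv_mul_le (hsm k m s hs)
        ((hFn.smooth.of_le (by exact_mod_cast le_top)).contDiffAt) fun i hi => ?_
      rw [iteratedDeriv_shift, mul_comm]
      have h1 := hT i (by omega) _ (hmem m s hs)
      have h2 : |iteratedDeriv (k - i) (F n) s| ≤ q ω n ^ (3 * k) := by
        refine (hFn.deriv_le (k - i) ?_ s).trans (pow_le_pow_right₀ hq1 (by omega))
        refine le_trans ?_ (hnk k n hkn)
        exact_mod_cast Nat.sub_le k i
      gcongr

/-! ### Hermite interpolation -/

theorem iteratedDeriv_eval (P : Polynomial ℝ) (k : ℕ) :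
    iteratedDeriv k (fun x => P.eval x) = fun x => (Polynomial.derivative^[k] P).eval x := by
  induction k with
  | zero => simp
  | succ k ih =>
    rw [iteratedDeriv_succ, ih, Function.iterate_succ_apply']
    funext x
    exact Polynomial.deriv _

theorem contDiff_eval (P : Polynomial ℝ) {n : WithTop ℕ∞} : ContDiff ℝ n (fun x => P.eval x) := by
  simp only [Polynomial.eval_eq_sum_range]
  fun_prop

open Polynomial in
/-- There is a polynomial of degree at most `2l + 1` with prescribed derivatives of order at most `l`
at two points. -/
theorem exists_hermite (l : ℕ) {a b : ℝ} (hab : a ≠ b) (u v : Fin (l + 1) → ℝ) :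
    ∃ P : ℝ[X], P.natDegree ≤ 2 * l + 1 ∧ (∀ i : Fin (l + 1), (derivative^[i] P).eval a = u i) ∧
      ∀ i : Fin (l + 1), (derivative^[i] P).eval b = v i := by
  let ev : ℝ → degreeLT ℝ (2 * l + 2) →ₗ[ℝ] (Fin (l + 1) → ℝ) := fun x =>
    LinearMap.pi fun i => (leval x ∘ₗ ((derivative : ℝ[X] →ₗ[ℝ] ℝ[X]) ^ (i : ℕ))) ∘ₗ
      (degreeLT ℝ (2 * l + 2)).subtype
  have hev : ∀ x P i, ev x P i = (derivative^[i] (P : ℝ[X])).eval x := by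
    intro x P i
    simp [ev, leval, Module.End.pow_apply]
  let L : degreeLT ℝ (2 * l + 2) →ₗ[ℝ] (Fin (l + 1) → ℝ) × (Fin (l + 1) → ℝ) := (ev a).prod (ev b)
  have hfin : Module.finrank ℝ (degreeLT ℝ (2 * l + 2))
      = Module.finrank ℝ ((Fin (l + 1) → ℝ) × (Fin (l + 1) → ℝ)) := by
    rw [(degreeLTEquiv ℝ (2 * l + 2)).finrank_eq]
    simp
    ring
  have : FiniteDimensional ℝ (degreeLT ℝ (2 * l + 2)) :=
    Module.Finite.equiv (degreeLTEquiv ℝ (2 * l + 2)).symm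
  -- a polynomial with both jets zero is divisible by `(X - a) ^ (l + 1) * (X - b) ^ (l + 1)`, whose
  -- degree exceeds `2 * l + 1`
  have hinj : Function.Injective L := by
    rw [← LinearMap.ker_eq_bot, LinearMap.ker_eq_bot']
    intro P hP
    by_contra hne
    have hP0 : (P : ℝ[X]) ≠ 0 := fun h => hne (Subtype.ext h)
    have h1 : ev a P = 0 ∧ ev b P = 0 := Prod.mk_eq_zero.1 hP
    have key : ∀ x, ev x P = 0 → (X - C x) ^ (l + 1) ∣ (P : ℝ[X]) := by
      intro x hx
      rw [← le_rootMultiplicity_iff hP0]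
      refine lt_rootMultiplicity_of_isRoot_iterate_derivative_of_mem_nonZeroDivisors hP0
        (fun m hm => ?_) (mem_nonZeroDivisors_of_ne_zero (by exact_mod_cast l.factorial_ne_zero))
      have := congrFun hx ⟨m, by omega⟩
      rw [hev] at this
      exact this
    have hcop : IsCoprime ((X - C a) ^ (l + 1)) ((X - C b) ^ (l + 1)) :=
      (pairwise_coprime_X_sub_C Function.injective_id hab).pow
    have hdvd := hcop.mul_dvd (key a h1.1) (key b h1.2)
    have hdeg := natDegree_le_of_dvd hdvd hP0
    rw [((monic_X_sub_C a).pow _).natDegree_mul ((monic_X_sub_C b).pow _), natDegree_pow, natDegree_pow,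
      natDegree_X_sub_C, natDegree_X_sub_C] at hdeg
    have hlt := mem_degreeLT.1 P.2
    rw [← natDegree_lt_iff_degree_lt hP0] at hlt
    omega
  obtain ⟨P, hP⟩ := (LinearMap.injective_iff_surjective_of_finrank_eq_finrank hfin).1 hinj (u, v)
  have h1 : ev a P = u ∧ ev b P = v := Prod.mk.inj hP
  refine ⟨P, ?_, fun i => by rw [← hev, h1.1], fun i => by rw [← hev, h1.2]⟩
  by_cases hP0 : (P : ℝ[X]) = 0
  · rw [hP0]; simp
  · have hlt := mem_degreeLT.1 P.2
    rw [← natDegree_lt_iff_degree_lt hP0] at hlt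
    omega

open Polynomial in
/-- The basis of Hermite interpolation on `[1/10, 1]` with zero jet at `1`. -/
theorem exists_hermite_basis (l : ℕ) : ∃ (H : ℕ → ℝ[X]) (K : ℝ), 0 ≤ K ∧
    (∀ j, (H j).natDegree ≤ 2 * l + 1) ∧
    (∀ j ≤ l, ∀ i ≤ l, (derivative^[i] (H j)).eval (1 / 10) = if i = j then 1 else 0) ∧
    (∀ j ≤ l, ∀ i ≤ l, (derivative^[i] (H j)).eval 1 = 0) ∧
    ∀ j ≤ l, ∀ i ≤ l, ∀ x ∈ Set.Icc (0 : ℝ) 1, |(derivative^[i] (H j)).eval x| ≤ K := by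
  have h := fun j : ℕ => exists_hermite l (a := 1 / 10) (b := 1) (by norm_num)
    (fun i => if (i : ℕ) = j then 1 else 0) (fun _ => 0)
  choose H h1 h2 h3 using h
  have hb : ∀ j i : ℕ, ∃ K, ∀ x ∈ Set.Icc (0 : ℝ) 1, |(derivative^[i] (H j)).eval x| ≤ K := by
    intro j i
    exact isCompact_Icc.exists_bound_of_continuousOn
      (f := fun x => (derivative^[i] (H j)).eval x) (Polynomial.continuous _).continuousOn
  choose K hK using hb
  have hK0 : ∀ j i, 0 ≤ K j i := fun j i => (abs_nonneg _).trans (hK j i 0 (by simp))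
  refine ⟨H, ∑ j ∈ Finset.range (l + 1), ∑ i ∈ Finset.range (l + 1), K j i,
    Finset.sum_nonneg fun j _ => Finset.sum_nonneg fun i _ => hK0 j i, h1, ?_, ?_, ?_⟩
  · intro j hj i hi
    exact h2 j ⟨i, by omega⟩
  · intro j hj i hi
    exact h3 j ⟨i, by omega⟩
  · intro j hj i hi x hx
    refine (hK j i x hx).trans ?_
    refine le_trans ?_ (Finset.single_le_sum (f := fun j => ∑ i ∈ Finset.range (l + 1), K j i)
      (fun j _ => Finset.sum_nonneg fun i _ => hK0 j i) (Finset.mem_range.2 (by omega : j < l + 1)))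
    exact Finset.single_le_sum (f := fun i => K j i) (fun i _ => hK0 j i)
      (Finset.mem_range.2 (by omega : i < l + 1))

/-! ### Gluing smooth functions -/

theorem contDiffOn_cut {U : Set ℝ} (hU : IsOpen U) {x₀ : ℝ} (n : ℕ) {f : ℝ → ℝ}
    (hf : ContDiffOn ℝ n f U) (h0 : x₀ ∈ U) (hj : ∀ j ≤ n, iteratedDeriv j f x₀ = 0) :
    ContDiffOn ℝ n (fun s => if s ≤ x₀ then 0 else f s) U := by
  induction n generalizing f with
  | zero =>
    rw [Nat.cast_zero, contDiffOn_zero] at hf ⊢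
    have hf0 : f x₀ = 0 := by simpa using hj 0 le_rfl
    refine ContinuousOn.if (fun a ha => ?_) continuousOn_const (hf.mono Set.inter_subset_left)
    have : a ∈ frontier (Set.Iic x₀) := ha.2
    rw [frontier_Iic] at this
    have : a = x₀ := this
    rw [this, hf0]
  | succ n ih =>
    have hf0 : f x₀ = 0 := by simpa using hj 0 (by omega)
    have hf1 : deriv f x₀ = 0 := by simpa using hj 1 (by omega)
    have h1 := (contDiffOn_succ_iff_deriv_of_isOpen hU (n := (n : WithTop ℕ∞))).1
      (by exact_mod_cast hf)
    have hd : ∀ s ∈ U, HasDerivAt (fun s => if s ≤ x₀ then 0 else f s)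
        (if s ≤ x₀ then 0 else deriv f s) s := by
      intro s hs
      have hfs : HasDerivAt f (deriv f s) s := (h1.1.differentiableAt (hU.mem_nhds hs)).hasDerivAt
      rcases lt_trichotomy s x₀ with h | rfl | h
      · rw [if_pos h.le]
        refine (hasDerivAt_const s (0 : ℝ)).congr_of_eventuallyEq ?_
        filter_upwards [eventually_lt_nhds h] with y hy
        rw [if_pos hy.le]
      · rw [if_pos le_rfl]
        rw [hf1, hasDerivAt_iff_isLittleO] at hfs
        rw [hasDerivAt_iff_isLittleO]
        simp only [hf0, smul_zero, sub_zero, le_refl, if_true] at hfs ⊢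
        refine Asymptotics.IsBigO.trans_isLittleO ?_ hfs
        refine Asymptotics.IsBigO.of_bound 1 (Filter.Eventually.of_forall fun y => ?_)
        split_ifs
        · simp
        · simp
      · rw [if_neg (not_le.2 h)]
        refine hfs.congr_of_eventuallyEq ?_
        filter_upwards [eventually_gt_nhds h] with y hy
        rw [if_neg (not_le.2 hy)]
    have key := (contDiffOn_succ_iff_deriv_of_isOpen hU (n := (n : WithTop ℕ∞))
      (f := fun s => if s ≤ x₀ then 0 else f s)).2
      ⟨fun s hs => (hd s hs).differentiableAt.differentiableWithinAt, by simp, ?_⟩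
    · exact_mod_cast key
    · refine (ih h1.2.2 fun j hjn => ?_).congr fun s hs => (hd s hs).deriv
      rw [← iteratedDeriv_succ']
      exact hj (j + 1) (by omega)

/-- Two smooth functions with the same jet at `x₀` can be glued at `x₀`. -/
theorem contDiffOn_glue {U : Set ℝ} (hU : IsOpen U) {x₀ : ℝ} {n : ℕ} {f g : ℝ → ℝ}
    (hf : ContDiffOn ℝ n f U) (hg : ContDiffOn ℝ n g U) (h0 : x₀ ∈ U)
    (hj : ∀ j ≤ n, iteratedDeriv j f x₀ = iteratedDeriv j g x₀) :
    ContDiffOn ℝ n (fun s => if s ≤ x₀ then f s else g s) U := by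
  have h1 := contDiffOn_cut hU n (hg.sub hf) h0 (fun j hjn => ?_)
  · refine (hf.add h1).congr fun s _ => ?_
    change (if s ≤ x₀ then f s else g s) = f s + if s ≤ x₀ then 0 else g s - f s
    split_ifs <;> ring
  · have e : (fun s => g s - f s) = g - f := rfl
    rw [e, iteratedDeriv_sub, hj j hjn, sub_self]
    · exact (hg.contDiffAt (hU.mem_nhds h0)).of_le (by exact_mod_cast hjn)
    · exact (hf.contDiffAt (hU.mem_nhds h0)).of_le (by exact_mod_cast hjn)

/-! ### Corrections with polynomials -/

/-- The function `τ` up to `h / 10`, continued by the polynomial `P` up to `h` and by zero. -/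
def polyCut (h : ℝ) (τ : ℝ → ℝ) (P : Polynomial ℝ) (s : ℝ) : ℝ :=
  if s ≤ h / 10 then τ s else if s ≤ h then P.eval s else 0

/-- `P` interpolates between the `l`-jet of `τ` at `h / 10` and the zero jet at `h`. -/
structure Interpolates (l : ℕ) (h : ℝ) (τ : ℝ → ℝ) (P : Polynomial ℝ) : Prop where
  degree : P.natDegree ≤ 2 * l + 1
  inner : ∀ i ≤ l, iteratedDeriv i (fun s => P.eval s) (h / 10) = iteratedDeriv i τ (h / 10)
  outer : ∀ i ≤ l, iteratedDeriv i (fun s => P.eval s) h = 0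

theorem exists_interpolates (l : ℕ) : ∃ K : ℝ, 0 ≤ K ∧ ∀ (h : ℝ) (τ : ℝ → ℝ), 0 < h → h ≤ 1 →
    ∃ P, Interpolates l h τ P ∧ ∀ T : ℝ, (∀ j ≤ l, |iteratedDeriv j τ (h / 10)| ≤ T) →
      ∀ k ≤ l, ∀ s ∈ Set.Icc 0 h, |iteratedDeriv k (fun s => P.eval s) s| ≤ K * (h⁻¹) ^ k * T := by
  obtain ⟨H, K, hK0, h1, h2, h3, h4⟩ := exists_hermite_basis l
  refine ⟨(l + 1) * K, by positivity, fun h τ hh hh1 => ?_⟩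
  set P : Polynomial ℝ := ∑ j ∈ Finset.range (l + 1),
    Polynomial.C (iteratedDeriv j τ (h / 10) * h ^ j) * (H j).comp (Polynomial.C h⁻¹ * Polynomial.X)
    with hP
  have hder : ∀ i s, iteratedDeriv i (fun s => P.eval s) s = ∑ j ∈ Finset.range (l + 1),
      (iteratedDeriv j τ (h / 10) * h ^ j) *
        ((h⁻¹) ^ i * (Polynomial.derivative^[i] (H j)).eval (h⁻¹ * s)) := by
    intro i s
    have e : (fun s => P.eval s) = fun s => ∑ j ∈ Finset.range (l + 1),
        (iteratedDeriv j τ (h / 10) * h ^ j) * (H j).eval (h⁻¹ * s) := by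
      funext s
      simp [hP, Polynomial.eval_finsetSum]
    have hsm : ∀ j, ContDiff ℝ i (fun s => (H j).eval s) := fun j => contDiff_eval (H j)
    rw [e, iteratedDeriv_fun_sum]
    · refine Finset.sum_congr rfl fun j _ => ?_
      rw [iteratedDeriv_const_mul_field, congrFun (iteratedDeriv_comp_const_mul (hsm j) h⁻¹) s,
        iteratedDeriv_eval]
    · intro j _
      exact (contDiff_const.mul ((hsm j).comp (contDiff_const.mul contDiff_id))).contDiffAt
  have hhi : h⁻¹ * (h / 10) = 1 / 10 := by field_simp
  have hhi' : h⁻¹ * h = 1 := inv_mul_cancel₀ hh.ne'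
  refine ⟨P, ⟨?_, fun i hi => ?_, fun i hi => ?_⟩, fun T hT k hk s hs => ?_⟩
  · refine Polynomial.natDegree_sum_le_of_forall_le _ _ fun j _ => ?_
    refine (Polynomial.natDegree_C_mul_le _ _).trans ?_
    rw [Polynomial.natDegree_comp]
    refine (Nat.mul_le_mul_left _ ((Polynomial.natDegree_C_mul_le _ _).trans Polynomial.natDegree_X_le)).trans ?_
    rw [mul_one]
    exact h1 j
  · rw [hder, hhi, Finset.sum_eq_single i]
    · rw [h2 i hi i hi, if_pos rfl, mul_one, mul_assoc, ← mul_pow, mul_comm h, hhi', one_pow, mul_one]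
    · intro j hj hji
      rw [h2 j (by rw [Finset.mem_range] at hj; omega) i hi, if_neg (Ne.symm hji), mul_zero, mul_zero]
    · intro hni
      exact absurd (Finset.mem_range.2 (by omega)) hni
  · rw [hder, hhi']
    refine Finset.sum_eq_zero fun j hj => ?_
    rw [h3 j (by rw [Finset.mem_range] at hj; omega) i hi, mul_zero, mul_zero]
  · rw [hder]
    refine (Finset.abs_sum_le_sum_abs _ _).trans ?_
    have hT0 : 0 ≤ T := (abs_nonneg _).trans (hT 0 (Nat.zero_le _))
    have : ∀ j ∈ Finset.range (l + 1), |(iteratedDeriv j τ (h / 10) * h ^ j) *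
        ((h⁻¹) ^ k * (Polynomial.derivative^[k] (H j)).eval (h⁻¹ * s))| ≤ K * (h⁻¹) ^ k * T := by
      intro j hj
      have hjl : j ≤ l := by rw [Finset.mem_range] at hj; omega
      rw [abs_mul, abs_mul, abs_mul, abs_of_nonneg (show 0 ≤ h ^ j by positivity),
        abs_of_nonneg (show 0 ≤ h⁻¹ ^ k by positivity)]
      have a1 : h ^ j ≤ 1 := pow_le_one₀ hh.le hh1
      have a2 := hT j hjl
      have a3 := h4 j hjl k hk (h⁻¹ * s) ⟨mul_nonneg (inv_nonneg.2 hh.le) hs.1, by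
        rw [inv_mul_le_iff₀ hh, mul_one]; exact hs.2⟩
      calc _ ≤ (T * 1) * (h⁻¹ ^ k * K) := by gcongr
        _ = _ := by ring
    refine (Finset.sum_le_sum this).trans (le_of_eq ?_)
    rw [Finset.sum_const, Finset.card_range, nsmul_eq_mul]
    push_cast
    ring

section polyCut

variable {l : ℕ} {h : ℝ} {τ : ℝ → ℝ} {P : Polynomial ℝ}

theorem contDiffAt_polyCut (hh : 0 < h) (hP : Interpolates l h τ P)
    (hτ : ∀ s, |s| < h → ContDiffAt ℝ l τ s) {s : ℝ} (hs : -h < s) :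
    ContDiffAt ℝ l (polyCut h τ P) s := by
  rcases lt_or_ge s h with hsh | hsh
  · have h1 : ContDiffOn ℝ l (fun s => if s ≤ h / 10 then τ s else P.eval s) (Set.Ioo (-h) h) :=
      contDiffOn_glue isOpen_Ioo (fun y hy => (hτ y (abs_lt.2 hy)).contDiffWithinAt)
        (contDiff_eval P).contDiffOn ⟨by linarith, by linarith⟩ fun j hj => (hP.inner j hj).symm
    have h2 := h1.contDiffAt (isOpen_Ioo.mem_nhds ⟨hs, hsh⟩)
    refine h2.congr_of_eventuallyEq ?_
    filter_upwards [eventually_lt_nhds hsh] with y hy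
    unfold polyCut
    rw [if_pos hy.le]
  · have h1 : ContDiffOn ℝ l (fun s => if s ≤ h then P.eval s else 0) (Set.Ioi (h / 10)) :=
      contDiffOn_glue isOpen_Ioi (contDiff_eval P).contDiffOn contDiffOn_const
        (show h / 10 < h by linarith) fun j hj => by
          rw [hP.outer j hj, iteratedDeriv_fun_const_zero]
    have h2 := h1.contDiffAt (isOpen_Ioi.mem_nhds (show h / 10 < s by linarith))
    refine h2.congr_of_eventuallyEq ?_
    filter_upwards [eventually_gt_nhds (show h / 10 < s by linarith)] with y hy
    unfold polyCut
    rw [if_neg (not_le.2 hy)]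

theorem abs_iteratedDeriv_polyCut_le {k : ℕ} {B : ℝ} (hB : 0 ≤ B)
    (hτ : ∀ s, |s| < h → |iteratedDeriv k τ s| ≤ B)
    (hPB : ∀ s ∈ Set.Icc 0 h, |iteratedDeriv k (fun s => P.eval s) s| ≤ B) (hh : 0 < h) {s : ℝ}
    (hs : -h < s) (h1 : s ≠ h / 10) (h2 : s ≠ h) : |iteratedDeriv k (polyCut h τ P) s| ≤ B := by
  rcases lt_or_gt_of_ne h1 with h1 | h1
  · have : polyCut h τ P =ᶠ[nhds s] τ := by
      filter_upwards [eventually_lt_nhds h1] with y hy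
      unfold polyCut
      rw [if_pos hy.le]
    rw [this.iteratedDeriv_eq]
    exact hτ s (abs_lt.2 ⟨hs, by linarith⟩)
  · rcases lt_or_gt_of_ne h2 with h2 | h2
    · have : polyCut h τ P =ᶠ[nhds s] fun s => P.eval s := by
        filter_upwards [eventually_lt_nhds h2, eventually_gt_nhds h1] with y hy hy'
        unfold polyCut
        rw [if_neg (not_le.2 hy'), if_pos hy.le]
      rw [this.iteratedDeriv_eq]
      exact hPB s ⟨by linarith, h2.le⟩
    · have : polyCut h τ P =ᶠ[nhds s] fun _ => 0 := by
        filter_upwards [eventually_gt_nhds h2] with y hy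
        unfold polyCut
        rw [if_neg (not_le.2 (by linarith)), if_neg (not_le.2 hy)]
      rw [this.iteratedDeriv_eq, iteratedDeriv_fun_const_zero, abs_zero]
      exact hB

end polyCut

/-- The two-sided version of `polyCut`. -/
def polyCut₂ (h : ℝ) (τ : ℝ → ℝ) (P P' : Polynomial ℝ) (s : ℝ) : ℝ :=
  if 0 ≤ s then polyCut h τ P s else polyCut h (fun s => τ (-s)) P' (-s)

section polyCut₂

variable {l : ℕ} {h : ℝ} {τ : ℝ → ℝ} {P P' : Polynomial ℝ}

theorem polyCut₂_inner {s : ℝ} (hs : |s| ≤ h / 10) : polyCut₂ h τ P P' s = τ s := by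
  rw [abs_le] at hs
  unfold polyCut₂ polyCut
  rw [if_pos hs.2, if_pos (by linarith : -s ≤ h / 10)]
  simp only [neg_neg, ite_self]

theorem polyCut₂_right {s : ℝ} (hs : -(h / 10) ≤ s) :
    polyCut₂ h τ P P' s = polyCut h τ P s := by
  unfold polyCut₂
  split_ifs with h0
  · rfl
  · unfold polyCut
    rw [if_pos (by linarith), if_pos (by linarith)]
    simp only [neg_neg]

theorem polyCut₂_left {s : ℝ} (hs : s ≤ h / 10) :
    polyCut₂ h τ P P' s = polyCut h (fun s => τ (-s)) P' (-s) := by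
  unfold polyCut₂
  split_ifs with h0
  · unfold polyCut
    rw [if_pos hs, if_pos (by linarith)]
    simp only [neg_neg]
  · rfl

theorem polyCut₂_eventuallyEq_right {s : ℝ} (hs : -(h / 10) < s) :
    polyCut₂ h τ P P' =ᶠ[nhds s] polyCut h τ P := by
  filter_upwards [eventually_gt_nhds hs] with y hy using polyCut₂_right hy.le

theorem polyCut₂_eventuallyEq_left {s : ℝ} (hs : s < h / 10) :
    polyCut₂ h τ P P' =ᶠ[nhds s] fun s => polyCut h (fun s => τ (-s)) P' (-s) := by
  filter_upwards [eventually_lt_nhds hs] with y hy using polyCut₂_left hy.le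

theorem polyCut₂_outer (hh : 0 < h) (hP : Interpolates l h τ P)
    (hP' : Interpolates l h (fun s => τ (-s)) P') {s : ℝ} (hs : h ≤ |s|) :
    polyCut₂ h τ P P' s = 0 := by
  have aux : ∀ {τ : ℝ → ℝ} {P : Polynomial ℝ}, Interpolates l h τ P → ∀ {s}, h ≤ s →
      polyCut h τ P s = 0 := by
    intro τ P hP s hs
    unfold polyCut
    rw [if_neg (not_le.2 (by linarith))]
    split_ifs with h1
    · have := hP.outer 0 (Nat.zero_le _)
      rw [iteratedDeriv_zero] at this
      rw [le_antisymm h1 hs]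
      exact this
    · rfl
  rcases le_total 0 s with h0 | h0
  · rw [abs_of_nonneg h0] at hs
    rw [polyCut₂_right (by linarith), aux hP hs]
  · rw [abs_of_nonpos h0] at hs
    rw [polyCut₂_left (by linarith), aux hP' hs]

theorem contDiff_polyCut₂ (hh : 0 < h) (hP : Interpolates l h τ P)
    (hP' : Interpolates l h (fun s => τ (-s)) P') (hτ : ∀ s, |s| < h → ContDiffAt ℝ l τ s) :
    ContDiff ℝ l (polyCut₂ h τ P P') := by
  rw [contDiff_iff_contDiffAt]
  intro s
  rcases lt_or_ge (-(h / 10)) s with hs | hs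
  · exact (contDiffAt_polyCut hh hP hτ (by linarith)).congr_of_eventuallyEq
      (polyCut₂_eventuallyEq_right hs)
  · refine ContDiffAt.congr_of_eventuallyEq ?_ (polyCut₂_eventuallyEq_left (s := s) (by linarith))
    refine (contDiffAt_polyCut hh hP' (fun y hy => ?_) (by linarith)).comp s contDiffAt_id.neg
    exact (hτ (-y) (by rwa [abs_neg])).comp y contDiffAt_id.neg

theorem abs_iteratedDeriv_polyCut₂_le (hh : 0 < h) (hP : Interpolates l h τ P)
    (hP' : Interpolates l h (fun s => τ (-s)) P') (hτ : ∀ s, |s| < h → ContDiffAt ℝ l τ s) {k : ℕ}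
    (hk : k ≤ l) {B : ℝ} (hB : 0 ≤ B) (hτB : ∀ s, |s| < h → |iteratedDeriv k τ s| ≤ B)
    (hPB : ∀ s ∈ Set.Icc 0 h, |iteratedDeriv k (fun s => P.eval s) s| ≤ B)
    (hPB' : ∀ s ∈ Set.Icc 0 h, |iteratedDeriv k (fun s => P'.eval s) s| ≤ B) (s : ℝ) :
    |iteratedDeriv k (polyCut₂ h τ P P') s| ≤ B := by
  have hc : Continuous (iteratedDeriv k (polyCut₂ h τ P P')) :=
    (contDiff_polyCut₂ hh hP hP' hτ).continuous_iteratedDeriv k (by exact_mod_cast hk)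
  have hcl : IsClosed {s | |iteratedDeriv k (polyCut₂ h τ P P') s| ≤ B} :=
    isClosed_le hc.abs continuous_const
  have hdense : Dense (({h / 10, h, -(h / 10), -h} : Set ℝ)ᶜ) :=
    Set.Countable.dense_compl ℝ (Set.toFinite _).countable
  have hsub : ({h / 10, h, -(h / 10), -h} : Set ℝ)ᶜ ⊆
      {s | |iteratedDeriv k (polyCut₂ h τ P P') s| ≤ B} := by
    intro y hy
    simp only [Set.mem_compl_iff, Set.mem_insert_iff, Set.mem_singleton_iff, not_or] at hy
    obtain ⟨y1, y2, y3, y4⟩ := hy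
    change |iteratedDeriv k (polyCut₂ h τ P P') y| ≤ B
    rcases lt_or_ge (-(h / 10)) y with hs | hs
    · rw [(polyCut₂_eventuallyEq_right hs).iteratedDeriv_eq]
      exact abs_iteratedDeriv_polyCut_le hB hτB hPB hh (by linarith) y1 y2
    · rw [(polyCut₂_eventuallyEq_left (s := y) (by linarith)).iteratedDeriv_eq, iteratedDeriv_comp_neg,
        smul_eq_mul, abs_mul, abs_pow, abs_neg, abs_one, one_pow, one_mul]
      refine abs_iteratedDeriv_polyCut_le hB (fun s hs => ?_) hPB' hh (by linarith)
        (fun h => y3 (by linarith)) (fun h => y4 (by linarith))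
      rw [iteratedDeriv_comp_neg, smul_eq_mul, abs_mul, abs_pow, abs_neg, abs_one, one_pow, one_mul]
      exact hτB _ (by rwa [abs_neg])
  have := hcl.closure_subset_iff.2 hsub
  rw [hdense.closure_eq] at this
  exact this (Set.mem_univ s)

end polyCut₂

/-- The corrections by polynomials. -/
theorem corrector_poly {ω : ℝ} (hω : Irrational ω) (c : ℝ) (l : ℕ) : ∃ C : ℝ,
    Corrector ω c l (IsPolyCorrection ω c l) l 0 (fun _ => C) (fun k => 2 * k) (fun _ => 0) := by
  obtain ⟨K, hK0, hK⟩ := exists_interpolates l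
  refine ⟨K + 1, ⟨le_rfl, fun _ => by positivity, fun _ _ => le_rfl, ?_, ?_⟩⟩
  · rintro n t t' e h ⟨h1, h2, h3, h4, h5, h6⟩
    exact ⟨h1, h2, fun x hx => by
      rw [h3 x hx, h x (crit_subset hω c one_pos (by norm_num) le_rfl hx)], h4, h5, h6⟩
  · intro n _ t ht hts
    obtain ⟨hh0, hh1⟩ := one_div_sq_le_one hω n
    have hq1 := one_le_q hω n
    have hpi := Real.pi_gt_three
    obtain ⟨h, hh⟩ : ∃ h, h = 1 / q ω n ^ 2 := ⟨_, rfl⟩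
    rw [← hh] at hh0 hh1
    set τ : ℤ → ℝ → ℝ := fun m s => t (c + m * Real.pi + s) with hτ
    have hmem : ∀ (m : ℤ) s, |s| < h → c + m * Real.pi + s ∈ critOpen ω c n := by
      intro m s hs
      refine ⟨m, ?_⟩
      rwa [add_sub_cancel_left, ← hh]
    have hτs : ∀ m s, |s| < h → ContDiffAt ℝ l (τ m) s := by
      intro m s hs
      exact (hts l le_rfl _ (hmem m s hs)).comp s (contDiffAt_const.add contDiffAt_id)
    have hτper : ∀ m, τ (m + 2) = τ m := by
      intro m
      funext s
      simp only [hτ]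
      rw [← ht (c + m * Real.pi + s)]
      congr 1
      push_cast
      ring
    choose P hP hPB using fun f : ℝ → ℝ => hK h f hh0 hh1
    set e : ℤ → ℝ → ℝ := fun m => polyCut₂ h (τ m) (P (τ m)) (P fun s => τ m (-s)) with he
    have he0 : ∀ m s, h ≤ |s| → e m s = 0 := fun m s hs => polyCut₂_outer hh0 (hP _) (hP _) hs
    have he0' : ∀ m s, 1 / q ω n ^ 2 ≤ |s| → e m s = 0 := by rwa [← hh]
    have hsm : ContDiff ℝ l (patch c e) :=
      contDiff_patch hh1 he0 fun m => contDiff_polyCut₂ hh0 (hP _) (hP _) (hτs m)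
    have hper : Function.Periodic (patch c e) (2 * Real.pi) :=
      periodic_patch fun m s => by simp only [he, hτper]
    have hin : ∀ x ∈ crit ω c 10 n, patch c e x = t x := by
      intro x hx
      obtain ⟨m, s, rfl, hs, -, hs'⟩ := exists_of_mem_crit hω (by norm_num) hx
      rw [← hh] at hs'
      rw [patch_apply hh1 he0 m hs']
      refine polyCut₂_inner (hs.trans (le_of_eq ?_))
      rw [hh]
      field_simp
    have hout : ∀ x, x ∉ crit ω c 1 n → patch c e x = 0 := fun x hx => patch_eq_zero_of_not_mem he0' hx
    have hpos : ∀ s ∈ Set.Ioo (1 / (10 * q ω n ^ 2)) (1 / q ω n ^ 2), h / 10 < s ∧ s < h ∧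
        |s| < Real.pi - h := by
      intro s hs
      have e1 : 1 / (10 * q ω n ^ 2) = h / 10 := by rw [hh]; field_simp
      rw [e1, ← hh] at hs
      exact ⟨hs.1, hs.2, by rw [abs_of_pos (by linarith [hs.1])]; linarith [hs.2]⟩
    refine ⟨patch c e, ⟨hsm, hper, hin, hout, ?_, ?_⟩, hsm, hper, hin, hout, ?_⟩
    · intro m
      refine ⟨P (τ m), (hP _).degree, fun s hs => ?_⟩
      obtain ⟨h1, h2, h3⟩ := hpos s hs
      rw [patch_apply hh1 he0 m h3]
      simp only [he]
      rw [polyCut₂_right (by linarith)]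
      unfold polyCut
      rw [if_neg (not_le.2 h1), if_pos h2.le]
    · intro m
      refine ⟨P fun s => τ m (-s), (hP _).degree, fun s hs => ?_⟩
      obtain ⟨h1, h2, h3⟩ := hpos s hs
      rw [sub_eq_add_neg, patch_apply hh1 he0 m (by rwa [abs_neg])]
      simp only [he]
      rw [polyCut₂_left (by linarith), neg_neg]
      unfold polyCut
      rw [if_neg (not_le.2 h1), if_pos h2.le]
    · intro k hkl _ T hT
      have hkl' : k ≤ l := by exact_mod_cast hkl
      rw [max_eq_right hkl'] at hT
      have hT0 : 0 ≤ T := (abs_nonneg _).trans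
        (hT 0 (Nat.zero_le _) (c + (0 : ℤ) * Real.pi + 0) (hmem 0 0 (by rwa [abs_zero])))
      have hτT : ∀ m, ∀ j ≤ l, ∀ s, |s| < h → |iteratedDeriv j (τ m) s| ≤ T := by
        intro m j hj s hs
        simp only [hτ]
        rw [iteratedDeriv_shift]
        exact hT j hj _ (hmem m s hs)
      have hτT' : ∀ m, ∀ j ≤ l, ∀ s, |s| < h → |iteratedDeriv j (fun s => τ m (-s)) s| ≤ T := by
        intro m j hj s hs
        rw [iteratedDeriv_comp_neg, smul_eq_mul, abs_mul, abs_pow, abs_neg, abs_one, one_pow, one_mul]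
        exact hτT m j hj _ (by rwa [abs_neg])
      have hq2 : (h⁻¹) ^ k = q ω n ^ (2 * k) := by rw [hh, one_div, inv_inv, ← pow_mul]
      have hqk : 1 ≤ q ω n ^ (2 * k) := one_le_pow₀ hq1
      have hle : K * h⁻¹ ^ k * T ≤ (K + 1) * q ω n ^ (2 * k) * T := by
        rw [hq2]; gcongr; linarith
      have hTle : T ≤ (K + 1) * q ω n ^ (2 * k) * T := by
        have : 1 ≤ (K + 1) * q ω n ^ (2 * k) := by nlinarith
        nlinarith
      have h10 : |h / 10| < h := by rw [abs_of_pos (by linarith)]; linarith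
      refine abs_iteratedDeriv_patch_le hh1 he0 fun m => ?_
      refine abs_iteratedDeriv_polyCut₂_le hh0 (hP _) (hP _) (hτs m) hkl' (by positivity)
        (fun s hs => (hτT m k hkl' s hs).trans hTle) (fun s hs => ?_) (fun s hs => ?_)
      · exact (hPB _ T (fun j hj => hτT m j hj _ h10) k hkl' s hs).trans hle
      · exact (hPB _ T (fun j hj => hτT' m j hj _ h10) k hkl' s hs).trans hle

/-! ### The initial phase -/

/-- The properties of the profiles `sgn(t) |t|^{l+1}` and `sgn(t) exp(-1 / |t|^a)` that are used. -/
structure Profile (ω : ℝ) (l : ℕ∞) (g : ℝ → ℝ) : Prop where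
  odd : ∀ t, g (-t) = -g t
  mono : ∀ s t, 0 ≤ s → s ≤ t → g s ≤ g t
  le_one : ∀ t, 0 ≤ t → t ≤ 1 → g t ≤ 1
  isLittleO : ∀ k : ℕ, (k : ℕ∞) ≤ l → g =o[nhds 0] fun s => s ^ k
  gap_le : ∀ᶠ n in Filter.atTop, gap ω n ≤ g (1 / (10 * q ω n ^ 2))

theorem Profile.zero {ω : ℝ} {l : ℕ∞} {g : ℝ → ℝ} (h : Profile ω l g) : g 0 = 0 := by
  have := h.odd 0
  rw [neg_zero] at this
  linarith

theorem Profile.nonneg {ω : ℝ} {l : ℕ∞} {g : ℝ → ℝ} (h : Profile ω l g) {t : ℝ} (ht : 0 ≤ t) :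
    0 ≤ g t := by
  have := h.mono 0 t le_rfl ht
  rwa [h.zero] at this

theorem Profile.abs_eq {ω : ℝ} {l : ℕ∞} {g : ℝ → ℝ} (h : Profile ω l g) (t : ℝ) : |g t| = g |t| := by
  rcases le_total 0 t with ht | ht
  · rw [abs_of_nonneg ht, abs_of_nonneg (h.nonneg ht)]
  · rw [abs_of_nonpos ht, h.odd, abs_of_nonpos]
    have := h.nonneg (neg_nonneg.2 ht)
    rw [h.odd] at this
    linarith

theorem powProfile_of_nonneg (l : ℕ) {t : ℝ} (ht : 0 ≤ t) : powProfile l t = t ^ (l + 1) := by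
  unfold powProfile
  rcases ht.eq_or_lt with rfl | ht
  · simp
  · rw [Real.sign_of_pos ht, abs_of_pos ht, one_mul]

theorem profile_pow {ω : ℝ} (hω : Irrational ω) (l : ℕ) : Profile ω l (powProfile l) where
  odd t := by unfold powProfile; rw [Real.sign_neg, abs_neg, neg_mul]
  mono s t hs hst := by
    rw [powProfile_of_nonneg l hs, powProfile_of_nonneg l (hs.trans hst)]
    gcongr
  le_one t ht ht1 := by rw [powProfile_of_nonneg l ht]; exact pow_le_one₀ ht ht1
  isLittleO k hk := by
    have hk' : k < l + 1 := by
      have : k ≤ l := by exact_mod_cast hk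
      omega
    refine Asymptotics.IsBigO.trans_isLittleO ?_ (Asymptotics.isLittleO_pow_pow (𝕜 := ℝ) hk')
    refine Asymptotics.IsBigO.of_bound 1 (Filter.Eventually.of_forall fun t => ?_)
    unfold powProfile
    rw [one_mul, norm_mul, norm_pow, norm_pow, Real.norm_eq_abs |t|, abs_abs, Real.norm_eq_abs]
    refine mul_le_of_le_one_left (by positivity) ?_
    rcases Real.sign_apply_eq t with h | h | h <;> rw [h] <;> simp
  gap_le := by
    have h1 : ∀ᶠ y : ℝ in Filter.atTop, y ^ (4 * (l + 1)) * Real.exp (-y) ≤ 1 / 10 ^ (l + 1) :=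
      (Real.tendsto_pow_mul_exp_neg_atTop_nhds_zero _).eventually
        (eventually_le_nhds (by positivity))
    have h2 := (Real.tendsto_sqrt_atTop.comp (tendsto_q hω)).eventually h1
    filter_upwards [h2] with n hn
    have hq := q_pos hω n
    rw [powProfile_of_nonneg l (by positivity), one_div_pow]
    simp only [Function.comp_apply] at hn
    have e : √(q ω n) ^ (4 * (l + 1)) = (q ω n ^ 2) ^ (l + 1) := by
      rw [show 4 * (l + 1) = 2 * (2 * (l + 1)) by ring, pow_mul, Real.sq_sqrt hq.le, pow_mul]
    rw [e, mul_comm, ← le_div_iff₀ (by positivity), div_div, ← mul_pow] at hn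
    exact hn

theorem expProfile_of_pos (a : ℝ) {t : ℝ} (ht : 0 < t) :
    expProfile a t = Real.exp (-(1 / t ^ a)) := by
  unfold expProfile
  rw [Real.sign_of_pos ht, abs_of_pos ht, one_mul]

theorem profile_exp {ω a : ℝ} (hω : Irrational ω) (ha : a ∈ Set.Ioo (0 : ℝ) (1 / 10)) :
    Profile ω ⊤ (expProfile a) where
  odd t := by unfold expProfile; rw [Real.sign_neg, abs_neg, neg_mul]
  mono s t hs hst := by
    rcases hs.eq_or_lt with rfl | hs
    · have h0 : expProfile a 0 = 0 := by simp [expProfile]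
      rw [h0]
      rcases hst.eq_or_lt with rfl | ht
      · rw [h0]
      · rw [expProfile_of_pos a ht]; exact (Real.exp_pos _).le
    · rw [expProfile_of_pos a hs, expProfile_of_pos a (hs.trans_le hst)]
      apply Real.exp_le_exp.2
      apply neg_le_neg
      apply one_div_le_one_div_of_le (Real.rpow_pos_of_pos hs _)
      exact Real.rpow_le_rpow hs.le hst ha.1.le
  le_one t ht _ := by
    rcases ht.eq_or_lt with rfl | ht
    · simp [expProfile]
    · rw [expProfile_of_pos a ht, Real.exp_le_one_iff, neg_nonpos]
      positivity
  isLittleO k _ := by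
    have h1 := isLittleO_exp_neg_mul_rpow_atTop one_pos (-(k / a))
    have hu : Filter.Tendsto (fun s : ℝ => |s| ^ (-a)) (nhdsWithin 0 {0}ᶜ) Filter.atTop :=
      (tendsto_rpow_neg_nhdsGT_zero (neg_neg_of_pos ha.1)).comp (by
        refine tendsto_nhdsWithin_iff.2 ⟨?_, ?_⟩
        · have : Filter.Tendsto (fun s : ℝ => |s|) (nhds 0) (nhds 0) := by
            simpa using (continuous_abs (G := ℝ)).tendsto 0
          exact this.mono_left nhdsWithin_le_nhds
        · filter_upwards [self_mem_nhdsWithin] with s hs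
          exact abs_pos.2 hs)
    have h2 := h1.comp_tendsto hu
    rw [Asymptotics.isLittleO_iff] at h2 ⊢
    intro ε hε
    have h3 := h2 hε
    rw [eventually_nhdsWithin_iff] at h3
    filter_upwards [h3] with s hs
    rcases eq_or_ne s 0 with rfl | h0
    · simp only [expProfile, Real.sign_zero, zero_mul, norm_zero]
      positivity
    · have h4 := hs h0
      have hs0 : 0 < |s| := abs_pos.2 h0
      simp only [Function.comp_apply] at h4
      rw [← Real.rpow_mul hs0.le, show -a * -(k / a) = (k : ℝ) by have := ha.1.ne'; field_simp,
        Real.rpow_natCast, ← abs_pow, Real.norm_eq_abs |s ^ k|, abs_abs] at h4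
      rw [Real.norm_eq_abs (s ^ k)]
      refine le_trans (le_of_eq ?_) h4
      unfold expProfile
      rw [norm_mul, Real.rpow_neg hs0.le, neg_one_mul, one_div]
      rcases lt_or_gt_of_ne h0 with h | h
      · rw [Real.sign_of_neg h]; simp
      · rw [Real.sign_of_pos h]; simp
  gap_le := by
    filter_upwards [(tendsto_q hω).eventually_ge_atTop 3] with n hn
    rw [expProfile_of_pos a (by positivity)]
    apply Real.exp_le_exp.2
    apply neg_le_neg
    have h1 : (1 : ℝ) ≤ 10 * q ω n ^ 2 := by nlinarith
    rw [Real.div_rpow zero_le_one (by positivity), Real.one_rpow, one_div_one_div]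
    have h2 : 10 * q ω n ^ 2 ≤ q ω n ^ 5 := by
      have : (3 : ℝ) ^ 3 ≤ q ω n ^ 3 := by gcongr
      nlinarith [sq_nonneg (q ω n)]
    calc (10 * q ω n ^ 2) ^ a ≤ (10 * q ω n ^ 2) ^ (1 / 10 : ℝ) :=
          Real.rpow_le_rpow_of_exponent_le h1 ha.2.le
      _ ≤ (q ω n ^ 5) ^ (1 / 10 : ℝ) := Real.rpow_le_rpow (by positivity) h2 (by norm_num)
      _ = √(q ω n) := by
          rw [Real.sqrt_eq_rpow, ← Real.rpow_natCast, ← Real.rpow_mul (by linarith)]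
          norm_num

/-- `φ` is a lift of a function on the circle with values in `ℝ / 2πℤ`. -/
def IsLift (φ : ℝ → ℝ) : Prop := ∃ j : ℤ, ∀ x, φ (x + 2 * Real.pi) = φ x + j * (2 * Real.pi)

theorem IsLift.add {φ e : ℝ → ℝ} (h : IsLift φ) (he : Function.Periodic e (2 * Real.pi)) :
    IsLift (fun x => φ x + e x) := by
  obtain ⟨j, hj⟩ := h
  exact ⟨j, fun x => by simp only [hj x, he x]; ring⟩

theorem IsLift.periodic_iteratedDeriv {φ : ℝ → ℝ} (h : IsLift φ) {i : ℕ} (hi : 1 ≤ i) :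
    Function.Periodic (iteratedDeriv i φ) (2 * Real.pi) := by
  obtain ⟨j, hj⟩ := h
  obtain ⟨i, rfl⟩ := Nat.exists_eq_add_of_le' hi
  intro x
  have h1 : deriv φ = deriv fun x => φ (x + 2 * Real.pi) := by
    have : (fun x => φ (x + 2 * Real.pi)) = fun x => φ x + j * (2 * Real.pi) := funext hj
    rw [this, deriv_add_const']
  have h2 : iteratedDeriv (i + 1) φ = iteratedDeriv (i + 1) fun x => φ (x + 2 * Real.pi) := by
    rw [iteratedDeriv_succ', iteratedDeriv_succ', ← h1]
  conv_rhs => rw [h2]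
  rw [iteratedDeriv_comp_add_const]

theorem exists_bound_of_periodic {f : ℝ → ℝ} (hf : Continuous f)
    (hp : Function.Periodic f (2 * Real.pi)) : ∃ Y, ∀ x, |f x| ≤ Y := by
  obtain ⟨Y, hY⟩ := isCompact_Icc.exists_bound_of_continuousOn (s := Set.Icc 0 (2 * Real.pi))
    hf.continuousOn
  refine ⟨Y, fun x => ?_⟩
  obtain ⟨y, hy, hxy⟩ := hp.exists_mem_Ico₀ (by positivity) x
  rw [hxy]
  exact hY y ⟨hy.1, hy.2.le⟩

theorem IsLift.exists_bound {φ : ℝ → ℝ} (h : IsLift φ) {l : ℕ∞} (hs : ContDiff ℝ l φ) (k : ℕ)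
    (hk : (k : ℕ∞) ≤ l) : ∃ Y, 0 ≤ Y ∧ ∀ i, 1 ≤ i → i ≤ k → ∀ x, |iteratedDeriv i φ x| ≤ Y := by
  have h1 : ∀ i, ∃ Y, 1 ≤ i → i ≤ k → ∀ x, |iteratedDeriv i φ x| ≤ Y := by
    intro i
    by_cases hi : 1 ≤ i ∧ i ≤ k
    · have hc : Continuous (iteratedDeriv i φ) := hs.continuous_iteratedDeriv i
        (by exact_mod_cast (show (i : ℕ∞) ≤ k by exact_mod_cast hi.2).trans hk)
      obtain ⟨Y, hY⟩ := exists_bound_of_periodic hc (h.periodic_iteratedDeriv hi.1)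
      exact ⟨Y, fun _ _ => hY⟩
    · exact ⟨0, fun h1 h2 => absurd ⟨h1, h2⟩ hi⟩
  choose Y hY using h1
  refine ⟨∑ i ∈ Finset.range (k + 1), |Y i|, Finset.sum_nonneg fun _ _ => abs_nonneg _,
    fun i hi hik x => (hY i hi hik x).trans ((le_abs_self _).trans ?_)⟩
  exact Finset.single_le_sum (f := fun i => |Y i|) (fun _ _ => abs_nonneg _)
    (Finset.mem_range.2 (by omega))

theorem abs_sin_int_mul_pi_add (j : ℤ) (r : ℝ) : |Real.sin (j * Real.pi + r)| = |Real.sin r| := by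
  rw [add_comm, Real.sin_add_int_mul_pi, abs_mul, abs_zpow, abs_neg, abs_one, one_zpow, one_mul]

theorem half_mul_abs_le_abs_sin {r : ℝ} (h : |r| ≤ Real.pi / 2) : |r| / 2 ≤ |Real.sin r| := by
  refine le_trans ?_ (Real.mul_abs_le_abs_sin h)
  have h1 := Real.pi_lt_d2
  have h2 : (1 : ℝ) / 2 ≤ 2 / Real.pi := by
    rw [div_le_div_iff₀ (by norm_num) Real.pi_pos]; linarith
  nlinarith [abs_nonneg r]

section base

variable {ω c δ₀ : ℝ} {l : ℕ∞} {g φ : ℝ → ℝ} {tw : Bool}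

theorem IsBasePhase.isLift (h : IsBasePhase l g c δ₀ tw φ) : IsLift φ := by
  refine ⟨if tw then 1 else 0, fun x => ?_⟩
  rw [h.lift x]
  cases tw <;> simp

theorem IsBasePhase.exists_near (h : IsBasePhase l g c δ₀ tw φ) (m : ℤ) : ∃ (j : ℤ) (σ : ℝ),
    |σ| = 1 ∧ ∀ t, |t| ≤ δ₀ → φ (c + m * Real.pi + t) = j * Real.pi + σ * g t := by
  cases tw with
  | false =>
    refine ⟨0, (-1) ^ m, by rw [abs_zpow, abs_neg, abs_one, one_zpow], fun t ht => ?_⟩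
    rw [h.near m t ht]
    simp
  | true =>
    refine ⟨m, 1, abs_one, fun t ht => ?_⟩
    rw [h.near m t ht]
    simp

/-- Outside `I_n` the phase stays away from `πℤ`. -/
theorem IsBasePhase.gap_le_abs_sin (hω : Irrational ω) (hg : Profile ω l g) (hδ : δ₀ ≤ 1)
    (h : IsBasePhase l g c δ₀ tw φ) {n : ℕ} (hn : 1 / q ω n ^ 2 ≤ δ₀)
    (hgap : gap ω n ≤ g (1 / (10 * q ω n ^ 2))) {x : ℝ} (hx : x ∉ crit ω c 1 n) :
    gap ω n / 2 ≤ |Real.sin (φ x)| := by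
  obtain ⟨h0, h1⟩ := one_div_sq_le_one hω n
  have hq := q_pos hω n
  have hpi := Real.pi_gt_three
  have h10 : gap ω n ≤ g (1 / q ω n ^ 2) := by
    refine hgap.trans (hg.mono _ _ (by positivity) ?_)
    apply one_div_le_one_div_of_le (by positivity)
    nlinarith [sq_nonneg (q ω n)]
  by_cases hx' : ∀ m : ℤ, δ₀ < |x - (c + m * Real.pi)|
  · have ha := h.away x hx' (round ((φ x - 0) / Real.pi))
    have hr := abs_sub_round_le 0 (φ x)
    rw [zero_add] at hr
    set j := round ((φ x - 0) / Real.pi)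
    have e : φ x = j * Real.pi + (φ x - j * Real.pi) := by ring
    rw [e, abs_sin_int_mul_pi_add]
    refine le_trans ?_ (half_mul_abs_le_abs_sin hr)
    have := hg.mono _ _ h0.le hn
    linarith
  · push Not at hx'
    obtain ⟨m, hm⟩ := hx'
    have hm' : 1 / q ω n ^ 2 < |x - (c + m * Real.pi)| := by
      by_contra! hle
      exact hx (mem_crit_one_iff.2 ⟨m, hle⟩)
    obtain ⟨j, σ, hσ, hφ⟩ := h.exists_near m
    have e := hφ _ hm
    rw [add_sub_cancel] at e
    set t := x - (c + m * Real.pi)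
    have habs : |σ * g t| = g |t| := by rw [abs_mul, hσ, one_mul, hg.abs_eq]
    rw [e, abs_sin_int_mul_pi_add]
    have hle := hg.le_one |t| (abs_nonneg _) (hm.trans hδ)
    refine le_trans ?_ (half_mul_abs_le_abs_sin (by rw [habs]; linarith))
    rw [habs]
    have := hg.mono _ _ h0.le hm'.le
    linarith

end base

/-! ### Comparison of the scales -/

theorem eventually_eta_le {ω M : ℝ} (hω : Irrational ω) (hM : 1 ≤ M)
    (hbdd : ∀ n : ℕ, 1 ≤ n → q ω (n + 1) < M * q ω n) (A : ℝ) (B k : ℕ) :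
    ∀ᶠ n in Filter.atTop, A * q ω (n + 1) ^ B * eta ω M n * Real.exp (k * q ω (n + 1)) ≤
      (1 / 2) ^ (n + 3) * gap ω (n + 1) := by
  have hM0 : 0 < M := by linarith
  filter_upwards [(tendsto_q hω).eventually_ge_atTop (16 * M * (|A| + B * M + k * M + 2 + M)),
    Filter.eventually_ge_atTop 12] with n hn h12
  have h1 := (hbdd n (by omega)).le
  have hq1 := one_le_q hω n
  have hq2 := one_le_q hω (n + 1)
  have hfib : (n : ℝ) + 3 ≤ 2 * q ω n := by
    have h2 := (fib_le_q hω n)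
    have h3 := mul_le_fib n h12
    have h4 : ((n : ℝ) + 1) * (n + 2) ≤ q ω n := le_trans (by exact_mod_cast h3) h2
    nlinarith [n.cast_nonneg (α := ℝ)]
  have b1 : A ≤ Real.exp (|A| * q ω n) := by
    have := Real.add_one_le_exp (|A| * q ω n)
    nlinarith [le_abs_self A, abs_nonneg A]
  have b2 : q ω (n + 1) ^ B ≤ Real.exp (B * M * q ω n) := by
    have h5 : q ω (n + 1) ≤ Real.exp (M * q ω n) := by
      have := Real.add_one_le_exp (M * q ω n)
      linarith
    calc _ ≤ Real.exp (M * q ω n) ^ B := by gcongr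
      _ = _ := by rw [← Real.exp_nat_mul]; ring_nf
  have b3 : Real.exp (k * q ω (n + 1)) ≤ Real.exp (k * M * q ω n) := by
    apply Real.exp_le_exp.2
    rw [mul_assoc]
    gcongr
  have b4 : Real.exp (-(2 * q ω n)) ≤ (1 / 2) ^ (n + 3) := by
    have h6 : Real.exp (-1) ≤ 1 / 2 := by
      rw [Real.exp_neg, one_div]
      apply inv_anti₀ (by norm_num)
      have := Real.add_one_le_exp (1 : ℝ)
      linarith
    calc _ ≤ Real.exp (((n + 3 : ℕ) : ℝ) * (-1)) := by
          apply Real.exp_le_exp.2; push_cast; linarith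
      _ = Real.exp (-1) ^ (n + 3) := Real.exp_nat_mul _ _
      _ ≤ _ := by gcongr
  have b5 : Real.exp (-(M * q ω n)) ≤ gap ω (n + 1) := by
    apply Real.exp_le_exp.2
    apply neg_le_neg
    refine le_trans ?_ h1
    rw [Real.sqrt_le_left (by linarith)]
    nlinarith
  have hl : (|A| + B * M + k * M + 2 + M) * q ω n ≤ len ω M n := by
    unfold len
    rw [le_div_iff₀ (by positivity)]
    nlinarith
  calc A * q ω (n + 1) ^ B * eta ω M n * Real.exp (k * q ω (n + 1))
      ≤ Real.exp (|A| * q ω n) * Real.exp (B * M * q ω n) * eta ω M n *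
        Real.exp (k * M * q ω n) := by
        have := (Real.exp_pos (-len ω M n)).le
        unfold eta
        gcongr
    _ ≤ Real.exp (-(2 * q ω n)) * Real.exp (-(M * q ω n)) := by
        unfold eta
        rw [← Real.exp_add, ← Real.exp_add, ← Real.exp_add, ← Real.exp_add]
        apply Real.exp_le_exp.2
        linarith
    _ ≤ _ := by gcongr

/-! ### Dependence of the directions on the phase -/

theorem dirDiff_congr {ω lam : ℝ} {φ ψ : ℝ → ℝ} {m : ℕ} {x : ℝ} (hm : 1 ≤ m)
    (h : ∀ i : ℤ, i ≠ 0 → |i| < m → φ (tr ω x i) = ψ (tr ω x i)) :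
    dirDiff ω lam φ m x = dirDiff ω lam ψ m x := by
  have key : ((dirDiff ω lam φ m x : ℝ) : ℂ) = dirDiff ω lam ψ m x := by
    rw [ofReal_dirDiff, ofReal_dirDiff]
    unfold cdirDiff
    rw [blk_congr (fun j h0 h1 => by rw [h j (by omega) (by rw [abs_lt]; omega)]) hm,
      blk_congr (i := -(m : ℤ)) (fun j h0 h1 => by rw [h j (by omega) (by rw [abs_lt]; omega)]) hm]
  exact_mod_cast key

theorem IsLift.periodic_cocycle {φ : ℝ → ℝ} (h : IsLift φ) (lam : ℝ) :
    Function.Periodic (cocycle lam φ) (2 * Real.pi) := by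
  obtain ⟨j, hj⟩ := h
  intro x
  unfold cocycle rot
  rw [hj, Real.cos_pi_div_two_sub, Real.sin_pi_div_two_sub, Real.cos_pi_div_two_sub,
    Real.sin_pi_div_two_sub, Real.sin_add_int_mul_two_pi, Real.cos_add_int_mul_two_pi]

theorem periodic_fwd {A : ℝ → Mat} {T : ℝ} (h : Function.Periodic A T) (ω : ℝ) (j : ℕ) :
    Function.Periodic (fwd ω A j) T := by
  intro x
  induction j with
  | zero => rfl
  | succ j ih => rw [fwd, fwd, ih, add_right_comm, h]

theorem IsLift.periodic_dirDiff {φ : ℝ → ℝ} (h : IsLift φ) (ω lam : ℝ) (m : ℕ) :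
    Function.Periodic (dirDiff ω lam φ m) (2 * Real.pi) := by
  have h1 : ∀ x, rblk ω lam φ (x + 2 * Real.pi) m = rblk ω lam φ x m := by
    intro x
    unfold rblk
    rw [periodic_fwd (h.periodic_cocycle lam) ω m x]
    obtain ⟨j, hj⟩ := h
    congr 1
    unfold rot
    rw [hj, Real.cos_neg, Real.sin_neg, Real.cos_neg, Real.sin_neg, Real.cos_pi_div_two_sub,
      Real.sin_pi_div_two_sub, Real.cos_pi_div_two_sub, Real.sin_pi_div_two_sub,
      Real.sin_add_int_mul_two_pi, Real.cos_add_int_mul_two_pi]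
  intro x
  unfold dirDiff
  have e : tr ω (x + 2 * Real.pi) (-(m : ℤ)) = tr ω x (-(m : ℤ)) + 2 * Real.pi := by unfold tr; ring
  rw [e, h1, h1]

/-! ### One step of the construction -/

theorem abs_dirDiff_sub_le {ω lam : ℝ} {φ : ℝ → ℝ} {m m' : ℕ} {x ρ η : ℝ} (hρ : 0 < ρ)
    (h : ∀ θ, Near ω φ x ρ θ → DominantAt lam m θ ∧ DominantAt lam m' θ ∧
      ‖cdirDiff lam m θ - cdirDiff lam m' θ‖ ≤ η) :
    |dirDiff ω lam φ m x - dirDiff ω lam φ m' x| ≤ η := by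
  have h1 := (h _ (near_self φ x hρ)).2.2
  rw [← ofReal_dirDiff, ← ofReal_dirDiff, ← Complex.ofReal_sub, Complex.norm_real] at h1
  exact h1

/-- The correction for the difference of the angles given by two block lengths. -/
theorem Corrector.exists_dirDiff {ω c lam : ℝ} {l : ℕ∞} {step : ℕ → (ℝ → ℝ) → (ℝ → ℝ) → Prop}
    {k₀ n₁ : ℕ} {C : ℕ → ℝ} {B nk : ℕ → ℕ} (H : Corrector ω c l step k₀ n₁ C B nk) {n : ℕ}
    (hn : n₁ ≤ n) {φ : ℝ → ℝ} (hφ : ContDiff ℝ l φ) (hlift : IsLift φ) {m m' : ℕ} (hm : 1 ≤ m)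
    (hm' : 1 ≤ m') {ρ η : ℝ} (hρ : 0 < ρ)
    (hdom : ∀ x ∈ crit ω c 1 n, ∀ θ, Near ω φ x ρ θ → DominantAt lam m θ ∧ DominantAt lam m' θ ∧
      ‖cdirDiff lam m θ - cdirDiff lam m' θ‖ ≤ η) :
    ∃ e : ℝ → ℝ, step n (fun x => dirDiff ω lam φ m x - dirDiff ω lam φ m' x) e ∧ ContDiff ℝ l e ∧
      Function.Periodic e (2 * Real.pi) ∧
      (∀ x ∈ crit ω c 10 n, e x = dirDiff ω lam φ m x - dirDiff ω lam φ m' x) ∧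
      (∀ x, x ∉ crit ω c 1 n → e x = 0) ∧
      ∀ k : ℕ, (k : ℕ∞) ≤ l → nk k ≤ n → ∀ D : ℝ, 1 ≤ D →
        (∀ i, 1 ≤ i → i ≤ max k k₀ → ∀ x,
          |iteratedDeriv i φ x| * (2 * ((max k k₀ : ℕ) + 1) / ρ) ≤ D ^ i) →
        ∀ x, |iteratedDeriv k e x| ≤
          C k * q ω n ^ B k * ((max k k₀).factorial * η * D ^ max k k₀) := by
  have hopen : ∀ x ∈ critOpen ω c n, x ∈ crit ω c 1 n := by
    rintro x ⟨j, hj⟩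
    exact mem_crit_one_iff.2 ⟨j, hj.le⟩
  have hsm : ∀ k : ℕ, (k : ℕ∞) ≤ l → ContDiff ℝ k φ := fun k hk => hφ.of_le (by exact_mod_cast hk)
  -- smoothness only: a bound for the derivatives of the phase always exists
  have hbig : ∀ k : ℕ, (k : ℕ∞) ≤ l → ∃ D : ℝ, ∀ i, 1 ≤ i → i ≤ k → ∀ x,
      |iteratedDeriv i φ x| * (2 * (k + 1) / ρ) ≤ D ^ i := by
    intro k hk
    obtain ⟨Y, hY0, hY⟩ := hlift.exists_bound hφ k hk
    refine ⟨Y * (2 * (k + 1) / ρ) + 1, fun i hi hik x => ?_⟩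
    have h1 : |iteratedDeriv i φ x| * (2 * (k + 1) / ρ) ≤ Y * (2 * (k + 1) / ρ) := by
      have := hY i hi hik x
      gcongr
    have h2 : 0 ≤ Y * (2 * (k + 1) / ρ) := by positivity
    exact (h1.trans (by linarith)).trans (le_self_pow₀ (by linarith) (by omega))
  obtain ⟨e, h1, h2, h3, h4, h5, h6⟩ := H.exists_correction n hn
    (fun x => dirDiff ω lam φ m x - dirDiff ω lam φ m' x)
    ((hlift.periodic_dirDiff ω lam m).sub (hlift.periodic_dirDiff ω lam m')) (by
      intro k hk x hx
      obtain ⟨D, hD⟩ := hbig k hk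
      have hd := hdom x (hopen x hx)
      exact (abs_iteratedDeriv_dirDiff_sub_le hm hm' hρ (hsm k hk)
        (fun θ hθ => ⟨(hd θ hθ).1, (hd θ hθ).2.1⟩) (fun θ hθ => (hd θ hθ).2.2) hD).1)
  refine ⟨e, h1, h2, h3, h4, h5, fun k hk hnk D hD1 hD x => ?_⟩
  refine h6 k hk hnk _ (fun j hj y hy => ?_) x
  have hd := hdom y (hopen y hy)
  have hjl : (j : ℕ∞) ≤ l := by
    refine le_trans (by exact_mod_cast hj : (j : ℕ∞) ≤ (max k k₀ : ℕ)) ?_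
    rcases max_choice k k₀ with h | h <;> rw [h]
    · exact hk
    · exact H.le
  have hη : 0 ≤ η := (abs_nonneg _).trans (abs_dirDiff_sub_le hρ hd)
  refine (abs_iteratedDeriv_dirDiff_sub_le (D := D) hm hm' hρ (hsm j hjl)
    (fun θ hθ => ⟨(hd θ hθ).1, (hd θ hθ).2.1⟩) (fun θ hθ => (hd θ hθ).2.2)
    (fun i hi hij x => ?_)).2.trans ?_
  · refine le_trans ?_ (hD i hi (hij.trans hj) x)
    have : (j : ℝ) ≤ (max k k₀ : ℕ) := by exact_mod_cast hj
    gcongr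
  · have h7 : j.factorial ≤ (max k k₀).factorial := Nat.factorial_le hj
    have h8 : D ^ j ≤ D ^ max k k₀ := pow_le_pow_right₀ hD1 hj
    gcongr

/-- The standing assumptions: a rotation number of bounded type, an initial phase with a flat
profile, and a kind of correction. -/
structure Setting (ω M c δ₀ : ℝ) (l : ℕ∞) (g φ : ℝ → ℝ) (tw : Bool)
    (step : ℕ → (ℝ → ℝ) → (ℝ → ℝ) → Prop) (k₀ n₁ : ℕ) (C : ℕ → ℝ) (B nk : ℕ → ℕ) : Prop where
  irrational : Irrational ω
  one_le : 1 ≤ M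
  bdd : ∀ n : ℕ, 1 ≤ n → q ω (n + 1) < M * q ω n
  profile : Profile ω l g
  base : IsBasePhase l g c δ₀ tw φ
  delta_pos : 0 < δ₀
  delta_le : δ₀ ≤ 1
  corrector : Corrector ω c l step k₀ n₁ C B nk

/-- The properties of the phase `φ_n` that are preserved by the construction. The angle between its
stable and its unstable direction is comparable to the initial phase on `I_n`, and equal to it on
`I_n / 10`. -/
structure Stage (ω M c lam : ℝ) (l : ℕ∞) (g φ : ℝ → ℝ) (k₀ n : ℕ) (Φ : ℝ → ℝ) : Prop where
  smooth : ContDiff ℝ l Φ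
  periodic : Function.Periodic (fun x => Φ x - φ x) (2 * Real.pi)
  hyp : HypAt ω M c lam Φ (n - 1)
  inner : ∀ x ∈ crit ω c 10 n, Φ x + dirDiff ω lam Φ (minReturn ω c n) x = φ x
  near : ∀ (m : ℤ) (s : ℝ), |s| ≤ 1 / q ω n ^ 2 →
    |Φ (c + m * Real.pi + s) + dirDiff ω lam Φ (minReturn ω c n) (c + m * Real.pi + s)
      - φ (c + m * Real.pi + s)| ≤ 1 / 2 * (1 - (1 / 2) ^ n) * g |s|
  deriv : ∀ j, 1 ≤ j → j ≤ k₀ → ∀ x,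
    |iteratedDeriv j Φ x - iteratedDeriv j φ x| ≤ 1 - (1 / 2) ^ n

section stage

variable {ω M c δ₀ lam : ℝ} {l : ℕ∞} {g φ : ℝ → ℝ} {tw : Bool}
  {step : ℕ → (ℝ → ℝ) → (ℝ → ℝ) → Prop} {k₀ n₁ : ℕ} {C : ℕ → ℝ} {B nk : ℕ → ℕ}

theorem isLift_of_periodic_sub (S : Setting ω M c δ₀ l g φ tw step k₀ n₁ C B nk) {Φ : ℝ → ℝ}
    (h : Function.Periodic (fun x => Φ x - φ x) (2 * Real.pi)) : IsLift Φ := by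
  have := S.base.isLift.add h
  simpa using this

/-- A perturbation of the initial phase near a critical point, modulo `π`. -/
theorem Setting.exists_eq_add (S : Setting ω M c δ₀ l g φ tw step k₀ n₁ C B nk) {a : ℝ} (m : ℤ)
    {s u : ℝ} (hs : |s| ≤ δ₀) (hu : |u - φ (c + m * Real.pi + s)| ≤ a * g |s|) :
    ∃ (j : ℤ) (r : ℝ), u = r + j * Real.pi ∧ |r| ≤ (1 + a) * g |s| ∧ (1 - a) * g |s| ≤ |r| := by
  obtain ⟨j, σ, hσ, hφ⟩ := S.base.exists_near m
  rw [hφ s hs] at hu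
  have habs : |σ * g s| = g |s| := by rw [abs_mul, hσ, one_mul, S.profile.abs_eq]
  refine ⟨j, u - j * Real.pi, by ring, ?_, ?_⟩
  · have := abs_add_le (u - (j * Real.pi + σ * g s)) (σ * g s)
    rw [show u - (j * Real.pi + σ * g s) + σ * g s = u - j * Real.pi by ring, habs] at this
    linarith
  · have := abs_sub_abs_le_abs_sub (σ * g s) (σ * g s - (u - j * Real.pi))
    rw [show σ * g s - (σ * g s - (u - j * Real.pi)) = u - j * Real.pi by ring, habs,
      show σ * g s - (u - j * Real.pi) = -(u - (j * Real.pi + σ * g s)) by ring, abs_neg] at this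
    linarith

/-- The bound for the derivatives of the correction `e` that replaces directions which differ by
`η`. -/
def DerivBound (ω : ℝ) (l : ℕ∞) (k₀ : ℕ) (C : ℕ → ℝ) (B nk : ℕ → ℕ) (n : ℕ) (η : ℝ) (Φ e : ℝ → ℝ) :
    Prop :=
  ∀ k : ℕ, (k : ℕ∞) ≤ l → nk k ≤ n → ∀ D : ℝ, 1 ≤ D →
    (∀ i, 1 ≤ i → i ≤ max k k₀ → ∀ x,
      |iteratedDeriv i Φ x| * (2 * ((max k k₀ : ℕ) + 1) / rad ω n) ≤ D ^ i) →
    ∀ x, |iteratedDeriv k e x| ≤ C k * q ω n ^ B k * ((max k k₀).factorial * η * D ^ max k k₀)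

/-- The step of the construction, in a form that covers the first step (with `m = 1`, when
`dirDiff` vanishes) and the following ones (with `m` the return time to `I_{n-1}`). -/
theorem Setting.exists_stage (S : Setting ω M c δ₀ l g φ tw step k₀ n₁ C B nk) {p m : ℕ}
    (hp : Large ω M p) (hlam : LamLarge M lam) (hm : 1 ≤ m) (hn₁ : n₁ ≤ p + 1) {Φ : ℝ → ℝ}
    (hΦ : ContDiff ℝ l Φ) (hper : Function.Periodic (fun x => Φ x - φ x) (2 * Real.pi))
    (hyp : HypAt ω M c lam Φ p) {a b ε η Y : ℝ}
    (hδ : 1 / q ω (p + 1) ^ 2 ≤ δ₀) (hgap : gap ω (p + 1) ≤ g (1 / (10 * q ω (p + 1) ^ 2)))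
    (hdom : ∀ x ∈ crit ω c 1 (p + 1), ∀ θ, Near ω Φ x (rad ω (p + 1)) θ →
      DominantAt lam m θ ∧ DominantAt lam (minReturn ω c (p + 1)) θ ∧
      ‖cdirDiff lam m θ - cdirDiff lam (minReturn ω c (p + 1)) θ‖ ≤ η)
    (hinner : ∀ x ∈ crit ω c 10 (p + 1), Φ x + dirDiff ω lam Φ m x = φ x)
    (hnear : ∀ (j : ℤ) (s : ℝ), |s| ≤ 1 / q ω (p + 1) ^ 2 →
      |Φ (c + j * Real.pi + s) + dirDiff ω lam Φ m (c + j * Real.pi + s)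
        - φ (c + j * Real.pi + s)| ≤ a * g |s|)
    (hder : ∀ j, 1 ≤ j → j ≤ k₀ → ∀ x, |iteratedDeriv j Φ x - iteratedDeriv j φ x| ≤ b)
    (hY0 : 0 ≤ Y) (hY : ∀ j, 1 ≤ j → j ≤ k₀ → ∀ x, |iteratedDeriv j φ x| ≤ Y)
    (ha : a + ε ≤ 1 / 2 * (1 - (1 / 2) ^ (p + 1))) (hb : b + ε ≤ 1 - (1 / 2) ^ (p + 1))
    (hε0 : 0 ≤ ε) (hε : ε ≤ 1 / 16)
    (herr : ∀ j ≤ k₀, (C j + 1) * q ω (p + 1) ^ B j *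
      (k₀.factorial * η * ((Y + 1) * (2 * (k₀ + 1)) / rad ω (p + 1)) ^ k₀) ≤ ε * gap ω (p + 1)) :
    ∃ Φ' : ℝ → ℝ, Stage ω M c lam l g φ k₀ (p + 1) Φ' ∧
      step (p + 1) (fun x => nearZero (Φ x + dirDiff ω lam Φ m x) - angle ω c lam Φ (p + 1) x)
        (fun x => Φ' x - Φ x) ∧
      DerivBound ω l k₀ C B nk (p + 1) η Φ (fun x => Φ' x - Φ x) := by
  have hω := S.irrational
  have hH := S.corrector
  have hn := lt_sq_of_le hω hp.lt_sq (show p ≤ p + 1 by omega)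
  have hr := (minReturn_mem hω S.one_le S.bdd hn c).1
  have hρ : 0 < rad ω (p + 1) := Real.exp_pos _
  have hρ1 : rad ω (p + 1) ≤ 1 := Real.exp_le_one_iff.2 (neg_nonpos.2 (q_pos hω _).le)
  have hpow : (0 : ℝ) < (1 / 2) ^ (p + 1) := by positivity
  have hgap1 : gap ω (p + 1) ≤ 1 := Real.exp_le_one_iff.2 (neg_nonpos.2 (Real.sqrt_nonneg _))
  have hgap0 : 0 < gap ω (p + 1) := Real.exp_pos _
  have hq1 := one_le_q hω (p + 1)
  obtain ⟨hh0, hh1⟩ := one_div_sq_le_one hω (p + 1)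
  obtain ⟨e, he1, he2, he3, he4, he5, he6⟩ := hH.exists_dirDiff hn₁ hΦ
    (isLift_of_periodic_sub S hper) hm hr hρ hdom
  set r := minReturn ω c (p + 1) with hr_def
  set D : ℝ := (Y + 1) * (2 * (k₀ + 1)) / rad ω (p + 1) with hD
  have hD1 : 1 ≤ D := by
    rw [hD, le_div_iff₀ hρ, one_mul]
    refine hρ1.trans ?_
    nlinarith [k₀.cast_nonneg (α := ℝ), mul_nonneg hY0 (k₀.cast_nonneg (α := ℝ))]
  have ht : ∀ x ∈ crit ω c 1 (p + 1), |dirDiff ω lam Φ m x - dirDiff ω lam Φ r x| ≤ η :=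
    fun x hx => abs_dirDiff_sub_le hρ (hdom x hx)
  have hη0 : 0 ≤ η := (abs_nonneg _).trans (ht c (mem_crit_one_iff.2 ⟨0, by simpa using hh0.le⟩))
  set E : ℝ := k₀.factorial * η * D ^ k₀ with hE
  -- the estimate of `e` in `C^k` comes with the factor `E`, which is `η` times powers of `1 / rad`
  have hηE : η ≤ E := by
    have h1 : (1 : ℝ) ≤ k₀.factorial := by exact_mod_cast Nat.one_le_iff_ne_zero.2 k₀.factorial_ne_zero
    have h2 : 1 ≤ D ^ k₀ := one_le_pow₀ hD1
    calc η = 1 * η * 1 := by ring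
      _ ≤ E := by rw [hE]; gcongr
  have hE0 : 0 ≤ E := hη0.trans hηE
  have hder' : ∀ j ≤ k₀, ∀ x, |iteratedDeriv j e x| ≤ C j * q ω (p + 1) ^ B j * E := by
    intro j hj x
    have := he6 j ((by exact_mod_cast hj : (j : ℕ∞) ≤ k₀).trans hH.le) ((hH.nk_le j hj).trans hn₁)
      D hD1
    rw [max_eq_right hj] at this
    refine this (fun i hi hik x => ?_) x
    have h1 : |iteratedDeriv i Φ x| ≤ Y + 1 := by
      have h2 := hder i hi hik x
      have h3 := hY i hi hik x
      have h4 := abs_sub_abs_le_abs_sub (iteratedDeriv i Φ x) (iteratedDeriv i φ x)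
      linarith
    refine le_trans ?_ (le_self_pow₀ hD1 (by omega))
    rw [hD, ← mul_div_assoc]
    gcongr
  have herr1 : ∀ j ≤ k₀, C j * q ω (p + 1) ^ B j * E + η ≤ ε * gap ω (p + 1) := by
    intro j hj
    refine le_trans ?_ (herr j hj)
    have h1 : 1 ≤ q ω (p + 1) ^ B j := one_le_pow₀ hq1
    have h2 := hH.nonneg j
    have h3 : η ≤ q ω (p + 1) ^ B j * E := by nlinarith
    linarith
  have hgs : ∀ s : ℝ, |s| ≤ 1 / q ω (p + 1) ^ 2 → g |s| ≤ 1 := fun s hs =>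
    S.profile.le_one _ (abs_nonneg _) (hs.trans hh1)
  have hag : ∀ s : ℝ, |s| ≤ 1 / q ω (p + 1) ^ 2 → 0 ≤ g |s| := fun s hs =>
    S.profile.nonneg (abs_nonneg _)
  have hsub : crit ω c 10 (p + 1) ⊆ crit ω c 1 (p + 1) :=
    crit_subset hω c one_pos (by norm_num) le_rfl
  -- the directions of the new phase, for the return time to `I_n`, are those of the old one
  have hdir : ∀ x ∈ crit ω c 1 (p + 1),
      dirDiff ω lam (fun x => Φ x + e x) r x = dirDiff ω lam Φ r x := by
    intro x hx
    refine dirDiff_congr hr fun i hi hir => ?_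
    simp only [he5 _ (tr_not_mem_of_lt_minReturn hx hi hir), add_zero]
  have hsub_e : (fun x => Φ x + e x - Φ x) = e := by funext x; ring
  refine ⟨fun x => Φ x + e x, ⟨hΦ.add he2, ?_, ?_, ?_, ?_, ?_⟩, ?_, ?_⟩
  · intro x
    have h1 := hper x
    simp only at h1 ⊢
    rw [he3 x]
    linarith
  · exact HypAt.congr hyp fun x hx => by rw [he5 x hx, add_zero]
  · intro x hx
    rw [hdir x (hsub hx), ← hinner x hx, he4 x hx]
    ring
  · intro j s hs
    have hx : c + j * Real.pi + s ∈ crit ω c 1 (p + 1) :=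
      mem_crit_one_iff.2 ⟨j, by rwa [add_sub_cancel_left]⟩
    have hns := hnear j s hs
    have hg0 := hag s hs
    rw [hdir _ hx]
    -- on `I_n / 10` the change of the directions is compensated exactly; elsewhere in `I_n` it is small
    -- compared with the phase itself, which is at least `gap` there
    by_cases hs10 : |s| ≤ 1 / (10 * q ω (p + 1) ^ 2)
    · have hx10 : c + j * Real.pi + s ∈ crit ω c 10 (p + 1) := ⟨j, by rwa [add_sub_cancel_left]⟩
      rw [he4 _ hx10]
      rw [show ∀ u v w z : ℝ, u + (v - w) + w - z = u + v - z by intros; ring]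
      refine hns.trans (mul_le_mul_of_nonneg_right (by linarith) hg0)
    · push Not at hs10
      have h1 := ht _ hx
      have h2 := hder' 0 (Nat.zero_le _) (c + j * Real.pi + s)
      have h3 := herr1 0 (Nat.zero_le _)
      rw [iteratedDeriv_zero] at h2
      have h4 : gap ω (p + 1) ≤ g |s| := hgap.trans (S.profile.mono _ _ (by positivity) hs10.le)
      set x := c + j * Real.pi + s
      have h5 : Φ x + e x + dirDiff ω lam Φ r x - φ x = (Φ x + dirDiff ω lam Φ m x - φ x) + e x -
          (dirDiff ω lam Φ m x - dirDiff ω lam Φ r x) := by ring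
      rw [h5]
      have h6 := abs_sub (Φ x + dirDiff ω lam Φ m x - φ x + e x)
        (dirDiff ω lam Φ m x - dirDiff ω lam Φ r x)
      have h7 := abs_add_le (Φ x + dirDiff ω lam Φ m x - φ x) (e x)
      have h8 : ε * gap ω (p + 1) ≤ ε * g |s| := by gcongr
      calc _ ≤ a * g |s| + ε * g |s| := by linarith
        _ = (a + ε) * g |s| := by ring
        _ ≤ _ := mul_le_mul_of_nonneg_right ha hg0
  · intro j hj hjk x
    have hjl : (j : ℕ∞) ≤ l := (by exact_mod_cast hjk : (j : ℕ∞) ≤ k₀).trans hH.le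
    have h1 := hder j hj hjk x
    have h2 := hder' j hjk x
    have h3 := herr1 j hjk
    have hjl' : (j : WithTop ℕ∞) ≤ l := by exact_mod_cast hjl
    rw [iteratedDeriv_fun_add (hΦ.of_le hjl').contDiffAt (he2.of_le hjl').contDiffAt]
    have h4 := abs_add_le (iteratedDeriv j Φ x - iteratedDeriv j φ x) (iteratedDeriv j e x)
    rw [show iteratedDeriv j Φ x + iteratedDeriv j e x - iteratedDeriv j φ x =
      iteratedDeriv j Φ x - iteratedDeriv j φ x + iteratedDeriv j e x by ring]
    have h5 : ε * gap ω (p + 1) ≤ ε := mul_le_of_le_one_right hε0 hgap1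
    linarith
  · rw [hsub_e]
    refine hH.congr _ _ _ _ (fun x hx => ?_) he1
    obtain ⟨j, s, rfl, hs, -, -⟩ := exists_of_mem_crit hω le_rfl hx
    rw [one_mul] at hs
    -- both angles are small modulo `π`, so that passing to representatives commutes with the difference
    obtain ⟨i, t, h1, h2, -⟩ := S.exists_eq_add j (hs.trans hδ) (hnear j s hs)
    rw [hyp.angle_eq hω S.one_le S.bdd hp hlam (by omega) le_rfl hx, ← hr_def]
    have h3 := ht _ hx
    set x := c + j * Real.pi + s
    have h4 : Φ x + dirDiff ω lam Φ r x =
        (t - (dirDiff ω lam Φ m x - dirDiff ω lam Φ r x)) + i * Real.pi := by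
      rw [show ∀ u v w : ℝ, u - (v - w) + i * Real.pi = (u + i * Real.pi) - v + w by intros; ring,
        ← h1]
      ring
    have hg1 := hgs s hs
    have hg0 := hag s hs
    have hpi := Real.pi_gt_d2
    have h5 : |t| ≤ 3 / 2 := by
      refine h2.trans ?_
      have : (1 + a) * g |s| ≤ (3 / 2) * g |s| :=
        mul_le_mul_of_nonneg_right (by linarith) hg0
      linarith
    have h6 := herr1 0 (Nat.zero_le _)
    have h7 : 0 ≤ C 0 * q ω (p + 1) ^ B 0 * E :=
      mul_nonneg (mul_nonneg (hH.nonneg 0) (by positivity)) hE0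
    have h8 : ε * gap ω (p + 1) ≤ 1 / 16 := by nlinarith
    have h9 := abs_sub t (dirDiff ω lam Φ m x - dirDiff ω lam Φ r x)
    rw [h4, h1, nearZero_add_int_mul, nearZero_add_int_mul, nearZero_eq_self (by linarith),
      nearZero_eq_self (by linarith)]
    ring
  · rw [hsub_e]
    exact he6

end stage

/-! ### The sequence of phases -/

/-- The level `n` is so large that the construction can proceed from level `n` to level `n + 1`. -/
structure GoodLevel (ω M δ₀ Y : ℝ) (g : ℝ → ℝ) (k₀ n₁ : ℕ) (C : ℕ → ℝ) (B : ℕ → ℕ) (n : ℕ) :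
    Prop where
  one_le : 1 ≤ n
  large_pred : Large ω M (n - 1)
  large : Large ω M n
  le : n₁ ≤ n
  delta : 1 / q ω n ^ 2 ≤ δ₀
  gap_le : gap ω n ≤ g (1 / (10 * q ω n ^ 2))
  gap_le_succ : gap ω (n + 1) ≤ g (1 / (10 * q ω (n + 1) ^ 2))
  err : ∀ j ≤ k₀, (C j + 1) * q ω (n + 1) ^ B j * (k₀.factorial * (15 * eta ω M n) *
    ((Y + 1) * (2 * (k₀ + 1)) / rad ω (n + 1)) ^ k₀) ≤ (1 / 2) ^ (n + 3) * gap ω (n + 1)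

theorem exists_seq {α : Type*} (P : ℕ → α → Prop) (R : ℕ → α → α → Prop) (N : ℕ) (x₀ : α)
    (h₀ : P N x₀) (hs : ∀ n, N ≤ n → ∀ x, P n x → ∃ y, P (n + 1) y ∧ R n x y) :
    ∃ u : ℕ → α, u N = x₀ ∧ ∀ n, N ≤ n → P n (u n) ∧ R n (u n) (u (n + 1)) := by
  have hs' : ∀ i : ℕ, ∀ x : {x // P (N + i) x}, ∃ y : {y // P (N + (i + 1)) y}, R (N + i) x y := by
    intro i x
    obtain ⟨y, hy, hR⟩ := hs (N + i) (by omega) x x.2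
    exact ⟨⟨y, hy⟩, hR⟩
  choose f hf using hs'
  let F : ∀ i : ℕ, {x // P (N + i) x} := fun i => Nat.rec ⟨x₀, h₀⟩ f i
  let G : ℕ → α := fun i => (F i).1
  refine ⟨fun n => G (n - N), congrArg G (Nat.sub_self N), fun n hn => ?_⟩
  obtain ⟨i, rfl⟩ := Nat.exists_eq_add_of_le hn
  have h1 : N + i - N = i := by omega
  have h2 : N + i + 1 - N = i + 1 := by omega
  simp only [h1, h2]
  exact ⟨(F i).2, hf i (F i)⟩

section sequence

variable {ω M c δ₀ : ℝ} {l : ℕ∞} {g φ : ℝ → ℝ} {tw : Bool}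
  {step : ℕ → (ℝ → ℝ) → (ℝ → ℝ) → Prop} {k₀ n₁ : ℕ} {C : ℕ → ℝ} {B nk : ℕ → ℕ}

theorem tendsto_one_div_sq {ω : ℝ} (hω : Irrational ω) :
    Filter.Tendsto (fun n => 1 / q ω n ^ 2) Filter.atTop (nhds 0) := by
  have h1 : Filter.Tendsto (fun n => q ω n ^ 2) Filter.atTop Filter.atTop :=
    (Filter.tendsto_pow_atTop two_ne_zero).comp (tendsto_q hω)
  simp only [one_div]
  exact h1.inv_tendsto_atTop

theorem Setting.eventually_goodLevel (S : Setting ω M c δ₀ l g φ tw step k₀ n₁ C B nk) (Y : ℝ) :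
    ∀ᶠ n in Filter.atTop, GoodLevel ω M δ₀ Y g k₀ n₁ C B n := by
  have hω := S.irrational
  have h1 := eventually_large hω S.one_le S.bdd
  have h2 := (Filter.tendsto_sub_atTop_nat 1).eventually h1
  have h3 : ∀ᶠ n in Filter.atTop, 1 / q ω n ^ 2 ≤ δ₀ :=
    (tendsto_one_div_sq hω).eventually (eventually_le_nhds S.delta_pos)
  have h4 := S.profile.gap_le
  have h5 := (Filter.tendsto_add_atTop_nat 1).eventually h4
  have h6 : ∀ᶠ n in Filter.atTop, ∀ j ∈ Finset.range (k₀ + 1),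
      ((C j + 1) * (k₀.factorial * 15 * ((Y + 1) * (2 * (k₀ + 1))) ^ k₀)) * q ω (n + 1) ^ B j *
        eta ω M n * Real.exp (k₀ * q ω (n + 1)) ≤ (1 / 2) ^ (n + 3) * gap ω (n + 1) := by
    rw [Filter.eventually_all_finset]
    intro j _
    exact eventually_eta_le hω S.one_le S.bdd _ _ _
  filter_upwards [h1, h2, h3, h4, h5, h6, Filter.eventually_ge_atTop 1,
    Filter.eventually_ge_atTop n₁] with n h1 h2 h3 h4 h5 h6 h7 h8
  refine ⟨h7, h2, h1, h8, h3, h4, h5, fun j hj => ?_⟩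
  refine le_trans (le_of_eq ?_) (h6 j (Finset.mem_range.2 (by omega)))
  unfold rad
  rw [div_pow, ← Real.exp_nat_mul, mul_neg, Real.exp_neg, div_inv_eq_mul]
  ring

/-- The relation between consecutive phases of the construction. -/
structure Next (ω M c lam : ℝ) (l : ℕ∞) (step : ℕ → (ℝ → ℝ) → (ℝ → ℝ) → Prop) (k₀ : ℕ) (C : ℕ → ℝ)
    (B nk : ℕ → ℕ) (n : ℕ) (Φ Φ' : ℝ → ℝ) : Prop where
  hyperbolic : HyperbolicOn ω c lam Φ n
  hyperbolic_next : HyperbolicOn ω c lam Φ (n + 1)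
  next : step (n + 1) (fun x => angle ω c lam Φ n x - angle ω c lam Φ (n + 1) x)
    (fun x => Φ' x - Φ x)
  deriv : DerivBound ω l k₀ C B nk (n + 1) (15 * eta ω M n) Φ (fun x => Φ' x - Φ x)

/-- The induction step: the angle at level `n` is comparable to the profile `g`, hence bounded from
below on `I_n ∖ I_{n+1}`, which gives hyperbolicity at the next level and the next correction. -/
theorem Setting.exists_next (S : Setting ω M c δ₀ l g φ tw step k₀ n₁ C B nk) {Y lam : ℝ}
    (hlam : LamLarge M lam) (hY0 : 0 ≤ Y)
    (hY : ∀ j, 1 ≤ j → j ≤ k₀ → ∀ x, |iteratedDeriv j φ x| ≤ Y) {n : ℕ}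
    (hn : GoodLevel ω M δ₀ Y g k₀ n₁ C B n) {Φ : ℝ → ℝ} (h : Stage ω M c lam l g φ k₀ n Φ) :
    ∃ Φ', Stage ω M c lam l g φ k₀ (n + 1) Φ' ∧ Next ω M c lam l step k₀ C B nk n Φ Φ' := by
  obtain ⟨p, rfl⟩ := Nat.exists_eq_add_of_le' hn.one_le
  have hω := S.irrational
  have hp : Large ω M p := hn.large_pred
  have hyp : HypAt ω M c lam Φ p := h.hyp
  have hn1 := lt_sq_of_le hω hp.lt_sq (show p ≤ p + 1 by omega)
  have hr := (minReturn_mem hω S.one_le S.bdd hn1 c).1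
  have hpow : (0 : ℝ) < (1 / 2) ^ (p + 1) := by positivity
  have hpow1 : (1 / 2 : ℝ) ^ (p + 1) ≤ 1 / 2 := by
    rw [pow_succ]
    have : (1 / 2 : ℝ) ^ p ≤ 1 := pow_le_one₀ (by norm_num) (by norm_num)
    linarith
  have hpow2 : (1 / 2 : ℝ) ^ (p + 1 + 1) = (1 / 2) ^ (p + 1) / 2 := by rw [pow_succ]; ring
  have hpow3 : (1 / 2 : ℝ) ^ (p + 1 + 3) = (1 / 2) ^ (p + 1) / 8 := by rw [pow_add]; ring
  have hyp' : HypAt ω M c lam Φ (p + 1) := by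
    refine hyp.succ hω S.one_le S.bdd hp hlam fun y hy hy' => ?_
    obtain ⟨m, s, rfl, hs, -, -⟩ := exists_of_mem_crit hω le_rfl hy
    rw [one_mul] at hs
    obtain ⟨j, r, h1, h2, h3⟩ := S.exists_eq_add m (hs.trans hn.delta) (h.near m s hs)
    rw [h1, add_comm r, abs_sin_int_mul_pi_add]
    have hg0 := S.profile.nonneg (abs_nonneg s)
    have hg1 : g |s| ≤ 1 :=
      S.profile.le_one _ (abs_nonneg _) (hs.trans (one_div_sq_le_one hω _).2)
    -- outside `I_{n+1}` the angle is comparable to `g |s|`, hence at least of the order of `gap`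
    have hs' : 1 / q ω (p + 2) ^ 2 < |s| := by
      by_contra! hle
      exact hy' (mem_crit_one_iff.2 ⟨m, by rwa [add_sub_cancel_left]⟩)
    have hgap : gap ω (p + 2) ≤ g |s| := by
      refine hn.gap_le_succ.trans (S.profile.mono _ _ (by positivity) (le_trans ?_ hs'.le))
      have := q_pos hω (p + 2)
      apply one_div_le_one_div_of_le (by positivity)
      change q ω (p + 2) ^ 2 ≤ 10 * q ω (p + 2) ^ 2
      nlinarith [sq_nonneg (q ω (p + 2))]
    have hpi := Real.pi_gt_d2
    have hpi' := Real.pi_lt_d2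
    have hr2 : |r| ≤ Real.pi / 2 := by
      refine h2.trans ?_
      nlinarith
    refine le_trans ?_ (Real.mul_abs_le_abs_sin hr2)
    have h4 : 1 / 2 * g |s| ≤ |r| := le_trans (mul_le_mul_of_nonneg_right (by linarith) hg0) h3
    -- Jordan's inequality gives `3 / 10 = (1 / 2) * (3 / 5)`
    have h5 : (3 : ℝ) / 5 ≤ 2 / Real.pi := by
      rw [le_div_iff₀ Real.pi_pos]; linarith
    nlinarith [abs_nonneg r]
  have hrad : rad ω (p + 2) ≤ 1 := Real.exp_le_one_iff.2 (neg_nonpos.2 (q_pos hω _).le)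
  obtain ⟨Φ', h1, h2, h3⟩ := S.exists_stage (m := minReturn ω c (p + 1)) (p := p + 1) (Φ := Φ)
    (a := 1 / 2 * (1 - (1 / 2) ^ (p + 1))) (b := 1 - (1 / 2) ^ (p + 1))
    (ε := (1 / 2) ^ (p + 1 + 3)) (η := 15 * eta ω M (p + 1)) (Y := Y) hn.large hlam hr
    (hn.le.trans (by omega)) h.smooth h.periodic hyp'
    (le_trans (by
      have := q_pos hω (p + 1)
      have := q_mono ω (show p + 1 ≤ p + 2 by omega)
      apply one_div_le_one_div_of_le (by positivity)
      change q ω (p + 1) ^ 2 ≤ q ω (p + 2) ^ 2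
      gcongr) hn.delta) hn.gap_le_succ
    (fun x hx θ hθ => by
      have g1 := hyp'.pairGood hω S.one_le S.bdd hn.large hlam (n := p + 1) le_rfl (by omega) hx hθ
      have g2 := hyp'.pairGood hω S.one_le S.bdd hn.large hlam (n := p + 1 + 1) (by omega) le_rfl hx hθ
      exact ⟨g1.dominant, g2.dominant,
        g1.norm_cdirDiff_sub_le hω S.one_le S.bdd hn.large hlam (hθ.abs_im_le hrad) g2⟩)
    (fun x hx => h.inner x (crit_subset hω c (by norm_num) le_rfl (by omega) hx))
    (fun j s hs => h.near j s (hs.trans (by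
      have := q_pos hω (p + 1)
      have := q_mono ω (show p + 1 ≤ p + 2 by omega)
      apply one_div_le_one_div_of_le (by positivity)
      change q ω (p + 1) ^ 2 ≤ q ω (p + 2) ^ 2
      gcongr)))
    h.deriv hY0 hY (by rw [hpow2, hpow3]; linarith) (by rw [hpow2, hpow3]; linarith)
    (by positivity) (by rw [hpow3]; linarith) hn.err
  refine ⟨Φ', h1, hyp.hyperbolicOn hω S.one_le S.bdd hp hlam,
    hyp'.hyperbolicOn hω S.one_le S.bdd hn.large hlam, ?_, h3⟩
  refine S.corrector.congr _ _ _ _ (fun x hx => ?_) h2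
  rw [hyp.angle_eq hω S.one_le S.bdd hp hlam (n := p + 1) (by omega) le_rfl
    (crit_subset hω c one_pos le_rfl (by omega) hx)]

/-- The first correction is small because `lam` is large, not because the level is. -/
theorem Setting.eventually_first (S : Setting ω M c δ₀ l g φ tw step k₀ n₁ C B nk) {Y : ℝ}
    (hY0 : 0 ≤ Y) (hY : ∀ j, 1 ≤ j → j ≤ k₀ → ∀ x, |iteratedDeriv j φ x| ≤ Y) {n : ℕ}
    (hn : GoodLevel ω M δ₀ Y g k₀ n₁ C B n) :
    ∀ᶠ lam in Filter.atTop, LamLarge M lam ∧ ∃ Φ, Stage ω M c lam l g φ k₀ n Φ ∧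
      HyperbolicOn ω c lam φ n ∧
      step n (fun x => nearZero (φ x) - angle ω c lam φ n x) (fun x => Φ x - φ x) := by
  obtain ⟨p, rfl⟩ := Nat.exists_eq_add_of_le' hn.one_le
  have hω := S.irrational
  have hp : Large ω M p := hn.large_pred
  have hgap0 : 0 < gap ω (p + 1) := Real.exp_pos _
  have hρ : 0 < rad ω (p + 1) := Real.exp_pos _
  have hq := q_pos hω (p + 1)
  obtain ⟨K, hK⟩ : ∃ K : ℕ → ℝ, ∀ j, K j = (C j + 1) * q ω (p + 1) ^ B j *
      (k₀.factorial * ((Y + 1) * (2 * (k₀ + 1)) / rad ω (p + 1)) ^ k₀) := ⟨_, fun _ => rfl⟩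
  have hK0 : ∀ j, 0 ≤ K j := fun j => by
    have := S.corrector.nonneg j
    rw [hK]
    positivity
  -- `Z` depends on the level only, so that a large `lam` makes the first correction small against it
  obtain ⟨Z, hZ⟩ : ∃ Z, Z = 1 + ∑ j ∈ Finset.range (k₀ + 1), K j := ⟨_, rfl⟩
  have hZ1 : 1 ≤ Z := by
    have := Finset.sum_nonneg fun j (_ : j ∈ Finset.range (k₀ + 1)) => hK0 j
    linarith
  have hKZ : ∀ j ≤ k₀, K j ≤ Z := fun j hj => by
    have := Finset.single_le_sum (f := K) (fun j _ => hK0 j)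
      (Finset.mem_range.2 (by omega : j < k₀ + 1))
    linarith
  have hsin := fun x (hx : x ∉ crit ω c 1 (p + 1)) =>
    S.base.gap_le_abs_sin hω S.profile S.delta_le hn.delta hn.gap_le hx
  have hpow1 : (1 / 2 : ℝ) ^ (p + 1) ≤ 1 / 2 := by
    rw [pow_succ]
    have : (1 / 2 : ℝ) ^ p ≤ 1 := pow_le_one₀ (by norm_num) (by norm_num)
    linarith
  filter_upwards [eventually_lamLarge S.one_le, eventually_hypAt S.one_le hp c,
    eventually_norm_cdirDiff_le hω S.one_le S.bdd hp c
      (τ := 1 / 16 * gap ω (p + 1) / Z) (by positivity)] with lam h1 h2 h3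
  refine ⟨h1, ?_⟩
  have hyp := h2 φ hsin
  obtain ⟨Φ, a1, a2, -⟩ := S.exists_stage (m := 1) (p := p) (Φ := φ) (a := 0) (b := 0)
    (ε := 1 / 16) (Y := Y) hp h1 le_rfl hn.le S.base.smooth (fun x => by simp) hyp hn.delta hn.gap_le
    (h3 φ hsin) (fun x _ => by rw [dirDiff_one, add_zero])
    (fun j s _ => by rw [dirDiff_one, add_zero, sub_self, abs_zero, zero_mul])
    (fun j _ _ x => by rw [sub_self, abs_zero]) hY0 hY (by linarith) (by linarith) (by norm_num)
    le_rfl (fun j hj => by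
      have e : (C j + 1) * q ω (p + 1) ^ B j * (k₀.factorial * (1 / 16 * gap ω (p + 1) / Z) *
          ((Y + 1) * (2 * (k₀ + 1)) / rad ω (p + 1)) ^ k₀) = K j * (1 / 16 * gap ω (p + 1) / Z) := by
        rw [hK]; ring
      rw [e, mul_div_assoc', div_le_iff₀ (by linarith), mul_comm]
      exact mul_le_mul_of_nonneg_left (hKZ j hj) (by positivity))
  refine ⟨Φ, a1, hyp.hyperbolicOn hω S.one_le S.bdd hp h1, ?_⟩
  simpa only [dirDiff_one, add_zero] using a2

/-- The construction can be carried out from any level from which on all the levels are good. -/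
theorem Setting.eventually_construction (S : Setting ω M c δ₀ l g φ tw step k₀ n₁ C B nk) {Y : ℝ}
    (hY0 : 0 ≤ Y) (hY : ∀ j, 1 ≤ j → j ≤ k₀ → ∀ x, |iteratedDeriv j φ x| ≤ Y) {N : ℕ}
    (hN : ∀ n, N ≤ n → GoodLevel ω M δ₀ Y g k₀ n₁ C B n) :
    ∀ᶠ lam in Filter.atTop, LamLarge M lam ∧ ∃ Φ : ℕ → ℝ → ℝ, IsConstruction ω c lam N step φ Φ ∧
      ∀ n, N ≤ n → Stage ω M c lam l g φ k₀ n (Φ n) ∧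
        Next ω M c lam l step k₀ C B nk n (Φ n) (Φ (n + 1)) := by
  filter_upwards [S.eventually_first hY0 hY (hN N le_rfl)] with lam h
  obtain ⟨hlam, Φ₀, h1, h2, h3⟩ := h
  refine ⟨hlam, ?_⟩
  obtain ⟨Φ, e0, hΦ⟩ := exists_seq (fun n => Stage ω M c lam l g φ k₀ n)
    (fun n => Next ω M c lam l step k₀ C B nk n) N Φ₀ h1
    (fun n hn Ψ hΨ => S.exists_next hlam hY0 hY (hN n hn) hΨ)
  exact ⟨Φ, ⟨h2, by rw [e0]; exact h3, fun n hn => (hΦ n hn).2.hyperbolic,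
    fun n hn => (hΦ n hn).2.hyperbolic_next, fun n hn => (hΦ n hn).2.next⟩, hΦ⟩

end sequence

/-! ### Convergence of the phases -/

section growth

variable {ω M c δ₀ lam : ℝ} {l : ℕ∞} {g φ : ℝ → ℝ} {tw : Bool}
  {step : ℕ → (ℝ → ℝ) → (ℝ → ℝ) → Prop} {k₀ n₁ : ℕ} {C : ℕ → ℝ} {B nk : ℕ → ℕ}

/-- A bound for the derivatives of the phases of order at most `max k k₀`, where the bound for the
highest one may be larger, yields a bound for those of the correction that is linear in it. -/
theorem Setting.eventually_abs_iteratedDeriv_le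
    (S : Setting ω M c δ₀ l g φ tw step k₀ n₁ C B nk) {N : ℕ} {Φ : ℕ → ℝ → ℝ}
    (hΦ : ∀ n, N ≤ n → Next ω M c lam l step k₀ C B nk n (Φ n) (Φ (n + 1))) {k : ℕ}
    (hk : (k : ℕ∞) ≤ l) {Y : ℝ} (hY0 : 0 ≤ Y) : ∀ᶠ n in Filter.atTop, ∀ y : ℝ, 0 ≤ y →
      (∀ i, 1 ≤ i → i < max k k₀ → ∀ x, |iteratedDeriv i (Φ n) x| ≤ Y) →
      (∀ x, 1 ≤ max k k₀ → |iteratedDeriv (max k k₀) (Φ n) x| ≤ y) →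
      ∀ x, |iteratedDeriv k (fun x => Φ (n + 1) x - Φ n x) x| ≤ (1 / 2) ^ n * (1 + y) := by
  have hω := S.irrational
  set K := max k k₀ with hK
  filter_upwards [eventually_eta_le hω S.one_le S.bdd
    (C k * (K.factorial * 15 * ((Y + 1) * (2 * (K + 1))) ^ K)) (B k) K,
    Filter.eventually_ge_atTop N, Filter.eventually_ge_atTop (nk k)] with n h1 h2 h3 y hy h4 h5 x
  have hρ : 0 < rad ω (n + 1) := Real.exp_pos _
  have hρ1 : rad ω (n + 1) ≤ 1 := Real.exp_le_one_iff.2 (neg_nonpos.2 (q_pos hω _).le)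
  obtain ⟨P, hP⟩ : ∃ P, P = (Y + 1) * (2 * (K + 1)) / rad ω (n + 1) := ⟨_, rfl⟩
  have hP1 : 1 ≤ P := by
    rw [hP, le_div_iff₀ hρ, one_mul]
    refine hρ1.trans ?_
    nlinarith [K.cast_nonneg (α := ℝ), mul_nonneg hY0 (K.cast_nonneg (α := ℝ))]
  -- with `w ^ K = 1 + y`, `DerivBound` applies with `D = P * w`, and `D ^ K` is linear in `y`
  obtain ⟨w, hw1, hw⟩ : ∃ w : ℝ, 1 ≤ w ∧ (1 ≤ K → w ^ K = 1 + y) ∧ (K = 0 → w = 1) := by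
    rcases Nat.eq_zero_or_pos K with h | h
    · exact ⟨1, le_rfl, fun h' => by omega, fun _ => rfl⟩
    · refine ⟨(1 + y) ^ ((K : ℝ)⁻¹), Real.one_le_rpow (by linarith) (by positivity), fun _ => ?_,
        fun h' => by omega⟩
      exact Real.rpow_inv_natCast_pow (by linarith) (by omega)
  have hwK : w ^ K ≤ 1 + y := by
    rcases Nat.eq_zero_or_pos K with h | h
    · rw [h, pow_zero]; linarith
    · exact (hw.1 h).le
  have hD1 : 1 ≤ P * w := by nlinarith
  have key := (hΦ n h2).deriv k hk (by omega) (P * w) hD1 (fun i hi hik x => ?_) x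
  · refine key.trans ?_
    rw [← hK, mul_pow]
    have hη : 0 < eta ω M n := Real.exp_pos _
    have hCk := S.corrector.nonneg k
    have hq := q_pos hω (n + 1)
    have hgap1 : gap ω (n + 1) ≤ 1 := Real.exp_le_one_iff.2 (neg_nonpos.2 (Real.sqrt_nonneg _))
    have e : C k * q ω (n + 1) ^ B k * (K.factorial * (15 * eta ω M n) * P ^ K) ≤
        (1 / 2) ^ (n + 3) * gap ω (n + 1) := by
      refine le_trans (le_of_eq ?_) h1
      rw [hP]
      unfold rad
      rw [div_pow, ← Real.exp_nat_mul, mul_neg, Real.exp_neg, div_inv_eq_mul]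
      ring
    have e2 : (1 / 2 : ℝ) ^ (n + 3) * gap ω (n + 1) ≤ (1 / 2) ^ n := by
      rw [pow_add]
      have : (0 : ℝ) < (1 / 2) ^ n := by positivity
      nlinarith
    calc _ = C k * q ω (n + 1) ^ B k * (K.factorial * (15 * eta ω M n) * P ^ K) * w ^ K := by ring
      _ ≤ (1 / 2) ^ n * (1 + y) :=
          mul_le_mul (e.trans e2) hwK (by positivity) (by positivity)
  · have hPA : ∀ z, z * (2 * ((K : ℕ) + 1) / rad ω (n + 1)) = z * (2 * (K + 1)) / rad ω (n + 1) :=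
      fun z => by rw [mul_div_assoc']
    rw [← hK] at hik ⊢
    rw [hPA, mul_pow]
    rcases hik.lt_or_eq with hlt | rfl
    · have h6 : |iteratedDeriv i (Φ n) x| ≤ Y + 1 := (h4 i hi hlt x).trans (by linarith)
      have h7 : P ≤ P ^ i := le_self_pow₀ hP1 (by omega)
      have h8 : 1 ≤ w ^ i := one_le_pow₀ hw1
      calc _ ≤ P := by rw [hP]; gcongr
        _ ≤ P ^ i * 1 := by linarith
        _ ≤ _ := by gcongr
    · have h6 := h5 x hi
      rw [hw.1 hi]
      have h7 : P ≤ P ^ K := le_self_pow₀ hP1 (by omega)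
      calc _ ≤ y * (2 * (K + 1)) / rad ω (n + 1) := by gcongr
        _ ≤ P * (1 + y) := by
            rw [hP, div_mul_eq_mul_div]
            refine div_le_div_of_nonneg_right ?_ hρ.le
            have h8 : 0 ≤ 2 * ((K : ℝ) + 1) := by positivity
            nlinarith [mul_nonneg hY0 h8, mul_nonneg hy h8, mul_nonneg (mul_nonneg hY0 hy) h8]
        _ ≤ _ := by gcongr

theorem Setting.exists_bound_of_le (S : Setting ω M c δ₀ l g φ tw step k₀ n₁ C B nk) {N : ℕ}
    {Φ : ℕ → ℝ → ℝ} (hS : ∀ n, N ≤ n → Stage ω M c lam l g φ k₀ n (Φ n)) (k : ℕ)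
    (hk : (k : ℕ∞) ≤ l) (hkk : k ≤ k₀) : ∃ Z, 0 ≤ Z ∧ ∀ᶠ n in Filter.atTop, ∀ i, 1 ≤ i → i ≤ k →
      ∀ x, |iteratedDeriv i (Φ n) x| ≤ Z := by
  obtain ⟨Y, hY0, hY⟩ := S.base.isLift.exists_bound S.base.smooth k hk
  refine ⟨Y + 1, by linarith, ?_⟩
  filter_upwards [Filter.eventually_ge_atTop N] with n hn i hi hik x
  have h1 := (hS n hn).deriv i hi (hik.trans hkk) x
  have h2 := hY i hi hik x
  have h3 := abs_sub_abs_le_abs_sub (iteratedDeriv i (Φ n) x) (iteratedDeriv i φ x)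
  have h4 : (0 : ℝ) < (1 / 2) ^ n := by positivity
  linarith

/-- The derivatives of the phases are bounded. -/
theorem Setting.exists_bound (S : Setting ω M c δ₀ l g φ tw step k₀ n₁ C B nk) {N : ℕ}
    {Φ : ℕ → ℝ → ℝ} (hS : ∀ n, N ≤ n → Stage ω M c lam l g φ k₀ n (Φ n))
    (hΦ : ∀ n, N ≤ n → Next ω M c lam l step k₀ C B nk n (Φ n) (Φ (n + 1))) (k : ℕ)
    (hk : (k : ℕ∞) ≤ l) : ∃ Z, 0 ≤ Z ∧ ∀ᶠ n in Filter.atTop, ∀ i, 1 ≤ i → i ≤ k → ∀ x,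
      |iteratedDeriv i (Φ n) x| ≤ Z := by
  induction k with
  | zero => exact ⟨0, le_rfl, Filter.Eventually.of_forall fun n i h1 h2 => by omega⟩
  | succ k ih =>
    rcases le_or_gt (k + 1) k₀ with hkk | hkk
    · exact S.exists_bound_of_le hS (k + 1) hk hkk
    have hkl : (k : ℕ∞) ≤ l := le_trans (by exact_mod_cast k.le_succ) hk
    have hkl' : ((k + 1 : ℕ) : WithTop ℕ∞) ≤ l := by exact_mod_cast hk
    obtain ⟨Z, hZ0, hZ⟩ := ih hkl
    have hmax : max (k + 1) k₀ = k + 1 := max_eq_left hkk.le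
    have hgrow := S.eventually_abs_iteratedDeriv_le hΦ hk hZ0
    rw [hmax] at hgrow
    obtain ⟨n₂, hn₂⟩ := Filter.eventually_atTop.1
      ((hZ.and hgrow).and (Filter.eventually_ge_atTop N))
    have hN : N ≤ n₂ := (hn₂ n₂ le_rfl).2
    obtain ⟨Y, hY0, hY⟩ := (isLift_of_periodic_sub S (hS n₂ hN).periodic).exists_bound
      (hS n₂ hN).smooth (k + 1) hk
    -- the top derivative grows at most by the factor `1 + (1 / 2) ^ n` in the step at level `n`, and the
    -- product of these factors converges
    have claim : ∀ i x, 1 + |iteratedDeriv (k + 1) (Φ (n₂ + i)) x| ≤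
        (1 + Y) * Real.exp (2 * (1 / 2) ^ n₂ - 2 * (1 / 2) ^ (n₂ + i)) := by
      intro i
      induction i with
      | zero =>
        intro x
        rw [add_zero, sub_self, Real.exp_zero, mul_one]
        have := hY (k + 1) (by omega) le_rfl x
        linarith
      | succ i ih' =>
        intro x
        set G := (1 + Y) * Real.exp (2 * (1 / 2) ^ n₂ - 2 * (1 / 2) ^ (n₂ + i)) with hG
        obtain ⟨⟨h1, h2⟩, h3⟩ := hn₂ (n₂ + i) (by omega)
        have h4 : 0 ≤ G - 1 := by
          have := ih' x
          have := abs_nonneg (iteratedDeriv (k + 1) (Φ (n₂ + i)) x)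
          linarith
        have h5 := h2 (G - 1) h4 (fun j hj hjk x => h1 j hj (by omega) x)
          (fun x _ => by have := ih' x; linarith) x
        have e : Φ (n₂ + (i + 1)) = fun x => Φ (n₂ + i) x + (Φ (n₂ + i + 1) x - Φ (n₂ + i) x) := by
          funext x
          rw [← add_assoc]
          ring
        have s1 := (hS (n₂ + i) h3).smooth.of_le hkl'
        have s2 := (hS (n₂ + i + 1) (by omega)).smooth.of_le hkl'
        have h6 : |iteratedDeriv (k + 1) (Φ (n₂ + (i + 1))) x| ≤
            |iteratedDeriv (k + 1) (Φ (n₂ + i)) x| + (1 / 2) ^ (n₂ + i) * (1 + (G - 1)) := by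
          rw [e, iteratedDeriv_fun_add s1.contDiffAt (s2.sub s1).contDiffAt]
          exact (abs_add_le _ _).trans (by linarith)
        have h7 := ih' x
        have h8 := Real.add_one_le_exp ((1 / 2 : ℝ) ^ (n₂ + i))
        have h9 : (1 + Y) * Real.exp (2 * (1 / 2) ^ n₂ - 2 * (1 / 2) ^ (n₂ + (i + 1))) =
            G * Real.exp ((1 / 2) ^ (n₂ + i)) := by
          rw [hG, mul_assoc, ← Real.exp_add]
          congr 2
          rw [← add_assoc, pow_succ]
          ring
        rw [h9]
        have h10 : 0 ≤ G := by linarith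
        nlinarith
    refine ⟨max Z ((1 + Y) * Real.exp 2), le_max_of_le_left hZ0, ?_⟩
    filter_upwards [Filter.eventually_ge_atTop n₂, hZ] with n hn hZn i hi hik x
    rcases hik.lt_or_eq with hlt | rfl
    · exact (hZn i hi (by omega) x).trans (le_max_left _ _)
    · refine le_trans ?_ (le_max_right _ _)
      obtain ⟨i, rfl⟩ := Nat.exists_eq_add_of_le hn
      have h1 := claim i x
      have h2 : (1 / 2 : ℝ) ^ n₂ ≤ 1 := pow_le_one₀ (by norm_num) (by norm_num)
      have h3 : (0 : ℝ) ≤ (1 / 2) ^ (n₂ + i) := by positivity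
      have h4 : Real.exp (2 * (1 / 2) ^ n₂ - 2 * (1 / 2) ^ (n₂ + i)) ≤ Real.exp 2 :=
        Real.exp_le_exp.2 (by linarith)
      have h5 : (1 + Y) * Real.exp (2 * (1 / 2) ^ n₂ - 2 * (1 / 2) ^ (n₂ + i)) ≤
        (1 + Y) * Real.exp 2 := by gcongr
      linarith

theorem Setting.exists_summable_bound (S : Setting ω M c δ₀ l g φ tw step k₀ n₁ C B nk) {N : ℕ}
    {Φ : ℕ → ℝ → ℝ} (hS : ∀ n, N ≤ n → Stage ω M c lam l g φ k₀ n (Φ n))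
    (hΦ : ∀ n, N ≤ n → Next ω M c lam l step k₀ C B nk n (Φ n) (Φ (n + 1))) (k : ℕ)
    (hk : (k : ℕ∞) ≤ l) : ∃ Z : ℝ, ∀ᶠ n in Filter.atTop, ∀ x,
      |iteratedDeriv k (fun x => Φ (n + 1) x - Φ n x) x| ≤ Z * (1 / 2) ^ n := by
  have hK : ((max k k₀ : ℕ) : ℕ∞) ≤ l := by
    rcases max_choice k k₀ with h | h <;> rw [h]
    · exact hk
    · exact S.corrector.le
  obtain ⟨Z, hZ0, hZ⟩ := S.exists_bound hS hΦ _ hK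
  refine ⟨1 + Z, ?_⟩
  filter_upwards [hZ, S.eventually_abs_iteratedDeriv_le hΦ hk hZ0] with n h1 h2 x
  rw [mul_comm]
  exact h2 Z hZ0 (fun i hi hik x => h1 i hi hik.le x) (fun x hx => h1 _ hx le_rfl x) x

end growth

/-- A sequence of functions whose increments decay geometrically in `C^l` converges in `C^l`. -/
theorem exists_limit {l : ℕ∞} {f : ℕ → ℝ → ℝ} (hf : ∀ᶠ n in Filter.atTop, ContDiff ℝ l (f n))
    (h : ∀ k : ℕ, (k : ℕ∞) ≤ l → ∃ Z : ℝ, ∀ᶠ n in Filter.atTop, ∀ x,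
      |iteratedDeriv k (fun x => f (n + 1) x - f n x) x| ≤ Z * (1 / 2) ^ n) :
    ∃ F : ℝ → ℝ, ContDiff ℝ l F ∧ ∀ k : ℕ, (k : ℕ∞) ≤ l → ∀ ε > 0, ∀ᶠ n in Filter.atTop, ∀ x,
      |iteratedDeriv k (f n) x - iteratedDeriv k F x| ≤ ε := by
  have h1 : ∀ k : ℕ, (k : ℕ∞) ≤ l → ∃ G : ℝ → ℝ, ∀ ε > 0, ∀ᶠ n in Filter.atTop, ∀ x,
      |iteratedDeriv k (f n) x - G x| ≤ ε := by
    intro k hk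
    have hk' : (k : WithTop ℕ∞) ≤ l := by exact_mod_cast hk
    obtain ⟨Z, hZ⟩ := h k hk
    obtain ⟨n₀, hn₀⟩ := Filter.eventually_atTop.1 (hZ.and hf)
    have hd : ∀ x i, dist (iteratedDeriv k (f (n₀ + i)) x) (iteratedDeriv k (f (n₀ + (i + 1))) x) ≤
        Z * (1 / 2) ^ n₀ * (1 / 2) ^ i := by
      intro x i
      have a1 := (hn₀ (n₀ + i) (by omega)).1 x
      have s1 := ((hn₀ (n₀ + i) (by omega)).2.of_le hk')
      have s2 := ((hn₀ (n₀ + i + 1) (by omega)).2.of_le hk')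
      rw [iteratedDeriv_fun_sub s2.contDiffAt s1.contDiffAt, pow_add, ← mul_assoc] at a1
      rw [dist_comm, Real.dist_eq]
      exact a1
    have hlim : ∀ x, ∃ a, Filter.Tendsto (fun i => iteratedDeriv k (f (n₀ + i)) x) Filter.atTop
        (nhds a) := fun x =>
      cauchySeq_tendsto_of_complete (cauchySeq_of_le_geometric _ _ (by norm_num) (hd x))
    choose G hG using hlim
    refine ⟨G, fun ε hε => ?_⟩
    have hsmall : Filter.Tendsto (fun i : ℕ => Z * (1 / 2) ^ n₀ * (1 / 2) ^ i / (1 - 1 / 2))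
        Filter.atTop (nhds (Z * (1 / 2) ^ n₀ * 0 / (1 - 1 / 2))) :=
      ((tendsto_pow_atTop_nhds_zero_of_lt_one (by norm_num) (by norm_num)).const_mul _).div_const _
    rw [mul_zero, zero_div] at hsmall
    have hsmall' := (Filter.tendsto_sub_atTop_nat n₀).eventually
      (hsmall.eventually (eventually_le_nhds hε))
    filter_upwards [hsmall', Filter.eventually_ge_atTop n₀] with n hn hnn x
    obtain ⟨i, rfl⟩ := Nat.exists_eq_add_of_le hnn
    rw [add_tsub_cancel_left] at hn
    have := dist_le_of_le_geometric_of_tendsto _ _ (by norm_num) (hd x) (hG x) i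
    rw [Real.dist_eq] at this
    exact this.trans hn
  choose! G hG using h1
  have hunif : ∀ k : ℕ, (k : ℕ∞) ≤ l →
      TendstoUniformly (fun n => iteratedDeriv k (f n)) (G k) Filter.atTop := by
    intro k hk
    rw [Metric.tendstoUniformly_iff]
    intro ε hε
    filter_upwards [hG k hk (ε / 2) (by linarith)] with n hn x
    rw [dist_comm, Real.dist_eq]
    linarith [hn x]
  have hder : ∀ k : ℕ, ((k + 1 : ℕ) : ℕ∞) ≤ l → ∀ x, HasDerivAt (G k) (G (k + 1) x) x := by
    intro k hk x
    have hk0 : (k : ℕ∞) ≤ l := le_trans (by exact_mod_cast k.le_succ) hk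
    refine hasDerivAt_of_tendstoUniformly (hunif (k + 1) hk) ?_
      (fun x => (hunif k hk0).tendsto_at x) x
    filter_upwards [hf] with n hn x
    have := hn.differentiable_iteratedDeriv k (by
      have : (k : ℕ∞) < (k + 1 : ℕ) := by exact_mod_cast k.lt_succ_self
      exact_mod_cast this.trans_le hk)
    rw [iteratedDeriv_succ]
    exact (this x).hasDerivAt
  have heq : ∀ k : ℕ, (k : ℕ∞) ≤ l → iteratedDeriv k (G 0) = G k := by
    intro k
    induction k with
    | zero => intro _; rw [iteratedDeriv_zero]
    | succ k ih =>
      intro hk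
      have hk0 : (k : ℕ∞) ≤ l := le_trans (by exact_mod_cast k.le_succ) hk
      rw [iteratedDeriv_succ, ih hk0]
      funext x
      exact (hder k hk x).deriv
  refine ⟨G 0, contDiff_iff_iteratedDeriv.2 ⟨fun k hk => ?_, fun k hk => ?_⟩, fun k hk ε hε => ?_⟩
  · rw [heq k hk]
    refine (hunif k hk).continuous (Filter.Eventually.frequently ?_)
    filter_upwards [hf] with n hn
    exact hn.continuous_iteratedDeriv k (by exact_mod_cast hk)
  · rw [heq k hk.le]
    intro x
    exact (hder k (by
      rw [Nat.cast_add, Nat.cast_one]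
      exact Order.add_one_le_of_lt hk) x).differentiableAt
  · rw [heq k hk]
    exact hG k hk ε hε

/-! ### Convergence of the cocycles -/

/-- Uniform convergence on the line. -/
def UnifTo (F : ℕ → ℝ → ℝ) (G : ℝ → ℝ) : Prop :=
  ∀ ε > 0, ∀ᶠ n in Filter.atTop, ∀ x, |F n x - G x| ≤ ε

theorem UnifTo.add {F F' : ℕ → ℝ → ℝ} {G G' : ℝ → ℝ} (h : UnifTo F G) (h' : UnifTo F' G') :
    UnifTo (fun n x => F n x + F' n x) (fun x => G x + G' x) := by
  intro ε hε
  filter_upwards [h (ε / 2) (by linarith), h' (ε / 2) (by linarith)] with n h1 h2 x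
  have := abs_add_le (F n x - G x) (F' n x - G' x)
  rw [show F n x + F' n x - (G x + G' x) = F n x - G x + (F' n x - G' x) by ring]
  linarith [h1 x, h2 x]

theorem UnifTo.mul {F F' : ℕ → ℝ → ℝ} {G G' : ℝ → ℝ} (h : UnifTo F G) (h' : UnifTo F' G')
    (hb : ∃ Y, ∀ x, |G x| ≤ Y) (hb' : ∃ Y, ∀ x, |G' x| ≤ Y) :
    UnifTo (fun n x => F n x * F' n x) (fun x => G x * G' x) := by
  intro ε hε
  obtain ⟨Y, hY⟩ := hb
  obtain ⟨Y', hY'⟩ := hb'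
  have hY0 : 0 ≤ Y := (abs_nonneg _).trans (hY 0)
  have hY0' : 0 ≤ Y' := (abs_nonneg _).trans (hY' 0)
  obtain ⟨d, hd0, hd1, hd⟩ : ∃ d > 0, d ≤ 1 ∧ d * (1 + Y + Y') ≤ ε := by
    refine ⟨min 1 (ε / (1 + Y + Y')), lt_min one_pos (by positivity), min_le_left _ _, ?_⟩
    rw [← le_div_iff₀ (by positivity)]
    exact min_le_right _ _
  filter_upwards [h d hd0, h' d hd0] with n h1 h2 x
  have e : F n x * F' n x - G x * G' x =
      (F n x - G x) * (F' n x - G' x) + (F n x - G x) * G' x + G x * (F' n x - G' x) := by ring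
  rw [e]
  refine (abs_add_three _ _ _).trans ?_
  rw [abs_mul, abs_mul, abs_mul]
  calc _ ≤ d * 1 + d * Y' + Y * d := by
        have a1 := h1 x
        have a2 := h2 x
        have a3 := hY x
        have a4 := hY' x
        have a5 := a2.trans hd1
        gcongr
    _ ≤ ε := by linarith

theorem UnifTo.sum {ι : Type*} (s : Finset ι) {F : ι → ℕ → ℝ → ℝ} {G : ι → ℝ → ℝ}
    (h : ∀ i ∈ s, UnifTo (F i) (G i)) :
    UnifTo (fun n x => ∑ i ∈ s, F i n x) (fun x => ∑ i ∈ s, G i x) := by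
  classical
  induction s using Finset.induction_on with
  | empty => intro ε hε; simp [hε.le]
  | insert a s ha ih =>
    simp only [Finset.sum_insert ha]
    exact (h a (Finset.mem_insert_self _ _)).add (ih fun i hi => h i (Finset.mem_insert_of_mem hi))

theorem UnifTo.const_mul (a : ℝ) {F : ℕ → ℝ → ℝ} {G : ℝ → ℝ} (h : UnifTo F G) :
    UnifTo (fun n x => a * F n x) (fun x => a * G x) := by
  intro ε hε
  filter_upwards [h (ε / (|a| + 1)) (by positivity)] with n hn x
  rw [← mul_sub, abs_mul]
  have h1 := hn x
  rw [le_div_iff₀ (by positivity)] at h1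
  nlinarith [abs_nonneg (F n x - G x)]

/-- Convergence in `C^k` to a function with bounded derivatives. -/
structure ConvB (k : ℕ) (f : ℕ → ℝ → ℝ) (g : ℝ → ℝ) : Prop where
  smooth : ∀ᶠ n in Filter.atTop, ContDiff ℝ k (f n)
  smooth_limit : ContDiff ℝ k g
  unif : ∀ j ≤ k, UnifTo (fun n => iteratedDeriv j (f n)) (iteratedDeriv j g)
  bdd : ∀ j ≤ k, ∃ Y, ∀ x, |iteratedDeriv j g x| ≤ Y

theorem UnifTo.congr {F F' : ℕ → ℝ → ℝ} {G : ℝ → ℝ} (h : UnifTo F G)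
    (he : ∀ᶠ n in Filter.atTop, F' n = F n) : UnifTo F' G := by
  intro ε hε
  filter_upwards [h ε hε, he] with n hn hn' x
  rw [hn']
  exact hn x

theorem ConvB.mul {k : ℕ} {f f' : ℕ → ℝ → ℝ} {g g' : ℝ → ℝ} (h : ConvB k f g)
    (h' : ConvB k f' g') : ConvB k (fun n x => f n x * f' n x) (fun x => g x * g' x) := by
  have hle : ∀ {j : ℕ}, j ≤ k → (j : WithTop ℕ∞) ≤ k := fun hj => by exact_mod_cast hj
  have eg : ∀ j ≤ k, iteratedDeriv j (fun x => g x * g' x) = fun x => ∑ i ∈ Finset.range (j + 1),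
      (j.choose i : ℝ) * (iteratedDeriv i g x * iteratedDeriv (j - i) g' x) := by
    intro j hj
    funext x
    rw [iteratedDeriv_fun_mul (h.smooth_limit.of_le (hle hj)).contDiffAt
      (h'.smooth_limit.of_le (hle hj)).contDiffAt]
    simp only [mul_assoc]
  refine ⟨?_, h.smooth_limit.mul h'.smooth_limit, fun j hj => ?_, fun j hj => ?_⟩
  · filter_upwards [h.smooth, h'.smooth] with n h1 h2 using h1.mul h2
  · rw [eg j hj]
    refine (UnifTo.sum (Finset.range (j + 1)) fun i hi => ?_).congr
      (F := fun n x => ∑ i ∈ Finset.range (j + 1),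
        (j.choose i : ℝ) * (iteratedDeriv i (f n) x * iteratedDeriv (j - i) (f' n) x)) ?_
    · have hi' : i ≤ j := by rw [Finset.mem_range] at hi; omega
      exact (((h.unif i (by omega)).mul (h'.unif (j - i) (by omega)) (h.bdd i (by omega))
        (h'.bdd (j - i) (by omega))).const_mul _)
    · filter_upwards [h.smooth, h'.smooth] with n h1 h2
      funext x
      rw [iteratedDeriv_fun_mul (h1.of_le (hle hj)).contDiffAt (h2.of_le (hle hj)).contDiffAt]
      simp only [mul_assoc]
  · rw [eg j hj]
    have hb : ∀ i, ∃ Y, i ≤ j → ∀ x,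
        |(j.choose i : ℝ) * (iteratedDeriv i g x * iteratedDeriv (j - i) g' x)| ≤ Y := by
      intro i
      by_cases hi : i ≤ j
      · obtain ⟨Y, hY⟩ := h.bdd i (by omega)
        obtain ⟨Y', hY'⟩ := h'.bdd (j - i) (by omega)
        refine ⟨(j.choose i : ℝ) * (Y * Y'), fun _ x => ?_⟩
        have h0 : 0 ≤ Y := (abs_nonneg _).trans (hY x)
        rw [abs_mul, abs_mul, abs_of_nonneg (Nat.cast_nonneg _)]
        have a1 := hY x
        have a2 := hY' x
        gcongr
      · exact ⟨0, fun h => absurd h hi⟩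
    choose Y hY using hb
    refine ⟨∑ i ∈ Finset.range (j + 1), Y i, fun x => (Finset.abs_sum_le_sum_abs _ _).trans ?_⟩
    exact Finset.sum_le_sum fun i hi => hY i (by rw [Finset.mem_range] at hi; omega) x

theorem ConvB.neg {k : ℕ} {f : ℕ → ℝ → ℝ} {g : ℝ → ℝ} (h : ConvB k f g) :
    ConvB k (fun n x => -f n x) (fun x => -g x) := by
  refine ⟨h.smooth.mono fun n hn => hn.neg, h.smooth_limit.neg, fun j hj ε hε => ?_, fun j hj => ?_⟩
  · filter_upwards [h.unif j hj ε hε] with n hn x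
    rw [iteratedDeriv_fun_neg, iteratedDeriv_fun_neg, ← neg_sub', abs_neg]
    exact hn x
  · obtain ⟨Y, hY⟩ := h.bdd j hj
    exact ⟨Y, fun x => by rw [iteratedDeriv_fun_neg, abs_neg]; exact hY x⟩

theorem ConvB.of_deriv {k : ℕ} {f f' : ℕ → ℝ → ℝ} {g g' : ℝ → ℝ} (h0 : UnifTo f g)
    (hb : ∃ Y, ∀ x, |g x| ≤ Y) (hf : ∀ᶠ n in Filter.atTop, ∀ x, HasDerivAt (f n) (f' n x) x)
    (hg : ∀ x, HasDerivAt g (g' x) x) (h : ConvB k f' g') : ConvB (k + 1) f g := by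
  have eg : deriv g = g' := funext fun x => (hg x).deriv
  have hsucc : ∀ u : ℝ → ℝ, Differentiable ℝ u → ContDiff ℝ k (deriv u) →
      ContDiff ℝ (k + 1 : ℕ) u := by
    intro u h1 h2
    rw [Nat.cast_add, Nat.cast_one]
    exact contDiff_succ_iff_deriv.2 ⟨h1, by simp, h2⟩
  refine ⟨?_, hsucc g (fun x => (hg x).differentiableAt) (by rw [eg]; exact h.smooth_limit), ?_, ?_⟩
  · filter_upwards [hf, h.smooth] with n h1 h2
    refine hsucc _ (fun x => (h1 x).differentiableAt) ?_
    rwa [show deriv (f n) = f' n from funext fun x => (h1 x).deriv]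
  · intro j hj
    rcases Nat.eq_zero_or_pos j with rfl | hj0
    · simpa only [iteratedDeriv_zero] using h0
    · obtain ⟨i, rfl⟩ := Nat.exists_eq_add_of_le' hj0
      rw [iteratedDeriv_succ', eg]
      refine (h.unif i (by omega)).congr ?_
      filter_upwards [hf] with n h1
      rw [iteratedDeriv_succ', show deriv (f n) = f' n from funext fun x => (h1 x).deriv]
  · intro j hj
    rcases Nat.eq_zero_or_pos j with rfl | hj0
    · simpa only [iteratedDeriv_zero] using hb
    · obtain ⟨i, rfl⟩ := Nat.exists_eq_add_of_le' hj0
      rw [iteratedDeriv_succ', eg]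
      exact h.bdd i (by omega)

theorem abs_sin_sub_le (a b : ℝ) : |Real.sin a - Real.sin b| ≤ |a - b| := by
  have := Real.abs_sin_sub_sin_le a b
  exact this

theorem abs_cos_sub_le (a b : ℝ) : |Real.cos a - Real.cos b| ≤ |a - b| :=
  Real.abs_cos_sub_cos_le a b

/-- If the phases converge in `C^k`, so do their sines and cosines. -/
theorem convB_sin_cos {f : ℕ → ℝ → ℝ} {g : ℝ → ℝ} (k : ℕ)
    (hf : ∀ᶠ n in Filter.atTop, ContDiff ℝ k (f n)) (hg : ContDiff ℝ k g)
    (hu : ∀ j ≤ k, UnifTo (fun n => iteratedDeriv j (f n)) (iteratedDeriv j g))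
    (hb : ∀ j, 1 ≤ j → j ≤ k → ∃ Y, ∀ x, |iteratedDeriv j g x| ≤ Y) :
    ConvB k (fun n x => Real.sin (f n x)) (fun x => Real.sin (g x)) ∧
      ConvB k (fun n x => Real.cos (f n x)) (fun x => Real.cos (g x)) := by
  have hu0 : UnifTo f g := by simpa only [iteratedDeriv_zero] using hu 0 (Nat.zero_le _)
  have hs : UnifTo (fun n x => Real.sin (f n x)) (fun x => Real.sin (g x)) := fun ε hε =>
    (hu0 ε hε).mono fun n hn x => (abs_sin_sub_le _ _).trans (hn x)
  have hc : UnifTo (fun n x => Real.cos (f n x)) (fun x => Real.cos (g x)) := fun ε hε =>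
    (hu0 ε hε).mono fun n hn x => (abs_cos_sub_le _ _).trans (hn x)
  have bs : ∃ Y, ∀ x, |Real.sin (g x)| ≤ Y := ⟨1, fun x => Real.abs_sin_le_one _⟩
  have bc : ∃ Y, ∀ x, |Real.cos (g x)| ≤ Y := ⟨1, fun x => Real.abs_cos_le_one _⟩
  induction k with
  | zero =>
    rw [Nat.cast_zero, contDiff_zero] at hg
    simp only [Nat.cast_zero, contDiff_zero] at hf
    constructor
    · refine ⟨hf.mono fun n hn => ?_, ?_, fun j hj => ?_, fun j hj => ?_⟩
      · rw [Nat.cast_zero, contDiff_zero]; exact Real.continuous_sin.comp hn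
      · rw [Nat.cast_zero, contDiff_zero]; exact Real.continuous_sin.comp hg
      · obtain rfl : j = 0 := by omega
        simpa only [iteratedDeriv_zero] using hs
      · obtain rfl : j = 0 := by omega
        simpa only [iteratedDeriv_zero] using bs
    · refine ⟨hf.mono fun n hn => ?_, ?_, fun j hj => ?_, fun j hj => ?_⟩
      · rw [Nat.cast_zero, contDiff_zero]; exact Real.continuous_cos.comp hn
      · rw [Nat.cast_zero, contDiff_zero]; exact Real.continuous_cos.comp hg
      · obtain rfl : j = 0 := by omega
        simpa only [iteratedDeriv_zero] using hc
      · obtain rfl : j = 0 := by omega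
        simpa only [iteratedDeriv_zero] using bc
  | succ k ih =>
    have hle : ((k : ℕ) : WithTop ℕ∞) ≤ (k + 1 : ℕ) := by exact_mod_cast k.le_succ
    have hsplit : ∀ u : ℝ → ℝ, ContDiff ℝ (k + 1 : ℕ) u →
        Differentiable ℝ u ∧ ContDiff ℝ k (deriv u) := by
      intro u h
      rw [Nat.cast_add, Nat.cast_one] at h
      exact ⟨(contDiff_succ_iff_deriv.1 h).1, (contDiff_succ_iff_deriv.1 h).2.2⟩
    obtain ⟨ihs, ihc⟩ := ih (hf.mono fun n hn => hn.of_le hle) (hg.of_le hle)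
      (fun j hj => hu j (by omega)) (fun j hj hjk => hb j hj (by omega))
    have hd : ConvB k (fun n => deriv (f n)) (deriv g) := by
      refine ⟨hf.mono fun n hn => (hsplit _ hn).2, (hsplit _ hg).2, fun j hj => ?_, fun j hj => ?_⟩
      · have := hu (j + 1) (by omega)
        simpa only [iteratedDeriv_succ'] using this
      · have := hb (j + 1) (by omega) (by omega)
        simpa only [iteratedDeriv_succ'] using this
    constructor
    · refine ConvB.of_deriv hs bs ?_ (fun x => ((hsplit g hg).1 x).hasDerivAt.sin) (ihc.mul hd)
      filter_upwards [hf] with n hn x using ((hsplit _ hn).1 x).hasDerivAt.sin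
    · refine ConvB.of_deriv hc bc ?_ (fun x => ((hsplit g hg).1 x).hasDerivAt.cos) (ihs.neg.mul hd)
      filter_upwards [hf] with n hn x using ((hsplit _ hn).1 x).hasDerivAt.cos

theorem cocycle_eq (lam : ℝ) (φ : ℝ → ℝ) : cocycle lam φ = fun x =>
    Real.sin (φ x) • (!![lam, 0; 0, lam⁻¹] : Mat) + Real.cos (φ x) • (!![0, -lam; lam⁻¹, 0] : Mat) := by
  funext x
  ext i j
  fin_cases i <;> fin_cases j <;>
    simp [cocycle, rot, Matrix.mul_apply, Fin.sum_univ_two, Real.cos_pi_div_two_sub,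
      Real.sin_pi_div_two_sub, mul_comm]

theorem contDiff_cocycle {l : WithTop ℕ∞} (lam : ℝ) {φ : ℝ → ℝ} (h : ContDiff ℝ l φ) :
    ContDiff ℝ l (cocycle lam φ) := by
  rw [cocycle_eq]
  exact ((h.sin).smul contDiff_const).add ((h.cos).smul contDiff_const)

theorem isCocycle_cocycle {l : ℕ∞} {lam : ℝ} (hlam : lam ≠ 0) {φ : ℝ → ℝ} (h : ContDiff ℝ l φ)
    (hlift : IsLift φ) : IsCocycle l (cocycle lam φ) :=
  ⟨contDiff_cocycle lam h, hlift.periodic_cocycle lam, det_cocycle hlam φ⟩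

theorem convergesC_cocycle {l : ℕ∞} (lam : ℝ) {f : ℕ → ℝ → ℝ} {g : ℝ → ℝ}
    (hf : ∀ᶠ n in Filter.atTop, ContDiff ℝ l (f n)) (hg : ContDiff ℝ l g) (hlift : IsLift g)
    (hu : ∀ k : ℕ, (k : ℕ∞) ≤ l → UnifTo (fun n => iteratedDeriv k (f n)) (iteratedDeriv k g)) :
    ConvergesC l (fun n => cocycle lam (f n)) (cocycle lam g) := by
  intro k hk
  have hk' : (k : WithTop ℕ∞) ≤ l := by exact_mod_cast hk
  obtain ⟨Y, -, hY⟩ := hlift.exists_bound hg k hk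
  obtain ⟨hs, hc⟩ := convB_sin_cos k (hf.mono fun n hn => hn.of_le hk') (hg.of_le hk')
    (fun j hj => hu j (le_trans (by exact_mod_cast hj) hk)) (fun j hj hjk => ⟨Y, hY j hj hjk⟩)
  obtain ⟨E₁, hE₁⟩ : ∃ E₁ : Mat, E₁ = !![lam, 0; 0, lam⁻¹] := ⟨_, rfl⟩
  obtain ⟨E₂, hE₂⟩ : ∃ E₂ : Mat, E₂ = !![0, -lam; lam⁻¹, 0] := ⟨_, rfl⟩
  have hder : ∀ φ : ℝ → ℝ, ContDiff ℝ k φ → ∀ x, iteratedDeriv k (cocycle lam φ) x =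
      iteratedDeriv k (fun x => Real.sin (φ x)) x • E₁ +
        iteratedDeriv k (fun x => Real.cos (φ x)) x • E₂ := by
    intro φ hφ x
    have c₁ : ContDiff ℝ k fun x => Real.sin (φ x) • E₁ := hφ.sin.smul contDiff_const
    have c₂ : ContDiff ℝ k fun x => Real.cos (φ x) • E₂ := hφ.cos.smul contDiff_const
    rw [cocycle_eq, ← hE₁, ← hE₂, iteratedDeriv_fun_add c₁.contDiffAt c₂.contDiffAt,
      iteratedDeriv_smul_const hφ.sin.contDiffAt,
      iteratedDeriv_smul_const hφ.cos.contDiffAt]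
  rw [Metric.tendstoUniformly_iff]
  intro ε hε
  have hpos : 0 < ε / (‖E₁‖ + ‖E₂‖ + 1) := by positivity
  filter_upwards [hs.unif k le_rfl _ hpos, hc.unif k le_rfl _ hpos, hf] with n h1 h2 h3 x
  rw [dist_comm, dist_eq_norm, hder _ (h3.of_le hk'), hder _ (hg.of_le hk')]
  set a := iteratedDeriv k (fun x => Real.sin (f n x)) x
  set a' := iteratedDeriv k (fun x => Real.sin (g x)) x
  set b := iteratedDeriv k (fun x => Real.cos (f n x)) x
  set b' := iteratedDeriv k (fun x => Real.cos (g x)) x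
  have e : a • E₁ + b • E₂ - (a' • E₁ + b' • E₂) = (a - a') • E₁ + (b - b') • E₂ := by
    rw [sub_smul, sub_smul]; abel
  rw [e]
  refine (norm_add_le _ _).trans_lt ?_
  rw [norm_smul, norm_smul, Real.norm_eq_abs, Real.norm_eq_abs]
  have h4 : |a - a'| ≤ _ := h1 x
  have h5 : |b - b'| ≤ _ := h2 x
  have hn1 := norm_nonneg E₁
  have hn2 := norm_nonneg E₂
  calc |a - a'| * ‖E₁‖ + |b - b'| * ‖E₂‖
      ≤ ε / (‖E₁‖ + ‖E₂‖ + 1) * ‖E₁‖ + ε / (‖E₁‖ + ‖E₂‖ + 1) * ‖E₂‖ := by gcongr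
    _ < ε / (‖E₁‖ + ‖E₂‖ + 1) * (‖E₁‖ + ‖E₂‖ + 1) := by nlinarith
    _ = ε := by field_simp

/-! ### The tangent modifications -/

/-- A cut-off of the initial phase minus its values at the critical points. Subtracting it from a
phase makes the stable and the unstable directions coincide near the critical points. -/
def flatPart (ω c : ℝ) (φ F : ℝ → ℝ) (n : ℕ) : ℝ → ℝ :=
  patch c fun m => cutMul (1 / q ω n ^ 2)
    (fun s => φ (c + m * Real.pi + s) - φ (c + m * Real.pi)) (fun s => F (q ω n ^ 2 * s))

section flatPart

variable {ω M c δ₀ lam : ℝ} {l : ℕ∞} {g φ F : ℝ → ℝ} {tw : Bool}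
  {step : ℕ → (ℝ → ℝ) → (ℝ → ℝ) → Prop} {k₀ n₁ : ℕ} {C : ℕ → ℝ} {B nk : ℕ → ℕ}

theorem cut_eq_zero (hω : Irrational ω) (hF : ∀ s, 5 / 8 ≤ |s| → F s = 0) (n : ℕ) (s : ℝ)
    (hs : 5 / 8 * (1 / q ω n ^ 2) ≤ |s|) : F (q ω n ^ 2 * s) = 0 := by
  have hq := q_pos hω n
  apply hF
  rw [abs_mul, abs_of_pos (by positivity)]
  rw [mul_one_div, div_le_iff₀ (by positivity)] at hs
  linarith

theorem contDiff_flatPart (hω : Irrational ω) (hφ : ContDiff ℝ l φ)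
    (hFs : ContDiff ℝ (⊤ : ℕ∞) F) (hF : ∀ s, 5 / 8 ≤ |s| → F s = 0) (n : ℕ) :
    ContDiff ℝ l (flatPart ω c φ F n) := by
  obtain ⟨h0, h1⟩ := one_div_sq_le_one hω n
  refine contDiff_patch h1 (fun m s hs => cutMul_eq_zero s hs) fun m => ?_
  refine contDiff_cutMul h0 (fun s _ => ?_) ?_ (cut_eq_zero hω hF n)
  · exact ((hφ.comp (contDiff_const.add contDiff_id)).sub contDiff_const).contDiffAt
  · exact (hFs.of_le (by exact_mod_cast le_top)).comp (contDiff_const.mul contDiff_id)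

theorem periodic_flatPart (hφ : IsLift φ) (n : ℕ) :
    Function.Periodic (flatPart ω c φ F n) (2 * Real.pi) := by
  obtain ⟨j, hj⟩ := hφ
  refine periodic_patch fun m s => ?_
  unfold cutMul
  have e1 : c + ((m + 2 : ℤ) : ℝ) * Real.pi + s = c + m * Real.pi + s + 2 * Real.pi := by
    push_cast; ring
  have e2 : c + ((m + 2 : ℤ) : ℝ) * Real.pi = c + m * Real.pi + 2 * Real.pi := by push_cast; ring
  have e3 : φ (c + ((m + 2 : ℤ) : ℝ) * Real.pi + s) = φ (c + m * Real.pi + s) + j * (2 * Real.pi) := by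
    rw [e1, hj]
  have e4 : φ (c + ((m + 2 : ℤ) : ℝ) * Real.pi) = φ (c + m * Real.pi) + j * (2 * Real.pi) := by
    rw [e2, hj]
  simp only [e3, e4, add_sub_add_right_eq_sub]

theorem flatPart_eq_zero (n : ℕ) {x : ℝ} (hx : x ∉ crit ω c 1 n) : flatPart ω c φ F n x = 0 :=
  patch_eq_zero_of_not_mem (fun _ s hs => cutMul_eq_zero s hs) hx

theorem flatPart_eq (hω : Irrational ω) (hF1 : ∀ s, |s| ≤ 1 / 8 → F s = 1) (n : ℕ) {x : ℝ}
    (hx : x ∈ crit ω c 10 n) : ∃ m : ℤ, flatPart ω c φ F n x = φ x - φ (c + m * Real.pi) := by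
  obtain ⟨m, s, rfl, hs, -, hs'⟩ := exists_of_mem_crit hω (by norm_num) hx
  obtain ⟨h0, h1⟩ := one_div_sq_le_one hω n
  have hq := q_pos hω n
  refine ⟨m, ?_⟩
  rw [flatPart, patch_apply h1 (fun m s hs => cutMul_eq_zero s hs) m hs']
  have h2 : |s| < 1 / q ω n ^ 2 := by
    refine hs.trans_lt ?_
    apply one_div_lt_one_div_of_lt (by positivity)
    nlinarith [sq_pos_of_pos hq]
  rw [cutMul, if_pos h2, hF1, mul_one]
  rw [le_div_iff₀ (by positivity)] at hs
  rw [abs_mul, abs_of_pos (by positivity)]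
  linarith

theorem exists_bound_iteratedDeriv (hFs : ContDiff ℝ (⊤ : ℕ∞) F)
    (hF : ∀ s, 5 / 8 ≤ |s| → F s = 0) (k : ℕ) :
    ∃ K, 0 ≤ K ∧ ∀ r ≤ k, ∀ s, |iteratedDeriv r F s| ≤ K := by
  have h1 : ∀ r : ℕ, ∃ K, ∀ s, |iteratedDeriv r F s| ≤ K := by
    intro r
    have hc : Continuous (iteratedDeriv r F) :=
      hFs.continuous_iteratedDeriv r (by exact_mod_cast le_top)
    obtain ⟨K, hK⟩ := isCompact_Icc.exists_bound_of_continuousOn (s := Set.Icc (-1 : ℝ) 1)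
      hc.continuousOn
    refine ⟨K, fun s => ?_⟩
    rcases le_or_gt |s| 1 with h | h
    · exact hK s (abs_le.1 h)
    · have : F =ᶠ[nhds s] fun _ => 0 := by
        filter_upwards [continuous_abs.continuousAt.eventually (eventually_gt_nhds h)] with y hy
        exact hF y (by linarith)
      rw [this.iteratedDeriv_eq, iteratedDeriv_fun_const_zero, abs_zero]
      exact (abs_nonneg _).trans (hK 0 (by simp))
  choose K hK using h1
  have hK0 : ∀ r, 0 ≤ K r := fun r => (abs_nonneg _).trans (hK r 0)
  refine ⟨∑ r ∈ Finset.range (k + 1), K r, Finset.sum_nonneg fun r _ => hK0 r, fun r hr s => ?_⟩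
  exact (hK r s).trans (Finset.single_le_sum (f := K) (fun r _ => hK0 r)
    (Finset.mem_range.2 (by omega)))

/-- Since the initial phase is flat at the critical points, the modifications are small in `C^k`. -/
theorem Setting.eventually_abs_flatPart_le (S : Setting ω M c δ₀ l g φ tw step k₀ n₁ C B nk)
    (hFs : ContDiff ℝ (⊤ : ℕ∞) F) (hF : ∀ s, 5 / 8 ≤ |s| → F s = 0) {k : ℕ} (hk : (k : ℕ∞) ≤ l)
    {ε : ℝ} (hε : 0 < ε) : ∀ᶠ n in Filter.atTop, ∀ x,
      |iteratedDeriv k (flatPart ω c φ F n) x| ≤ ε := by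
  have hω := S.irrational
  have hk' : (k : WithTop ℕ∞) ≤ l := by exact_mod_cast hk
  obtain ⟨K, hK0, hK⟩ := exists_bound_iteratedDeriv hFs hF k
  set T : ℤ → ℝ → ℝ := fun m s => φ (c + m * Real.pi + s) - φ (c + m * Real.pi) with hT
  have hTs : ∀ m, ContDiff ℝ k (T m) := fun m =>
    ((S.base.smooth.of_le hk').comp (contDiff_const.add contDiff_id)).sub contDiff_const
  have hTg : ∀ m, ∃ σ : ℝ, |σ| = 1 ∧ ∀ s, |s| ≤ δ₀ → T m s = σ * g s := by
    intro m
    obtain ⟨j, σ, hσ, h⟩ := S.base.exists_near m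
    refine ⟨σ, hσ, fun s hs => ?_⟩
    have h0 := h 0 (by rw [abs_zero]; exact S.delta_pos.le)
    rw [add_zero, S.profile.zero, mul_zero, add_zero] at h0
    simp only [hT]
    rw [h s hs, h0, add_sub_cancel_left]
  have habs : ∀ m i s, |s| < δ₀ → |iteratedDeriv i (T m) s| = |iteratedDeriv i g s| := by
    intro m i s hs
    obtain ⟨σ, hσ, h⟩ := hTg m
    have e : T m =ᶠ[nhds s] fun s => σ * g s := by
      filter_upwards [continuous_abs.continuousAt.eventually (eventually_lt_nhds hs)] with y hy
      exact h y hy.le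
    rw [e.iteratedDeriv_eq, iteratedDeriv_const_mul_field, abs_mul, hσ, one_mul]
  have ho : T 0 =o[nhds 0] fun s => s ^ k := by
    refine Asymptotics.IsBigO.trans_isLittleO ?_ (S.profile.isLittleO k hk)
    obtain ⟨σ, hσ, h⟩ := hTg 0
    refine Asymptotics.IsBigO.of_bound 1 ?_
    filter_upwards [continuous_abs.continuousAt.eventually
      (eventually_lt_nhds (show |(0 : ℝ)| < δ₀ by rw [abs_zero]; exact S.delta_pos))] with y hy
    rw [h y hy.le, norm_mul, Real.norm_eq_abs, hσ]
  obtain ⟨d, hd0, hd⟩ : ∃ d > 0, 2 ^ k * (d * K) ≤ ε := by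
    refine ⟨ε / (2 ^ k * (K + 1)), by positivity, ?_⟩
    rw [div_mul_eq_mul_div, mul_div_assoc', div_le_iff₀ (by positivity)]
    have : (0 : ℝ) < 2 ^ k := by positivity
    nlinarith [mul_pos hε this]
  have hsmall : ∀ᶠ s in nhds (0 : ℝ), ∀ i ∈ Finset.range (k + 1),
      |iteratedDeriv i (T 0) s| ≤ d * |s| ^ (k - i) := by
    rw [Filter.eventually_all_finset]
    intro i hi
    have hi' : i ≤ k := by rw [Finset.mem_range] at hi; omega
    have := isLittleO_iteratedDeriv (hTs 0) ho i (k - i) (by omega)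
    filter_upwards [this.bound hd0] with s hs
    rwa [Real.norm_eq_abs, norm_pow, Real.norm_eq_abs] at hs
  obtain ⟨ρ, hρ, hρs⟩ := Metric.eventually_nhds_iff.1 hsmall
  have hmin : 0 < min ρ δ₀ := lt_min hρ S.delta_pos
  filter_upwards [(tendsto_one_div_sq hω).eventually (eventually_le_nhds hmin)] with n hn x
  obtain ⟨h0, h1⟩ := one_div_sq_le_one hω n
  have hq := q_pos hω n
  refine abs_iteratedDeriv_patch_le h1 (fun m s hs => cutMul_eq_zero s hs) (fun m s => ?_) x
  refine abs_iteratedDeriv_cutMul_le h0 (cut_eq_zero hω hF n) hε.le (fun s hs => ?_) s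
  have hcut : ContDiff ℝ (⊤ : ℕ∞) fun s => F (q ω n ^ 2 * s) :=
    hFs.comp (contDiff_const.mul contDiff_id)
  refine le_trans (abs_iteratedDeriv_mul_le (hTs m).contDiffAt
    (hcut.of_le (by exact_mod_cast le_top)).contDiffAt (B := d * K) fun i hi => ?_) hd
  have hsd : |s| < min ρ δ₀ := hs.trans_le hn
  have b1 := hρs (y := s) (by
    rw [dist_zero_right, Real.norm_eq_abs]; exact hsd.trans_le (min_le_left _ _)) i
    (Finset.mem_range.2 (by omega))
  have hFk : ContDiff ℝ ((k - i : ℕ) : WithTop ℕ∞) F :=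
    hFs.of_le (WithTop.coe_le_coe.2 (le_top : ((k - i : ℕ) : ℕ∞) ≤ ⊤))
  rw [habs 0 i s (hsd.trans_le (min_le_right _ _))] at b1
  rw [habs m i s (hsd.trans_le (min_le_right _ _)),
    congrFun (iteratedDeriv_comp_const_mul hFk (q ω n ^ 2)) s,
    abs_mul, abs_of_nonneg (show 0 ≤ (q ω n ^ 2) ^ (k - i) by positivity)]
  have b2 := hK (k - i) (by omega) (q ω n ^ 2 * s)
  have b3 : |s| ^ (k - i) * (q ω n ^ 2) ^ (k - i) ≤ 1 := by
    rw [← mul_pow]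
    refine pow_le_one₀ (by positivity) ?_
    have := hs.le
    rwa [le_div_iff₀ (by positivity)] at this
  calc _ ≤ (d * |s| ^ (k - i)) * ((q ω n ^ 2) ^ (k - i) * K) := by gcongr
    _ = (|s| ^ (k - i) * (q ω n ^ 2) ^ (k - i)) * (d * K) := by ring
    _ ≤ 1 * (d * K) := by gcongr
    _ = d * K := one_mul _

theorem eq_of_nearZero_sub_eq_zero {a b : ℝ} (ha : a ∈ Set.Ioc (-(Real.pi / 2)) (Real.pi / 2))
    (hb : b ∈ Set.Ioc (-(Real.pi / 2)) (Real.pi / 2)) (h : nearZero (a - b) = 0) : a = b := by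
  have hpi := Real.pi_pos
  have h1 := self_sub_toIocDiv_zsmul Real.pi_pos (-(Real.pi / 2)) (a - b)
  change a - b - _ = nearZero (a - b) at h1
  rw [h, zsmul_eq_mul] at h1
  set k := toIocDiv Real.pi_pos (-(Real.pi / 2)) (a - b)
  have h2 : ((-1 : ℤ) : ℝ) < k := by
    push_cast
    by_contra! hle
    nlinarith [ha.1, ha.2, hb.1, hb.2]
  have h3 : (k : ℝ) < ((1 : ℤ) : ℝ) := by
    push_cast
    by_contra! hle
    nlinarith [ha.1, ha.2, hb.1, hb.2]
  have h4 : k = 0 := by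
    have h2' : -1 < k := by exact_mod_cast h2
    have h3' : k < 1 := by exact_mod_cast h3
    omega
  rw [h4, Int.cast_zero, zero_mul] at h1
  linarith

/-- The phase with the flat part removed is constant modulo `π`, up to the change of the directions,
on `I_n / 10`, and the directions themselves are not affected by the removal. -/
theorem Setting.isTangentModification (S : Setting ω M c δ₀ l g φ tw step k₀ n₁ C B nk) {Y : ℝ}
    (hlam : LamLarge M lam) (hFs : ContDiff ℝ (⊤ : ℕ∞) F) (hF : ∀ s, 5 / 8 ≤ |s| → F s = 0)
    (hF1 : ∀ s, |s| ≤ 1 / 8 → F s = 1) {n : ℕ} (hn : GoodLevel ω M δ₀ Y g k₀ n₁ C B n) {Φ : ℝ → ℝ}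
    (h : Stage ω M c lam l g φ k₀ n Φ) :
    IsTangentModification ω c lam l n Φ (fun x => Φ x - flatPart ω c φ F n x) := by
  obtain ⟨p, rfl⟩ := Nat.exists_eq_add_of_le' hn.one_le
  have hω := S.irrational
  have hp : Large ω M p := hn.large_pred
  have hn1 := lt_sq_of_le hω hp.lt_sq (show p ≤ p + 1 by omega)
  have hr := (minReturn_mem hω S.one_le S.bdd hn1 c).1
  have hout : ∀ x, x ∉ crit ω c 1 (p + 1) → Φ x - flatPart ω c φ F (p + 1) x = Φ x := fun x hx => by
    rw [flatPart_eq_zero _ hx, sub_zero]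
  have hyp : HypAt ω M c lam (fun x => Φ x - flatPart ω c φ F (p + 1) x) p :=
    HypAt.congr h.hyp hout
  refine ⟨h.smooth.sub (contDiff_flatPart hω S.base.smooth hFs hF _), ?_, hout,
    hyp.hyperbolicOn hω S.one_le S.bdd hp hlam, fun x hx => ?_⟩
  · intro x
    have := periodic_flatPart (ω := ω) (c := c) (F := F) S.base.isLift (p + 1) x
    simp only [this]
    ring
  · have hx1 : x ∈ crit ω c 1 (p + 1) := crit_subset hω c one_pos (by norm_num) le_rfl hx
    have ha := hyp.angle_eq hω S.one_le S.bdd hp hlam (n := p + 1) (by omega) le_rfl hx1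
    obtain ⟨m, hm⟩ := flatPart_eq (φ := φ) hω hF1 (p + 1) hx
    obtain ⟨j, σ, hσ, hφ⟩ := S.base.exists_near m
    have h0 := hφ 0 (by rw [abs_zero]; exact S.delta_pos.le)
    rw [add_zero, S.profile.zero, mul_zero, add_zero] at h0
    have hdir : dirDiff ω lam (fun x => Φ x - flatPart ω c φ F (p + 1) x) (minReturn ω c (p + 1)) x =
        dirDiff ω lam Φ (minReturn ω c (p + 1)) x :=
      dirDiff_congr hr fun i hi hir => hout _ (tr_not_mem_of_lt_minReturn hx1 hi hir)
    have hin := h.inner x hx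
    rw [hdir, hm, h0] at ha
    have e : Φ x - (φ x - j * Real.pi) + dirDiff ω lam Φ (minReturn ω c (p + 1)) x =
        0 + j * Real.pi := by
      rw [← hin]; ring
    rw [e, nearZero_add_int_mul, nearZero_eq_self (by rw [abs_zero]; positivity)] at ha
    exact eq_of_nearZero_sub_eq_zero (mostContracted_mem _) (mostContracted_mem _) ha

end flatPart

/-! ### The Lyapunov exponent -/

theorem one_le_norm_of_det_eq_one {A : Mat} (hA : A.det = 1) : 1 ≤ ‖A‖ := by
  have h1 : A * A⁻¹ = 1 := Matrix.mul_nonsing_inv A (by rw [hA]; exact isUnit_one)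
  have h2 : ‖(1 : Mat)‖ = 1 := CStarRing.norm_one
  have h3 := Matrix.l2_opNorm_mul A A⁻¹
  rw [h1, h2, norm_inv_of_det_eq_one hA] at h3
  nlinarith [norm_nonneg A]

theorem continuous_fwd (ω : ℝ) {A : ℝ → Mat} (hc : Continuous A) (j : ℕ) :
    Continuous (fwd ω A j) := by
  induction j with
  | zero => exact continuous_const
  | succ j ih => exact (hc.comp (continuous_id.add continuous_const)).mul ih

theorem continuous_log_norm_fwd (ω : ℝ) {A : ℝ → Mat} (hc : Continuous A)
    (hA : ∀ x, (A x).det = 1) (j : ℕ) : Continuous fun x => Real.log ‖fwd ω A j x‖ :=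
  (continuous_fwd ω hc j).norm.log fun x =>
    (zero_lt_one.trans_le (one_le_norm_of_det_eq_one (det_fwd_eq_one ω hA j x))).ne'

theorem norm_fwd_add_le (ω : ℝ) (A : ℝ → Mat) (j k : ℕ) (x : ℝ) :
    ‖fwd ω A (j + k) x‖ ≤ ‖fwd ω A k (tr ω x j)‖ * ‖fwd ω A j x‖ := by
  rw [fwd_add]
  exact Matrix.l2_opNorm_mul _ _

/-- The limit in the definition of the Lyapunov exponent exists, as the integrals are subadditive. -/
theorem exists_hasLyapunovExponent (ω : ℝ) {A : ℝ → Mat} (hc : Continuous A)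
    (hp : Function.Periodic A (2 * Real.pi)) (hA : ∀ x, (A x).det = 1) :
    ∃ L, HasLyapunovExponent ω A L := by
  have hpi := Real.pi_pos
  set v : ℕ → ℝ → ℝ := fun j x => Real.log ‖fwd ω A j x‖ with hv
  have hone : ∀ j x, 1 ≤ ‖fwd ω A j x‖ := fun j x =>
    one_le_norm_of_det_eq_one (det_fwd_eq_one ω hA j x)
  have hvc : ∀ j, Continuous (v j) := continuous_log_norm_fwd ω hc hA
  set u : ℕ → ℝ := fun j => (2 * Real.pi)⁻¹ * ∫ x in (0 : ℝ)..(2 * Real.pi), v j x with hu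
  have hu0 : ∀ j, 0 ≤ u j := fun j => mul_nonneg (by positivity)
    (intervalIntegral.integral_nonneg (by positivity) fun x _ => Real.log_nonneg (hone j x))
  -- Fekete's lemma; the rotation preserves the integral over a period
  have hsub : Subadditive u := by
    intro m n
    simp only [hu]
    rw [← mul_add]
    refine mul_le_mul_of_nonneg_left ?_ (by positivity)
    have hper : Function.Periodic (v n) (2 * Real.pi) := fun x => by
      simp only [hv, periodic_fwd hp ω n x]
    have hshift : ∫ x in (0 : ℝ)..(2 * Real.pi), v n (tr ω x m) =
        ∫ x in (0 : ℝ)..(2 * Real.pi), v n x := by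
      have h1 := intervalIntegral.integral_comp_add_right (a := 0) (b := 2 * Real.pi) (v n)
        (2 * Real.pi * ω * (m : ℤ))
      have h2 := hper.intervalIntegral_add_eq (0 + 2 * Real.pi * ω * (m : ℤ)) 0
      rw [zero_add (2 * Real.pi)] at h2
      rw [show 0 + 2 * Real.pi * ω * ((m : ℤ) : ℝ) + 2 * Real.pi =
        2 * Real.pi + 2 * Real.pi * ω * ((m : ℤ) : ℝ) by ring] at h2
      exact h1.trans h2
    have hct : Continuous fun x => v n (tr ω x m) :=
      (hvc n).comp (continuous_id.add continuous_const)
    rw [← hshift, ← intervalIntegral.integral_add ((hvc m).intervalIntegrable _ _)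
      (hct.intervalIntegrable _ _)]
    refine intervalIntegral.integral_mono_on (by positivity) ((hvc _).intervalIntegrable _ _)
      (((hvc m).add hct).intervalIntegrable _ _) fun x _ => ?_
    have h3 := hone n (tr ω x m)
    have h4 := hone m x
    simp only [hv]
    rw [add_comm (Real.log _), ← Real.log_mul (by positivity) (by positivity)]
    exact Real.log_le_log (zero_lt_one.trans_le (hone _ _)) (norm_fwd_add_le ω A m n x)
  have hbdd : BddBelow (Set.range fun n => u n / n) := by
    refine ⟨0, ?_⟩
    rintro _ ⟨n, rfl⟩
    exact div_nonneg (hu0 n) (Nat.cast_nonneg n)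
  refine ⟨hsub.lim, (hsub.tendsto_lim hbdd).congr fun n => ?_⟩
  rw [div_eq_inv_mul]

theorem HasLyapunovExponent.le {ω L a b : ℝ} {A : ℝ → Mat} (h : HasLyapunovExponent ω A L)
    (hc : Continuous A) (hA : ∀ x, (A x).det = 1)
    (hab : ∀ (j : ℕ) x, Real.log ‖fwd ω A j x‖ ≤ a * j + b) : L ≤ a := by
  have hpi := Real.pi_pos
  have h1 : Filter.Tendsto (fun j : ℕ => a + b / (j : ℝ)) Filter.atTop (nhds (a + 0)) :=
    tendsto_const_nhds.add (tendsto_const_nhds.div_atTop tendsto_natCast_atTop_atTop)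
  rw [add_zero] at h1
  refine le_of_tendsto_of_tendsto h h1 ?_
  filter_upwards [Filter.eventually_gt_atTop 0] with j hj
  have hj' : (0 : ℝ) < j := by exact_mod_cast hj
  have h2 : ∫ x in (0 : ℝ)..(2 * Real.pi), Real.log ‖fwd ω A j x‖ ≤
      ∫ x in (0 : ℝ)..(2 * Real.pi), (a * j + b) :=
    intervalIntegral.integral_mono_on (by positivity)
      ((continuous_log_norm_fwd ω hc hA j).intervalIntegrable _ _)
      (continuous_const.intervalIntegrable _ _) fun x _ => hab j x
  rw [intervalIntegral.integral_const, smul_eq_mul, sub_zero] at h2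
  rw [inv_mul_le_iff₀ hj', inv_mul_le_iff₀ (by positivity)]
  refine h2.trans (le_of_eq ?_)
  field_simp

/-! ### Cancellation at a tangency -/

theorem exists_polar (u : Fin 2 → ℝ) :
    ∃ ρ ψ : ℝ, u = ρ • ![Real.cos ψ, Real.sin ψ] := by
  refine ⟨‖(⟨u 0, u 1⟩ : ℂ)‖, Complex.arg ⟨u 0, u 1⟩, ?_⟩
  ext i
  fin_cases i <;> simp

theorem norm_mulVec_smul (A : Mat) (ρ ψ : ℝ) :
    ‖(WithLp.toLp 2 (A.mulVec (ρ • ![Real.cos ψ, Real.sin ψ])) : EuclideanSpace ℝ (Fin 2))‖ =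
      |ρ| * stretch A ψ := by
  rw [Matrix.mulVec_smul, WithLp.toLp_smul, norm_smul, Real.norm_eq_abs, stretch]

theorem stretch_one (ψ : ℝ) : stretch 1 ψ = 1 := by
  rw [stretch, Matrix.one_mulVec, ← sq_eq_sq₀ (norm_nonneg _) zero_le_one, norm_toLp_sq]
  simp

theorem stretch_le_norm (A : Mat) (ψ : ℝ) : stretch A ψ ≤ ‖A‖ := by
  have h := Matrix.l2_opNorm_mulVec A (WithLp.toLp 2 ![Real.cos ψ, Real.sin ψ])
  have h1 := stretch_one ψ
  rw [stretch, Matrix.one_mulVec] at h1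
  rw [h1, mul_one] at h
  exact h

theorem norm_le_of_stretch_le {A : Mat} {K : ℝ} (hK : 0 ≤ K) (h : ∀ ψ, stretch A ψ ≤ K) :
    ‖A‖ ≤ K := by
  refine norm_le_of_mulVec hK fun u => ?_
  obtain ⟨ρ, ψ, rfl⟩ := exists_polar u
  rw [norm_mulVec_smul]
  have h1 := norm_mulVec_smul 1 ρ ψ
  rw [Matrix.one_mulVec, stretch_one, mul_one] at h1
  rw [h1, mul_comm]
  exact mul_le_mul_of_nonneg_right (h ψ) (abs_nonneg ρ)

/-- The singular value decomposition of a matrix with determinant `1`. -/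
theorem stretch_sq_of_minimizer {A : Mat} (hA : A.det = 1) {s : ℝ}
    (hs : ∀ ψ, stretch A s ≤ stretch A ψ) (ψ : ℝ) : stretch A ψ ^ 2 =
      (‖A‖ ^ 2)⁻¹ * Real.cos (ψ - s) ^ 2 + ‖A‖ ^ 2 * Real.sin (ψ - s) ^ 2 := by
  obtain ⟨hX, hY⟩ := quadratic_of_minimizer hs
  set R := √(qX A ^ 2 + qY A ^ 2) with hR
  have hR2 : R ^ 2 = qX A ^ 2 + qY A ^ 2 := Real.sq_sqrt (by positivity)
  have hR0 : 0 ≤ R := Real.sqrt_nonneg _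
  have hst : ∀ ψ, stretch A ψ ^ 2 = (qT A - R * Real.cos (2 * (ψ - s))) / 2 := by
    intro ψ
    rw [stretch_sq, mul_sub, Real.cos_sub]
    nth_rewrite 1 [hX]
    nth_rewrite 1 [hY]
    ring
  have hnorm : ‖A‖ ^ 2 = (qT A + R) / 2 := by
    apply le_antisymm
    · have hT0 : 0 ≤ qT A := by unfold qT; positivity
      rw [← Real.sq_sqrt (show 0 ≤ (qT A + R) / 2 by positivity)]
      refine pow_le_pow_left₀ (norm_nonneg _)
        (norm_le_of_stretch_le (Real.sqrt_nonneg _) fun ψ => Real.le_sqrt_of_sq_le ?_) 2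
      rw [hst]
      nlinarith [Real.neg_one_le_cos (2 * (ψ - s))]
    · have h1 := hst (s + Real.pi / 2)
      rw [show 2 * (s + Real.pi / 2 - s) = Real.pi by ring, Real.cos_pi] at h1
      rw [show (qT A + R) / 2 = stretch A (s + Real.pi / 2) ^ 2 by rw [h1]; ring]
      exact pow_le_pow_left₀ (norm_nonneg _) (stretch_le_norm _ _) 2
  -- the product of the extreme values of `stretch A ^ 2` is `det A ^ 2`
  have hinv : (‖A‖ ^ 2)⁻¹ = (qT A - R) / 2 := by
    have h1 := one_le_norm_of_det_eq_one hA
    rw [inv_eq_one_div, div_eq_iff (by positivity), hnorm]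
    rw [Matrix.det_fin_two] at hA
    have h2 : (qT A - R) / 2 * ((qT A + R) / 2) = (A 0 0 * A 1 1 - A 0 1 * A 1 0) ^ 2 := by
      unfold qT qX qY at *
      linear_combination -hR2 / 4
    rw [h2, hA, one_pow]
  rw [hinv, hnorm, hst, Real.cos_two_mul, Real.sin_sq]
  ring

/-- If two matrices of comparable norm contract the same direction most, then the expansion by
`C⁻¹` is undone by `B`. -/
theorem norm_mul_inv_le_of_common_minimizer {B C : Mat} (hB : B.det = 1) (hC : C.det = 1) {s : ℝ}
    (hBs : ∀ ψ, stretch B s ≤ stretch B ψ) (hCs : ∀ ψ, stretch C s ≤ stretch C ψ) {K : ℝ}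
    (hK : 0 ≤ K) (hBC : ‖B‖ ≤ K * ‖C‖) (hCB : ‖C‖ ≤ K * ‖B‖) : ‖B * C⁻¹‖ ≤ K := by
  have hB1 := one_le_norm_of_det_eq_one hB
  have hC1 := one_le_norm_of_det_eq_one hC
  have h1 : ‖B‖ ^ 2 ≤ K ^ 2 * ‖C‖ ^ 2 := by
    rw [← mul_pow]; exact pow_le_pow_left₀ (norm_nonneg _) hBC 2
  have h2 : ‖C‖ ^ 2 ≤ K ^ 2 * ‖B‖ ^ 2 := by
    rw [← mul_pow]; exact pow_le_pow_left₀ (norm_nonneg _) hCB 2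
  have h3 : (‖B‖ ^ 2)⁻¹ ≤ K ^ 2 * (‖C‖ ^ 2)⁻¹ := by
    rw [← div_eq_mul_inv, le_div_iff₀ (by positivity), inv_mul_le_iff₀ (by positivity)]
    linarith
  -- in the common frame both axes of the ellipse of `B` are within the factor `K` of those of `C`
  have key : ∀ ψ, stretch B ψ ≤ K * stretch C ψ := by
    intro ψ
    refine le_of_sq_le_sq ?_ (mul_nonneg hK (norm_nonneg _))
    rw [mul_pow, stretch_sq_of_minimizer hB hBs, stretch_sq_of_minimizer hC hCs]
    nlinarith [mul_le_mul_of_nonneg_right h3 (sq_nonneg (Real.cos (ψ - s))),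
      mul_le_mul_of_nonneg_right h1 (sq_nonneg (Real.sin (ψ - s)))]
  refine norm_le_of_mulVec hK fun v => ?_
  obtain ⟨ρ, ψ, h⟩ := exists_polar (C⁻¹.mulVec v)
  have hv : v = C.mulVec (ρ • ![Real.cos ψ, Real.sin ψ]) := by
    rw [← h, Matrix.mulVec_mulVec, Matrix.mul_nonsing_inv C (by rw [hC]; exact isUnit_one),
      Matrix.one_mulVec]
  rw [← Matrix.mulVec_mulVec, h, norm_mulVec_smul]
  conv_rhs => rw [hv, norm_mulVec_smul]
  calc _ ≤ |ρ| * (K * stretch C ψ) := by gcongr; exact key ψ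
    _ = _ := by ring

theorem norm_fwd_le {ω lam : ℝ} (hlam : 1 ≤ lam) (φ : ℝ → ℝ) (j : ℕ) (x : ℝ) :
    ‖fwd ω (cocycle lam φ) j x‖ ≤ lam ^ j := by
  induction j with
  | zero => simp [fwd, (CStarRing.norm_one : ‖(1 : Mat)‖ = 1)]
  | succ j ih =>
    rw [fwd, pow_succ']
    refine (Matrix.l2_opNorm_mul _ _).trans ?_
    exact mul_le_mul (norm_cocycle_le hlam _ _) ih (norm_nonneg _) (by linarith)

/-- At a tangency, the hyperbolicity gained before the visit to `I_n` is lost after it. -/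
theorem PairGood.norm_fwd_two_mul_le {ω M lam : ℝ} {p r : ℕ} {φ : ℝ → ℝ} {x : ℝ} (hM : 1 ≤ M)
    (hlam : 1 < lam) (h : PairGood ω M lam p r (fun i => (φ (tr ω x i) : ℂ)))
    (ht : mostContracted (fwd ω (cocycle lam φ) r x) =
      mostContracted (bwd ω (cocycle lam φ) r x)) :
    ‖fwd ω (cocycle lam φ) (r + r) (tr ω x (-(r : ℤ)))‖ ≤ lam ^ ((r : ℝ) / 2) := by
  have hl0 : lam ≠ 0 := by linarith
  have hl1 : 0 < lam := by linarith
  set B := fwd ω (cocycle lam φ) r x with hB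
  set A := fwd ω (cocycle lam φ) r (tr ω x (-(r : ℤ))) with hA
  have hBd : B.det = 1 := det_fwd hl0 _ _ _
  have hAd : A.det = 1 := det_fwd hl0 _ _ _
  have hAu : IsUnit A.det := by rw [hAd]; exact isUnit_one
  have hC : bwd ω (cocycle lam φ) r x = A⁻¹ := bwd_eq_inv_fwd _ _ _ _
  rw [hC] at ht
  have hCd : (A⁻¹).det = 1 := by rw [Matrix.det_nonsing_inv, hAd, Ring.inverse_one]
  have e : fwd ω (cocycle lam φ) (r + r) (tr ω x (-(r : ℤ))) = B * (A⁻¹)⁻¹ := by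
    rw [fwd_add, tr_tr, neg_add_cancel, tr_zero, Matrix.nonsing_inv_nonsing_inv A hAu]
  rw [e]
  -- only `rate ≥ 1 / 2` is used: both blocks have norm between `lam ^ (r / 2)` and `lam ^ r`
  have hrate : lam ^ ((r : ℝ) / 2) ≤ lam ^ (rate M (p + 1) * r) := by
    refine Real.rpow_le_rpow_of_exponent_le hlam.le ?_
    have h1 := le_rate hM (p + 1)
    have h2 := eps_le hM
    have h3 : (0 : ℝ) ≤ r := Nat.cast_nonneg r
    nlinarith
  have hR := hrate.trans h.right.le
  have hL := hrate.trans h.left.le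
  rw [← map_rblk, Matrix.map_apply, Complex.norm_real, Real.norm_eq_abs] at hR
  rw [← map_rblk_neg, Matrix.map_apply, Complex.norm_real, Real.norm_eq_abs] at hL
  have hB' : lam ^ ((r : ℝ) / 2) ≤ ‖B‖ := by
    refine hR.trans ((norm_entry_le _ 0 0).trans (le_of_eq ?_))
    rw [rblk, norm_mul_rot]
  have hA' : lam ^ ((r : ℝ) / 2) ≤ ‖A⁻¹‖ := by
    rw [norm_inv_of_det_eq_one hAd]
    refine hL.trans ((norm_entry_le _ 0 0).trans (le_of_eq ?_))
    rw [rblk, norm_mul_rot]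
  have hsq : lam ^ r = lam ^ ((r : ℝ) / 2) * lam ^ ((r : ℝ) / 2) := by
    rw [← Real.rpow_add hl1, add_halves, Real.rpow_natCast]
  have hB2 : ‖B‖ ≤ lam ^ r := norm_fwd_le hlam.le _ _ _
  have hA2 : ‖A⁻¹‖ ≤ lam ^ r := by
    rw [norm_inv_of_det_eq_one hAd]
    exact norm_fwd_le hlam.le _ _ _
  have hK : 0 ≤ lam ^ ((r : ℝ) / 2) := by positivity
  rw [hsq] at hB2 hA2
  exact norm_mul_inv_le_of_common_minimizer hBd hCd (mostContracted_le B)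
    (fun ψ => by rw [ht]; exact mostContracted_le _ ψ) hK
    (hB2.trans (mul_le_mul_of_nonneg_left hA' hK)) (hA2.trans (mul_le_mul_of_nonneg_left hB' hK))

/-- If every orbit segment of length `w` contains a piece of length `2r` on which `s` is lost, the
growth rate drops by `s / (w + 2r)`. -/
theorem log_norm_fwd_le {ω lam : ℝ} {φ : ℝ → ℝ} (hlam : 1 < lam) {r w : ℕ} {s : ℝ} (hs : 0 ≤ s)
    (hw : 0 < w + (r + r))
    (hvis : ∀ x, ∃ j ≤ w, Real.log ‖fwd ω (cocycle lam φ) (r + r) (tr ω x j)‖ ≤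
      (r + r : ℕ) * Real.log lam - s) (m : ℕ) (x : ℝ) :
    Real.log ‖fwd ω (cocycle lam φ) m x‖ ≤
      (Real.log lam - s / (w + (r + r) : ℕ)) * m + s := by
  have hl0 : lam ≠ 0 := by linarith
  have hlog : 0 < Real.log lam := Real.log_pos hlam
  have hone : ∀ j x, 0 < ‖fwd ω (cocycle lam φ) j x‖ := fun j x =>
    zero_lt_one.trans_le (one_le_norm_of_det_eq_one (det_fwd hl0 φ j x))
  have hmax : ∀ (j : ℕ) x, Real.log ‖fwd ω (cocycle lam φ) j x‖ ≤ j * Real.log lam := by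
    intro j x
    rw [← Real.log_pow]
    exact Real.log_le_log (hone j x) (norm_fwd_le hlam.le φ j x)
  have hadd : ∀ (j k : ℕ) x, Real.log ‖fwd ω (cocycle lam φ) (j + k) x‖ ≤
      Real.log ‖fwd ω (cocycle lam φ) j x‖ + Real.log ‖fwd ω (cocycle lam φ) k (tr ω x j)‖ := by
    intro j k x
    rw [add_comm (Real.log _), ← Real.log_mul (hone _ _).ne' (hone _ _).ne']
    exact Real.log_le_log (hone _ _) (norm_fwd_add_le ω _ j k x)
  set W := w + (r + r) with hW
  have hW0 : (0 : ℝ) < W := by exact_mod_cast hw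
  induction m using Nat.strong_induction_on generalizing x with
  | _ m ih =>
    rcases lt_or_ge m W with hm | hm
    · have h1 := hmax m x
      have h2 : s / W * m ≤ s := by
        rw [div_mul_eq_mul_div, div_le_iff₀ hW0]
        have : (m : ℝ) ≤ W := by exact_mod_cast hm.le
        nlinarith
      linarith
    · obtain ⟨j, hj, hjx⟩ := hvis x
      obtain ⟨k, rfl⟩ : ∃ k, m = j + (r + r) + k := Nat.exists_eq_add_of_le (by omega)
      -- for `r = 0` the segment may be empty, but then `s = 0`
      rcases Nat.eq_zero_or_pos (j + (r + r)) with h0 | h0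
      · have hr0 : r = 0 := by omega
        have hj0 : j = 0 := by omega
        subst hr0 hj0
        simp only [fwd, add_zero, Nat.cast_zero, zero_mul, zero_sub,
          (CStarRing.norm_one : ‖(1 : Mat)‖ = 1), Real.log_one] at hjx
        have hs0 : s = 0 := by linarith
        have := hmax (0 + (0 + 0) + k) x
        simp only [hs0, zero_div, sub_zero, add_zero]
        linarith
      · have h1 := hadd (j + (r + r)) k x
        have h2 := hadd j (r + r) x
        have h3 := hmax j x
        have h4 := ih k (by omega) (tr ω x (j + (r + r) : ℕ))
        have h5 : s / W * (j + (r + r) : ℕ) ≤ s := by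
          rw [div_mul_eq_mul_div, div_le_iff₀ hW0]
          have : ((j + (r + r) : ℕ) : ℝ) ≤ W := by exact_mod_cast (by omega)
          nlinarith
        rw [Nat.cast_add (j + (r + r)) k, mul_add, sub_mul (Real.log lam) _ ((j + (r + r) : ℕ) : ℝ)]
        rw [Nat.cast_add j (r + r)] at h5 ⊢
        linarith

/-- The proportion of the growth lost at the tangencies, `3r / 2` out of `W + 2r` with `W` the waiting
time, exceeds `δ = M⁻²⁰ / 4`. -/
theorem lyapunov_constant {M Q r : ℝ} (hM : (√5 + 1) / 2 ≤ M) (hQ : 0 < Q)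
    (hr : Q / (16 * M) ≤ r) :
    (M ^ 20)⁻¹ / 4 < 3 / 2 * r / (384 * M * Q + (r + r)) := by
  have h5 : 2 ≤ √5 := Real.le_sqrt_of_sq_le (by norm_num)
  have hM1 : 3 / 2 ≤ M := by linarith
  have hM0 : 0 < M := by linarith
  have hr0 : 0 < r := lt_of_lt_of_le (by positivity) hr
  rw [div_le_iff₀ (by positivity)] at hr
  rw [lt_div_iff₀ (by positivity), inv_eq_one_div, div_div, div_mul_eq_mul_div, one_mul,
    div_lt_iff₀ (by positivity)]
  -- `3 / 2` is enough of the lower bound for `M` since `(3 / 2) ^ 18 ≥ 1030`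
  have h18 : (3 / 2 : ℝ) ^ 18 ≤ M ^ 18 := pow_le_pow_left₀ (by norm_num) hM1 18
  have h20 : 1030 * M ^ 2 ≤ M ^ 20 := by
    have : M ^ 20 = M ^ 18 * M ^ 2 := by ring
    rw [this]
    have h2 : (1030 : ℝ) ≤ M ^ 18 := le_trans (by norm_num) h18
    exact mul_le_mul_of_nonneg_right h2 (by positivity)
  have h2 : 9 / 4 ≤ M ^ 2 := by nlinarith
  have h3 : 384 * M * Q ≤ 6144 * M ^ 2 * r := by nlinarith
  nlinarith [mul_le_mul_of_nonneg_left h20 hr0.le]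

/-- The tangency in `I_n / 10`, which every orbit visits within a time comparable to the return time
to `I_n`, forces the Lyapunov exponent below `log lam` by a definite proportion. -/
theorem HypAt.exists_lyapunov_lt {ω M c lam : ℝ} (hω : Irrational ω) (hM : (√5 + 1) / 2 ≤ M)
    (hbdd : ∀ n : ℕ, 1 ≤ n → q ω (n + 1) < M * q ω n) {φ : ℝ → ℝ} {p : ℕ}
    (h : HypAt ω M c lam φ p) (hp : Large ω M p) (hlam : LamLarge M lam)
    (hc : Continuous φ) (hl : IsLift φ)
    (ht : ∀ x ∈ crit ω c 10 (p + 1), stableDir ω c lam φ (p + 1) x =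
      unstableDir ω c lam φ (p + 1) x) :
    ∃ L, HasLyapunovExponent ω (cocycle lam φ) L ∧ L < (1 - (M ^ 20)⁻¹ / 4) * Real.log lam := by
  have h5 : 2 ≤ √5 := Real.le_sqrt_of_sq_le (by norm_num)
  have hM1 : 1 ≤ M := by linarith
  have hl1 := hlam.one_lt
  have hl0 : lam ≠ 0 := by linarith
  have hlog : 0 < Real.log lam := Real.log_pos hl1
  have hcA : Continuous (cocycle lam φ) :=
    (contDiff_cocycle (l := 0) lam (contDiff_zero.2 hc)).continuous
  have hdet : ∀ x, (cocycle lam φ x).det = 1 := det_cocycle hl0 φ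
  obtain ⟨L, hL⟩ := exists_hasLyapunovExponent ω hcA (hl.periodic_cocycle lam) hdet
  refine ⟨L, hL, ?_⟩
  have hn := lt_sq_of_le hω hp.lt_sq (show p ≤ p + 1 by omega)
  have hq := q_pos hω (p + 1)
  obtain ⟨hr1, -, -⟩ := minReturn_mem hω hM1 hbdd hn c
  have hself := self_mem_crit hω c one_pos (p + 1)
  have hlen : q ω (p + 1) ^ 2 / (16 * M) ≤ minReturn ω c (p + 1) :=
    len_le_of_mem hω hM1 hbdd hn hr1 (crit_subset hω c (by norm_num) (by norm_num) le_rfl hself)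
      (tr_minReturn_mem hω hM1 hbdd hn hself).1
  have hconst := lyapunov_constant hM (by positivity) hlen
  set r := minReturn ω c (p + 1) with hr
  have hr0 : (1 : ℝ) ≤ r := by exact_mod_cast hr1
  have hW0 : 0 ≤ 384 * M * q ω (p + 1) ^ 2 := by positivity
  set w := ⌊384 * M * q ω (p + 1) ^ 2⌋₊ with hw
  have hwle : (w : ℝ) ≤ 384 * M * q ω (p + 1) ^ 2 := Nat.floor_le hW0
  -- the segment of length `2r` is centred at the visit `y` to `I_n / 10`, hence the shift by `r`
  have hvis : ∀ x, ∃ j ≤ w, Real.log ‖fwd ω (cocycle lam φ) (r + r) (tr ω x j)‖ ≤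
      (r + r : ℕ) * Real.log lam - 3 / 2 * r * Real.log lam := by
    intro x
    obtain ⟨j, -, hj, hjx⟩ := exists_visit hω hM1 hbdd hn c (tr ω x r)
    refine ⟨j, Nat.le_floor hj, ?_⟩
    set y := tr ω (tr ω x r) j
    have hy : tr ω x j = tr ω y (-(r : ℤ)) := by
      simp only [y, tr_tr]
      congr 1
      ring
    have hg := (h.pairGood hω hM1 hbdd hp hlam (by omega) le_rfl
      (crit_subset hω c one_pos (by norm_num) le_rfl hjx)
      (near_self φ y (Real.exp_pos _))).norm_fwd_two_mul_le hM1 hl1 (ht y hjx)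
    rw [hy]
    refine (Real.log_le_log (zero_lt_one.trans_le
      (one_le_norm_of_det_eq_one (det_fwd hl0 φ _ _))) hg).trans (le_of_eq ?_)
    rw [Real.log_rpow (by linarith)]
    push_cast
    ring
  have hle := hL.le hcA hdet (log_norm_fwd_le hl1 (by positivity) (by omega) hvis)
  refine hle.trans_lt ?_
  have h1 : 3 / 2 * (r : ℝ) / (384 * M * q ω (p + 1) ^ 2 + (r + r)) ≤
      3 / 2 * r / ((w + (r + r) : ℕ) : ℝ) := by
    push_cast
    gcongr
  have h2 := hconst.trans_le h1
  have h3 := mul_lt_mul_of_pos_right h2 hlog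
  rw [div_mul_eq_mul_div (3 / 2 * (r : ℝ))] at h3
  linarith

/-! ### The limit and its slow approximations -/

theorem IsLift.of_tendsto {f : ℕ → ℝ → ℝ} {g φ : ℝ → ℝ} (hφ : IsLift φ)
    (hf : ∀ᶠ n in Filter.atTop, Function.Periodic (fun x => f n x - φ x) (2 * Real.pi))
    (hfg : ∀ x, Filter.Tendsto (fun n => f n x) Filter.atTop (nhds (g x))) : IsLift g := by
  obtain ⟨j, hj⟩ := hφ
  refine ⟨j, fun x => ?_⟩
  refine tendsto_nhds_unique (hfg (x + 2 * Real.pi)) (((hfg x).add_const _).congr' ?_)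
  filter_upwards [hf] with n hn
  have := hn x
  simp only [hj] at this
  linarith

/-- The theorem for all kinds of corrections at once. -/
theorem Setting.exists_construction {ω M c δ₀ : ℝ} {l : ℕ∞} {g φ : ℝ → ℝ} {tw : Bool}
    {step : ℕ → (ℝ → ℝ) → (ℝ → ℝ) → Prop} {k₀ n₁ : ℕ} {C : ℕ → ℝ} {B nk : ℕ → ℕ}
    (S : Setting ω M c δ₀ l g φ tw step k₀ n₁ C B nk) (hM : (√5 + 1) / 2 ≤ M) :
    ∃ N₀, ∀ N, N₀ ≤ N → ∀ᶠ lam in Filter.atTop, ∃ Φ : ℕ → ℝ → ℝ,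
      IsConstruction ω c lam N step φ Φ ∧ LimitHasSlowApproximation ω M c lam l N Φ := by
  have hω := S.irrational
  obtain ⟨F, hFs, -, hF1, hF0, -⟩ := exists_bump 1 le_rfl
  obtain ⟨Y, hY0, hY⟩ := S.base.isLift.exists_bound S.base.smooth k₀ S.corrector.le
  obtain ⟨N₀, hN₀⟩ := Filter.eventually_atTop.1 (S.eventually_goodLevel Y)
  refine ⟨N₀, fun N hN => ?_⟩
  filter_upwards [S.eventually_construction hY0 hY fun n hn => hN₀ n (hN.trans hn)]
    with lam ⟨hlam, Φ, hC, hΦ⟩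
  refine ⟨Φ, hC, ?_⟩
  have hS := fun n hn => (hΦ n hn).1
  have hl0 : lam ≠ 0 := by linarith [hlam.one_lt]
  have hsm : ∀ᶠ n in Filter.atTop, ContDiff ℝ l (Φ n) := by
    filter_upwards [Filter.eventually_ge_atTop N] with n hn using (hS n hn).smooth
  obtain ⟨G, hG, hlim⟩ := exists_limit hsm fun k hk =>
    S.exists_summable_bound hS (fun n hn => (hΦ n hn).2) k hk
  have hGl : IsLift G := by
    refine S.base.isLift.of_tendsto (f := Φ) ?_ fun x => ?_
    · filter_upwards [Filter.eventually_ge_atTop N] with n hn using (hS n hn).periodic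
    · refine Metric.tendsto_nhds.2 fun ε hε => ?_
      filter_upwards [hlim 0 (by simp) (ε / 2) (by linarith)] with n hn
      have := hn x
      rw [iteratedDeriv_zero, iteratedDeriv_zero] at this
      rw [Real.dist_eq]
      linarith
  set Ψ : ℕ → ℝ → ℝ := fun n x => Φ n x - flatPart ω c φ F n x with hΨ
  have htan : ∀ n, N ≤ n → IsTangentModification ω c lam l n (Φ n) (Ψ n) := fun n hn =>
    S.isTangentModification hlam hFs hF0 hF1 (hN₀ n (hN.trans hn)) (hS n hn)
  have hΨl : ∀ n, N ≤ n → IsLift (Ψ n) := by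
    intro n hn
    have := (isLift_of_periodic_sub S (hS n hn).periodic).add (htan n hn).periodic
    simpa using this
  refine ⟨cocycle lam G, isCocycle_cocycle hl0 hG hGl, convergesC_cocycle lam hsm hG hGl hlim, Ψ,
    htan, fun n hn => isCocycle_cocycle hl0 (htan n hn).smooth (hΨl n hn),
    convergesC_cocycle lam ?_ hG hGl fun k hk ε hε => ?_, N, fun n hn => ?_⟩
  · filter_upwards [Filter.eventually_ge_atTop N] with n hn using (htan n hn).smooth
  · have hk' : (k : WithTop ℕ∞) ≤ l := by exact_mod_cast hk
    filter_upwards [hlim k hk (ε / 2) (by linarith), hsm,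
      S.eventually_abs_flatPart_le hFs hF0 hk (show 0 < ε / 2 by linarith)] with n h1 h2 h3 x
    have e : iteratedDeriv k (Ψ n) x =
        iteratedDeriv k (Φ n) x - iteratedDeriv k (flatPart ω c φ F n) x :=
      iteratedDeriv_fun_sub (h2.of_le hk').contDiffAt
        ((contDiff_flatPart hω S.base.smooth hFs hF0 n).of_le hk').contDiffAt
    rw [e, sub_right_comm]
    refine (abs_sub _ _).trans ?_
    linarith [h1 x, h3 x]
  · have hgood := hN₀ n (hN.trans hn)
    obtain ⟨p, rfl⟩ := Nat.exists_eq_add_of_le' hgood.one_le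
    have hyp : HypAt ω M c lam (Ψ (p + 1)) p :=
      HypAt.congr (hS _ hn).hyp (htan _ hn).outer
    exact hyp.exists_lyapunov_lt hω hM S.bdd hgood.large_pred hlam (htan _ hn).smooth.continuous
      (hΨl _ hn) (htan _ hn).tangent

end

end QPCocycle

theorem theorem4 (ω M : ℝ) (hω : Irrational ω) (hM : (Real.sqrt 5 + 1) / 2 ≤ M)
    (hbdd : ∀ n : ℕ, 1 ≤ n → QPCocycle.q ω (n + 1) < M * QPCocycle.q ω n) :
    (∀ l : ℕ, 1 ≤ l → ∀ c ∈ Set.Ico 0 Real.pi, ∀ δ₀ ∈ Set.Ioo (0 : ℝ) 1, ∀ twisted : Bool,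
      ∀ φ : ℝ → ℝ, QPCocycle.IsBasePhase l (QPCocycle.powProfile l) c δ₀ twisted φ →
      ∃ N₀ : ℕ, ∀ N, N₀ ≤ N → ∃ lam₀ : ℝ, ∀ lam, lam₀ ≤ lam →
        ∃ Φ : ℕ → ℝ → ℝ,
          QPCocycle.IsConstruction ω c lam N (QPCocycle.IsPolyCorrection ω c l) φ Φ ∧
          QPCocycle.LimitHasSlowApproximation ω M c lam l N Φ) ∧
    (∀ a ∈ Set.Ioo (0 : ℝ) (1 / 10), ∀ c ∈ Set.Ico 0 Real.pi, ∀ δ₀ ∈ Set.Ioo (0 : ℝ) 1,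
      ∀ twisted : Bool, ∀ φ : ℝ → ℝ,
      QPCocycle.IsBasePhase ⊤ (QPCocycle.expProfile a) c δ₀ twisted φ →
      ∃ N₀ : ℕ, ∀ N, N₀ ≤ N →
        ∃ f : ℕ → ℝ → ℝ, (∀ n, N ≤ n → QPCocycle.IsCutoff ω c n (f n)) ∧
        ∃ lam₀ : ℝ, ∀ lam, lam₀ ≤ lam →
          ∃ Φ : ℕ → ℝ → ℝ,
            QPCocycle.IsConstruction ω c lam N
              (fun n => QPCocycle.IsCutoffCorrection ω c (f n) n) φ Φ ∧
            QPCocycle.LimitHasSlowApproximation ω M c lam ⊤ N Φ) := by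
  have h5 : 2 ≤ √5 := Real.le_sqrt_of_sq_le (by norm_num)
  have hM1 : 1 ≤ M := by linarith
  constructor
  · intro l _ c _ δ₀ hδ twisted φ hφ
    obtain ⟨C, hC⟩ := QPCocycle.corrector_poly hω c l
    -- corrections by polynomials are controlled in `C^l` by the full `l`-jet, hence `k₀ = l`
    have S : QPCocycle.Setting ω M c δ₀ l (QPCocycle.powProfile l) φ twisted
        (QPCocycle.IsPolyCorrection ω c l) l 0 (fun _ => C) (fun k => 2 * k) (fun _ => 0) :=
      ⟨hω, hM1, hbdd, QPCocycle.profile_pow hω l, hφ, hδ.1, hδ.2.le, hC⟩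
    obtain ⟨N₀, h⟩ := S.exists_construction hM
    exact ⟨N₀, fun N hN => Filter.eventually_atTop.1 (h N hN)⟩
  · intro a ha c _ δ₀ hδ twisted φ hφ
    obtain ⟨n₁, hn₁⟩ := Filter.eventually_atTop.1
      ((QPCocycle.tendsto_q hω).eventually (Filter.eventually_ge_atTop 32))
    choose! F hF using fun n hn => QPCocycle.exists_isLocalCutoff (hn₁ n hn)
    obtain ⟨nk, hC⟩ := QPCocycle.corrector_cutoff hω c hF
    -- corrections by cut-offs need no derivatives of the phase beyond those estimated, hence `k₀ = 0`
    have S : QPCocycle.Setting ω M c δ₀ ⊤ (QPCocycle.expProfile a) φ twisted _ 0 n₁ _ _ nk :=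
      ⟨hω, hM1, hbdd, QPCocycle.profile_exp hω ha, hφ, hδ.1, hδ.2.le, hC⟩
    obtain ⟨N₀, h⟩ := S.exists_construction hM
    exact ⟨max N₀ n₁, fun N hN => ⟨fun n => QPCocycle.patch c fun _ => F n,
      fun n hn => (hF n (((le_max_right _ _).trans hN).trans hn)).isCutoff hω c,
      Filter.eventually_atTop.1 (h N ((le_max_left _ _).trans hN))⟩⟩
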